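/- **General coinduction principle.** Work in Linear Abadi–Plotkin Logic (LAPL): the higher-order intuitionistic logic over the polymorphic dual intuitionistic/linear lambda calculus with fixed point combinator $Y\colon\Pi\alpha.\,(\alpha\to\alpha)\to\alpha$ (types $\alpha\mid I\mid\sigma\otimes\tau\mid\sigma\multimap\tau\mid{!}\sigma\mid\Pi\alpha.\sigma$ over a polymorphic signature of type and term constants; $\sigma\to\tau$ means ${!}\sigma\multimap\tau$), with definable relations, the axiomatized class of admissible relations, and the relational interpretation $\sigma[\vec\rho]$ of types. Provability means provability in LAPL together with the extensionality schemes $(\forall x.\,t\,x=u\,x)\supset t=u$, $(\forall\alpha.\,t\,\alpha=u\,\alpha)\supset t=u$ and the identity extension scheme $\sigma[\mathrm{eq}_{\vec\alpha}]\equiv \mathrm{eq}_{\sigma(\vec\alpha)}$. Let $\alpha\vdash\sigma(\alpha)$ be an inductively constructed type, i.e. one built from type variables and closed types by $\multimap,\otimes,I,!,\Pi$, in which $\alpha$ occurs only positively. Let $$\nu\alpha.\sigma(\alpha)=\Pi\beta.\bigl(\Pi\alpha.\,{!}(\alpha\multimap\sigma(\alpha))\otimes\alpha\multimap\beta\bigr)\multimap\beta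 ,$$ $$\mathit{pack}=\Lambda\alpha.\lambda^\circ x.\Lambda\beta.\lambda^\circ f.\,f\,\alpha\,x,\qquad \mathit{unfold}=\Lambda\alpha.\lambda^\circ f\colon{!}(\alpha\multimap\sigma(\alpha)).\lambda^\circ x\colon\alpha.\ \mathit{pack}\,\alpha\,(f\otimes x),$$ $$\mathit{out}=\lambda^\circ x\colon\nu\alpha.\sigma(\alpha).\ x\;\sigma(\nu\alpha.\sigma(\alpha))\;r\ \colon\ \nu\alpha.\sigma(\alpha)\multimap\sigma(\nu\alpha.\sigma(\alpha)),$$ $$r=\Lambda\alpha.\lambda^\circ y\colon{!}(\alpha\multimap\sigma(\alpha))\otimes\alpha.\ \mathsf{let}\ w\otimes z=y\ \mathsf{in}\ \mathsf{let}\ {!}f=w\ \mathsf{in}\ \sigma(\mathit{unfold}\,\alpha\,{!}f)(f\,z),$$ where $\sigma(g)\colon\sigma(\tau)\multimap\sigma(\tau')$ is the functorial action of $\sigma$ on $g\colon\tau\multimap\tau'$, defined by induction on $\sigma$. For relations $\rho$ between $\tau,\tau'$ and $\rho'$ between $\omega,\omega'$, $\rho\multimap\rho'$ relates $f\colon\tau\multimap\omega$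 to $g\colon\tau'\multimap\omega'$ iff $\forall x\,\forall y.\ \rho(x,y)\supset\rho'(f\,x,g\,y)$. For an arbitrary definable relation $R$ on $\nu\alpha.\sigma(\alpha)$, not necessarily admissible, let $\sigma[R]$ be the relation on $\sigma(\nu\alpha.\sigma(\alpha))$ defined by induction on the construction of $\sigma$: the variable $\alpha$ is interpreted by $R$, a closed type by its own relational interpretation, a type constructor by the corresponding operation of LAPL on relations ($\rho\multimap\rho'$, $\rho\otimes\rho'$, $I_{Rel}$, $!\rho$, and $\forall(\beta,\beta',S).\rho$ for $\Pi\beta$, where $S$ ranges over admissible relations between $\beta$ and $\beta'$). Then for every context $\Xi\mid\Gamma\mid\Theta$, every list $\Phi$ of propositions in it and every definable relation $R$ between $\nu\alpha.\sigma(\alpha)$ and $\nu\alpha.\sigma(\alpha)$ in that context, it is provable that $$\Xi\mid\Gamma\mid\Theta\mid\Phi\ \vdash\ (R\multimap\sigma[R])(\mathit{out},\mathit{out})\ \supset\ \forall x,y\colon\nu\alpha.\sigma(\alpha).\ R(x,y)\supset x=_{\nu\alpha.\sigma(\alpha)}y .$$ -/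

import Mathlib

universe u v

namespace LAPL

/-! ### Types of the polymorphic intuitionistic/linear lambda calculus

Type variables, term variables and relation variables are de Bruijn indices. Types over `n` type
variables are scoped by construction. -/

/-- Type constants with their arities. -/
structure TySig where
  con : Type u
  arity : con → ℕ

/-- Types `Ξ ⊢ σ : Type` in a kind context `Ξ` of `n` type variables. -/
inductive Ty (K : TySig.{u}) : ℕ → Type u
  | var {n : ℕ} (i : Fin n) : Ty K n
  | unit {n : ℕ} : Ty K n
  | tensor {n : ℕ} (σ τ : Ty K n) : Ty K n
  | lolli {n : ℕ} (σ τ : Ty K n) : Ty K n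
  | bang {n : ℕ} (σ : Ty K n) : Ty K n
  | pi {n : ℕ} (σ : Ty K (n + 1)) : Ty K n
  | con {n : ℕ} (c : K.con) (a : Fin (K.arity c) → Ty K n) : Ty K n

/-- A renaming of type variables under one more binder. -/
def upTyRen {n m : ℕ} (r : Fin n → Fin m) : Fin (n + 1) → Fin (m + 1) :=
  Fin.cases 0 (fun i => (r i).succ)

/-- A renaming of term or relation variables under one more binder. -/
def upRen (r : ℕ → ℕ) : ℕ → ℕ
  | 0 => 0
  | i + 1 => r i + 1

/-- Extend an assignment to de Bruijn indices by a value at index `0`. -/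
def scons {α : Type*} (a : α) (f : ℕ → α) : ℕ → α
  | 0 => a
  | i + 1 => f i

def Ty.ren {K : TySig.{u}} : {n : ℕ} → Ty K n → {m : ℕ} → (Fin n → Fin m) → Ty K m
  | _, .var i, _, r => .var (r i)
  | _, .unit, _, _ => .unit
  | _, .tensor σ τ, _, r => .tensor (σ.ren r) (τ.ren r)
  | _, .lolli σ τ, _, r => .lolli (σ.ren r) (τ.ren r)
  | _, .bang σ, _, r => .bang (σ.ren r)
  | _, .pi σ, _, r => .pi (σ.ren (upTyRen r))
  | _, .con c a, _, r => .con c (fun i => (a i).ren r)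

/-- Weakening by one type variable. -/
def Ty.wk {K : TySig.{u}} {n : ℕ} (σ : Ty K n) : Ty K (n + 1) := σ.ren Fin.succ

/-- Weakening by two type variables. -/
def Ty.wk2 {K : TySig.{u}} {n : ℕ} (σ : Ty K n) : Ty K (n + 2) :=
  σ.ren (fun i => i.succ.succ)

/-- A closed type in an arbitrary kind context. -/
def Ty.ofClosed {K : TySig.{u}} (σ : Ty K 0) {n : ℕ} : Ty K n := σ.ren Fin.elim0

/-- A type substitution under one more binder. -/
def upTy {K : TySig.{u}} {n m : ℕ} (s : Fin n → Ty K m) : Fin (n + 1) → Ty K (m + 1) :=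
  Fin.cases (.var 0) (fun i => (s i).wk)

def Ty.subst {K : TySig.{u}} : {n : ℕ} → Ty K n → {m : ℕ} → (Fin n → Ty K m) → Ty K m
  | _, .var i, _, s => s i
  | _, .unit, _, _ => .unit
  | _, .tensor σ τ, _, s => .tensor (σ.subst s) (τ.subst s)
  | _, .lolli σ τ, _, s => .lolli (σ.subst s) (τ.subst s)
  | _, .bang σ, _, s => .bang (σ.subst s)
  | _, .pi σ, _, s => .pi (σ.subst (upTy s))
  | _, .con c a, _, s => .con c (fun i => (a i).subst s)

/-- `σ[τ/α]`, where `α` is the last variable of the kind context. -/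
def Ty.inst {K : TySig.{u}} {n : ℕ} (σ : Ty K (n + 1)) (τ : Ty K n) : Ty K n :=
  σ.subst (Fin.cases τ .var)

/-- The Girard encoding `σ → τ = !σ ⊸ τ`. -/
def Ty.arrow {K : TySig.{u}} {n : ℕ} (σ τ : Ty K n) : Ty K n := .lolli (.bang σ) τ

/-- The type `Πα. (α → α) → α` of the fixed point combinator. -/
def Ty.fixTy {K : TySig.{u}} {n : ℕ} : Ty K n :=
  .pi (.arrow (.arrow (.var 0) (.var 0)) (.var 0))

/-! ### Terms -/

/-- A polymorphic signature: type constants, and term constants with closed (possibly polymorphic)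
types. -/
structure Signature extends TySig.{u} where
  tm : Type v
  tmTy : tm → Ty toTySig 0

/-- Raw terms. Intuitionistic variables `ivar` and linear variables `lvar` are numbered separately.
`lam` and `letT` bind linear variables (`letT σ τ s t` is `let x:σ ⊗ y:τ be s in t`, in which `x`
has index `1` and `y` has index `0`), `letB` binds an intuitionistic variable, `tlam` a type
variable. -/
inductive Tm (S : Signature.{u, v}) : ℕ → Type (max u v)
  | ivar {n : ℕ} (i : ℕ) : Tm S n
  | lvar {n : ℕ} (j : ℕ) : Tm S n
  | con {n : ℕ} (c : S.tm) : Tm S n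
  | star {n : ℕ} : Tm S n
  | fix {n : ℕ} : Tm S n
  | lam {n : ℕ} (σ : Ty S.toTySig n) (t : Tm S n) : Tm S n
  | app {n : ℕ} (t s : Tm S n) : Tm S n
  | tensor {n : ℕ} (t s : Tm S n) : Tm S n
  | bang {n : ℕ} (t : Tm S n) : Tm S n
  | tlam {n : ℕ} (t : Tm S (n + 1)) : Tm S n
  | tapp {n : ℕ} (t : Tm S n) (σ : Ty S.toTySig n) : Tm S n
  | letT {n : ℕ} (σ τ : Ty S.toTySig n) (s t : Tm S n) : Tm S n
  | letB {n : ℕ} (σ : Ty S.toTySig n) (s t : Tm S n) : Tm S n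
  | letS {n : ℕ} (s t : Tm S n) : Tm S n

/-- Simultaneous renaming of type, intuitionistic and linear variables. -/
def Tm.ren {S : Signature.{u, v}} :
    {n : ℕ} → Tm S n → {m : ℕ} → (Fin n → Fin m) → (ℕ → ℕ) → (ℕ → ℕ) → Tm S m
  | _, .ivar i, _, _, ri, _ => .ivar (ri i)
  | _, .lvar j, _, _, _, rl => .lvar (rl j)
  | _, .con c, _, _, _, _ => .con c
  | _, .star, _, _, _, _ => .star
  | _, .fix, _, _, _, _ => .fix
  | _, .lam σ t, _, r, ri, rl => .lam (σ.ren r) (t.ren r ri (upRen rl))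
  | _, .app t s, _, r, ri, rl => .app (t.ren r ri rl) (s.ren r ri rl)
  | _, .tensor t s, _, r, ri, rl => .tensor (t.ren r ri rl) (s.ren r ri rl)
  | _, .bang t, _, r, ri, rl => .bang (t.ren r ri rl)
  | _, .tlam t, _, r, ri, rl => .tlam (t.ren (upTyRen r) ri rl)
  | _, .tapp t σ, _, r, ri, rl => .tapp (t.ren r ri rl) (σ.ren r)
  | _, .letT σ τ s t, _, r, ri, rl =>
      .letT (σ.ren r) (τ.ren r) (s.ren r ri rl) (t.ren r ri (upRen (upRen rl)))
  | _, .letB σ s t, _, r, ri, rl => .letB (σ.ren r) (s.ren r ri rl) (t.ren r (upRen ri) rl)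
  | _, .letS s t, _, r, ri, rl => .letS (s.ren r ri rl) (t.ren r ri rl)

/-- Weakening by one type variable. -/
def Tm.wkT {S : Signature.{u, v}} {n : ℕ} (t : Tm S n) : Tm S (n + 1) := t.ren Fin.succ id id

/-- Weakening by `k` intuitionistic variables. -/
def Tm.wkI {S : Signature.{u, v}} {n : ℕ} (k : ℕ) (t : Tm S n) : Tm S n := t.ren id (· + k) id

/-- Weakening by `k` linear variables. -/
def Tm.wkL {S : Signature.{u, v}} {n : ℕ} (k : ℕ) (t : Tm S n) : Tm S n := t.ren id id (· + k)

/-- A closed term in an arbitrary kind context. -/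
def Tm.ofClosed {S : Signature.{u, v}} (t : Tm S 0) {n : ℕ} : Tm S n := t.ren Fin.elim0 id id

/-- Simultaneous capture-avoiding substitution for type, intuitionistic and linear variables. -/
def Tm.subst {S : Signature.{u, v}} :
    {n : ℕ} → Tm S n → {m : ℕ} → (Fin n → Ty S.toTySig m) → (ℕ → Tm S m) → (ℕ → Tm S m) → Tm S m
  | _, .ivar i, _, _, si, _ => si i
  | _, .lvar j, _, _, _, sl => sl j
  | _, .con c, _, _, _, _ => .con c
  | _, .star, _, _, _, _ => .star
  | _, .fix, _, _, _, _ => .fix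
  | _, .lam σ t, _, s, si, sl =>
      .lam (σ.subst s)
        (t.subst s (fun i => (si i).wkL 1) (scons (.lvar 0) (fun j => (sl j).wkL 1)))
  | _, .app t u, _, s, si, sl => .app (t.subst s si sl) (u.subst s si sl)
  | _, .tensor t u, _, s, si, sl => .tensor (t.subst s si sl) (u.subst s si sl)
  | _, .bang t, _, s, si, sl => .bang (t.subst s si sl)
  | _, .tlam t, _, s, si, sl =>
      .tlam (t.subst (upTy s) (fun i => (si i).wkT) (fun j => (sl j).wkT))
  | _, .tapp t σ, _, s, si, sl => .tapp (t.subst s si sl) (σ.subst s)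
  | _, .letT σ τ t u, _, s, si, sl =>
      .letT (σ.subst s) (τ.subst s) (t.subst s si sl)
        (u.subst s (fun i => (si i).wkL 2)
          (scons (.lvar 0) (scons (.lvar 1) (fun j => (sl j).wkL 2))))
  | _, .letB σ t u, _, s, si, sl =>
      .letB (σ.subst s) (t.subst s si sl)
        (u.subst s (scons (.ivar 0) (fun i => (si i).wkI 1)) (fun j => (sl j).wkI 1))
  | _, .letS t u, _, s, si, sl => .letS (t.subst s si sl) (u.subst s si sl)

/-- Substitution for the last linear variable. -/
def Tm.instL {S : Signature.{u, v}} {n : ℕ} (t s : Tm S n) : Tm S n :=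
  t.subst .var .ivar (scons s .lvar)

/-- Substitution for the last intuitionistic variable. -/
def Tm.instI {S : Signature.{u, v}} {n : ℕ} (t s : Tm S n) : Tm S n :=
  t.subst .var (scons s .ivar) .lvar

/-- Substitution for the last type variable. -/
def Tm.instT {S : Signature.{u, v}} {n : ℕ} (t : Tm S (n + 1)) (σ : Ty S.toTySig n) : Tm S n :=
  t.subst (Fin.cases σ .var) .ivar .lvar

/-! ### Typing of terms -/

/-- Linear contexts. Only finitely many indices are in use in a typable term; `none` marks an index
which is not a variable of the context. -/
abbrev LCtx (K : TySig.{u}) (n : ℕ) := ℕ → Option (Ty K n)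

/-- The empty linear context. -/
def LCtx.empty {K : TySig.{u}} {n : ℕ} : LCtx K n := fun _ => none

/-- The linear context whose only variable is `j : σ`. -/
def LCtx.single {K : TySig.{u}} {n : ℕ} (j : ℕ) (σ : Ty K n) : LCtx K n :=
  fun k => if k = j then some σ else none

/-- `Δ` is the union of the disjoint linear contexts `Δ₁` and `Δ₂`. -/
def LCtx.Split {K : TySig.{u}} {n : ℕ} (Δ Δ₁ Δ₂ : LCtx K n) : Prop :=
  ∀ j, (Δ₁ j = Δ j ∧ Δ₂ j = none) ∨ (Δ₁ j = none ∧ Δ₂ j = Δ j)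

/-- Extension of a linear context by a variable. -/
def LCtx.cons {K : TySig.{u}} {n : ℕ} (σ : Ty K n) (Δ : LCtx K n) : LCtx K n := scons (some σ) Δ

def LCtx.wk {K : TySig.{u}} {n : ℕ} (Δ : LCtx K n) : LCtx K (n + 1) :=
  fun j => (Δ j).map Ty.wk

/-- The typing judgement `Ξ | Γ; Δ ⊢ t : τ`. -/
inductive HasType {S : Signature.{u, v}} :
    {n : ℕ} → List (Ty S.toTySig n) → LCtx S.toTySig n → Tm S n → Ty S.toTySig n → Prop
  | star {n : ℕ} {Γ : List (Ty S.toTySig n)} : HasType Γ .empty .star .unit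
  | fix {n : ℕ} {Γ : List (Ty S.toTySig n)} : HasType Γ .empty .fix .fixTy
  | con {n : ℕ} {Γ : List (Ty S.toTySig n)} (c : S.tm) :
      HasType Γ .empty (.con c) (S.tmTy c).ofClosed
  | ivar {n : ℕ} {Γ : List (Ty S.toTySig n)} {i : ℕ} {σ : Ty S.toTySig n} :
      Γ[i]? = some σ → HasType Γ .empty (.ivar i) σ
  | lvar {n : ℕ} {Γ : List (Ty S.toTySig n)} {j : ℕ} {σ : Ty S.toTySig n} :
      HasType Γ (.single j σ) (.lvar j) σ
  | app {n : ℕ} {Γ : List (Ty S.toTySig n)} {Δ Δ₁ Δ₂ : LCtx S.toTySig n} {t u : Tm S n}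
      {σ τ : Ty S.toTySig n} :
      Δ.Split Δ₁ Δ₂ → HasType Γ Δ₁ t (.lolli σ τ) → HasType Γ Δ₂ u σ → HasType Γ Δ (.app t u) τ
  | lam {n : ℕ} {Γ : List (Ty S.toTySig n)} {Δ : LCtx S.toTySig n} {t : Tm S n}
      {σ τ : Ty S.toTySig n} :
      HasType Γ (Δ.cons σ) t τ → HasType Γ Δ (.lam σ t) (.lolli σ τ)
  | tensor {n : ℕ} {Γ : List (Ty S.toTySig n)} {Δ Δ₁ Δ₂ : LCtx S.toTySig n} {t u : Tm S n}
      {σ τ : Ty S.toTySig n} :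
      Δ.Split Δ₁ Δ₂ → HasType Γ Δ₁ t σ → HasType Γ Δ₂ u τ →
      HasType Γ Δ (.tensor t u) (.tensor σ τ)
  | bang {n : ℕ} {Γ : List (Ty S.toTySig n)} {t : Tm S n} {σ : Ty S.toTySig n} :
      HasType Γ .empty t σ → HasType Γ .empty (.bang t) (.bang σ)
  | tlam {n : ℕ} {Γ : List (Ty S.toTySig n)} {Δ : LCtx S.toTySig n} {t : Tm S (n + 1)}
      {σ : Ty S.toTySig (n + 1)} :
      HasType (Γ.map Ty.wk) Δ.wk t σ → HasType Γ Δ (.tlam t) (.pi σ)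
  | tapp {n : ℕ} {Γ : List (Ty S.toTySig n)} {Δ : LCtx S.toTySig n} {t : Tm S n}
      {σ : Ty S.toTySig (n + 1)} (τ : Ty S.toTySig n) :
      HasType Γ Δ t (.pi σ) → HasType Γ Δ (.tapp t τ) (σ.inst τ)
  | letT {n : ℕ} {Γ : List (Ty S.toTySig n)} {Δ Δ₁ Δ₂ : LCtx S.toTySig n} {s t : Tm S n}
      {σ σ' τ : Ty S.toTySig n} :
      Δ.Split Δ₁ Δ₂ → HasType Γ Δ₁ s (.tensor σ σ') → HasType Γ ((Δ₂.cons σ).cons σ') t τ →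
      HasType Γ Δ (.letT σ σ' s t) τ
  | letB {n : ℕ} {Γ : List (Ty S.toTySig n)} {Δ Δ₁ Δ₂ : LCtx S.toTySig n} {s t : Tm S n}
      {σ τ : Ty S.toTySig n} :
      Δ.Split Δ₁ Δ₂ → HasType Γ Δ₁ s (.bang σ) → HasType (σ :: Γ) Δ₂ t τ →
      HasType Γ Δ (.letB σ s t) τ
  | letS {n : ℕ} {Γ : List (Ty S.toTySig n)} {Δ Δ₁ Δ₂ : LCtx S.toTySig n} {s t : Tm S n}
      {τ : Ty S.toTySig n} :
      Δ.Split Δ₁ Δ₂ → HasType Γ Δ₁ s .unit → HasType Γ Δ₂ t τ → HasType Γ Δ (.letS s t) τ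

/-! ### External equality -/

/-- External equality `Ξ | Γ; Δ ⊢ t = u : τ`: the least typed congruence containing the `β`- and
`η`-rules, the commuting conversions and the fixed point equation.

A linear context `C[-]`, i.e. one whose hole is not under a `!`, is written as a term `f` with one
additional linear variable `z` (in a typable term a linear variable occurs once, and not under a
`!`). The rules `commS`, `commT`, `commB` say `let p be t in f[p/z] = f[t/z]` for the
patterns `⋆`, `x ⊗ y`, `!x`. For `f = z` these are the `η`-rules `let p be t in p = t`; for
`f = C[let p be z in u]` they are, by the `β`-rules, the commuting conversions
`let p be t in C[u] = C[let p be t in u]`, from which together with `η` they follow in turn. -/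
inductive ExtEq {S : Signature.{u, v}} :
    {n : ℕ} → List (Ty S.toTySig n) → LCtx S.toTySig n → Tm S n → Tm S n → Ty S.toTySig n → Prop
  | refl {n : ℕ} {Γ : List (Ty S.toTySig n)} {Δ : LCtx S.toTySig n} {t : Tm S n}
      {τ : Ty S.toTySig n} : HasType Γ Δ t τ → ExtEq Γ Δ t t τ
  | symm {n : ℕ} {Γ : List (Ty S.toTySig n)} {Δ : LCtx S.toTySig n} {t u : Tm S n}
      {τ : Ty S.toTySig n} : ExtEq Γ Δ t u τ → ExtEq Γ Δ u t τ
  | trans {n : ℕ} {Γ : List (Ty S.toTySig n)} {Δ : LCtx S.toTySig n} {t u w : Tm S n}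
      {τ : Ty S.toTySig n} : ExtEq Γ Δ t u τ → ExtEq Γ Δ u w τ → ExtEq Γ Δ t w τ
  | betaTerm {n : ℕ} {Γ : List (Ty S.toTySig n)} {Δ Δ₁ Δ₂ : LCtx S.toTySig n} {t u : Tm S n}
      {σ τ : Ty S.toTySig n} :
      Δ.Split Δ₁ Δ₂ → HasType Γ (Δ₁.cons σ) t τ → HasType Γ Δ₂ u σ →
      ExtEq Γ Δ (.app (.lam σ t) u) (t.instL u) τ
  | betaType {n : ℕ} {Γ : List (Ty S.toTySig n)} {Δ : LCtx S.toTySig n} {t : Tm S (n + 1)}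
      {σ : Ty S.toTySig (n + 1)} (τ : Ty S.toTySig n) :
      HasType (Γ.map Ty.wk) Δ.wk t σ → ExtEq Γ Δ (.tapp (.tlam t) τ) (t.instT τ) (σ.inst τ)
  | etaTerm {n : ℕ} {Γ : List (Ty S.toTySig n)} {Δ : LCtx S.toTySig n} {t : Tm S n}
      {σ τ : Ty S.toTySig n} :
      HasType Γ Δ t (.lolli σ τ) → ExtEq Γ Δ (.lam σ (.app (t.wkL 1) (.lvar 0))) t (.lolli σ τ)
  | etaType {n : ℕ} {Γ : List (Ty S.toTySig n)} {Δ : LCtx S.toTySig n} {t : Tm S n}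
      {σ : Ty S.toTySig (n + 1)} :
      HasType Γ Δ t (.pi σ) → ExtEq Γ Δ (.tlam (.tapp t.wkT (.var 0))) t (.pi σ)
  | betaS {n : ℕ} {Γ : List (Ty S.toTySig n)} {Δ : LCtx S.toTySig n} {t : Tm S n}
      {τ : Ty S.toTySig n} : HasType Γ Δ t τ → ExtEq Γ Δ (.letS .star t) t τ
  | betaT {n : ℕ} {Γ : List (Ty S.toTySig n)} {Δ Δ₀ Δ₁ Δ₂ Δ₃ : LCtx S.toTySig n}
      {s u t : Tm S n} {σ σ' τ : Ty S.toTySig n} :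
      Δ.Split Δ₀ Δ₃ → Δ₀.Split Δ₁ Δ₂ → HasType Γ Δ₁ s σ → HasType Γ Δ₂ u σ' →
      HasType Γ ((Δ₃.cons σ).cons σ') t τ →
      ExtEq Γ Δ (.letT σ σ' (.tensor s u) t) (t.subst .var .ivar (scons u (scons s .lvar))) τ
  | betaB {n : ℕ} {Γ : List (Ty S.toTySig n)} {Δ : LCtx S.toTySig n} {u t : Tm S n}
      {σ τ : Ty S.toTySig n} :
      HasType Γ .empty u σ → HasType (σ :: Γ) Δ t τ →
      ExtEq Γ Δ (.letB σ (.bang u) t) (t.instI u) τ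
  | commS {n : ℕ} {Γ : List (Ty S.toTySig n)} {Δ Δ₁ Δ₂ : LCtx S.toTySig n} {t f : Tm S n}
      {τ : Ty S.toTySig n} :
      Δ.Split Δ₁ Δ₂ → HasType Γ Δ₁ t .unit → HasType Γ (Δ₂.cons .unit) f τ →
      ExtEq Γ Δ (.letS t (f.instL .star)) (f.instL t) τ
  | commT {n : ℕ} {Γ : List (Ty S.toTySig n)} {Δ Δ₁ Δ₂ : LCtx S.toTySig n} {t f : Tm S n}
      {σ σ' τ : Ty S.toTySig n} :
      Δ.Split Δ₁ Δ₂ → HasType Γ Δ₁ t (.tensor σ σ') → HasType Γ (Δ₂.cons (.tensor σ σ')) f τ →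
      ExtEq Γ Δ
        (.letT σ σ' t
          (f.subst .var .ivar (scons (.tensor (.lvar 1) (.lvar 0)) (fun j => .lvar (j + 2)))))
        (f.instL t) τ
  | commB {n : ℕ} {Γ : List (Ty S.toTySig n)} {Δ Δ₁ Δ₂ : LCtx S.toTySig n} {t f : Tm S n}
      {σ τ : Ty S.toTySig n} :
      Δ.Split Δ₁ Δ₂ → HasType Γ Δ₁ t (.bang σ) → HasType Γ (Δ₂.cons (.bang σ)) f τ →
      ExtEq Γ Δ
        (.letB σ t (f.subst .var (fun i => .ivar (i + 1)) (scons (.bang (.ivar 0)) .lvar)))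
        (f.instL t) τ
  | fixEq {n : ℕ} {Γ : List (Ty S.toTySig n)} {f : Tm S n} {σ : Ty S.toTySig n} :
      HasType Γ .empty f (.lolli (.bang σ) σ) →
      ExtEq Γ .empty (.app f (.bang (.app (.tapp .fix σ) (.bang f))))
        (.app (.tapp .fix σ) (.bang f)) σ
  | congApp {n : ℕ} {Γ : List (Ty S.toTySig n)} {Δ Δ₁ Δ₂ : LCtx S.toTySig n} {t t' u u' : Tm S n}
      {σ τ : Ty S.toTySig n} :
      Δ.Split Δ₁ Δ₂ → ExtEq Γ Δ₁ t t' (.lolli σ τ) → ExtEq Γ Δ₂ u u' σ →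
      ExtEq Γ Δ (.app t u) (.app t' u') τ
  | congLam {n : ℕ} {Γ : List (Ty S.toTySig n)} {Δ : LCtx S.toTySig n} {t t' : Tm S n}
      {σ τ : Ty S.toTySig n} :
      ExtEq Γ (Δ.cons σ) t t' τ → ExtEq Γ Δ (.lam σ t) (.lam σ t') (.lolli σ τ)
  | congTensor {n : ℕ} {Γ : List (Ty S.toTySig n)} {Δ Δ₁ Δ₂ : LCtx S.toTySig n}
      {t t' u u' : Tm S n} {σ τ : Ty S.toTySig n} :
      Δ.Split Δ₁ Δ₂ → ExtEq Γ Δ₁ t t' σ → ExtEq Γ Δ₂ u u' τ →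
      ExtEq Γ Δ (.tensor t u) (.tensor t' u') (.tensor σ τ)
  | congBang {n : ℕ} {Γ : List (Ty S.toTySig n)} {t t' : Tm S n} {σ : Ty S.toTySig n} :
      ExtEq Γ .empty t t' σ → ExtEq Γ .empty (.bang t) (.bang t') (.bang σ)
  | congTlam {n : ℕ} {Γ : List (Ty S.toTySig n)} {Δ : LCtx S.toTySig n} {t t' : Tm S (n + 1)}
      {σ : Ty S.toTySig (n + 1)} :
      ExtEq (Γ.map Ty.wk) Δ.wk t t' σ → ExtEq Γ Δ (.tlam t) (.tlam t') (.pi σ)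
  | congTapp {n : ℕ} {Γ : List (Ty S.toTySig n)} {Δ : LCtx S.toTySig n} {t t' : Tm S n}
      {σ : Ty S.toTySig (n + 1)} (τ : Ty S.toTySig n) :
      ExtEq Γ Δ t t' (.pi σ) → ExtEq Γ Δ (.tapp t τ) (.tapp t' τ) (σ.inst τ)
  | congLetT {n : ℕ} {Γ : List (Ty S.toTySig n)} {Δ Δ₁ Δ₂ : LCtx S.toTySig n}
      {s s' t t' : Tm S n} {σ σ' τ : Ty S.toTySig n} :
      Δ.Split Δ₁ Δ₂ → ExtEq Γ Δ₁ s s' (.tensor σ σ') →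
      ExtEq Γ ((Δ₂.cons σ).cons σ') t t' τ →
      ExtEq Γ Δ (.letT σ σ' s t) (.letT σ σ' s' t') τ
  | congLetB {n : ℕ} {Γ : List (Ty S.toTySig n)} {Δ Δ₁ Δ₂ : LCtx S.toTySig n}
      {s s' t t' : Tm S n} {σ τ : Ty S.toTySig n} :
      Δ.Split Δ₁ Δ₂ → ExtEq Γ Δ₁ s s' (.bang σ) → ExtEq (σ :: Γ) Δ₂ t t' τ →
      ExtEq Γ Δ (.letB σ s t) (.letB σ s' t') τ
  | congLetS {n : ℕ} {Γ : List (Ty S.toTySig n)} {Δ Δ₁ Δ₂ : LCtx S.toTySig n}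
      {s s' t t' : Tm S n} {τ : Ty S.toTySig n} :
      Δ.Split Δ₁ Δ₂ → ExtEq Γ Δ₁ s s' .unit → ExtEq Γ Δ₂ t t' τ →
      ExtEq Γ Δ (.letS s t) (.letS s' t') τ

/-! ### Formulas and definable relations -/

/-- The two kinds of relation variables: arbitrary relations and admissible relations. -/
inductive Kind
  | rel
  | adm

mutual

/-- Raw definable relations: a relation variable, a comprehension `(x:σ, y:τ).φ` (in `φ`, the
variable `x` has index `1` and `y` has index `0`), and the relational interpretation `σ[ρ₁,…,ρₖ]`
of a type `α₁,…,αₖ ⊢ σ`. -/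
inductive Rel (S : Signature.{u, v}) : ℕ → Type (max u v)
  | var {n : ℕ} (i : ℕ) : Rel S n
  | abs {n : ℕ} (σ τ : Ty S.toTySig n) (φ : Fm S n) : Rel S n
  | interp {n k : ℕ} (σ : Ty S.toTySig k) (ρ : Fin k → Rel S n) : Rel S n

/-- Raw formulas: internal equality `t =_σ u`, `ρ(t, u)`, the connectives and the quantifiers over
types, over (intuitionistic) elements of a type, and over relations and admissible relations
between two types. -/
inductive Fm (S : Signature.{u, v}) : ℕ → Type (max u v)
  | eq {n : ℕ} (σ : Ty S.toTySig n) (t u : Tm S n) : Fm S n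
  | app {n : ℕ} (ρ : Rel S n) (t u : Tm S n) : Fm S n
  | imp {n : ℕ} (φ ψ : Fm S n) : Fm S n
  | bot {n : ℕ} : Fm S n
  | top {n : ℕ} : Fm S n
  | and {n : ℕ} (φ ψ : Fm S n) : Fm S n
  | or {n : ℕ} (φ ψ : Fm S n) : Fm S n
  | allTy {n : ℕ} (φ : Fm S (n + 1)) : Fm S n
  | allTm {n : ℕ} (σ : Ty S.toTySig n) (φ : Fm S n) : Fm S n
  | allRel {n : ℕ} (κ : Kind) (σ τ : Ty S.toTySig n) (φ : Fm S n) : Fm S n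
  | exTy {n : ℕ} (φ : Fm S (n + 1)) : Fm S n
  | exTm {n : ℕ} (σ : Ty S.toTySig n) (φ : Fm S n) : Fm S n
  | exRel {n : ℕ} (κ : Kind) (σ τ : Ty S.toTySig n) (φ : Fm S n) : Fm S n

end

mutual

/-- Simultaneous renaming of type, term and relation variables. -/
def Rel.ren {S : Signature.{u, v}} :
    {n : ℕ} → Rel S n → {m : ℕ} → (Fin n → Fin m) → (ℕ → ℕ) → (ℕ → ℕ) → Rel S m
  | _, .var i, _, _, _, rr => .var (rr i)
  | _, .abs σ τ φ, _, r, ri, rr => .abs (σ.ren r) (τ.ren r) (φ.ren r (upRen (upRen ri)) rr)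
  | _, .interp σ ρ, _, r, ri, rr => .interp σ (fun i => (ρ i).ren r ri rr)

def Fm.ren {S : Signature.{u, v}} :
    {n : ℕ} → Fm S n → {m : ℕ} → (Fin n → Fin m) → (ℕ → ℕ) → (ℕ → ℕ) → Fm S m
  | _, .eq σ t u, _, r, ri, _ => .eq (σ.ren r) (t.ren r ri id) (u.ren r ri id)
  | _, .app ρ t u, _, r, ri, rr => .app (ρ.ren r ri rr) (t.ren r ri id) (u.ren r ri id)
  | _, .imp φ ψ, _, r, ri, rr => .imp (φ.ren r ri rr) (ψ.ren r ri rr)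
  | _, .bot, _, _, _, _ => .bot
  | _, .top, _, _, _, _ => .top
  | _, .and φ ψ, _, r, ri, rr => .and (φ.ren r ri rr) (ψ.ren r ri rr)
  | _, .or φ ψ, _, r, ri, rr => .or (φ.ren r ri rr) (ψ.ren r ri rr)
  | _, .allTy φ, _, r, ri, rr => .allTy (φ.ren (upTyRen r) ri rr)
  | _, .allTm σ φ, _, r, ri, rr => .allTm (σ.ren r) (φ.ren r (upRen ri) rr)
  | _, .allRel κ σ τ φ, _, r, ri, rr => .allRel κ (σ.ren r) (τ.ren r) (φ.ren r ri (upRen rr))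
  | _, .exTy φ, _, r, ri, rr => .exTy (φ.ren (upTyRen r) ri rr)
  | _, .exTm σ φ, _, r, ri, rr => .exTm (σ.ren r) (φ.ren r (upRen ri) rr)
  | _, .exRel κ σ τ φ, _, r, ri, rr => .exRel κ (σ.ren r) (τ.ren r) (φ.ren r ri (upRen rr))

end

/-- Weakening by `k` term variables. -/
def Rel.wkI {S : Signature.{u, v}} {n : ℕ} (k : ℕ) (ρ : Rel S n) : Rel S n := ρ.ren id (· + k) id

/-- Weakening by one type variable. -/
def Rel.wkT {S : Signature.{u, v}} {n : ℕ} (ρ : Rel S n) : Rel S (n + 1) := ρ.ren Fin.succ id id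

/-- Weakening by one relation variable. -/
def Rel.wkR {S : Signature.{u, v}} {n : ℕ} (ρ : Rel S n) : Rel S n := ρ.ren id id (· + 1)

/-- Weakening by two type variables and one relation variable. -/
def Rel.wkTTR {S : Signature.{u, v}} {n : ℕ} (ρ : Rel S n) : Rel S (n + 2) :=
  ρ.ren (fun i => i.succ.succ) id (· + 1)

def Fm.wkI {S : Signature.{u, v}} {n : ℕ} (k : ℕ) (φ : Fm S n) : Fm S n := φ.ren id (· + k) id

def Fm.wkT {S : Signature.{u, v}} {n : ℕ} (φ : Fm S n) : Fm S (n + 1) := φ.ren Fin.succ id id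

def Fm.wkR {S : Signature.{u, v}} {n : ℕ} (φ : Fm S n) : Fm S n := φ.ren id id (· + 1)

mutual

/-- Simultaneous capture-avoiding substitution for type, term and relation variables. -/
def Rel.subst {S : Signature.{u, v}} :
    {n : ℕ} → Rel S n → {m : ℕ} → (Fin n → Ty S.toTySig m) → (ℕ → Tm S m) → (ℕ → Rel S m) →
      Rel S m
  | _, .var i, _, _, _, sr => sr i
  | _, .abs σ τ φ, _, s, si, sr =>
      .abs (σ.subst s) (τ.subst s)
        (φ.subst s (scons (.ivar 0) (scons (.ivar 1) (fun i => (si i).wkI 2)))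
          (fun i => (sr i).wkI 2))
  | _, .interp σ ρ, _, s, si, sr => .interp σ (fun i => (ρ i).subst s si sr)

def Fm.subst {S : Signature.{u, v}} :
    {n : ℕ} → Fm S n → {m : ℕ} → (Fin n → Ty S.toTySig m) → (ℕ → Tm S m) → (ℕ → Rel S m) →
      Fm S m
  | _, .eq σ t u, _, s, si, _ => .eq (σ.subst s) (t.subst s si .lvar) (u.subst s si .lvar)
  | _, .app ρ t u, _, s, si, sr =>
      .app (ρ.subst s si sr) (t.subst s si .lvar) (u.subst s si .lvar)
  | _, .imp φ ψ, _, s, si, sr => .imp (φ.subst s si sr) (ψ.subst s si sr)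
  | _, .bot, _, _, _, _ => .bot
  | _, .top, _, _, _, _ => .top
  | _, .and φ ψ, _, s, si, sr => .and (φ.subst s si sr) (ψ.subst s si sr)
  | _, .or φ ψ, _, s, si, sr => .or (φ.subst s si sr) (ψ.subst s si sr)
  | _, .allTy φ, _, s, si, sr =>
      .allTy (φ.subst (upTy s) (fun i => (si i).wkT) (fun i => (sr i).wkT))
  | _, .allTm σ φ, _, s, si, sr =>
      .allTm (σ.subst s)
        (φ.subst s (scons (.ivar 0) (fun i => (si i).wkI 1)) (fun i => (sr i).wkI 1))
  | _, .allRel κ σ τ φ, _, s, si, sr =>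
      .allRel κ (σ.subst s) (τ.subst s)
        (φ.subst s si (scons (.var 0) (fun i => (sr i).wkR)))
  | _, .exTy φ, _, s, si, sr =>
      .exTy (φ.subst (upTy s) (fun i => (si i).wkT) (fun i => (sr i).wkT))
  | _, .exTm σ φ, _, s, si, sr =>
      .exTm (σ.subst s)
        (φ.subst s (scons (.ivar 0) (fun i => (si i).wkI 1)) (fun i => (sr i).wkI 1))
  | _, .exRel κ σ τ φ, _, s, si, sr =>
      .exRel κ (σ.subst s) (τ.subst s)
        (φ.subst s si (scons (.var 0) (fun i => (sr i).wkR)))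

end

/-- Substitution for the last term variable. -/
def Fm.instI {S : Signature.{u, v}} {n : ℕ} (φ : Fm S n) (t : Tm S n) : Fm S n :=
  φ.subst .var (scons t .ivar) .var

/-- Substitution for the last type variable. -/
def Fm.instT {S : Signature.{u, v}} {n : ℕ} (φ : Fm S (n + 1)) (σ : Ty S.toTySig n) : Fm S n :=
  φ.subst (Fin.cases σ .var) .ivar .var

/-- Substitution for the last relation variable. -/
def Fm.instR {S : Signature.{u, v}} {n : ℕ} (φ : Fm S n) (ρ : Rel S n) : Fm S n :=
  φ.subst .var .ivar (scons ρ .var)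

def Fm.iff {S : Signature.{u, v}} {n : ℕ} (φ ψ : Fm S n) : Fm S n :=
  .and (.imp φ ψ) (.imp ψ φ)

/-- `ρ ≡ ρ'` for relations between `σ` and `τ`: `∀x:σ. ∀y:τ. ρ(x,y) ⊃⊂ ρ'(x,y)`. -/
def equivRel {S : Signature.{u, v}} {n : ℕ} (σ τ : Ty S.toTySig n) (ρ ρ' : Rel S n) : Fm S n :=
  .allTm σ (.allTm τ (.iff (.app (ρ.wkI 2) (.ivar 1) (.ivar 0))
    (.app (ρ'.wkI 2) (.ivar 1) (.ivar 0))))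

/-! ### Constructions on definable relations -/

/-- The identity map `λ°x:σ. x`. -/
def idTm {S : Signature.{u, v}} {n : ℕ} (σ : Ty S.toTySig n) : Tm S n := .lam σ (.lvar 0)

/-- The graph `⟨f⟩ = (x:σ, y:τ). f x =_τ y` of `f : σ ⊸ τ`. -/
def graph {S : Signature.{u, v}} {n : ℕ} (σ τ : Ty S.toTySig n) (f : Tm S n) : Rel S n :=
  .abs σ τ (.eq τ (.app (f.wkI 2) (.ivar 1)) (.ivar 0))

/-- The equality relation on `σ`: the graph of the identity. -/
def eqRel {S : Signature.{u, v}} {n : ℕ} (σ : Ty S.toTySig n) : Rel S n := graph σ σ (idTm σ)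

/-- Reindexing `(f, g)^* ρ = (x:σ', y:τ'). ρ(f x, g y)`, for `f : σ' ⊸ σ` and `g : τ' ⊸ τ`. -/
def pullRel {S : Signature.{u, v}} {n : ℕ} (σ' τ' : Ty S.toTySig n) (f g : Tm S n) (ρ : Rel S n) :
    Rel S n :=
  .abs σ' τ' (.app (ρ.wkI 2) (.app (f.wkI 2) (.ivar 1)) (.app (g.wkI 2) (.ivar 0)))

/-- `ρ ⊸ ρ'`, for `ρ` between `σ` and `τ` and `ρ'` between `σ'` and `τ'`:
`(f : σ ⊸ σ', g : τ ⊸ τ'). ∀x:σ. ∀y:τ. ρ(x, y) ⊃ ρ'(f x, g y)`. -/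
def lolliRel {S : Signature.{u, v}} {n : ℕ} (σ τ σ' τ' : Ty S.toTySig n) (ρ ρ' : Rel S n) :
    Rel S n :=
  .abs (.lolli σ σ') (.lolli τ τ')
    (.allTm σ (.allTm τ (.imp (.app (ρ.wkI 4) (.ivar 1) (.ivar 0))
      (.app (ρ'.wkI 4) (.app (.ivar 3) (.ivar 1)) (.app (.ivar 2) (.ivar 0))))))

/-- `ρ → ρ'`: `(f : σ → σ', g : τ → τ'). ∀x:σ. ∀y:τ. ρ(x, y) ⊃ ρ'(f !x, g !y)`. -/
def arrowRel {S : Signature.{u, v}} {n : ℕ} (σ τ σ' τ' : Ty S.toTySig n) (ρ ρ' : Rel S n) :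
    Rel S n :=
  .abs (.arrow σ σ') (.arrow τ τ')
    (.allTm σ (.allTm τ (.imp (.app (ρ.wkI 4) (.ivar 1) (.ivar 0))
      (.app (ρ'.wkI 4) (.app (.ivar 3) (.bang (.ivar 1))) (.app (.ivar 2) (.bang (.ivar 0)))))))

/-- `∀(α, β, R adm α β). ρ`, for `Ξ,α ⊢ σ`, `Ξ,β ⊢ τ` and `ρ` a relation between `σ` and `τ` over
`Ξ,α,β` and a new last admissible relation variable `R` between `α` and `β`:
`(t : Πα.σ, u : Πβ.τ). ∀α,β. ∀R adm α β. ρ(t α, u β)`. -/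
def polyRel {S : Signature.{u, v}} {n : ℕ} (σ τ : Ty S.toTySig (n + 1)) (ρ : Rel S (n + 2)) :
    Rel S n :=
  .abs (.pi σ) (.pi τ) (.allTy (.allTy (.allRel .adm (.var 1) (.var 0)
    (.app (ρ.wkI 2) (.tapp (.ivar 1) (.var 1)) (.tapp (.ivar 0) (.var 0))))))

/-- `λ°x:σ⊗σ'. let x'⊗x'' be x in Λα. λ°h:σ⊸σ'⊸α. h x' x''`. -/
def tensorMap {S : Signature.{u, v}} {n : ℕ} (σ σ' : Ty S.toTySig n) : Tm S n :=
  .lam (.tensor σ σ') (.letT σ σ' (.lvar 0)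
    (.tlam (.lam (.lolli σ.wk (.lolli σ'.wk (.var 0)))
      (.app (.app (.lvar 0) (.lvar 2)) (.lvar 1)))))

/-- `ρ ⊗ ρ'`, the reindexing of `∀(α, β, R adm α β). (ρ ⊸ ρ' ⊸ R) ⊸ R` along `tensorMap`. -/
def tensorRel {S : Signature.{u, v}} {n : ℕ} (σ τ σ' τ' : Ty S.toTySig n) (ρ ρ' : Rel S n) :
    Rel S n :=
  pullRel (.tensor σ σ') (.tensor τ τ') (tensorMap σ σ') (tensorMap τ τ')
    (polyRel
      (.lolli (.lolli σ.wk (.lolli σ'.wk (.var 0))) (.var 0))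
      (.lolli (.lolli τ.wk (.lolli τ'.wk (.var 0))) (.var 0))
      (lolliRel
        (.lolli σ.wk2 (.lolli σ'.wk2 (.var 1))) (.lolli τ.wk2 (.lolli τ'.wk2 (.var 0)))
        (.var 1) (.var 0)
        (lolliRel σ.wk2 τ.wk2 (.lolli σ'.wk2 (.var 1)) (.lolli τ'.wk2 (.var 0)) ρ.wkTTR
          (lolliRel σ'.wk2 τ'.wk2 (.var 1) (.var 0) ρ'.wkTTR (.var 0)))
        (.var 0)))

/-- `λ°x:I. let ⋆ be x in Λα. λ°x:α. x`. -/
def unitMap {S : Signature.{u, v}} {n : ℕ} : Tm S n :=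
  .lam .unit (.letS (.lvar 0) (.tlam (idTm (.var 0))))

/-- `I_Rel`, the reindexing of `∀(α, β, R adm α β). R ⊸ R` along `unitMap`. -/
def unitRel {S : Signature.{u, v}} {n : ℕ} : Rel S n :=
  pullRel .unit .unit unitMap unitMap
    (polyRel (.lolli (.var 0) (.var 0)) (.lolli (.var 0) (.var 0))
      (lolliRel (.var 1) (.var 0) (.var 1) (.var 0) (.var 0) (.var 0)))

/-- `λ°x:!σ. Λα. λ°g:σ→α. g x`. -/
def bangMap {S : Signature.{u, v}} {n : ℕ} (σ : Ty S.toTySig n) : Tm S n :=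
  .lam (.bang σ) (.tlam (.lam (.arrow σ.wk (.var 0)) (.app (.lvar 0) (.lvar 1))))

/-- `!ρ`, the reindexing of `∀(α, β, R adm α β). (ρ → R) ⊸ R` along `bangMap`. -/
def bangRel {S : Signature.{u, v}} {n : ℕ} (σ τ : Ty S.toTySig n) (ρ : Rel S n) : Rel S n :=
  pullRel (.bang σ) (.bang τ) (bangMap σ) (bangMap τ)
    (polyRel
      (.lolli (.arrow σ.wk (.var 0)) (.var 0))
      (.lolli (.arrow τ.wk (.var 0)) (.var 0))
      (lolliRel (.arrow σ.wk2 (.var 1)) (.arrow τ.wk2 (.var 0)) (.var 1) (.var 0)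
        (arrowRel σ.wk2 τ.wk2 (.var 1) (.var 0) ρ.wkTTR (.var 0))
        (.var 0)))

/-- The vector `ρ₁,…,ρₖ` extended by the last relation variable, over a context extended by two
type variables and that relation variable. -/
def extRel {S : Signature.{u, v}} {n k : ℕ} (ρ : Fin k → Rel S n) : Fin (k + 1) → Rel S (n + 2) :=
  Fin.cases (.var 0) (fun i => (ρ i).wkTTR)

/-! ### The judgements of the logic -/

/-- A relation variable of a relational context: its kind, domain and codomain. -/
structure RelDecl (K : TySig.{u}) (n : ℕ) where
  kind : Kind
  dom : Ty K n
  cod : Ty K n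

def RelDecl.wk {K : TySig.{u}} {n : ℕ} (d : RelDecl K n) : RelDecl K (n + 1) :=
  ⟨d.kind, d.dom.wk, d.cod.wk⟩

/-- The additional axiom schemes. -/
inductive Scheme
  | extensionality
  | identityExtension

mutual

/-- `IsFm A Γ Θ φ` is `Ξ | Γ | Θ ⊢ φ : Prop`. Here and below `A` is the set of axiom schemes that
are assumed in addition to the rules of the logic. -/
inductive IsFm {S : Signature.{u, v}} (A : Set Scheme) :
    {n : ℕ} → List (Ty S.toTySig n) → List (RelDecl S.toTySig n) → Fm S n → Prop
  | eq {n : ℕ} {Γ : List (Ty S.toTySig n)} {Θ : List (RelDecl S.toTySig n)} {σ : Ty S.toTySig n}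
      {t u : Tm S n} : HasType Γ .empty t σ → HasType Γ .empty u σ → IsFm A Γ Θ (.eq σ t u)
  | app {n : ℕ} {Γ : List (Ty S.toTySig n)} {Θ : List (RelDecl S.toTySig n)}
      {σ τ : Ty S.toTySig n} {ρ : Rel S n} {t u : Tm S n} :
      IsRel A .rel Γ Θ ρ σ τ → HasType Γ .empty t σ → HasType Γ .empty u τ →
      IsFm A Γ Θ (.app ρ t u)
  | imp {n : ℕ} {Γ : List (Ty S.toTySig n)} {Θ : List (RelDecl S.toTySig n)} {φ ψ : Fm S n} :
      IsFm A Γ Θ φ → IsFm A Γ Θ ψ → IsFm A Γ Θ (.imp φ ψ)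
  | bot {n : ℕ} {Γ : List (Ty S.toTySig n)} {Θ : List (RelDecl S.toTySig n)} : IsFm A Γ Θ .bot
  | top {n : ℕ} {Γ : List (Ty S.toTySig n)} {Θ : List (RelDecl S.toTySig n)} : IsFm A Γ Θ .top
  | and {n : ℕ} {Γ : List (Ty S.toTySig n)} {Θ : List (RelDecl S.toTySig n)} {φ ψ : Fm S n} :
      IsFm A Γ Θ φ → IsFm A Γ Θ ψ → IsFm A Γ Θ (.and φ ψ)
  | or {n : ℕ} {Γ : List (Ty S.toTySig n)} {Θ : List (RelDecl S.toTySig n)} {φ ψ : Fm S n} :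
      IsFm A Γ Θ φ → IsFm A Γ Θ ψ → IsFm A Γ Θ (.or φ ψ)
  | allTy {n : ℕ} {Γ : List (Ty S.toTySig n)} {Θ : List (RelDecl S.toTySig n)}
      {φ : Fm S (n + 1)} :
      IsFm A (Γ.map Ty.wk) (Θ.map RelDecl.wk) φ → IsFm A Γ Θ (.allTy φ)
  | allTm {n : ℕ} {Γ : List (Ty S.toTySig n)} {Θ : List (RelDecl S.toTySig n)}
      {σ : Ty S.toTySig n} {φ : Fm S n} : IsFm A (σ :: Γ) Θ φ → IsFm A Γ Θ (.allTm σ φ)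
  | allRel {n : ℕ} {Γ : List (Ty S.toTySig n)} {Θ : List (RelDecl S.toTySig n)} {κ : Kind}
      {σ τ : Ty S.toTySig n} {φ : Fm S n} :
      IsFm A Γ (⟨κ, σ, τ⟩ :: Θ) φ → IsFm A Γ Θ (.allRel κ σ τ φ)
  | exTy {n : ℕ} {Γ : List (Ty S.toTySig n)} {Θ : List (RelDecl S.toTySig n)}
      {φ : Fm S (n + 1)} :
      IsFm A (Γ.map Ty.wk) (Θ.map RelDecl.wk) φ → IsFm A Γ Θ (.exTy φ)
  | exTm {n : ℕ} {Γ : List (Ty S.toTySig n)} {Θ : List (RelDecl S.toTySig n)}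
      {σ : Ty S.toTySig n} {φ : Fm S n} : IsFm A (σ :: Γ) Θ φ → IsFm A Γ Θ (.exTm σ φ)
  | exRel {n : ℕ} {Γ : List (Ty S.toTySig n)} {Θ : List (RelDecl S.toTySig n)} {κ : Kind}
      {σ τ : Ty S.toTySig n} {φ : Fm S n} :
      IsFm A Γ (⟨κ, σ, τ⟩ :: Θ) φ → IsFm A Γ Θ (.exRel κ σ τ φ)

/-- `IsRel A .rel Γ Θ ρ σ τ` says that `ρ` is a definable relation between `σ` and `τ` in the context
`Ξ | Γ | Θ`, and `IsRel A .adm Γ Θ ρ σ τ` that it is an admissible relation. -/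
inductive IsRel {S : Signature.{u, v}} (A : Set Scheme) :
    Kind → {n : ℕ} → List (Ty S.toTySig n) → List (RelDecl S.toTySig n) → Rel S n →
      Ty S.toTySig n → Ty S.toTySig n → Prop
  | var {n : ℕ} {Γ : List (Ty S.toTySig n)} {Θ : List (RelDecl S.toTySig n)} {κ : Kind}
      {σ τ : Ty S.toTySig n} {i : ℕ} :
      Θ[i]? = some ⟨κ, σ, τ⟩ → IsRel A κ Γ Θ (.var i) σ τ
  | abs {n : ℕ} {Γ : List (Ty S.toTySig n)} {Θ : List (RelDecl S.toTySig n)}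
      {σ τ : Ty S.toTySig n} {φ : Fm S n} :
      IsFm A (τ :: σ :: Γ) Θ φ → IsRel A .rel Γ Θ (.abs σ τ φ) σ τ
  | ofAdm {n : ℕ} {Γ : List (Ty S.toTySig n)} {Θ : List (RelDecl S.toTySig n)}
      {σ τ : Ty S.toTySig n} {ρ : Rel S n} :
      IsRel A .adm Γ Θ ρ σ τ → IsRel A .rel Γ Θ ρ σ τ
  | admEq {n : ℕ} {Γ : List (Ty S.toTySig n)} {Θ : List (RelDecl S.toTySig n)}
      (σ : Ty S.toTySig n) : IsRel A .adm Γ Θ (eqRel σ) σ σ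
  | admPull {n : ℕ} {Γ : List (Ty S.toTySig n)} {Θ : List (RelDecl S.toTySig n)}
      {σ τ σ' τ' : Ty S.toTySig n} {ρ : Rel S n} {f g : Tm S n} :
      IsRel A .adm Γ Θ ρ σ τ → HasType Γ .empty f (.lolli σ' σ) →
      HasType Γ .empty g (.lolli τ' τ) → IsRel A .adm Γ Θ (pullRel σ' τ' f g ρ) σ' τ'
  | admAnd {n : ℕ} {Γ : List (Ty S.toTySig n)} {Θ : List (RelDecl S.toTySig n)}
      {σ τ : Ty S.toTySig n} {ρ ρ' : Rel S n} :
      IsRel A .adm Γ Θ ρ σ τ → IsRel A .adm Γ Θ ρ' σ τ →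
      IsRel A .adm Γ Θ
        (.abs σ τ (.and (.app (ρ.wkI 2) (.ivar 1) (.ivar 0))
          (.app (ρ'.wkI 2) (.ivar 1) (.ivar 0)))) σ τ
  | admOp {n : ℕ} {Γ : List (Ty S.toTySig n)} {Θ : List (RelDecl S.toTySig n)}
      {σ τ : Ty S.toTySig n} {ρ : Rel S n} :
      IsRel A .adm Γ Θ ρ σ τ →
      IsRel A .adm Γ Θ (.abs τ σ (.app (ρ.wkI 2) (.ivar 0) (.ivar 1))) τ σ
  | admTop {n : ℕ} {Γ : List (Ty S.toTySig n)} {Θ : List (RelDecl S.toTySig n)}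
      (σ τ : Ty S.toTySig n) : IsRel A .adm Γ Θ (.abs σ τ .top) σ τ
  | admImp {n : ℕ} {Γ : List (Ty S.toTySig n)} {Θ : List (RelDecl S.toTySig n)}
      {σ τ : Ty S.toTySig n} {ρ : Rel S n} {φ : Fm S n} :
      IsRel A .adm Γ Θ ρ σ τ → IsFm A Γ Θ φ →
      IsRel A .adm Γ Θ
        (.abs σ τ (.imp (φ.wkI 2) (.app (ρ.wkI 2) (.ivar 1) (.ivar 0)))) σ τ
  | admAllTy {n : ℕ} {Γ : List (Ty S.toTySig n)} {Θ : List (RelDecl S.toTySig n)}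
      {σ τ : Ty S.toTySig n} {ρ : Rel S (n + 1)} :
      IsRel A .adm (Γ.map Ty.wk) (Θ.map RelDecl.wk) ρ σ.wk τ.wk →
      IsRel A .adm Γ Θ (.abs σ τ (.allTy (.app (ρ.wkI 2) (.ivar 1) (.ivar 0)))) σ τ
  | admAllTm {n : ℕ} {Γ : List (Ty S.toTySig n)} {Θ : List (RelDecl S.toTySig n)}
      {σ τ ω : Ty S.toTySig n} {ρ : Rel S n} :
      IsRel A .adm (ω :: Γ) Θ ρ σ τ →
      IsRel A .adm Γ Θ
        (.abs σ τ (.allTm ω (.app (ρ.ren id (upRen (· + 2)) id) (.ivar 2) (.ivar 1)))) σ τ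
  | admAllRel {n : ℕ} {Γ : List (Ty S.toTySig n)} {Θ : List (RelDecl S.toTySig n)} {κ : Kind}
      {σ τ ω ω' : Ty S.toTySig n} {ρ : Rel S n} :
      IsRel A .adm Γ (⟨κ, ω, ω'⟩ :: Θ) ρ σ τ →
      IsRel A .adm Γ Θ
        (.abs σ τ (.allRel κ ω ω' (.app (ρ.wkI 2) (.ivar 1) (.ivar 0)))) σ τ
  | admEquiv {n : ℕ} {Γ : List (Ty S.toTySig n)} {Θ : List (RelDecl S.toTySig n)}
      {σ τ : Ty S.toTySig n} {ρ ρ' : Rel S n} :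
      IsRel A .adm Γ Θ ρ σ τ → IsRel A .rel Γ Θ ρ' σ τ →
      Proves A Γ Θ [] (equivRel σ τ ρ ρ') → IsRel A .adm Γ Θ ρ' σ τ
  | admInterp {n k : ℕ} {Γ : List (Ty S.toTySig n)} {Θ : List (RelDecl S.toTySig n)}
      (σ : Ty S.toTySig k) {τ τ' : Fin k → Ty S.toTySig n} {ρ : Fin k → Rel S n} :
      (∀ i, IsRel A .adm Γ Θ (ρ i) (τ i) (τ' i)) →
      IsRel A .adm Γ Θ (.interp σ ρ) (σ.subst τ) (σ.subst τ')

/-- `Proves A Γ Θ Φ ψ` is the judgement `Ξ | Γ | Θ | Φ ⊢ ψ`, derivability from the rules of the logic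
and the schemes in `A`. -/
inductive Proves {S : Signature.{u, v}} (A : Set Scheme) :
    {n : ℕ} → List (Ty S.toTySig n) → List (RelDecl S.toTySig n) → List (Fm S n) → Fm S n → Prop
  -- structural rules and intuitionistic predicate logic
  | hyp {n : ℕ} {Γ : List (Ty S.toTySig n)} {Θ : List (RelDecl S.toTySig n)} {Φ : List (Fm S n)}
      {φ : Fm S n} : (∀ χ ∈ Φ, IsFm A Γ Θ χ) → φ ∈ Φ → Proves A Γ Θ Φ φ
  | weaken {n : ℕ} {Γ : List (Ty S.toTySig n)} {Θ : List (RelDecl S.toTySig n)}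
      {Φ Φ' : List (Fm S n)} {φ : Fm S n} :
      (∀ χ ∈ Φ', IsFm A Γ Θ χ) → Φ ⊆ Φ' → Proves A Γ Θ Φ φ → Proves A Γ Θ Φ' φ
  | topI {n : ℕ} {Γ : List (Ty S.toTySig n)} {Θ : List (RelDecl S.toTySig n)} :
      Proves A Γ Θ [] .top
  | botE {n : ℕ} {Γ : List (Ty S.toTySig n)} {Θ : List (RelDecl S.toTySig n)} {Φ : List (Fm S n)}
      {φ : Fm S n} : IsFm A Γ Θ φ → Proves A Γ Θ Φ .bot → Proves A Γ Θ Φ φ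
  | andI {n : ℕ} {Γ : List (Ty S.toTySig n)} {Θ : List (RelDecl S.toTySig n)} {Φ : List (Fm S n)}
      {φ ψ : Fm S n} : Proves A Γ Θ Φ φ → Proves A Γ Θ Φ ψ → Proves A Γ Θ Φ (.and φ ψ)
  | andL {n : ℕ} {Γ : List (Ty S.toTySig n)} {Θ : List (RelDecl S.toTySig n)} {Φ : List (Fm S n)}
      {φ ψ : Fm S n} : Proves A Γ Θ Φ (.and φ ψ) → Proves A Γ Θ Φ φ
  | andR {n : ℕ} {Γ : List (Ty S.toTySig n)} {Θ : List (RelDecl S.toTySig n)} {Φ : List (Fm S n)}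
      {φ ψ : Fm S n} : Proves A Γ Θ Φ (.and φ ψ) → Proves A Γ Θ Φ ψ
  | orL {n : ℕ} {Γ : List (Ty S.toTySig n)} {Θ : List (RelDecl S.toTySig n)} {Φ : List (Fm S n)}
      {φ ψ : Fm S n} : IsFm A Γ Θ ψ → Proves A Γ Θ Φ φ → Proves A Γ Θ Φ (.or φ ψ)
  | orR {n : ℕ} {Γ : List (Ty S.toTySig n)} {Θ : List (RelDecl S.toTySig n)} {Φ : List (Fm S n)}
      {φ ψ : Fm S n} : IsFm A Γ Θ φ → Proves A Γ Θ Φ ψ → Proves A Γ Θ Φ (.or φ ψ)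
  | orE {n : ℕ} {Γ : List (Ty S.toTySig n)} {Θ : List (RelDecl S.toTySig n)} {Φ : List (Fm S n)}
      {φ ψ χ : Fm S n} : Proves A Γ Θ Φ (.or φ ψ) → Proves A Γ Θ (φ :: Φ) χ →
      Proves A Γ Θ (ψ :: Φ) χ → Proves A Γ Θ Φ χ
  | impI {n : ℕ} {Γ : List (Ty S.toTySig n)} {Θ : List (RelDecl S.toTySig n)} {Φ : List (Fm S n)}
      {φ ψ : Fm S n} : IsFm A Γ Θ φ → Proves A Γ Θ (φ :: Φ) ψ → Proves A Γ Θ Φ (.imp φ ψ)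
  | impE {n : ℕ} {Γ : List (Ty S.toTySig n)} {Θ : List (RelDecl S.toTySig n)} {Φ : List (Fm S n)}
      {φ ψ : Fm S n} : Proves A Γ Θ Φ (.imp φ ψ) → Proves A Γ Θ Φ φ → Proves A Γ Θ Φ ψ
  | allTyI {n : ℕ} {Γ : List (Ty S.toTySig n)} {Θ : List (RelDecl S.toTySig n)}
      {Φ : List (Fm S n)} {φ : Fm S (n + 1)} :
      (∀ χ ∈ Φ, IsFm A Γ Θ χ) →
      Proves A (Γ.map Ty.wk) (Θ.map RelDecl.wk) (Φ.map Fm.wkT) φ → Proves A Γ Θ Φ (.allTy φ)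
  | allTyE {n : ℕ} {Γ : List (Ty S.toTySig n)} {Θ : List (RelDecl S.toTySig n)}
      {Φ : List (Fm S n)} {φ : Fm S (n + 1)} (σ : Ty S.toTySig n) :
      Proves A Γ Θ Φ (.allTy φ) → Proves A Γ Θ Φ (φ.instT σ)
  | allTmI {n : ℕ} {Γ : List (Ty S.toTySig n)} {Θ : List (RelDecl S.toTySig n)}
      {Φ : List (Fm S n)} {σ : Ty S.toTySig n} {φ : Fm S n} :
      (∀ χ ∈ Φ, IsFm A Γ Θ χ) →
      Proves A (σ :: Γ) Θ (Φ.map (Fm.wkI 1)) φ → Proves A Γ Θ Φ (.allTm σ φ)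
  | allTmE {n : ℕ} {Γ : List (Ty S.toTySig n)} {Θ : List (RelDecl S.toTySig n)}
      {Φ : List (Fm S n)} {σ : Ty S.toTySig n} {φ : Fm S n} {t : Tm S n} :
      Proves A Γ Θ Φ (.allTm σ φ) → HasType Γ .empty t σ → Proves A Γ Θ Φ (φ.instI t)
  | allRelI {n : ℕ} {Γ : List (Ty S.toTySig n)} {Θ : List (RelDecl S.toTySig n)}
      {Φ : List (Fm S n)} {κ : Kind} {σ τ : Ty S.toTySig n} {φ : Fm S n} :
      (∀ χ ∈ Φ, IsFm A Γ Θ χ) →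
      Proves A Γ (⟨κ, σ, τ⟩ :: Θ) (Φ.map Fm.wkR) φ → Proves A Γ Θ Φ (.allRel κ σ τ φ)
  | allRelE {n : ℕ} {Γ : List (Ty S.toTySig n)} {Θ : List (RelDecl S.toTySig n)}
      {Φ : List (Fm S n)} {κ : Kind} {σ τ : Ty S.toTySig n} {φ : Fm S n} {ρ : Rel S n} :
      Proves A Γ Θ Φ (.allRel κ σ τ φ) → IsRel A κ Γ Θ ρ σ τ → Proves A Γ Θ Φ (φ.instR ρ)
  | exTyI {n : ℕ} {Γ : List (Ty S.toTySig n)} {Θ : List (RelDecl S.toTySig n)}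
      {Φ : List (Fm S n)} {φ : Fm S (n + 1)} (σ : Ty S.toTySig n) :
      IsFm A Γ Θ (.exTy φ) → Proves A Γ Θ Φ (φ.instT σ) → Proves A Γ Θ Φ (.exTy φ)
  | exTyE {n : ℕ} {Γ : List (Ty S.toTySig n)} {Θ : List (RelDecl S.toTySig n)}
      {Φ : List (Fm S n)} {φ : Fm S (n + 1)} {ψ : Fm S n} :
      IsFm A Γ Θ ψ → Proves A Γ Θ Φ (.exTy φ) →
      Proves A (Γ.map Ty.wk) (Θ.map RelDecl.wk) (φ :: Φ.map Fm.wkT) ψ.wkT → Proves A Γ Θ Φ ψ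
  | exTmI {n : ℕ} {Γ : List (Ty S.toTySig n)} {Θ : List (RelDecl S.toTySig n)}
      {Φ : List (Fm S n)} {σ : Ty S.toTySig n} {φ : Fm S n} {t : Tm S n} :
      IsFm A Γ Θ (.exTm σ φ) → HasType Γ .empty t σ → Proves A Γ Θ Φ (φ.instI t) →
      Proves A Γ Θ Φ (.exTm σ φ)
  | exTmE {n : ℕ} {Γ : List (Ty S.toTySig n)} {Θ : List (RelDecl S.toTySig n)}
      {Φ : List (Fm S n)} {σ : Ty S.toTySig n} {φ ψ : Fm S n} :
      IsFm A Γ Θ ψ → Proves A Γ Θ Φ (.exTm σ φ) →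
      Proves A (σ :: Γ) Θ (φ :: Φ.map (Fm.wkI 1)) (ψ.wkI 1) → Proves A Γ Θ Φ ψ
  | exRelI {n : ℕ} {Γ : List (Ty S.toTySig n)} {Θ : List (RelDecl S.toTySig n)}
      {Φ : List (Fm S n)} {κ : Kind} {σ τ : Ty S.toTySig n} {φ : Fm S n} {ρ : Rel S n} :
      IsFm A Γ Θ (.exRel κ σ τ φ) → IsRel A κ Γ Θ ρ σ τ → Proves A Γ Θ Φ (φ.instR ρ) →
      Proves A Γ Θ Φ (.exRel κ σ τ φ)
  | exRelE {n : ℕ} {Γ : List (Ty S.toTySig n)} {Θ : List (RelDecl S.toTySig n)}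
      {Φ : List (Fm S n)} {κ : Kind} {σ τ : Ty S.toTySig n} {φ ψ : Fm S n} :
      IsFm A Γ Θ ψ → Proves A Γ Θ Φ (.exRel κ σ τ φ) →
      Proves A Γ (⟨κ, σ, τ⟩ :: Θ) (φ :: Φ.map Fm.wkR) ψ.wkR → Proves A Γ Θ Φ ψ
  -- substitution of types, terms and (admissible) relations for variables; instances are weakening
  -- and exchange in the contexts
  | subst {n m : ℕ} {Γ : List (Ty S.toTySig n)} {Θ : List (RelDecl S.toTySig n)}
      {Φ : List (Fm S n)} {φ : Fm S n} {Γ' : List (Ty S.toTySig m)}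
      {Θ' : List (RelDecl S.toTySig m)} (s : Fin n → Ty S.toTySig m) (si : ℕ → Tm S m)
      (sr : ℕ → Rel S m) :
      Proves A Γ Θ Φ φ →
      (∀ i σ, Γ[i]? = some σ → HasType Γ' .empty (si i) (σ.subst s)) →
      (∀ i κ σ τ, Θ[i]? = some ⟨κ, σ, τ⟩ → IsRel A κ Γ' Θ' (sr i) (σ.subst s) (τ.subst s)) →
      Proves A Γ' Θ' (Φ.map (fun χ => χ.subst s si sr)) (φ.subst s si sr)
  -- internal equality
  | ofExtEq {n : ℕ} {Γ : List (Ty S.toTySig n)} {Θ : List (RelDecl S.toTySig n)} {t u : Tm S n}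
      {σ : Ty S.toTySig n} : ExtEq Γ .empty t u σ → Proves A Γ Θ [] (.eq σ t u)
  | eqSymm {n : ℕ} {Γ : List (Ty S.toTySig n)} {Θ : List (RelDecl S.toTySig n)}
      {Φ : List (Fm S n)} {t u : Tm S n} {σ : Ty S.toTySig n} :
      Proves A Γ Θ Φ (.eq σ t u) → Proves A Γ Θ Φ (.eq σ u t)
  | eqTrans {n : ℕ} {Γ : List (Ty S.toTySig n)} {Θ : List (RelDecl S.toTySig n)}
      {Φ : List (Fm S n)} {t u w : Tm S n} {σ : Ty S.toTySig n} :
      Proves A Γ Θ Φ (.eq σ t u) → Proves A Γ Θ Φ (.eq σ u w) → Proves A Γ Θ Φ (.eq σ t w)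
  | eqSubst {n : ℕ} {Γ : List (Ty S.toTySig n)} {Θ : List (RelDecl S.toTySig n)}
      {Φ : List (Fm S n)} {ρ : Rel S n} {t t' u u' : Tm S n} {σ τ : Ty S.toTySig n} :
      IsRel A .rel Γ Θ ρ σ τ → Proves A Γ Θ Φ (.app ρ t u) → Proves A Γ Θ Φ (.eq σ t t') →
      Proves A Γ Θ Φ (.eq τ u u') → Proves A Γ Θ Φ (.app ρ t' u')
  -- the relational interpretation of types
  | interpVar {n k : ℕ} {Γ : List (Ty S.toTySig n)} {Θ : List (RelDecl S.toTySig n)} (i : Fin k)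
      {τ τ' : Fin k → Ty S.toTySig n} {ρ : Fin k → Rel S n} :
      (∀ i, IsRel A .adm Γ Θ (ρ i) (τ i) (τ' i)) →
      Proves A Γ Θ [] (equivRel (τ i) (τ' i) (.interp (.var i) ρ) (ρ i))
  | interpLolli {n k : ℕ} {Γ : List (Ty S.toTySig n)} {Θ : List (RelDecl S.toTySig n)}
      (σ σ' : Ty S.toTySig k) {τ τ' : Fin k → Ty S.toTySig n} {ρ : Fin k → Rel S n} :
      (∀ i, IsRel A .adm Γ Θ (ρ i) (τ i) (τ' i)) →
      Proves A Γ Θ [] (equivRel ((Ty.lolli σ σ').subst τ) ((Ty.lolli σ σ').subst τ')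
        (.interp (.lolli σ σ') ρ)
        (lolliRel (σ.subst τ) (σ.subst τ') (σ'.subst τ) (σ'.subst τ')
          (.interp σ ρ) (.interp σ' ρ)))
  | interpTensor {n k : ℕ} {Γ : List (Ty S.toTySig n)} {Θ : List (RelDecl S.toTySig n)}
      (σ σ' : Ty S.toTySig k) {τ τ' : Fin k → Ty S.toTySig n} {ρ : Fin k → Rel S n} :
      (∀ i, IsRel A .adm Γ Θ (ρ i) (τ i) (τ' i)) →
      Proves A Γ Θ [] (equivRel ((Ty.tensor σ σ').subst τ) ((Ty.tensor σ σ').subst τ')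
        (.interp (.tensor σ σ') ρ)
        (tensorRel (σ.subst τ) (σ.subst τ') (σ'.subst τ) (σ'.subst τ')
          (.interp σ ρ) (.interp σ' ρ)))
  | interpUnit {n k : ℕ} {Γ : List (Ty S.toTySig n)} {Θ : List (RelDecl S.toTySig n)}
      {τ τ' : Fin k → Ty S.toTySig n} {ρ : Fin k → Rel S n} :
      (∀ i, IsRel A .adm Γ Θ (ρ i) (τ i) (τ' i)) →
      Proves A Γ Θ [] (equivRel .unit .unit (.interp .unit ρ) unitRel)
  | interpPi {n k : ℕ} {Γ : List (Ty S.toTySig n)} {Θ : List (RelDecl S.toTySig n)}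
      (σ : Ty S.toTySig (k + 1)) {τ τ' : Fin k → Ty S.toTySig n} {ρ : Fin k → Rel S n} :
      (∀ i, IsRel A .adm Γ Θ (ρ i) (τ i) (τ' i)) →
      Proves A Γ Θ [] (equivRel ((Ty.pi σ).subst τ) ((Ty.pi σ).subst τ')
        (.interp (.pi σ) ρ)
        (polyRel (σ.subst (upTy τ)) (σ.subst (upTy τ')) (.interp σ (extRel ρ))))
  | interpBang {n k : ℕ} {Γ : List (Ty S.toTySig n)} {Θ : List (RelDecl S.toTySig n)}
      (σ : Ty S.toTySig k) {τ τ' : Fin k → Ty S.toTySig n} {ρ : Fin k → Rel S n} :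
      (∀ i, IsRel A .adm Γ Θ (ρ i) (τ i) (τ' i)) →
      Proves A Γ Θ [] (equivRel ((Ty.bang σ).subst τ) ((Ty.bang σ).subst τ')
        (.interp (.bang σ) ρ)
        (bangRel (σ.subst τ) (σ.subst τ') (.interp σ ρ)))
  -- comprehension
  | defRel {n : ℕ} {Γ : List (Ty S.toTySig n)} {Θ : List (RelDecl S.toTySig n)}
      {σ τ : Ty S.toTySig n} {φ : Fm S n} {t u : Tm S n} :
      IsFm A (τ :: σ :: Γ) Θ φ → HasType Γ .empty t σ → HasType Γ .empty u τ →
      Proves A Γ Θ []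
        (.iff (.app (.abs σ τ φ) t u) (φ.subst .var (scons u (scons t .ivar)) .var))
  -- parametricity of the fixed point combinator
  | fixParam {n : ℕ} {Γ : List (Ty S.toTySig n)} {Θ : List (RelDecl S.toTySig n)} :
      Proves A Γ Θ [] (.app (.interp (Ty.fixTy : Ty S.toTySig 0) Fin.elim0) .fix .fix)
  -- the extensionality schemes
  | extTm {n : ℕ} {Γ : List (Ty S.toTySig n)} {Θ : List (RelDecl S.toTySig n)}
      {σ τ : Ty S.toTySig n} {t u : Tm S n} :
      Scheme.extensionality ∈ A → HasType Γ .empty t (.lolli σ τ) →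
      HasType Γ .empty u (.lolli σ τ) →
      Proves A Γ Θ []
        (.imp (.allTm σ (.eq τ (.app (t.wkI 1) (.ivar 0)) (.app (u.wkI 1) (.ivar 0))))
          (.eq (.lolli σ τ) t u))
  | extTy {n : ℕ} {Γ : List (Ty S.toTySig n)} {Θ : List (RelDecl S.toTySig n)}
      {τ : Ty S.toTySig (n + 1)} {t u : Tm S n} :
      Scheme.extensionality ∈ A → HasType Γ .empty t (.pi τ) → HasType Γ .empty u (.pi τ) →
      Proves A Γ Θ []
        (.imp (.allTy (.eq τ (.tapp t.wkT (.var 0)) (.tapp u.wkT (.var 0)))) (.eq (.pi τ) t u))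
  -- the identity extension scheme, at arbitrary types `τ` for the universally quantified variables
  | identityExtension {n k : ℕ} {Γ : List (Ty S.toTySig n)} {Θ : List (RelDecl S.toTySig n)}
      (σ : Ty S.toTySig k) (τ : Fin k → Ty S.toTySig n) :
      Scheme.identityExtension ∈ A →
      Proves A Γ Θ [] (equivRel (σ.subst τ) (σ.subst τ)
        (.interp σ (fun i => eqRel (τ i))) (eqRel (σ.subst τ)))

end

/-! ### Inductively constructed types -/

/-- Inductively constructed types: those built from the type variables and from closed types
(possibly involving type constants) by the type constructors. -/
inductive IndTy (K : TySig.{u}) : ℕ → Type u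
  | var {k : ℕ} (i : Fin k) : IndTy K k
  | closed {k : ℕ} (σ : Ty K 0) : IndTy K k
  | unit {k : ℕ} : IndTy K k
  | tensor {k : ℕ} (σ τ : IndTy K k) : IndTy K k
  | lolli {k : ℕ} (σ τ : IndTy K k) : IndTy K k
  | bang {k : ℕ} (σ : IndTy K k) : IndTy K k
  | pi {k : ℕ} (σ : IndTy K (k + 1)) : IndTy K k

/-- The type that has been constructed. -/
def IndTy.toTy {K : TySig.{u}} : {k : ℕ} → IndTy K k → Ty K k
  | _, .var i => .var i
  | _, .closed σ => σ.ofClosed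
  | _, .unit => .unit
  | _, .tensor σ τ => .tensor σ.toTy τ.toTy
  | _, .lolli σ τ => .lolli σ.toTy τ.toTy
  | _, .bang σ => .bang σ.toTy
  | _, .pi σ => .pi σ.toTy

/-- `σ.Occurs p i`: the `i`-th type variable has a positive (`p = true`), respectively negative
(`p = false`), occurrence in `σ`. -/
def IndTy.Occurs {K : TySig.{u}} : {k : ℕ} → IndTy K k → Bool → Fin k → Prop
  | _, .var j, p, i => p = true ∧ j = i
  | _, .closed _, _, _ => False
  | _, .unit, _, _ => False
  | _, .tensor σ τ, p, i => σ.Occurs p i ∨ τ.Occurs p i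
  | _, .lolli σ τ, p, i => σ.Occurs (!p) i ∨ τ.Occurs p i
  | _, .bang σ, p, i => σ.Occurs p i
  | _, .pi σ, p, i => σ.Occurs p i.succ

/-- The relational interpretation `σ[ρ₁,…,ρₖ]` of an inductively constructed type at arbitrary
definable relations `ρᵢ` between `τᵢ` and `τ'ᵢ`, by recursion on the construction of `σ`. A closed
type is interpreted by its relational interpretation at the empty vector. -/
def IndTy.interp {S : Signature.{u, v}} : {k : ℕ} → IndTy S.toTySig k → {n : ℕ} →
    (Fin k → Ty S.toTySig n) → (Fin k → Ty S.toTySig n) → (Fin k → Rel S n) → Rel S n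
  | _, .var i, _, _, _, ρ => ρ i
  | _, .closed σ, _, _, _, _ => .interp σ Fin.elim0
  | _, .unit, _, _, _, _ => unitRel
  | _, .tensor σ σ', _, τ, τ', ρ =>
      tensorRel (σ.toTy.subst τ) (σ.toTy.subst τ') (σ'.toTy.subst τ) (σ'.toTy.subst τ')
        (σ.interp τ τ' ρ) (σ'.interp τ τ' ρ)
  | _, .lolli σ σ', _, τ, τ', ρ =>
      lolliRel (σ.toTy.subst τ) (σ.toTy.subst τ') (σ'.toTy.subst τ) (σ'.toTy.subst τ')
        (σ.interp τ τ' ρ) (σ'.interp τ τ' ρ)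
  | _, .bang σ, _, τ, τ', ρ =>
      bangRel (σ.toTy.subst τ) (σ.toTy.subst τ') (σ.interp τ τ' ρ)
  | _, .pi σ, _, τ, τ', ρ =>
      polyRel (σ.toTy.subst (upTy τ)) (σ.toTy.subst (upTy τ'))
        (σ.interp (Fin.cases (.var 1) (fun i => (τ i).wk2))
          (Fin.cases (.var 0) (fun i => (τ' i).wk2)) (extRel ρ))

/-- The functorial action of an inductively constructed type: for terms `f i : τ i ⊸ τ' i`, one for
each variable, `σ.act true τ τ' f : σ(τ) ⊸ σ(τ')` if the variables with `τ i ≠ τ' i` occur only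
positively in `σ`, and `σ.act false τ τ' f : σ(τ') ⊸ σ(τ)` if they occur only negatively. A type
variable bound by a `Π` is mapped by its identity. -/
def IndTy.act {S : Signature.{u, v}} : {k : ℕ} → IndTy S.toTySig k → Bool → {n : ℕ} →
    (Fin k → Ty S.toTySig n) → (Fin k → Ty S.toTySig n) → (Fin k → Tm S n) → Tm S n
  | _, .var i, _, _, _, _, f => f i
  | _, .closed σ, _, _, _, _, _ => idTm σ.ofClosed
  | _, .unit, _, _, _, _, _ => idTm .unit
  | _, .tensor σ σ', p, _, τ, τ', f =>
      let s := if p then τ else τ'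
      .lam (.tensor (σ.toTy.subst s) (σ'.toTy.subst s))
        (.letT (σ.toTy.subst s) (σ'.toTy.subst s) (.lvar 0)
          (.tensor (.app ((σ.act p τ τ' f).wkL 3) (.lvar 1))
            (.app ((σ'.act p τ τ' f).wkL 3) (.lvar 0))))
  | _, .lolli σ σ', p, _, τ, τ', f =>
      let s := if p then τ else τ'
      let s' := if p then τ' else τ
      .lam (.lolli (σ.toTy.subst s) (σ'.toTy.subst s)) (.lam (σ.toTy.subst s')
        (.app ((σ'.act p τ τ' f).wkL 2)
          (.app (.lvar 1) (.app ((σ.act (!p) τ τ' f).wkL 2) (.lvar 0)))))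
  | _, .bang σ, p, _, τ, τ', f =>
      let s := if p then τ else τ'
      .lam (.bang (σ.toTy.subst s)) (.letB (σ.toTy.subst s) (.lvar 0)
        (.bang (.app (((σ.act p τ τ' f).wkL 1).wkI 1) (.ivar 0))))
  | _, .pi σ, p, _, τ, τ', f =>
      let s := if p then τ else τ'
      .lam (.pi (σ.toTy.subst (upTy s))) (.tlam
        (.app ((σ.act p (upTy τ) (upTy τ')
            (Fin.cases (idTm (.var 0)) (fun i => (f i).wkT))).wkL 1)
          (.tapp (.lvar 0) (.var 0))))

/-- For `α ⊢ σ` in which `α` occurs only positively, the closed term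
`M_σ = Λα. Λα'. λf:α⊸α'. (the action of σ at f) : Πα. Πα'. (α ⊸ α') → σ(α) ⊸ σ(α')`. -/
def IndTy.functorTm {S : Signature.{u, v}} (σ : IndTy S.toTySig 1) : Tm S 0 :=
  .tlam (.tlam (.lam (.bang (.lolli (.var 1) (.var 0)))
    (.letB (.lolli (.var 1) (.var 0)) (.lvar 0)
      (σ.act true (fun _ => .var 1) (fun _ => .var 0) (fun _ => .ivar 0)))))

/-- `σ(f) = M_σ τ τ' !f`, for `f : τ ⊸ τ'`. -/
def IndTy.map {S : Signature.{u, v}} {n : ℕ} (σ : IndTy S.toTySig 1) (τ τ' : Ty S.toTySig n)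
    (f : Tm S n) : Tm S n :=
  .app (.tapp (.tapp σ.functorTm.ofClosed τ) τ') (.bang f)

/-! ### Final coalgebras -/

/-- The existential type `∐α.σ = Πβ. (Πα. σ ⊸ β) ⊸ β`. -/
def Ty.ex {K : TySig.{u}} {n : ℕ} (σ : Ty K (n + 1)) : Ty K n :=
  .pi (.lolli (.pi (.lolli (σ.ren (upTyRen Fin.succ)) (.var 1))) (.var 0))

/-- `pack = Λα. λ°x:σ. Λβ. λ°f:Πα.(σ⊸β). f α x : Πα. (σ ⊸ ∐α.σ)`. -/
def pack {S : Signature.{u, v}} {n : ℕ} (σ : Ty S.toTySig (n + 1)) : Tm S n :=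
  .tlam (.lam σ (.tlam (.lam
    (.pi (.lolli (σ.ren (upTyRen (fun i => i.succ.succ))) (.var 1)))
    (.app (.tapp (.lvar 0) (.var 1)) (.lvar 1)))))

/-- `!(α ⊸ σ(α)) ⊗ α`, for `α ⊢ σ`. -/
def coalgTy {K : TySig.{u}} (σ : Ty K 1) : Ty K 1 := .tensor (.bang (.lolli (.var 0) σ)) (.var 0)

/-- The closed type `να.σ(α) = ∐α. !(α ⊸ σ(α)) ⊗ α`. -/
def Ty.nu {K : TySig.{u}} (σ : Ty K 1) : Ty K 0 := .ex (coalgTy σ)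

/-- `unfold = Λα. λ°f:!(α⊸σ(α)). λ°x:α. pack α (f ⊗ x) : Πα. (α ⊸ σ(α)) → α ⊸ να.σ(α)`. -/
def unfoldTm {S : Signature.{u, v}} (σ : Ty S.toTySig 1) : Tm S 0 :=
  .tlam (.lam (.bang (.lolli (.var 0) σ)) (.lam (.var 0)
    (.app (.tapp (pack (coalgTy σ)).ofClosed (.var 0)) (.tensor (.lvar 1) (.lvar 0)))))

/-- `r = Λα. λ°y:!(α⊸σ(α))⊗α. let w ⊗ z be y in let !f be w in σ(unfold α !f) (f z)`, of type
`Πα. !(α ⊸ σ(α)) ⊗ α ⊸ σ(να.σ(α))`. -/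
def outAux {S : Signature.{u, v}} (σ : IndTy S.toTySig 1) : Tm S 0 :=
  .tlam (.lam (coalgTy σ.toTy)
    (.letT (.bang (.lolli (.var 0) σ.toTy)) (.var 0) (.lvar 0)
      (.letB (.lolli (.var 0) σ.toTy) (.lvar 1)
        (.app
          (σ.map (.var 0) (Ty.nu σ.toTy).ofClosed
            (.app (.tapp (unfoldTm σ.toTy).ofClosed (.var 0)) (.bang (.ivar 0))))
          (.app (.ivar 0) (.lvar 0))))))

/-- `out = λ°x:να.σ(α). x σ(να.σ(α)) r : να.σ(α) ⊸ σ(να.σ(α))`. -/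
def outTm {S : Signature.{u, v}} (σ : IndTy S.toTySig 1) : Tm S 0 :=
  .lam (Ty.nu σ.toTy) (.app (.tapp (.lvar 0) (σ.toTy.inst (Ty.nu σ.toTy))) (outAux σ))

end LAPL

set_option linter.unusedSimpArgs false

namespace LAPL

/-! ### Renaming and substitution of types -/

section Types
variable {K : TySig.{u}}

@[simp] theorem upTyRen_zero {n m : ℕ} (r : Fin n → Fin m) : upTyRen r 0 = 0 := rfl
@[simp] theorem upTyRen_succ {n m : ℕ} (r : Fin n → Fin m) (i : Fin n) :
    upTyRen r i.succ = (r i).succ := rfl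
@[simp] theorem upTy_zero {n m : ℕ} (s : Fin n → Ty K m) : upTy s 0 = .var 0 := rfl
@[simp] theorem upTy_succ {n m : ℕ} (s : Fin n → Ty K m) (i : Fin n) :
    upTy s i.succ = (s i).wk := rfl
@[simp] theorem upTy_one {n m : ℕ} (s : Fin (n + 1) → Ty K m) : upTy s 1 = (s 0).wk := rfl
@[simp] theorem upTyRen_one {n m : ℕ} (r : Fin (n + 1) → Fin m) : upTyRen r 1 = (r 0).succ := rfl
@[simp] theorem scons_zero {α : Type*} (a : α) (f : ℕ → α) : scons a f 0 = a := rfl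
@[simp] theorem scons_succ {α : Type*} (a : α) (f : ℕ → α) (i : ℕ) : scons a f (i + 1) = f i := rfl
@[simp] theorem scons_one {α : Type*} (a : α) (f : ℕ → α) : scons a f 1 = f 0 := rfl
@[simp] theorem scons_two {α : Type*} (a : α) (f : ℕ → α) : scons a f 2 = f 1 := rfl
@[simp] theorem scons_three {α : Type*} (a : α) (f : ℕ → α) : scons a f 3 = f 2 := rfl
@[simp] theorem upRen_zero (r : ℕ → ℕ) : upRen r 0 = 0 := rfl
@[simp] theorem upRen_succ (r : ℕ → ℕ) (i : ℕ) : upRen r (i + 1) = r i + 1 := rfl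
@[simp] theorem upRen_one (r : ℕ → ℕ) : upRen r 1 = r 0 + 1 := rfl
@[simp] theorem upRen_two (r : ℕ → ℕ) : upRen r 2 = r 1 + 1 := rfl
@[simp] theorem upRen_three (r : ℕ → ℕ) : upRen r 3 = r 2 + 1 := rfl

@[simp] theorem upTyRen_id {n : ℕ} : upTyRen (fun i : Fin n => i) = fun i => i := by
  funext i; refine Fin.cases ?_ (fun i => ?_) i <;> rfl

@[simp] theorem upRen_id : upRen (fun i => i) = fun i => i := by
  funext i; cases i <;> rfl

@[simp] theorem upRen_id' : upRen id = id := upRen_id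

theorem upTyRen_comp {n m k : ℕ} (r : Fin n → Fin m) (r' : Fin m → Fin k) (i : Fin (n + 1)) :
    upTyRen r' (upTyRen r i) = upTyRen (fun i => r' (r i)) i := by
  refine Fin.cases ?_ (fun i => ?_) i <;> rfl

theorem upRen_comp (r r' : ℕ → ℕ) (i : ℕ) :
    upRen r' (upRen r i) = upRen (fun i => r' (r i)) i := by
  cases i <;> rfl

theorem Ty.ren_ren {n : ℕ} (σ : Ty K n) {m k : ℕ} (r : Fin n → Fin m) (r' : Fin m → Fin k) :
    (σ.ren r).ren r' = σ.ren (fun i => r' (r i)) := by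
  induction σ generalizing m k with
  | pi σ ih => simp only [Ty.ren, ih, upTyRen_comp]
  | _ => simp [*, Ty.ren]

@[simp] theorem Ty.ren_id {n : ℕ} (σ : Ty K n) : σ.ren (fun i => i) = σ := by
  induction σ with
  | pi σ ih => simp only [Ty.ren, ih, upTyRen_id]
  | _ => simp [*, Ty.ren]

@[simp] theorem Ty.ren_id' {n : ℕ} (σ : Ty K n) : σ.ren id = σ := σ.ren_id

theorem upTy_upTyRen {n m k : ℕ} (r : Fin n → Fin m) (s : Fin m → Ty K k) (i : Fin (n + 1)) :
    upTy s (upTyRen r i) = upTy (fun i => s (r i)) i := by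
  refine Fin.cases ?_ (fun i => ?_) i <;> rfl

theorem Ty.ren_subst {n : ℕ} (σ : Ty K n) {m k : ℕ} (r : Fin n → Fin m) (s : Fin m → Ty K k) :
    (σ.ren r).subst s = σ.subst (fun i => s (r i)) := by
  induction σ generalizing m k with
  | pi σ ih => simp only [Ty.ren, Ty.subst, ih, upTy_upTyRen]
  | _ => simp [*, Ty.ren, Ty.subst]

theorem upTy_ren {n m k : ℕ} (s : Fin n → Ty K m) (r : Fin m → Fin k) (i : Fin (n + 1)) :
    (upTy s i).ren (upTyRen r) = upTy (fun i => (s i).ren r) i := by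
  refine Fin.cases rfl (fun i => ?_) i
  simp [Ty.wk, Ty.ren_ren]

theorem Ty.subst_ren {n : ℕ} (σ : Ty K n) {m k : ℕ} (s : Fin n → Ty K m) (r : Fin m → Fin k) :
    (σ.subst s).ren r = σ.subst (fun i => (s i).ren r) := by
  induction σ generalizing m k with
  | pi σ ih => simp only [Ty.ren, Ty.subst, ih, upTy_ren]
  | _ => simp [*, Ty.ren, Ty.subst]

theorem upTy_subst {n m k : ℕ} (s : Fin n → Ty K m) (s' : Fin m → Ty K k) (i : Fin (n + 1)) :
    (upTy s i).subst (upTy s') = upTy (fun i => (s i).subst s') i := by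
  refine Fin.cases rfl (fun i => ?_) i
  simp [Ty.wk, Ty.ren_subst, Ty.subst_ren]

theorem Ty.subst_subst {n : ℕ} (σ : Ty K n) {m k : ℕ} (s : Fin n → Ty K m)
    (s' : Fin m → Ty K k) : (σ.subst s).subst s' = σ.subst (fun i => (s i).subst s') := by
  induction σ generalizing m k with
  | pi σ ih => simp only [Ty.subst, ih, upTy_subst]
  | _ => simp [*, Ty.subst]

@[simp] theorem upTy_var {n : ℕ} : upTy (fun i : Fin n => (.var i : Ty K n)) = fun i => .var i := by
  funext i; refine Fin.cases ?_ (fun i => ?_) i <;> rfl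

theorem upTy_var_ren {n m : ℕ} (r : Fin n → Fin m) :
    upTy (fun i => (.var (r i) : Ty K m)) = fun i => .var (upTyRen r i) := by
  funext i; refine Fin.cases ?_ (fun i => ?_) i <;> rfl

@[simp] theorem Ty.subst_var {n : ℕ} (σ : Ty K n) : σ.subst (fun i => .var i) = σ := by
  induction σ with
  | pi σ ih => simp only [Ty.subst, ih, upTy_var]
  | _ => simp [*, Ty.subst]

@[simp] theorem Ty.subst_var' {n : ℕ} (σ : Ty K n) : σ.subst .var = σ := σ.subst_var

theorem Ty.ren_eq_subst {n : ℕ} (σ : Ty K n) {m : ℕ} (r : Fin n → Fin m) :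
    σ.ren r = σ.subst (fun i => .var (r i)) := by
  rw [← Ty.subst_var (σ.ren r), Ty.ren_subst]

@[simp] theorem Ty.ofClosed_ren (σ : Ty K 0) {n m : ℕ} (r : Fin n → Fin m) :
    (σ.ofClosed : Ty K n).ren r = σ.ofClosed := by
  simp only [Ty.ofClosed, Ty.ren_ren]; congr 1; funext i; exact i.elim0

@[simp] theorem Ty.ofClosed_subst (σ : Ty K 0) {n m : ℕ} (s : Fin n → Ty K m) :
    (σ.ofClosed : Ty K n).subst s = σ.ofClosed := by
  simp only [Ty.ofClosed, Ty.ren_subst]; rw [Ty.ren_eq_subst]; congr 1; funext i; exact i.elim0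

theorem Ty.closed_subst (σ : Ty K 0) {m : ℕ} (s : Fin 0 → Ty K m) :
    σ.subst s = σ.ofClosed := by
  rw [Ty.ofClosed, Ty.ren_eq_subst]; congr 1; funext i; exact i.elim0

end Types

/-! ### Renaming and substitution of terms -/

section Terms
variable {S : Signature.{u, v}}

theorem Tm.ren_ren {n : ℕ} (t : Tm S n) {m k : ℕ} (r : Fin n → Fin m) (ri rl : ℕ → ℕ)
    (r' : Fin m → Fin k) (ri' rl' : ℕ → ℕ) :
    (t.ren r ri rl).ren r' ri' rl' =
      t.ren (fun i => r' (r i)) (fun i => ri' (ri i)) (fun i => rl' (rl i)) := by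
  induction t generalizing m k ri rl ri' rl' with
  | _ => simp [*, Tm.ren, Ty.ren_ren, upTyRen_comp, upRen_comp]

@[simp] theorem Tm.ren_id {n : ℕ} (t : Tm S n) :
    t.ren (fun i => i) (fun i => i) (fun i => i) = t := by
  induction t with
  | _ => simp [*, Tm.ren]

theorem scons_upRen {α : Type*} (a : α) (f : ℕ → α) (r : ℕ → ℕ) (i : ℕ) :
    scons a f (upRen r i) = scons a (fun i => f (r i)) i := by
  cases i <;> rfl

theorem id_eq_fun {α : Type*} : (id : α → α) = fun x => x := rfl

theorem scons_tmRen {n m : ℕ} (r : Fin n → Fin m) (ri rl : ℕ → ℕ) (a : Tm S n) (f : ℕ → Tm S n)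
    (i : ℕ) :
    (scons a f i).ren r ri rl = scons (a.ren r ri rl) (fun i => (f i).ren r ri rl) i := by
  cases i <;> rfl

theorem scons_tmSubst {n m : ℕ} (s : Fin n → Ty S.toTySig m) (si sl : ℕ → Tm S m) (a : Tm S n)
    (f : ℕ → Tm S n) (i : ℕ) :
    (scons a f i).subst s si sl = scons (a.subst s si sl) (fun i => (f i).subst s si sl) i := by
  cases i <;> rfl

theorem scons_relRen {n m : ℕ} (r : Fin n → Fin m) (ri rl : ℕ → ℕ) (a : Rel S n)
    (f : ℕ → Rel S n) (i : ℕ) :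
    (scons a f i).ren r ri rl = scons (a.ren r ri rl) (fun i => (f i).ren r ri rl) i := by
  cases i <;> rfl

theorem scons_relSubst {n m : ℕ} (s : Fin n → Ty S.toTySig m) (si : ℕ → Tm S m)
    (sr : ℕ → Rel S m) (a : Rel S n) (f : ℕ → Rel S n) (i : ℕ) :
    (scons a f i).subst s si sr = scons (a.subst s si sr) (fun i => (f i).subst s si sr) i := by
  cases i <;> rfl

theorem Tm.ren_subst {n : ℕ} (t : Tm S n) {m k : ℕ} (r : Fin n → Fin m) (ri rl : ℕ → ℕ)
    (s : Fin m → Ty S.toTySig k) (si sl : ℕ → Tm S k) :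
    (t.ren r ri rl).subst s si sl =
      t.subst (fun i => s (r i)) (fun i => si (ri i)) (fun i => sl (rl i)) := by
  induction t generalizing m k ri rl with
  | _ => simp [*, Tm.ren, Tm.subst, Ty.ren_subst, upTy_upTyRen, scons_upRen]

theorem Tm.subst_ren {n : ℕ} (t : Tm S n) {m k : ℕ}
    (s : Fin n → Ty S.toTySig m) (si sl : ℕ → Tm S m) (r : Fin m → Fin k) (ri rl : ℕ → ℕ) :
    (t.subst s si sl).ren r ri rl =
      t.subst (fun i => (s i).ren r) (fun i => (si i).ren r ri rl)
        (fun i => (sl i).ren r ri rl) := by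
  induction t generalizing m k ri rl with
  | _ =>
    simp [*, Tm.ren, Tm.subst, Ty.subst_ren, upTy_ren, Tm.wkI, Tm.wkL, Tm.wkT, Tm.ren_ren,
      scons_tmRen, Nat.add_assoc, id_eq_fun]

theorem Tm.subst_subst {n : ℕ} (t : Tm S n) {m k : ℕ}
    (s : Fin n → Ty S.toTySig m) (si sl : ℕ → Tm S m)
    (s' : Fin m → Ty S.toTySig k) (si' sl' : ℕ → Tm S k) :
    (t.subst s si sl).subst s' si' sl' =
      t.subst (fun i => (s i).subst s') (fun i => (si i).subst s' si' sl')
        (fun i => (sl i).subst s' si' sl') := by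
  induction t generalizing m k with
  | _ =>
    simp [*, Tm.subst, Ty.subst_subst, upTy_subst, Tm.wkI, Tm.wkL, Tm.wkT, Tm.ren_subst,
      Tm.subst_ren, scons_tmSubst, Ty.wk, id_eq_fun]

theorem scons_eta {α : Type*} (f : ℕ → α) : scons (f 0) (fun i => f (i + 1)) = f := by
  funext i; cases i <;> rfl

@[simp] theorem scons_lvar {n : ℕ} :
    scons (.lvar 0 : Tm S n) (fun i => .lvar (i + 1)) = fun i => .lvar i := scons_eta _
@[simp] theorem scons_ivar {n : ℕ} :
    scons (.ivar 0 : Tm S n) (fun i => .ivar (i + 1)) = fun i => .ivar i := scons_eta _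

@[simp] theorem scons_lvar_two {n : ℕ} :
    scons (.lvar 0 : Tm S n) (scons (.lvar 1) (fun i => .lvar (i + 2))) = fun i => .lvar i := by
  funext i; rcases i with _ | _ | i <;> rfl
@[simp] theorem scons_ivar_two {n : ℕ} :
    scons (.ivar 0 : Tm S n) (scons (.ivar 1) (fun i => .ivar (i + 2))) = fun i => .ivar i := by
  funext i; rcases i with _ | _ | i <;> rfl

@[simp] theorem Tm.subst_var {n : ℕ} (t : Tm S n) :
    t.subst (fun i => .var i) (fun i => .ivar i) (fun i => .lvar i) = t := by
  induction t with
  | _ => simp [*, Tm.subst, Tm.wkI, Tm.wkL, Tm.wkT, Tm.ren]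

@[simp] theorem Tm.subst_var' {n : ℕ} (t : Tm S n) : t.subst .var .ivar .lvar = t := t.subst_var

theorem Tm.ren_eq_subst {n : ℕ} (t : Tm S n) {m : ℕ} (r : Fin n → Fin m) (ri rl : ℕ → ℕ) :
    t.ren r ri rl =
      t.subst (fun i => .var (r i)) (fun i => .ivar (ri i)) (fun i => .lvar (rl i)) := by
  rw [← Tm.subst_var (t.ren r ri rl), Tm.ren_subst]

end Terms

/-! ### Renaming and substitution of relations and formulas -/

section Relations
variable {S : Signature.{u, v}}

mutual

theorem Rel.ren_ren {n : ℕ} (ρ : Rel S n) {m k : ℕ} (r : Fin n → Fin m) (ri rr : ℕ → ℕ)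
    (r' : Fin m → Fin k) (ri' rr' : ℕ → ℕ) :
    (ρ.ren r ri rr).ren r' ri' rr' =
      ρ.ren (fun i => r' (r i)) (fun i => ri' (ri i)) (fun i => rr' (rr i)) := by
  match ρ with
  | .var i => rfl
  | .abs σ τ φ => simp [Rel.ren, Fm.ren_ren φ, Ty.ren_ren, upRen_comp]
  | .interp σ ρ => simp [Rel.ren, fun i => @Rel.ren_ren _ (ρ i)]

theorem Fm.ren_ren {n : ℕ} (φ : Fm S n) {m k : ℕ} (r : Fin n → Fin m) (ri rr : ℕ → ℕ)
    (r' : Fin m → Fin k) (ri' rr' : ℕ → ℕ) :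
    (φ.ren r ri rr).ren r' ri' rr' =
      φ.ren (fun i => r' (r i)) (fun i => ri' (ri i)) (fun i => rr' (rr i)) := by
  match φ with
  | .eq σ t u => simp [Fm.ren, Ty.ren_ren, Tm.ren_ren, id_eq_fun]
  | .app ρ t u => simp [Fm.ren, Rel.ren_ren ρ, Tm.ren_ren, id_eq_fun]
  | .imp φ ψ => simp [Fm.ren, Fm.ren_ren φ, Fm.ren_ren ψ]
  | .bot => rfl
  | .top => rfl
  | .and φ ψ => simp [Fm.ren, Fm.ren_ren φ, Fm.ren_ren ψ]
  | .or φ ψ => simp [Fm.ren, Fm.ren_ren φ, Fm.ren_ren ψ]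
  | .allTy φ => simp [Fm.ren, Fm.ren_ren φ, upTyRen_comp]
  | .allTm σ φ => simp [Fm.ren, Fm.ren_ren φ, Ty.ren_ren, upRen_comp]
  | .allRel κ σ τ φ => simp [Fm.ren, Fm.ren_ren φ, Ty.ren_ren, upRen_comp]
  | .exTy φ => simp [Fm.ren, Fm.ren_ren φ, upTyRen_comp]
  | .exTm σ φ => simp [Fm.ren, Fm.ren_ren φ, Ty.ren_ren, upRen_comp]
  | .exRel κ σ τ φ => simp [Fm.ren, Fm.ren_ren φ, Ty.ren_ren, upRen_comp]

end

mutual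

theorem Rel.ren_subst {n : ℕ} (ρ : Rel S n) {m k : ℕ} (r : Fin n → Fin m) (ri rr : ℕ → ℕ)
    (s : Fin m → Ty S.toTySig k) (si : ℕ → Tm S k) (sr : ℕ → Rel S k) :
    (ρ.ren r ri rr).subst s si sr =
      ρ.subst (fun i => s (r i)) (fun i => si (ri i)) (fun i => sr (rr i)) := by
  match ρ with
  | .var i => rfl
  | .abs σ τ φ => simp [Rel.ren, Rel.subst, Fm.ren_subst φ, Ty.ren_subst, scons_upRen]
  | .interp σ ρ => simp [Rel.ren, Rel.subst, fun i => @Rel.ren_subst _ (ρ i)]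

theorem Fm.ren_subst {n : ℕ} (φ : Fm S n) {m k : ℕ} (r : Fin n → Fin m) (ri rr : ℕ → ℕ)
    (s : Fin m → Ty S.toTySig k) (si : ℕ → Tm S k) (sr : ℕ → Rel S k) :
    (φ.ren r ri rr).subst s si sr =
      φ.subst (fun i => s (r i)) (fun i => si (ri i)) (fun i => sr (rr i)) := by
  match φ with
  | .eq σ t u => simp [Fm.ren, Fm.subst, Ty.ren_subst, Tm.ren_subst]
  | .app ρ t u => simp [Fm.ren, Fm.subst, Rel.ren_subst ρ, Tm.ren_subst]
  | .imp φ ψ => simp [Fm.ren, Fm.subst, Fm.ren_subst φ, Fm.ren_subst ψ]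
  | .bot => rfl
  | .top => rfl
  | .and φ ψ => simp [Fm.ren, Fm.subst, Fm.ren_subst φ, Fm.ren_subst ψ]
  | .or φ ψ => simp [Fm.ren, Fm.subst, Fm.ren_subst φ, Fm.ren_subst ψ]
  | .allTy φ => simp [Fm.ren, Fm.subst, Fm.ren_subst φ, upTy_upTyRen]
  | .allTm σ φ => simp [Fm.ren, Fm.subst, Fm.ren_subst φ, Ty.ren_subst, scons_upRen]
  | .allRel κ σ τ φ => simp [Fm.ren, Fm.subst, Fm.ren_subst φ, Ty.ren_subst, scons_upRen]
  | .exTy φ => simp [Fm.ren, Fm.subst, Fm.ren_subst φ, upTy_upTyRen]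
  | .exTm σ φ => simp [Fm.ren, Fm.subst, Fm.ren_subst φ, Ty.ren_subst, scons_upRen]
  | .exRel κ σ τ φ => simp [Fm.ren, Fm.subst, Fm.ren_subst φ, Ty.ren_subst, scons_upRen]

end

mutual

theorem Rel.subst_ren {n : ℕ} (ρ : Rel S n) {m k : ℕ}
    (s : Fin n → Ty S.toTySig m) (si : ℕ → Tm S m) (sr : ℕ → Rel S m)
    (r : Fin m → Fin k) (ri rr : ℕ → ℕ) :
    (ρ.subst s si sr).ren r ri rr =
      ρ.subst (fun i => (s i).ren r) (fun i => (si i).ren r ri id)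
        (fun i => (sr i).ren r ri rr) := by
  match ρ with
  | .var i => rfl
  | .abs σ τ φ =>
    simp [Rel.ren, Rel.subst, Fm.subst_ren φ, Ty.subst_ren, Tm.ren, Tm.wkI, Rel.wkI, Tm.ren_ren,
      Rel.ren_ren, scons_tmRen, Nat.add_assoc, id_eq_fun, Ty.wk, id_eq_fun]
  | .interp σ ρ => simp [Rel.ren, Rel.subst, fun i => @Rel.subst_ren _ (ρ i)]

theorem Fm.subst_ren {n : ℕ} (φ : Fm S n) {m k : ℕ}
    (s : Fin n → Ty S.toTySig m) (si : ℕ → Tm S m) (sr : ℕ → Rel S m)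
    (r : Fin m → Fin k) (ri rr : ℕ → ℕ) :
    (φ.subst s si sr).ren r ri rr =
      φ.subst (fun i => (s i).ren r) (fun i => (si i).ren r ri id)
        (fun i => (sr i).ren r ri rr) := by
  match φ with
  | .eq σ t u => simp [Fm.ren, Fm.subst, Ty.subst_ren, Tm.subst_ren, Tm.ren]
  | .app ρ t u => simp [Fm.ren, Fm.subst, Rel.subst_ren ρ, Tm.subst_ren, Tm.ren]
  | .imp φ ψ => simp [Fm.ren, Fm.subst, Fm.subst_ren φ, Fm.subst_ren ψ]
  | .bot => rfl
  | .top => rfl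
  | .and φ ψ => simp [Fm.ren, Fm.subst, Fm.subst_ren φ, Fm.subst_ren ψ]
  | .or φ ψ => simp [Fm.ren, Fm.subst, Fm.subst_ren φ, Fm.subst_ren ψ]
  | .allTy φ =>
    simp [Fm.ren, Fm.subst, Fm.subst_ren φ, upTy_ren, Tm.wkT, Rel.wkT, Tm.ren_ren, Rel.ren_ren]
  | .allTm σ φ =>
    simp [Fm.ren, Fm.subst, Fm.subst_ren φ, Ty.subst_ren, Tm.wkI, Rel.wkI, Tm.ren_ren,
      Rel.ren_ren, scons_tmRen, Nat.add_assoc, id_eq_fun, Tm.ren, Ty.wk, id_eq_fun]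
  | .allRel κ σ τ φ =>
    simp [Fm.ren, Fm.subst, Fm.subst_ren φ, Ty.subst_ren, Rel.wkR,
      Rel.ren_ren, scons_relRen, Nat.add_assoc, id_eq_fun, Rel.ren]
  | .exTy φ =>
    simp [Fm.ren, Fm.subst, Fm.subst_ren φ, upTy_ren, Tm.wkT, Rel.wkT, Tm.ren_ren, Rel.ren_ren]
  | .exTm σ φ =>
    simp [Fm.ren, Fm.subst, Fm.subst_ren φ, Ty.subst_ren, Tm.wkI, Rel.wkI, Tm.ren_ren,
      Rel.ren_ren, scons_tmRen, Nat.add_assoc, id_eq_fun, Tm.ren, Ty.wk, id_eq_fun]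
  | .exRel κ σ τ φ =>
    simp [Fm.ren, Fm.subst, Fm.subst_ren φ, Ty.subst_ren, Rel.wkR,
      Rel.ren_ren, scons_relRen, Nat.add_assoc, id_eq_fun, Rel.ren]

end

mutual

theorem Rel.subst_subst {n : ℕ} (ρ : Rel S n) {m k : ℕ}
    (s : Fin n → Ty S.toTySig m) (si : ℕ → Tm S m) (sr : ℕ → Rel S m)
    (s' : Fin m → Ty S.toTySig k) (si' : ℕ → Tm S k) (sr' : ℕ → Rel S k) :
    (ρ.subst s si sr).subst s' si' sr' =
      ρ.subst (fun i => (s i).subst s') (fun i => (si i).subst s' si' .lvar)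
        (fun i => (sr i).subst s' si' sr') := by
  match ρ with
  | .var i => rfl
  | .abs σ τ φ =>
    simp [Rel.subst, Fm.subst_subst φ, Ty.subst_subst, Tm.subst, Tm.wkI, Rel.wkI, Tm.ren_subst,
      Tm.subst_ren, Rel.ren_subst, Rel.subst_ren,
      scons_tmSubst, Ty.wk, id_eq_fun, Tm.ren, Ty.wk, id_eq_fun]
  | .interp σ ρ => simp [Rel.subst, fun i => @Rel.subst_subst _ (ρ i)]

theorem Fm.subst_subst {n : ℕ} (φ : Fm S n) {m k : ℕ}
    (s : Fin n → Ty S.toTySig m) (si : ℕ → Tm S m) (sr : ℕ → Rel S m)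
    (s' : Fin m → Ty S.toTySig k) (si' : ℕ → Tm S k) (sr' : ℕ → Rel S k) :
    (φ.subst s si sr).subst s' si' sr' =
      φ.subst (fun i => (s i).subst s') (fun i => (si i).subst s' si' .lvar)
        (fun i => (sr i).subst s' si' sr') := by
  match φ with
  | .eq σ t u => simp [Fm.subst, Ty.subst_subst, Tm.subst_subst, Tm.subst]
  | .app ρ t u => simp [Fm.subst, Rel.subst_subst ρ, Tm.subst_subst, Tm.subst]
  | .imp φ ψ => simp [Fm.subst, Fm.subst_subst φ, Fm.subst_subst ψ]
  | .bot => rfl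
  | .top => rfl
  | .and φ ψ => simp [Fm.subst, Fm.subst_subst φ, Fm.subst_subst ψ]
  | .or φ ψ => simp [Fm.subst, Fm.subst_subst φ, Fm.subst_subst ψ]
  | .allTy φ =>
    simp [Fm.subst, Fm.subst_subst φ, upTy_subst, Tm.wkT, Rel.wkT, Tm.ren_subst, Rel.ren_subst,
      Tm.subst_ren, Rel.subst_ren, Tm.ren, Ty.wk, id_eq_fun]
  | .allTm σ φ =>
    simp [Fm.subst, Fm.subst_subst φ, Ty.subst_subst, Tm.wkI, Rel.wkI, Tm.ren_subst,
      Rel.ren_subst, Tm.subst_ren, Rel.subst_ren,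
      scons_tmSubst, Ty.wk, id_eq_fun, Tm.subst, Tm.ren, Ty.wk, id_eq_fun]
  | .allRel κ σ τ φ =>
    simp [Fm.subst, Fm.subst_subst φ, Ty.subst_subst, Rel.wkR, Rel.ren_subst, Rel.subst_ren,
      scons_relSubst, Ty.wk, id_eq_fun, Rel.subst, Tm.ren, Ty.wk, id_eq_fun]
  | .exTy φ =>
    simp [Fm.subst, Fm.subst_subst φ, upTy_subst, Tm.wkT, Rel.wkT, Tm.ren_subst, Rel.ren_subst,
      Tm.subst_ren, Rel.subst_ren, Tm.ren, Ty.wk, id_eq_fun]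
  | .exTm σ φ =>
    simp [Fm.subst, Fm.subst_subst φ, Ty.subst_subst, Tm.wkI, Rel.wkI, Tm.ren_subst,
      Rel.ren_subst, Tm.subst_ren, Rel.subst_ren,
      scons_tmSubst, Ty.wk, id_eq_fun, Tm.subst, Tm.ren, Ty.wk, id_eq_fun]
  | .exRel κ σ τ φ =>
    simp [Fm.subst, Fm.subst_subst φ, Ty.subst_subst, Rel.wkR, Rel.ren_subst, Rel.subst_ren,
      scons_relSubst, Ty.wk, id_eq_fun, Rel.subst, Tm.ren, Ty.wk, id_eq_fun]

end

@[simp] theorem scons_rvar {n : ℕ} :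
    scons (.var 0 : Rel S n) (fun i => .var (i + 1)) = fun i => .var i := scons_eta _

mutual

theorem Rel.subst_var {n : ℕ} (ρ : Rel S n) :
    ρ.subst (fun i => .var i) (fun i => .ivar i) (fun i => .var i) = ρ := by
  match ρ with
  | .var i => rfl
  | .abs σ τ φ => simp [Rel.subst, Tm.wkI, Rel.wkI, Tm.ren, Rel.ren, Fm.subst_var φ]
  | .interp σ ρ => simp [Rel.subst, fun i => @Rel.subst_var _ (ρ i)]

theorem Fm.subst_var {n : ℕ} (φ : Fm S n) :
    φ.subst (fun i => .var i) (fun i => .ivar i) (fun i => .var i) = φ := by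
  match φ with
  | .eq σ t u => simp only [Fm.subst, Ty.subst_var]; exact congr (by simp) (Tm.subst_var _)
  | .app ρ t u =>
    simp only [Fm.subst, Rel.subst_var ρ]; exact congr (congrArg _ (Tm.subst_var _)) (Tm.subst_var _)
  | .imp φ ψ => simp [Fm.subst, Fm.subst_var φ, Fm.subst_var ψ]
  | .bot => rfl
  | .top => rfl
  | .and φ ψ => simp [Fm.subst, Fm.subst_var φ, Fm.subst_var ψ]
  | .or φ ψ => simp [Fm.subst, Fm.subst_var φ, Fm.subst_var ψ]
  | .allTy φ => simp [Fm.subst, Fm.subst_var φ, Tm.wkT, Rel.wkT, Tm.ren, Rel.ren]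
  | .allTm σ φ => simp [Fm.subst, Fm.subst_var φ, Tm.wkI, Rel.wkI, Tm.ren, Rel.ren]
  | .allRel κ σ τ φ => simp [Fm.subst, Fm.subst_var φ, Rel.wkR, Rel.ren]
  | .exTy φ => simp [Fm.subst, Fm.subst_var φ, Tm.wkT, Rel.wkT, Tm.ren, Rel.ren]
  | .exTm σ φ => simp [Fm.subst, Fm.subst_var φ, Tm.wkI, Rel.wkI, Tm.ren, Rel.ren]
  | .exRel κ σ τ φ => simp [Fm.subst, Fm.subst_var φ, Rel.wkR, Rel.ren]

end

attribute [simp] Rel.subst_var Fm.subst_var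

@[simp] theorem Rel.subst_var' {n : ℕ} (ρ : Rel S n) : ρ.subst .var .ivar .var = ρ := ρ.subst_var
@[simp] theorem Fm.subst_var' {n : ℕ} (φ : Fm S n) : φ.subst .var .ivar .var = φ := φ.subst_var

theorem Rel.ren_eq_subst {n : ℕ} (ρ : Rel S n) {m : ℕ} (r : Fin n → Fin m) (ri rr : ℕ → ℕ) :
    ρ.ren r ri rr =
      ρ.subst (fun i => .var (r i)) (fun i => .ivar (ri i)) (fun i => .var (rr i)) := by
  rw [← Rel.subst_var (ρ.ren r ri rr), Rel.ren_subst]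

theorem Fm.ren_eq_subst {n : ℕ} (φ : Fm S n) {m : ℕ} (r : Fin n → Fin m) (ri rr : ℕ → ℕ) :
    φ.ren r ri rr =
      φ.subst (fun i => .var (r i)) (fun i => .ivar (ri i)) (fun i => .var (rr i)) := by
  rw [← Fm.subst_var (φ.ren r ri rr), Fm.ren_subst]

end Relations

section Typing
variable {S : Signature.{u, v}}

/-! ### Linear contexts -/

theorem LCtx.split_empty {K : TySig.{u}} {n : ℕ} :
    (LCtx.empty : LCtx K n).Split .empty .empty := fun _ => .inl ⟨rfl, rfl⟩

theorem LCtx.split_left {K : TySig.{u}} {n : ℕ} (Δ : LCtx K n) : Δ.Split Δ .empty :=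
  fun _ => .inl ⟨rfl, rfl⟩

theorem LCtx.split_right {K : TySig.{u}} {n : ℕ} (Δ : LCtx K n) : Δ.Split .empty Δ :=
  fun _ => .inr ⟨rfl, rfl⟩

@[simp] theorem LCtx.wk_empty {K : TySig.{u}} {n : ℕ} :
    (LCtx.empty : LCtx K n).wk = .empty := rfl

theorem LCtx.cons_empty {K : TySig.{u}} {n : ℕ} (σ : Ty K n) :
    LCtx.empty.cons σ = .single 0 σ := by
  funext k; cases k <;> rfl

theorem LCtx.Split.left_ne {K : TySig.{u}} {n : ℕ} {Δ Δ₁ Δ₂ : LCtx K n} (h : Δ.Split Δ₁ Δ₂) {j : ℕ}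
    (hj : Δ₁ j ≠ none) : Δ j ≠ none := by
  rcases h j with h | h <;> simp_all

theorem LCtx.Split.right_ne {K : TySig.{u}} {n : ℕ} {Δ Δ₁ Δ₂ : LCtx K n} (h : Δ.Split Δ₁ Δ₂)
    {j : ℕ} (hj : Δ₂ j ≠ none) : Δ j ≠ none := by
  rcases h j with h | h <;> simp_all

/-- Renaming of the type variables of a linear context. -/
def LCtx.ren {K : TySig.{u}} {n m : ℕ} (Δ : LCtx K n) (r : Fin n → Fin m) : LCtx K m :=
  fun j => (Δ j).map (fun σ => σ.ren r)

@[simp] theorem LCtx.ren_id {K : TySig.{u}} {n : ℕ} (Δ : LCtx K n) :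
    Δ.ren (fun i => i) = Δ := by
  funext j; simp [LCtx.ren]

theorem LCtx.Split.ren {K : TySig.{u}} {n m : ℕ} {Δ Δ₁ Δ₂ : LCtx K n} (h : Δ.Split Δ₁ Δ₂)
    (r : Fin n → Fin m) : (Δ.ren r).Split (Δ₁.ren r) (Δ₂.ren r) := by
  intro j
  rcases h j with ⟨h₁, h₂⟩ | ⟨h₁, h₂⟩
  · exact .inl ⟨by simp [LCtx.ren, h₁], by simp [LCtx.ren, h₂]⟩
  · exact .inr ⟨by simp [LCtx.ren, h₁], by simp [LCtx.ren, h₂]⟩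

theorem LCtx.ren_cons {K : TySig.{u}} {n m : ℕ} (Δ : LCtx K n) (σ : Ty K n) (r : Fin n → Fin m) :
    (Δ.cons σ).ren r = (Δ.ren r).cons (σ.ren r) := by
  funext k; cases k <;> rfl

theorem LCtx.ren_wk {K : TySig.{u}} {n m : ℕ} (Δ : LCtx K n) (r : Fin n → Fin m) :
    Δ.wk.ren (upTyRen r) = (Δ.ren r).wk := by
  funext k; simp only [LCtx.ren, LCtx.wk]
  cases Δ k <;> simp [Ty.wk, Ty.ren_ren]

theorem LCtx.ren_single {K : TySig.{u}} {n m : ℕ} (j : ℕ) (σ : Ty K n) (r : Fin n → Fin m) :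
    (LCtx.single j σ).ren r = .single j (σ.ren r) := by
  funext k; simp only [LCtx.ren, LCtx.single]; split <;> rfl

/-! ### Weakening and invariance of typed terms -/

theorem Ty.inst_ren {K : TySig.{u}} {n m : ℕ} (σ : Ty K (n + 1)) (τ : Ty K n) (r : Fin n → Fin m) :
    (σ.inst τ).ren r = (σ.ren (upTyRen r)).inst (τ.ren r) := by
  simp only [Ty.inst, Ty.subst_ren, Ty.ren_subst]
  congr 1; funext i; refine Fin.cases ?_ (fun i => ?_) i <;> rfl

theorem upTyRen_wk {K : TySig.{u}} {n m : ℕ} (σ : Ty K n) (r : Fin n → Fin m) :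
    σ.wk.ren (upTyRen r) = (σ.ren r).wk := by
  simp [Ty.wk, Ty.ren_ren]

theorem getElem?_map_wk {K : TySig.{u}} {n m : ℕ} {Γ : List (Ty K n)} {Γ' : List (Ty K m)}
    {r : Fin n → Fin m} {ri : ℕ → ℕ}
    (h : ∀ i σ, Γ[i]? = some σ → Γ'[ri i]? = some (σ.ren r)) (i : ℕ) (σ : Ty K (n + 1))
    (hi : (Γ.map Ty.wk)[i]? = some σ) : (Γ'.map Ty.wk)[ri i]? = some (σ.ren (upTyRen r)) := by
  simp only [List.getElem?_map, Option.map_eq_some_iff] at hi ⊢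
  obtain ⟨τ, hτ, rfl⟩ := hi
  exact ⟨_, h _ _ hτ, (upTyRen_wk _ _).symm⟩

theorem getElem?_cons_ren {K : TySig.{u}} {n m : ℕ} {Γ : List (Ty K n)} {Γ' : List (Ty K m)}
    {r : Fin n → Fin m} {ri : ℕ → ℕ} (ω : Ty K n)
    (h : ∀ i σ, Γ[i]? = some σ → Γ'[ri i]? = some (σ.ren r)) (i : ℕ) (σ : Ty K n)
    (hi : (ω :: Γ)[i]? = some σ) : (ω.ren r :: Γ')[upRen ri i]? = some (σ.ren r) := by
  cases i with
  | zero => simp_all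
  | succ i => exact h i σ hi

theorem HasType.ren {n : ℕ} {Γ : List (Ty S.toTySig n)} {Δ : LCtx S.toTySig n} {t : Tm S n}
    {τ : Ty S.toTySig n} (h : HasType Γ Δ t τ) : ∀ {m : ℕ} (r : Fin n → Fin m) (ri : ℕ → ℕ)
    (Γ' : List (Ty S.toTySig m)), (∀ i σ, Γ[i]? = some σ → Γ'[ri i]? = some (σ.ren r)) →
    HasType Γ' (Δ.ren r) (t.ren r ri id) (τ.ren r) := by
  induction h with
  | star => intros; exact .star
  | fix => intros; exact .fix
  | con c => intros; rw [Ty.ofClosed_ren]; exact .con c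
  | ivar h => intro m r ri Γ' hΓ; exact .ivar (hΓ _ _ h)
  | lvar => intros; rw [LCtx.ren_single]; exact .lvar
  | app hs _ _ ih₁ ih₂ =>
    intro m r ri Γ' hΓ
    exact .app (hs.ren r) (ih₁ r ri Γ' hΓ) (ih₂ r ri Γ' hΓ)
  | lam _ ih =>
    intro m r ri Γ' hΓ
    refine .lam ?_
    have := ih r ri Γ' hΓ
    rwa [LCtx.ren_cons, ← upRen_id'] at this
  | tensor hs _ _ ih₁ ih₂ =>
    intro m r ri Γ' hΓ
    exact .tensor (hs.ren r) (ih₁ r ri Γ' hΓ) (ih₂ r ri Γ' hΓ)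
  | bang _ ih => intro m r ri Γ' hΓ; exact .bang (ih r ri Γ' hΓ)
  | tlam _ ih =>
    intro m r ri Γ' hΓ
    refine .tlam ?_
    have := ih (upTyRen r) ri (Γ'.map Ty.wk) (getElem?_map_wk hΓ)
    rwa [LCtx.ren_wk] at this
  | tapp τ _ ih =>
    intro m r ri Γ' hΓ
    rw [Ty.inst_ren]
    exact .tapp _ (ih r ri Γ' hΓ)
  | letT hs _ _ ih₁ ih₂ =>
    intro m r ri Γ' hΓ
    refine .letT (hs.ren r) (ih₁ r ri Γ' hΓ) ?_
    have := ih₂ r ri Γ' hΓ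
    rw [LCtx.ren_cons, LCtx.ren_cons] at this
    simpa using this
  | letB hs _ _ ih₁ ih₂ =>
    intro m r ri Γ' hΓ
    exact .letB (hs.ren r) (ih₁ r ri Γ' hΓ) (ih₂ r _ _ (getElem?_cons_ren _ hΓ))
  | letS hs _ _ ih₁ ih₂ =>
    intro m r ri Γ' hΓ
    exact .letS (hs.ren r) (ih₁ r ri Γ' hΓ) (ih₂ r ri Γ' hΓ)

theorem HasType.subst_congr {n : ℕ} {Γ : List (Ty S.toTySig n)} {Δ : LCtx S.toTySig n} {t : Tm S n}
    {τ : Ty S.toTySig n} (h : HasType Γ Δ t τ) : ∀ {m : ℕ} {s : Fin n → Ty S.toTySig m}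
    {si si' sl sl' : ℕ → Tm S m}, (∀ i < Γ.length, si i = si' i) →
    (∀ j, Δ j ≠ none → sl j = sl' j) → t.subst s si sl = t.subst s si' sl' := by
  induction h with
  | star => intros; rfl
  | fix => intros; rfl
  | con c => intros; rfl
  | ivar h => intro m s si si' sl sl' hi hl; exact hi _ (List.getElem?_eq_some_iff.1 h).1
  | lvar => intro m s si si' sl sl' hi hl; exact hl _ (by simp [LCtx.single])
  | app hs _ _ ih₁ ih₂ =>
    intro m s si si' sl sl' hi hl
    simp only [Tm.subst]
    rw [ih₁ hi fun j hj => hl j (hs.left_ne hj), ih₂ hi fun j hj => hl j (hs.right_ne hj)]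
  | lam _ ih =>
    intro m s si si' sl sl' hi hl
    simp only [Tm.subst]
    rw [ih (fun i h => by rw [hi i h])]
    rintro (_ | j) hj
    · rfl
    · exact congrArg (Tm.wkL 1) (hl j hj)
  | tensor hs _ _ ih₁ ih₂ =>
    intro m s si si' sl sl' hi hl
    simp only [Tm.subst]
    rw [ih₁ hi fun j hj => hl j (hs.left_ne hj), ih₂ hi fun j hj => hl j (hs.right_ne hj)]
  | bang _ ih =>
    intro m s si si' sl sl' hi hl
    simp only [Tm.subst]
    rw [ih hi hl]
  | tlam _ ih =>
    intro m s si si' sl sl' hi hl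
    simp only [Tm.subst]
    rw [ih (fun i h => by rw [hi i (by simpa using h)])]
    intro j hj
    rw [hl j (fun h => hj (by simp [LCtx.wk, h]))]
  | tapp τ _ ih =>
    intro m s si si' sl sl' hi hl
    simp only [Tm.subst]
    rw [ih hi hl]
  | letT hs _ _ ih₁ ih₂ =>
    intro m s si si' sl sl' hi hl
    simp only [Tm.subst]
    rw [ih₁ hi fun j hj => hl j (hs.left_ne hj), ih₂ (fun i h => by rw [hi i h])]
    rintro (_ | _ | j) hj
    · rfl
    · rfl
    · exact congrArg (Tm.wkL 2) (hl j (hs.right_ne hj))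
  | letB hs _ _ ih₁ ih₂ =>
    intro m s si si' sl sl' hi hl
    simp only [Tm.subst]
    rw [ih₁ hi fun j hj => hl j (hs.left_ne hj), ih₂]
    · rintro (_ | i) h
      · rfl
      · exact congrArg (Tm.wkI 1) (hi i (by simpa using h))
    · exact fun j hj => congrArg _ (hl j (hs.right_ne hj))
  | letS hs _ _ ih₁ ih₂ =>
    intro m s si si' sl sl' hi hl
    simp only [Tm.subst]
    rw [ih₁ hi fun j hj => hl j (hs.left_ne hj), ih₂ hi fun j hj => hl j (hs.right_ne hj)]

theorem HasType.wkL_eq {n : ℕ} {Γ : List (Ty S.toTySig n)} {t : Tm S n} {τ : Ty S.toTySig n}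
    (h : HasType Γ .empty t τ) (k : ℕ) : t.wkL k = t := by
  rw [Tm.wkL, Tm.ren_eq_subst]
  refine Eq.trans ?_ t.subst_var
  exact h.subst_congr (fun _ _ => rfl) (fun j hj => absurd rfl hj)

theorem HasType.closed_subst {t : Tm S 0} {τ : Ty S.toTySig 0} (h : HasType [] .empty t τ)
    {m : ℕ} (s : Fin 0 → Ty S.toTySig m) (si sl : ℕ → Tm S m) : t.subst s si sl = t.ofClosed := by
  rw [Tm.ofClosed, Tm.ren_eq_subst, show s = fun i => .var (Fin.elim0 i) from
    funext fun i => i.elim0]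
  exact h.subst_congr (fun i hi => by simp at hi) (fun j hj => absurd rfl hj)

theorem HasType.ofClosed_subst {t : Tm S 0} {τ : Ty S.toTySig 0} (h : HasType [] .empty t τ)
    {n m : ℕ} (s : Fin n → Ty S.toTySig m) (si sl : ℕ → Tm S m) :
    (t.ofClosed : Tm S n).subst s si sl = t.ofClosed := by
  rw [Tm.ofClosed, Tm.ren_subst, h.closed_subst]

theorem HasType.ofClosed_ren {t : Tm S 0} {τ : Ty S.toTySig 0} (h : HasType [] .empty t τ)
    {n m : ℕ} (r : Fin n → Fin m) (ri rl : ℕ → ℕ) :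
    (t.ofClosed : Tm S n).ren r ri rl = t.ofClosed := by
  rw [Tm.ren_eq_subst, h.ofClosed_subst]

theorem HasType.ofClosed {t : Tm S 0} {τ : Ty S.toTySig 0} (h : HasType [] .empty t τ)
    {n : ℕ} {Γ : List (Ty S.toTySig n)} : HasType Γ .empty t.ofClosed τ.ofClosed :=
  h.ren Fin.elim0 id Γ (fun i σ hi => by simp at hi)

theorem HasType.wkI {n : ℕ} {Γ : List (Ty S.toTySig n)} {Δ : LCtx S.toTySig n} {t : Tm S n}
    {τ : Ty S.toTySig n} (h : HasType Γ Δ t τ) (σ : Ty S.toTySig n) :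
    HasType (σ :: Γ) Δ (t.wkI 1) τ := by
  have := h.ren (fun i => i) (· + 1) (σ :: Γ) (fun i σ hi => by simpa using hi)
  rwa [LCtx.ren_id, Ty.ren_id] at this

theorem HasType.wkI₂ {n : ℕ} {Γ : List (Ty S.toTySig n)} {Δ : LCtx S.toTySig n} {t : Tm S n}
    {τ : Ty S.toTySig n} (h : HasType Γ Δ t τ) (σ σ' : Ty S.toTySig n) :
    HasType (σ' :: σ :: Γ) Δ (t.wkI 2) τ := by
  have := h.ren (fun i => i) (· + 2) (σ' :: σ :: Γ) (fun i σ hi => by simpa using hi)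
  rwa [LCtx.ren_id, Ty.ren_id] at this

theorem HasType.wkT {n : ℕ} {Γ : List (Ty S.toTySig n)} {t : Tm S n}
    {τ : Ty S.toTySig n} (h : HasType Γ .empty t τ) :
    HasType (Γ.map Ty.wk) .empty t.wkT τ.wk :=
  h.ren Fin.succ id (Γ.map Ty.wk) (fun i σ hi => by simp [hi, Ty.wk])

theorem HasType.app' {n : ℕ} {Γ : List (Ty S.toTySig n)} {t u : Tm S n} {σ τ : Ty S.toTySig n}
    (h : HasType Γ .empty t (.lolli σ τ)) (h' : HasType Γ .empty u σ) :
    HasType Γ .empty (.app t u) τ := .app LCtx.split_empty h h'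

theorem HasType.tensor' {n : ℕ} {Γ : List (Ty S.toTySig n)} {t u : Tm S n} {σ τ : Ty S.toTySig n}
    (h : HasType Γ .empty t σ) (h' : HasType Γ .empty u τ) :
    HasType Γ .empty (.tensor t u) (.tensor σ τ) := .tensor LCtx.split_empty h h'

theorem HasType.tapp' {n : ℕ} {Γ : List (Ty S.toTySig n)} {Δ : LCtx S.toTySig n} {t : Tm S n}
    {σ : Ty S.toTySig (n + 1)} {τ ω : Ty S.toTySig n} (h : HasType Γ Δ t (.pi σ))
    (hω : σ.inst τ = ω) : HasType Γ Δ (.tapp t τ) ω := hω ▸ .tapp τ h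

end Typing

/-! ### Weakening of formulas and relations -/

section Weakening
variable {S : Signature.{u, v}} {A : Set Scheme}

/-- Renaming of the type variables of a declaration. -/
def RelDecl.ren {K : TySig.{u}} {n m : ℕ} (d : RelDecl K n) (r : Fin n → Fin m) : RelDecl K m :=
  ⟨d.kind, d.dom.ren r, d.cod.ren r⟩

theorem getElem?_map_relWk {K : TySig.{u}} {n m : ℕ} {Θ : List (RelDecl K n)}
    {Θ' : List (RelDecl K m)} {r : Fin n → Fin m} {rr : ℕ → ℕ}
    (h : ∀ i d, Θ[i]? = some d → Θ'[rr i]? = some (d.ren r)) (i : ℕ) (d : RelDecl K (n + 1))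
    (hi : (Θ.map RelDecl.wk)[i]? = some d) :
    (Θ'.map RelDecl.wk)[rr i]? = some (d.ren (upTyRen r)) := by
  simp only [List.getElem?_map, Option.map_eq_some_iff] at hi ⊢
  obtain ⟨e, he, rfl⟩ := hi
  exact ⟨_, h _ _ he, by simp [RelDecl.wk, RelDecl.ren, upTyRen_wk]⟩

theorem getElem?_cons_relRen {K : TySig.{u}} {n m : ℕ} {Θ : List (RelDecl K n)}
    {Θ' : List (RelDecl K m)} {r : Fin n → Fin m} {rr : ℕ → ℕ} (κ : Kind) (σ τ : Ty K n)
    (h : ∀ i d, Θ[i]? = some d → Θ'[rr i]? = some (d.ren r)) (i : ℕ) (d : RelDecl K n)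
    (hi : (⟨κ, σ, τ⟩ :: Θ)[i]? = some d) :
    (⟨κ, σ.ren r, τ.ren r⟩ :: Θ')[upRen rr i]? = some (d.ren r) := by
  cases i with
  | zero => simp at hi; subst hi; rfl
  | succ i => exact h i d hi

theorem Rel.wkI_ren {n m : ℕ} (ρ : Rel S n) (r : Fin n → Fin m) (ri rr : ℕ → ℕ) :
    (ρ.wkI 2).ren r (upRen (upRen ri)) rr = (ρ.ren r ri rr).wkI 2 := by
  simp only [Rel.wkI, Rel.ren_ren]; rfl

theorem Fm.wkI_ren {n m : ℕ} (φ : Fm S n) (r : Fin n → Fin m) (ri rr : ℕ → ℕ) :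
    (φ.wkI 2).ren r (upRen (upRen ri)) rr = (φ.ren r ri rr).wkI 2 := by
  simp only [Fm.wkI, Fm.ren_ren]; rfl

theorem Tm.wkI_ren {n m : ℕ} (t : Tm S n) (r : Fin n → Fin m) (ri rl : ℕ → ℕ) :
    (t.wkI 2).ren r (upRen (upRen ri)) rl = (t.ren r ri rl).wkI 2 := by
  simp only [Tm.wkI, Tm.ren_ren]; rfl

theorem graph_ren {n m : ℕ} (σ τ : Ty S.toTySig n) (f : Tm S n) (r : Fin n → Fin m)
    (ri rr : ℕ → ℕ) : (graph σ τ f).ren r ri rr = graph (σ.ren r) (τ.ren r) (f.ren r ri id) := by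
  simp [graph, Rel.ren, Fm.ren, Tm.ren, Tm.wkI_ren]

theorem eqRel_ren {n m : ℕ} (σ : Ty S.toTySig n) (r : Fin n → Fin m)
    (ri rr : ℕ → ℕ) : (eqRel σ : Rel S n).ren r ri rr = eqRel (σ.ren r) := by
  simp [eqRel, graph_ren, idTm, Tm.ren]

theorem pullRel_ren {n m : ℕ} (σ τ : Ty S.toTySig n) (f g : Tm S n) (ρ : Rel S n)
    (r : Fin n → Fin m) (ri rr : ℕ → ℕ) : (pullRel σ τ f g ρ).ren r ri rr =
      pullRel (σ.ren r) (τ.ren r) (f.ren r ri id) (g.ren r ri id) (ρ.ren r ri rr) := by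
  simp [pullRel, Rel.ren, Fm.ren, Tm.ren, Tm.wkI_ren, Rel.wkI_ren]

theorem equivRel_ren {n m : ℕ} (σ τ : Ty S.toTySig n) (ρ ρ' : Rel S n)
    (r : Fin n → Fin m) (ri rr : ℕ → ℕ) : (equivRel σ τ ρ ρ').ren r ri rr =
      equivRel (σ.ren r) (τ.ren r) (ρ.ren r ri rr) (ρ'.ren r ri rr) := by
  simp [equivRel, Fm.iff, Rel.ren, Fm.ren, Tm.ren, Rel.wkI_ren]

theorem Proves.ren {n : ℕ} {Γ : List (Ty S.toTySig n)} {Θ : List (RelDecl S.toTySig n)}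
    {Φ : List (Fm S n)} {φ : Fm S n} (h : Proves A Γ Θ Φ φ) {m : ℕ} (r : Fin n → Fin m)
    (ri rr : ℕ → ℕ) {Γ' : List (Ty S.toTySig m)} {Θ' : List (RelDecl S.toTySig m)}
    (hΓ : ∀ i σ, Γ[i]? = some σ → Γ'[ri i]? = some (σ.ren r))
    (hΘ : ∀ i d, Θ[i]? = some d → Θ'[rr i]? = some (d.ren r)) :
    Proves A Γ' Θ' (Φ.map fun χ => χ.ren r ri rr) (φ.ren r ri rr) := by
  have := h.subst (Γ' := Γ') (Θ' := Θ') (fun i => .var (r i)) (fun i => .ivar (ri i))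
    (fun i => .var (rr i)) (fun i σ hi => by rw [← Ty.ren_eq_subst]; exact .ivar (hΓ i σ hi))
    (fun i κ σ τ hi => by
      rw [← Ty.ren_eq_subst, ← Ty.ren_eq_subst]; exact .var (hΘ i _ hi))
  simpa [Fm.ren_eq_subst] using this

mutual

theorem IsFm.ren {n : ℕ} {Γ : List (Ty S.toTySig n)} {Θ : List (RelDecl S.toTySig n)}
    {φ : Fm S n} (h : IsFm A Γ Θ φ) {m : ℕ} (r : Fin n → Fin m)
    (ri rr : ℕ → ℕ) {Γ' : List (Ty S.toTySig m)} {Θ' : List (RelDecl S.toTySig m)}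
    (hΓ : ∀ i σ, Γ[i]? = some σ → Γ'[ri i]? = some (σ.ren r))
    (hΘ : ∀ i d, Θ[i]? = some d → Θ'[rr i]? = some (d.ren r)) : IsFm A Γ' Θ' (φ.ren r ri rr) := by
  match h with
  | .eq ht hu => exact .eq (ht.ren r ri _ hΓ) (hu.ren r ri _ hΓ)
  | .app hρ ht hu => exact .app (hρ.ren r ri rr hΓ hΘ) (ht.ren r ri _ hΓ) (hu.ren r ri _ hΓ)
  | .imp h₁ h₂ => exact .imp (h₁.ren r ri rr hΓ hΘ) (h₂.ren r ri rr hΓ hΘ)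
  | .bot => exact .bot
  | .top => exact .top
  | .and h₁ h₂ => exact .and (h₁.ren r ri rr hΓ hΘ) (h₂.ren r ri rr hΓ hΘ)
  | .or h₁ h₂ => exact .or (h₁.ren r ri rr hΓ hΘ) (h₂.ren r ri rr hΓ hΘ)
  | .allTy h₁ => exact .allTy (h₁.ren _ ri rr (getElem?_map_wk hΓ) (getElem?_map_relWk hΘ))
  | .allTm h₁ => exact .allTm (h₁.ren r _ rr (getElem?_cons_ren _ hΓ) hΘ)
  | .allRel h₁ => exact .allRel (h₁.ren r ri _ hΓ (getElem?_cons_relRen _ _ _ hΘ))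
  | .exTy h₁ => exact .exTy (h₁.ren _ ri rr (getElem?_map_wk hΓ) (getElem?_map_relWk hΘ))
  | .exTm h₁ => exact .exTm (h₁.ren r _ rr (getElem?_cons_ren _ hΓ) hΘ)
  | .exRel h₁ => exact .exRel (h₁.ren r ri _ hΓ (getElem?_cons_relRen _ _ _ hΘ))

theorem IsRel.ren {n : ℕ} {κ : Kind} {Γ : List (Ty S.toTySig n)} {Θ : List (RelDecl S.toTySig n)}
    {ρ : Rel S n} {σ τ : Ty S.toTySig n} (h : IsRel A κ Γ Θ ρ σ τ) {m : ℕ} (r : Fin n → Fin m)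
    (ri rr : ℕ → ℕ) {Γ' : List (Ty S.toTySig m)} {Θ' : List (RelDecl S.toTySig m)}
    (hΓ : ∀ i σ, Γ[i]? = some σ → Γ'[ri i]? = some (σ.ren r))
    (hΘ : ∀ i d, Θ[i]? = some d → Θ'[rr i]? = some (d.ren r)) :
    IsRel A κ Γ' Θ' (ρ.ren r ri rr) (σ.ren r) (τ.ren r) := by
  match h with
  | .var hi => exact .var (hΘ _ _ hi)
  | .abs h₁ =>
    exact .abs (h₁.ren r _ rr (getElem?_cons_ren _ (getElem?_cons_ren _ hΓ)) hΘ)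
  | .ofAdm h₁ => exact .ofAdm (h₁.ren r ri rr hΓ hΘ)
  | .admEq σ => rw [eqRel_ren]; exact .admEq _
  | .admPull h₁ hf hg =>
    rw [pullRel_ren]
    exact .admPull (h₁.ren r ri rr hΓ hΘ) (hf.ren r ri _ hΓ) (hg.ren r ri _ hΓ)
  | .admAnd h₁ h₂ =>
    have := IsRel.admAnd (h₁.ren r ri rr hΓ hΘ) (h₂.ren r ri rr hΓ hΘ)
    simpa [Rel.ren, Fm.ren, Tm.ren, Rel.wkI_ren] using this
  | .admOp h₁ =>
    have := IsRel.admOp (h₁.ren r ri rr hΓ hΘ)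
    simpa [Rel.ren, Fm.ren, Tm.ren, Rel.wkI_ren] using this
  | .admTop σ τ => exact .admTop _ _
  | .admImp h₁ h₂ =>
    have := IsRel.admImp (h₁.ren r ri rr hΓ hΘ) (h₂.ren r ri rr hΓ hΘ)
    simpa [Rel.ren, Fm.ren, Tm.ren, Rel.wkI_ren, Fm.wkI_ren] using this
  | .admAllTy h₁ =>
    have := h₁.ren _ ri rr (getElem?_map_wk hΓ) (getElem?_map_relWk hΘ)
    rw [upTyRen_wk, upTyRen_wk] at this
    have := IsRel.admAllTy this
    simpa [Rel.ren, Fm.ren, Tm.ren, Rel.wkI_ren] using this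
  | .admAllTm h₁ =>
    have := IsRel.admAllTm (h₁.ren r _ rr (getElem?_cons_ren _ hΓ) hΘ)
    simpa [Rel.ren, Fm.ren, Tm.ren, Rel.ren_ren, upRen_comp] using this
  | .admAllRel h₁ =>
    have := IsRel.admAllRel (h₁.ren r ri _ hΓ (getElem?_cons_relRen _ _ _ hΘ))
    simpa [Rel.ren, Fm.ren, Tm.ren, Rel.wkI_ren] using this
  | .admEquiv h₁ h₂ hp =>
    have := hp.ren r ri rr hΓ hΘ
    rw [equivRel_ren] at this
    exact .admEquiv (h₁.ren r ri rr hΓ hΘ) (h₂.ren r ri rr hΓ hΘ) this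
  | .admInterp σ h₁ =>
    rw [Ty.subst_ren, Ty.subst_ren]
    exact .admInterp σ fun i => (h₁ i).ren r ri rr hΓ hΘ

end

end Weakening

section Constructions
variable {S : Signature.{u, v}}

attribute [simp] Ty.ren Ty.subst Tm.ren Tm.subst Rel.ren Rel.subst Fm.ren Fm.subst
attribute [simp] Ty.wk Ty.wk2 Tm.wkT Tm.wkI Tm.wkL Rel.wkI Rel.wkT Rel.wkR Rel.wkTTR Fm.wkI Fm.wkT
  Fm.wkR Ty.inst Tm.instL Tm.instI Tm.instT Fm.instI Fm.instT Fm.instR id_eq_fun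
attribute [simp] Ty.ren_ren Ty.ren_subst Ty.subst_ren Ty.subst_subst Tm.ren_ren Tm.ren_subst
  Tm.subst_ren Tm.subst_subst Rel.ren_ren Rel.ren_subst Rel.subst_ren Rel.subst_subst Fm.ren_ren
  Fm.ren_subst Fm.subst_ren Fm.subst_subst

/-! ### Substitution in the constructions on relations -/

variable {n m : ℕ} (s : Fin n → Ty S.toTySig m) (si : ℕ → Tm S m) (sr : ℕ → Rel S m)

theorem lolliRel_subst (σ τ σ' τ' : Ty S.toTySig n) (ρ ρ' : Rel S n) :
    (lolliRel σ τ σ' τ' ρ ρ').subst s si sr =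
      lolliRel (σ.subst s) (τ.subst s) (σ'.subst s) (τ'.subst s) (ρ.subst s si sr)
        (ρ'.subst s si sr) := by
  simp [lolliRel, Nat.add_assoc]

theorem arrowRel_subst (σ τ σ' τ' : Ty S.toTySig n) (ρ ρ' : Rel S n) :
    (arrowRel σ τ σ' τ' ρ ρ').subst s si sr =
      arrowRel (σ.subst s) (τ.subst s) (σ'.subst s) (τ'.subst s) (ρ.subst s si sr)
        (ρ'.subst s si sr) := by
  simp [arrowRel, Ty.arrow, Nat.add_assoc]

theorem pullRel_subst (σ τ : Ty S.toTySig n) (f g : Tm S n) (ρ : Rel S n) :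
    (pullRel σ τ f g ρ).subst s si sr =
      pullRel (σ.subst s) (τ.subst s) (f.subst s si .lvar) (g.subst s si .lvar)
        (ρ.subst s si sr) := by
  simp [pullRel, Nat.add_assoc]

theorem polyRel_subst (σ τ : Ty S.toTySig (n + 1)) (ρ : Rel S (n + 2)) :
    (polyRel σ τ ρ).subst s si sr =
      polyRel (σ.subst (upTy s)) (τ.subst (upTy s))
        (ρ.subst (upTy (upTy s)) (fun i => (si i).wkT.wkT)
          (scons (.var 0) fun i => (sr i).wkTTR)) := by
  simp [polyRel, Nat.add_assoc, scons_relRen]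

theorem eqRel_subst (σ : Ty S.toTySig n) :
    (eqRel σ : Rel S n).subst s si sr = eqRel (σ.subst s) := by
  simp [eqRel, graph, idTm]

theorem tensorMap_subst (sl : ℕ → Tm S m) (σ σ' : Ty S.toTySig n) :
    (tensorMap σ σ').subst s si sl = tensorMap (σ.subst s) (σ'.subst s) := by
  simp [tensorMap]

theorem unitMap_subst (sl : ℕ → Tm S m) :
    (unitMap : Tm S n).subst s si sl = unitMap := by
  simp [unitMap, idTm]

theorem bangMap_subst (sl : ℕ → Tm S m) (σ : Ty S.toTySig n) :
    (bangMap σ).subst s si sl = bangMap (σ.subst s) := by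
  simp [bangMap, Ty.arrow]

theorem tensorRel_subst (σ τ σ' τ' : Ty S.toTySig n) (ρ ρ' : Rel S n) :
    (tensorRel σ τ σ' τ' ρ ρ').subst s si sr =
      tensorRel (σ.subst s) (τ.subst s) (σ'.subst s) (τ'.subst s) (ρ.subst s si sr)
        (ρ'.subst s si sr) := by
  rw [tensorRel, pullRel_subst, polyRel_subst, lolliRel_subst, lolliRel_subst, lolliRel_subst,
    tensorMap_subst, tensorMap_subst, tensorRel]
  simp

theorem bangRel_subst (σ τ : Ty S.toTySig n) (ρ : Rel S n) :
    (bangRel σ τ ρ).subst s si sr = bangRel (σ.subst s) (τ.subst s) (ρ.subst s si sr) := by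
  rw [bangRel, pullRel_subst, polyRel_subst, lolliRel_subst, arrowRel_subst, bangMap_subst,
    bangMap_subst, bangRel]
  simp [Ty.arrow]

theorem unitRel_subst : (unitRel : Rel S n).subst s si sr = unitRel := by
  rw [unitRel, pullRel_subst, polyRel_subst, lolliRel_subst, unitMap_subst, unitRel]
  simp

end Constructions

section Formation
variable {S : Signature.{u, v}} {A : Set Scheme} {n : ℕ} {Γ : List (Ty S.toTySig n)}
  {Θ : List (RelDecl S.toTySig n)} {σ τ σ' τ' : Ty S.toTySig n} {ρ ρ' : Rel S n} {κ : Kind}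

theorem IsRel.wkI (h : IsRel A κ Γ Θ ρ σ τ) (L : List (Ty S.toTySig n)) :
    IsRel A κ (L ++ Γ) Θ (ρ.wkI L.length) σ τ := by
  have := h.ren (Γ' := L ++ Γ) (Θ' := Θ) (fun i => i) (· + L.length) (fun i => i)
    (fun i σ hi => by simpa [List.getElem?_append_right] using hi) (fun i d hi => by simpa [RelDecl.ren] using hi)
  simpa using this

theorem IsFm.wkI {φ : Fm S n} (h : IsFm A Γ Θ φ) (L : List (Ty S.toTySig n)) :
    IsFm A (L ++ Γ) Θ (φ.wkI L.length) := by
  have := h.ren (Γ' := L ++ Γ) (Θ' := Θ) (fun i => i) (· + L.length) (fun i => i)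
    (fun i σ hi => by simpa [List.getElem?_append_right] using hi) (fun i d hi => by simpa [RelDecl.ren] using hi)
  simpa using this

theorem IsRel.wkT (h : IsRel A κ Γ Θ ρ σ τ) :
    IsRel A κ (Γ.map Ty.wk) (Θ.map RelDecl.wk) ρ.wkT σ.wk τ.wk :=
  h.ren Fin.succ id id (fun i σ hi => by simp [hi]) (fun i d hi => by simp [hi, RelDecl.wk, RelDecl.ren])

theorem IsFm.wkT {φ : Fm S n} (h : IsFm A Γ Θ φ) :
    IsFm A (Γ.map Ty.wk) (Θ.map RelDecl.wk) φ.wkT :=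
  h.ren Fin.succ id id (fun i σ hi => by simp [hi]) (fun i d hi => by simp [hi, RelDecl.wk, RelDecl.ren])

theorem IsFm.wkR {φ : Fm S n} (h : IsFm A Γ Θ φ) (d : RelDecl S.toTySig n) :
    IsFm A Γ (d :: Θ) φ.wkR := by
  have := h.ren (Γ' := Γ) (Θ' := d :: Θ) (fun i => i) (fun i => i) (· + 1)
    (fun i σ hi => by simpa using hi) (fun i d hi => by simpa [RelDecl.ren] using hi)
  simpa using this

/-- The intuitionistic context under two new type variables. -/
abbrev wkΓ (Γ : List (Ty S.toTySig n)) : List (Ty S.toTySig (n + 2)) := (Γ.map Ty.wk).map Ty.wk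

/-- The relational context under two new type variables and an admissible relation between them. -/
abbrev wkΘ (Θ : List (RelDecl S.toTySig n)) : List (RelDecl S.toTySig (n + 2)) :=
  ⟨.adm, .var 1, .var 0⟩ :: (Θ.map RelDecl.wk).map RelDecl.wk

/-- Weakening by two type variables and one relation variable. -/
def Fm.wkTTR (φ : Fm S n) : Fm S (n + 2) := φ.ren (fun i => i.succ.succ) id (· + 1)

theorem IsRel.wkTTR (h : IsRel A κ Γ Θ ρ σ τ) :
    IsRel A κ (wkΓ Γ) (wkΘ Θ) ρ.wkTTR σ.wk2 τ.wk2 :=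
  h.ren (fun i => i.succ.succ) id (· + 1) (fun i σ hi => by simp [hi]) (fun i d hi => by
    simp [hi, RelDecl.wk, RelDecl.ren])

theorem IsFm.wkTTR {φ : Fm S n} (h : IsFm A Γ Θ φ) : IsFm A (wkΓ Γ) (wkΘ Θ) φ.wkTTR :=
  h.ren (fun i => i.succ.succ) id (· + 1) (fun i σ hi => by simp [hi]) (fun i d hi => by
    simp [hi, RelDecl.wk, RelDecl.ren])

theorem HasType.wkTT {t : Tm S n} (h : HasType Γ .empty t τ) :
    HasType (wkΓ Γ) .empty t.wkT.wkT τ.wk2 := by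
  simpa using h.wkT.wkT

theorem IsRel.isRel (h : IsRel A κ Γ Θ ρ σ τ) : IsRel A .rel Γ Θ ρ σ τ := by
  cases κ with
  | rel => exact h
  | adm => exact .ofAdm h

theorem isFm_eqRel : IsFm A (σ :: σ :: Γ) Θ
    (.eq σ (.app ((idTm σ).wkI 2) (.ivar 1)) (.ivar 0) : Fm S n) := by
  refine .eq (.app' ?_ (.ivar rfl)) (.ivar rfl)
  simp only [Tm.wkI, idTm, Tm.ren, id_eq_fun, Ty.ren_id, upRen_zero]
  exact .lam (by rw [LCtx.cons_empty]; exact .lvar)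

theorem isFm_lolliRel (h : IsRel A .rel Γ Θ ρ σ τ) (h' : IsRel A .rel Γ Θ ρ' σ' τ') :
    IsFm A (.lolli τ τ' :: .lolli σ σ' :: Γ) Θ
      (.allTm σ (.allTm τ (.imp (.app (ρ.wkI 4) (.ivar 1) (.ivar 0))
        (.app (ρ'.wkI 4) (.app (.ivar 3) (.ivar 1)) (.app (.ivar 2) (.ivar 0)))))) :=
  .allTm (.allTm (.imp (.app (h.wkI [τ, σ, _, _]) (.ivar rfl) (.ivar rfl))
    (.app (h'.wkI [τ, σ, _, _]) (.app' (.ivar rfl) (.ivar rfl)) (.app' (.ivar rfl) (.ivar rfl)))))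

theorem isRel_lolliRel (h : IsRel A .rel Γ Θ ρ σ τ) (h' : IsRel A .rel Γ Θ ρ' σ' τ') :
    IsRel A .rel Γ Θ (lolliRel σ τ σ' τ' ρ ρ') (.lolli σ σ') (.lolli τ τ') :=
  .abs (isFm_lolliRel h h')

theorem isFm_arrowRel (h : IsRel A .rel Γ Θ ρ σ τ) (h' : IsRel A .rel Γ Θ ρ' σ' τ') :
    IsFm A (.arrow τ τ' :: .arrow σ σ' :: Γ) Θ
      (.allTm σ (.allTm τ (.imp (.app (ρ.wkI 4) (.ivar 1) (.ivar 0))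
        (.app (ρ'.wkI 4) (.app (.ivar 3) (.bang (.ivar 1))) (.app (.ivar 2) (.bang (.ivar 0))))))) :=
  .allTm (.allTm (.imp (.app (h.wkI [τ, σ, _, _]) (.ivar rfl) (.ivar rfl))
    (.app (h'.wkI [τ, σ, _, _]) (.app' (.ivar rfl) (.bang (.ivar rfl)))
      (.app' (.ivar rfl) (.bang (.ivar rfl))))))

theorem isRel_arrowRel (h : IsRel A .rel Γ Θ ρ σ τ) (h' : IsRel A .rel Γ Θ ρ' σ' τ') :
    IsRel A .rel Γ Θ (arrowRel σ τ σ' τ' ρ ρ') (.arrow σ σ') (.arrow τ τ') :=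
  .abs (isFm_arrowRel h h')

theorem isFm_pullRel {f g : Tm S n} (h : IsRel A .rel Γ Θ ρ σ τ)
    (hf : HasType Γ .empty f (.lolli σ' σ)) (hg : HasType Γ .empty g (.lolli τ' τ)) :
    IsFm A (τ' :: σ' :: Γ) Θ
      (.app (ρ.wkI 2) (.app (f.wkI 2) (.ivar 1)) (.app (g.wkI 2) (.ivar 0))) :=
  .app (h.wkI [τ', σ']) (.app' (hf.wkI₂ _ _) (.ivar rfl)) (.app' (hg.wkI₂ _ _) (.ivar rfl))

theorem isRel_pullRel {f g : Tm S n} (h : IsRel A .rel Γ Θ ρ σ τ)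
    (hf : HasType Γ .empty f (.lolli σ' σ)) (hg : HasType Γ .empty g (.lolli τ' τ)) :
    IsRel A .rel Γ Θ (pullRel σ' τ' f g ρ) σ' τ' :=
  .abs (isFm_pullRel h hf hg)

/-- A type with a last variable, at the first of two new type variables. -/
abbrev tyFst (σ : Ty S.toTySig (n + 1)) : Ty S.toTySig (n + 2) :=
  σ.subst (Fin.cases (.var 1) fun i => .var i.succ.succ)

/-- A type with a last variable, at the second of two new type variables. -/
abbrev tySnd (σ : Ty S.toTySig (n + 1)) : Ty S.toTySig (n + 2) :=
  σ.subst (Fin.cases (.var 0) fun i => .var i.succ.succ)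

theorem isFm_polyRel {σ τ : Ty S.toTySig (n + 1)} {ρ : Rel S (n + 2)}
    (h : IsRel A .rel (wkΓ Γ) (wkΘ Θ) ρ (tyFst σ) (tySnd τ)) :
    IsFm A (.pi τ :: .pi σ :: Γ) Θ
      (.allTy (.allTy (.allRel .adm (.var 1) (.var 0)
        (.app (ρ.wkI 2) (.tapp (.ivar 1) (.var 1)) (.tapp (.ivar 0) (.var 0)))))) := by
  refine .allTy (.allTy (.allRel (.app (h.wkI [_, _]) (.tapp' (.ivar rfl) ?_)
    (.tapp' (.ivar rfl) ?_))))
  all_goals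
    simp
    congr 1; funext i; refine Fin.cases rfl (fun i => rfl) i

theorem isRel_polyRel {σ τ : Ty S.toTySig (n + 1)} {ρ : Rel S (n + 2)}
    (h : IsRel A .rel (wkΓ Γ) (wkΘ Θ) ρ (tyFst σ) (tySnd τ)) :
    IsRel A .rel Γ Θ (polyRel σ τ ρ) (.pi σ) (.pi τ) :=
  .abs (isFm_polyRel h)

theorem hasType_idTm : HasType Γ .empty (idTm σ) (.lolli σ σ) :=
  .lam (by rw [LCtx.cons_empty]; exact .lvar)

theorem hasType_bangMap_body : HasType Γ (.single 0 (.bang σ))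
    (.tlam (.lam (.arrow σ.wk (.var 0)) (.app (.lvar 0) (.lvar 1))) : Tm S n)
    (.pi (.lolli (.arrow σ.wk (.var 0)) (.var 0))) := by
  refine .tlam (.lam (.app (Δ₁ := .single 0 _) (Δ₂ := .single 1 (.bang σ.wk)) ?_ .lvar .lvar))
  rintro (_ | _ | j) <;> simp [Ty.arrow, LCtx.cons, LCtx.single, LCtx.wk, LCtx.empty, scons]

theorem hasType_bangMap : HasType Γ .empty (bangMap σ)
    (.lolli (.bang σ) (.pi (.lolli (.arrow σ.wk (.var 0)) (.var 0)))) :=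
  .lam (by rw [LCtx.cons_empty]; exact hasType_bangMap_body)

theorem hasType_unitMap : HasType Γ .empty (unitMap : Tm S n)
    (.lolli .unit (.pi (.lolli (.var 0) (.var 0)))) :=
  .lam (.letS (Δ₁ := .single 0 _) (Δ₂ := .empty) (by rw [LCtx.cons_empty]; exact LCtx.split_left _)
    .lvar (.tlam hasType_idTm))

theorem hasType_tensorMap_body₁ : HasType Γ ((LCtx.empty.cons σ).cons σ')
    (.tlam (.lam (.lolli σ.wk (.lolli σ'.wk (.var 0)))
      (.app (.app (.lvar 0) (.lvar 2)) (.lvar 1))) : Tm S n)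
    (.pi (.lolli (.lolli σ.wk (.lolli σ'.wk (.var 0))) (.var 0))) := by
  refine .tlam (.lam
      (.app (Δ₁ := (LCtx.single 1 σ.wk).cons (.lolli σ.wk (.lolli σ'.wk (.var 0))))
        (Δ₂ := .single 1 σ'.wk) ?_ (.app (Δ₁ := .single 0 _) (Δ₂ := .single 2 σ.wk) ?_ .lvar .lvar)
        .lvar))
  all_goals rintro (_ | _ | _ | j) <;> simp [LCtx.cons, LCtx.single, LCtx.wk, LCtx.empty, scons]

theorem hasType_tensorMap_body : HasType Γ (.single 0 (.tensor σ σ'))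
    (.letT σ σ' (.lvar 0) (.tlam (.lam (.lolli σ.wk (.lolli σ'.wk (.var 0)))
      (.app (.app (.lvar 0) (.lvar 2)) (.lvar 1)))) : Tm S n)
    (.pi (.lolli (.lolli σ.wk (.lolli σ'.wk (.var 0))) (.var 0))) :=
  .letT (LCtx.split_left _) .lvar hasType_tensorMap_body₁

theorem hasType_tensorMap : HasType Γ .empty (tensorMap σ σ')
    (.lolli (.tensor σ σ')
      (.pi (.lolli (.lolli σ.wk (.lolli σ'.wk (.var 0))) (.var 0)))) :=
  .lam (by rw [LCtx.cons_empty]; exact hasType_tensorMap_body)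

theorem isRel_bangRel_body (h : IsRel A .rel Γ Θ ρ σ τ) : IsRel A .rel (wkΓ Γ) (wkΘ Θ)
    (lolliRel (.arrow σ.wk2 (.var 1)) (.arrow τ.wk2 (.var 0)) (.var 1) (.var 0)
      (arrowRel σ.wk2 τ.wk2 (.var 1) (.var 0) ρ.wkTTR (.var 0)) (.var 0))
    (tyFst (.lolli (.arrow σ.wk (.var 0)) (.var 0)))
    (tySnd (.lolli (.arrow τ.wk (.var 0)) (.var 0))) := by
  have h0 : IsRel A .rel (wkΓ Γ) (wkΘ Θ) (.var 0) (.var 1) (.var 0) := .ofAdm (.var rfl)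
  have := isRel_lolliRel (isRel_arrowRel h.wkTTR h0) h0
  simpa [Ty.arrow, Ty.ren_eq_subst] using this

theorem isRel_tensorRel_body (h : IsRel A .rel Γ Θ ρ σ τ) (h' : IsRel A .rel Γ Θ ρ' σ' τ') :
    IsRel A .rel (wkΓ Γ) (wkΘ Θ)
    (lolliRel
        (.lolli σ.wk2 (.lolli σ'.wk2 (.var 1))) (.lolli τ.wk2 (.lolli τ'.wk2 (.var 0)))
        (.var 1) (.var 0)
        (lolliRel σ.wk2 τ.wk2 (.lolli σ'.wk2 (.var 1)) (.lolli τ'.wk2 (.var 0)) ρ.wkTTR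
          (lolliRel σ'.wk2 τ'.wk2 (.var 1) (.var 0) ρ'.wkTTR (.var 0)))
        (.var 0))
    (tyFst (.lolli (.lolli σ.wk (.lolli σ'.wk (.var 0))) (.var 0)))
    (tySnd (.lolli (.lolli τ.wk (.lolli τ'.wk (.var 0))) (.var 0))) := by
  have h0 : IsRel A .rel (wkΓ Γ) (wkΘ Θ) (.var 0) (.var 1) (.var 0) := .ofAdm (.var rfl)
  have := isRel_lolliRel (isRel_lolliRel h.wkTTR (isRel_lolliRel h'.wkTTR h0)) h0
  simpa [Ty.arrow, Ty.ren_eq_subst] using this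

theorem isRel_unitRel_body : IsRel A .rel (wkΓ Γ) (wkΘ Θ)
    (lolliRel (.var 1) (.var 0) (.var 1) (.var 0) (.var 0) (.var 0) : Rel S (n + 2))
    (tyFst (.lolli (.var 0) (.var 0))) (tySnd (.lolli (.var 0) (.var 0))) :=
  isRel_lolliRel (.ofAdm (.var rfl)) (.ofAdm (.var rfl))

theorem isRel_bangRel (h : IsRel A .rel Γ Θ ρ σ τ) :
    IsRel A .rel Γ Θ (bangRel σ τ ρ) (.bang σ) (.bang τ) :=
  isRel_pullRel (isRel_polyRel (isRel_bangRel_body h)) hasType_bangMap hasType_bangMap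

theorem isRel_tensorRel (h : IsRel A .rel Γ Θ ρ σ τ) (h' : IsRel A .rel Γ Θ ρ' σ' τ') :
    IsRel A .rel Γ Θ (tensorRel σ τ σ' τ' ρ ρ') (.tensor σ σ') (.tensor τ τ') :=
  isRel_pullRel (isRel_polyRel (isRel_tensorRel_body h h')) hasType_tensorMap hasType_tensorMap

theorem isRel_unitRel : IsRel A .rel Γ Θ (unitRel : Rel S n) .unit .unit :=
  isRel_pullRel (isRel_polyRel isRel_unitRel_body) hasType_unitMap hasType_unitMap

end Formation

section Rules
variable {S : Signature.{u, v}} {A : Set Scheme} {n : ℕ} {Γ : List (Ty S.toTySig n)}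
  {Θ : List (RelDecl S.toTySig n)} {Φ : List (Fm S n)} {σ τ σ' τ' : Ty S.toTySig n}
  {ρ ρ' : Rel S n} {κ : Kind} {t u f g : Tm S n}

/-- All hypotheses are well-formed. -/
abbrev WfHyps (A : Set Scheme) (Γ : List (Ty S.toTySig n)) (Θ : List (RelDecl S.toTySig n))
    (Φ : List (Fm S n)) : Prop := ∀ χ ∈ Φ, IsFm A Γ Θ χ

theorem wfHyps_nil : WfHyps A Γ Θ [] := fun _ h => nomatch h

theorem WfHyps.cons {φ : Fm S n} (hφ : IsFm A Γ Θ φ) (hΦ : WfHyps A Γ Θ Φ) :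
    WfHyps A Γ Θ (φ :: Φ) := by
  intro χ h
  rcases List.mem_cons.1 h with rfl | h
  · exact hφ
  · exact hΦ _ h

theorem WfHyps.wkI (hΦ : WfHyps A Γ Θ Φ) (L : List (Ty S.toTySig n)) :
    WfHyps A (L ++ Γ) Θ (Φ.map (Fm.wkI L.length)) := by
  intro χ h
  obtain ⟨φ, hφ, rfl⟩ := List.mem_map.1 h
  exact (hΦ φ hφ).wkI L

theorem WfHyps.wkT (hΦ : WfHyps A Γ Θ Φ) :
    WfHyps A (Γ.map Ty.wk) (Θ.map RelDecl.wk) (Φ.map Fm.wkT) := by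
  intro χ h
  obtain ⟨φ, hφ, rfl⟩ := List.mem_map.1 h
  exact (hΦ φ hφ).wkT

theorem WfHyps.wkR (hΦ : WfHyps A Γ Θ Φ) (d : RelDecl S.toTySig n) :
    WfHyps A Γ (d :: Θ) (Φ.map Fm.wkR) := by
  intro χ h
  obtain ⟨φ, hφ, rfl⟩ := List.mem_map.1 h
  exact (hΦ φ hφ).wkR d

theorem WfHyps.wkTTR (hΦ : WfHyps A Γ Θ Φ) :
    WfHyps A (wkΓ Γ) (wkΘ Θ) (Φ.map Fm.wkTTR) := by
  intro χ h
  obtain ⟨φ, hφ, rfl⟩ := List.mem_map.1 h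
  exact (hΦ φ hφ).wkTTR

theorem map_wkI_wkI (Φ : List (Fm S n)) :
    (Φ.map (Fm.wkI 1)).map (Fm.wkI 1) = Φ.map (Fm.wkI 2) := by
  simp [Function.comp_def, show (Fm.wkI 2 : Fm S n → Fm S n) =
    fun φ => φ.ren (fun i => i) (· + 2) (fun i => i) from rfl]

theorem map_wkT_wkT_wkR (Φ : List (Fm S n)) :
    ((Φ.map Fm.wkT).map Fm.wkT).map Fm.wkR = Φ.map Fm.wkTTR := by
  simp [Function.comp_def, show (Fm.wkTTR : Fm S n → Fm S (n + 2)) =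
    fun φ => φ.ren (fun i => i.succ.succ) (fun i => i) (· + 1) from rfl]

theorem Proves.weakenNil {φ : Fm S n} (h : Proves A Γ Θ [] φ) (hΦ : WfHyps A Γ Θ Φ) :
    Proves A Γ Θ Φ φ := .weaken hΦ (by simp) h

theorem Proves.head {φ : Fm S n} (hφ : IsFm A Γ Θ φ) (hΦ : WfHyps A Γ Θ Φ) :
    Proves A Γ Θ (φ :: Φ) φ := .hyp (hΦ.cons hφ) (by simp)

theorem Proves.ext {t u : Tm S n} (h : ExtEq Γ .empty t u σ) (hΦ : WfHyps A Γ Θ Φ) :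
    Proves A Γ Θ Φ (.eq σ t u) := (Proves.ofExtEq h).weakenNil hΦ

theorem Proves.eqRefl (h : HasType Γ .empty t σ) (hΦ : WfHyps A Γ Θ Φ) :
    Proves A Γ Θ Φ (.eq σ t t) := .ext (.refl h) hΦ

/-- Weakening to a larger intuitionistic context. -/
theorem Proves.wkI {φ : Fm S n} (h : Proves A Γ Θ Φ φ) (L : List (Ty S.toTySig n)) :
    Proves A (L ++ Γ) Θ (Φ.map (Fm.wkI L.length)) (φ.wkI L.length) := by
  have := h.ren (Γ' := L ++ Γ) (Θ' := Θ) (fun i => i) (· + L.length) (fun i => i)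
    (fun i σ hi => by simpa [List.getElem?_append_right] using hi)
    (fun i d hi => by simpa [RelDecl.ren] using hi)
  exact this

/-! ### Comprehension -/

theorem Proves.absE {φ : Fm S n} (h : Proves A Γ Θ Φ (.app (.abs σ τ φ) t u))
    (hφ : IsFm A (τ :: σ :: Γ) Θ φ) (hΦ : WfHyps A Γ Θ Φ) (ht : HasType Γ .empty t σ)
    (hu : HasType Γ .empty u τ) :
    Proves A Γ Θ Φ (φ.subst .var (scons u (scons t .ivar)) .var) :=
  .impE (.andL ((Proves.defRel hφ ht hu).weakenNil hΦ)) h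

theorem Proves.absI {φ : Fm S n}
    (h : Proves A Γ Θ Φ (φ.subst .var (scons u (scons t .ivar)) .var))
    (hφ : IsFm A (τ :: σ :: Γ) Θ φ) (hΦ : WfHyps A Γ Θ Φ) (ht : HasType Γ .empty t σ)
    (hu : HasType Γ .empty u τ) :
    Proves A Γ Θ Φ (.app (.abs σ τ φ) t u) :=
  .impE (.andR ((Proves.defRel hφ ht hu).weakenNil hΦ)) h

/-! ### The constructions on relations -/

theorem Proves.lolliE {x y : Tm S n} (h : Proves A Γ Θ Φ (.app (lolliRel σ τ σ' τ' ρ ρ') f g))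
    (hΦ : WfHyps A Γ Θ Φ) (hρ : IsRel A .rel Γ Θ ρ σ τ) (hρ' : IsRel A .rel Γ Θ ρ' σ' τ')
    (hf : HasType Γ .empty f (.lolli σ σ')) (hg : HasType Γ .empty g (.lolli τ τ'))
    (hx : HasType Γ .empty x σ) (hy : HasType Γ .empty y τ) (hxy : Proves A Γ Θ Φ (.app ρ x y)) :
    Proves A Γ Θ Φ (.app ρ' (.app f x) (.app g y)) := by
  have h1 : Proves A Γ Θ Φ (.allTm σ (.allTm τ (.imp (.app (ρ.wkI 2) (.ivar 1) (.ivar 0))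
      (.app (ρ'.wkI 2) (.app (f.wkI 2) (.ivar 1)) (.app (g.wkI 2) (.ivar 0)))))) := by
    have := h.absE (isFm_lolliRel hρ hρ') hΦ hf hg
    simpa [Rel.ren_eq_subst, Tm.ren_eq_subst] using this
  have h2 := h1.allTmE hx
  simp at h2
  have h3 := h2.allTmE hy
  simp at h3
  exact h3.impE hxy

theorem Proves.lolliI
    (h : Proves A (τ :: σ :: Γ) Θ (.app (ρ.wkI 2) (.ivar 1) (.ivar 0) :: Φ.map (Fm.wkI 2))
      (.app (ρ'.wkI 2) (.app (f.wkI 2) (.ivar 1)) (.app (g.wkI 2) (.ivar 0))))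
    (hΦ : WfHyps A Γ Θ Φ) (hρ : IsRel A .rel Γ Θ ρ σ τ) (hρ' : IsRel A .rel Γ Θ ρ' σ' τ')
    (hf : HasType Γ .empty f (.lolli σ σ')) (hg : HasType Γ .empty g (.lolli τ τ')) :
    Proves A Γ Θ Φ (.app (lolliRel σ τ σ' τ' ρ ρ') f g) := by
  have h1 : Proves A Γ Θ Φ (.allTm σ (.allTm τ (.imp (.app (ρ.wkI 2) (.ivar 1) (.ivar 0))
      (.app (ρ'.wkI 2) (.app (f.wkI 2) (.ivar 1)) (.app (g.wkI 2) (.ivar 0)))))) := by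
    refine .allTmI hΦ (.allTmI (hΦ.wkI [σ]) (.impI (.app (hρ.wkI [τ, σ]) (.ivar rfl) (.ivar rfl)) ?_))
    rwa [map_wkI_wkI]
  refine .absI ?_ (isFm_lolliRel hρ hρ') hΦ hf hg
  simpa [Rel.ren_eq_subst, Tm.ren_eq_subst] using h1

theorem Proves.arrowE {x y : Tm S n} (h : Proves A Γ Θ Φ (.app (arrowRel σ τ σ' τ' ρ ρ') f g))
    (hΦ : WfHyps A Γ Θ Φ) (hρ : IsRel A .rel Γ Θ ρ σ τ) (hρ' : IsRel A .rel Γ Θ ρ' σ' τ')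
    (hf : HasType Γ .empty f (.arrow σ σ')) (hg : HasType Γ .empty g (.arrow τ τ'))
    (hx : HasType Γ .empty x σ) (hy : HasType Γ .empty y τ) (hxy : Proves A Γ Θ Φ (.app ρ x y)) :
    Proves A Γ Θ Φ (.app ρ' (.app f (.bang x)) (.app g (.bang y))) := by
  have h1 : Proves A Γ Θ Φ (.allTm σ (.allTm τ (.imp (.app (ρ.wkI 2) (.ivar 1) (.ivar 0))
      (.app (ρ'.wkI 2) (.app (f.wkI 2) (.bang (.ivar 1)))
        (.app (g.wkI 2) (.bang (.ivar 0))))))) := by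
    have := h.absE (isFm_arrowRel hρ hρ') hΦ hf hg
    simpa [Rel.ren_eq_subst, Tm.ren_eq_subst] using this
  have h2 := h1.allTmE hx
  simp at h2
  have h3 := h2.allTmE hy
  simp at h3
  exact h3.impE hxy

theorem Proves.arrowI
    (h : Proves A (τ :: σ :: Γ) Θ (.app (ρ.wkI 2) (.ivar 1) (.ivar 0) :: Φ.map (Fm.wkI 2))
      (.app (ρ'.wkI 2) (.app (f.wkI 2) (.bang (.ivar 1))) (.app (g.wkI 2) (.bang (.ivar 0)))))
    (hΦ : WfHyps A Γ Θ Φ) (hρ : IsRel A .rel Γ Θ ρ σ τ) (hρ' : IsRel A .rel Γ Θ ρ' σ' τ')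
    (hf : HasType Γ .empty f (.arrow σ σ')) (hg : HasType Γ .empty g (.arrow τ τ')) :
    Proves A Γ Θ Φ (.app (arrowRel σ τ σ' τ' ρ ρ') f g) := by
  have h1 : Proves A Γ Θ Φ (.allTm σ (.allTm τ (.imp (.app (ρ.wkI 2) (.ivar 1) (.ivar 0))
      (.app (ρ'.wkI 2) (.app (f.wkI 2) (.bang (.ivar 1)))
        (.app (g.wkI 2) (.bang (.ivar 0))))))) := by
    refine .allTmI hΦ (.allTmI (hΦ.wkI [σ]) (.impI (.app (hρ.wkI [τ, σ]) (.ivar rfl) (.ivar rfl)) ?_))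
    rwa [map_wkI_wkI]
  refine .absI ?_ (isFm_arrowRel hρ hρ') hΦ hf hg
  simpa [Rel.ren_eq_subst, Tm.ren_eq_subst] using h1

theorem Proves.pullE (h : Proves A Γ Θ Φ (.app (pullRel σ' τ' f g ρ) t u))
    (hΦ : WfHyps A Γ Θ Φ) (hρ : IsRel A .rel Γ Θ ρ σ τ)
    (hf : HasType Γ .empty f (.lolli σ' σ)) (hg : HasType Γ .empty g (.lolli τ' τ))
    (ht : HasType Γ .empty t σ') (hu : HasType Γ .empty u τ') :
    Proves A Γ Θ Φ (.app ρ (.app f t) (.app g u)) := by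
  have := h.absE (isFm_pullRel hρ hf hg) hΦ ht hu
  simpa using this

theorem Proves.pullI (h : Proves A Γ Θ Φ (.app ρ (.app f t) (.app g u)))
    (hΦ : WfHyps A Γ Θ Φ) (hρ : IsRel A .rel Γ Θ ρ σ τ)
    (hf : HasType Γ .empty f (.lolli σ' σ)) (hg : HasType Γ .empty g (.lolli τ' τ))
    (ht : HasType Γ .empty t σ') (hu : HasType Γ .empty u τ') :
    Proves A Γ Θ Φ (.app (pullRel σ' τ' f g ρ) t u) := by
  refine .absI ?_ (isFm_pullRel hρ hf hg) hΦ ht hu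
  simpa using h

/-- The substitution of two types for the last two type variables. -/
abbrev inst₂ (α β : Ty S.toTySig n) : Fin (n + 2) → Ty S.toTySig n :=
  Fin.cases β (Fin.cases α .var)

theorem upTy_cases_subst {m k : ℕ} (s : Fin n → Ty S.toTySig m) (β : Ty S.toTySig k)
    (s' : Fin m → Ty S.toTySig k) (i : Fin (n + 1)) :
    (upTy s i).subst (Fin.cases β s') =
      (Fin.cases β (fun i => (s i).subst s') i : Ty S.toTySig k) := by
  refine Fin.cases rfl (fun i => ?_) i
  simp

theorem Proves.polyE {σ τ : Ty S.toTySig (n + 1)} {ρ : Rel S (n + 2)} {R : Rel S n}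
    {α β : Ty S.toTySig n}
    (h : Proves A Γ Θ Φ (.app (polyRel σ τ ρ) t u)) (hΦ : WfHyps A Γ Θ Φ)
    (hρ : IsRel A .rel (wkΓ Γ) (wkΘ Θ) ρ (tyFst σ) (tySnd τ))
    (ht : HasType Γ .empty t (.pi σ)) (hu : HasType Γ .empty u (.pi τ))
    (hR : IsRel A .adm Γ Θ R α β) :
    Proves A Γ Θ Φ (.app (ρ.subst (inst₂ α β) .ivar (scons R .var)) (.tapp t α) (.tapp u β)) := by
  have h1 := h.absE (isFm_polyRel hρ) hΦ ht hu
  have h2 := (h1.allTyE α).allTyE β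
  have h3 : Proves A Γ Θ Φ (.allRel .adm α β (.app (ρ.subst (inst₂ α β) .ivar
      (scons (.var 0) (fun i => .var (i + 1)))) (.tapp t α) (.tapp u β))) := by
    simp [upTy_cases_subst, inst₂] at h2 ⊢
    exact h2
  have h4 := h3.allRelE hR
  simpa using h4

theorem Proves.polyI {σ τ : Ty S.toTySig (n + 1)} {ρ : Rel S (n + 2)}
    (h : Proves A (wkΓ Γ) (wkΘ Θ) (Φ.map Fm.wkTTR)
      (.app ρ (.tapp t.wkT.wkT (.var 1)) (.tapp u.wkT.wkT (.var 0)))) (hΦ : WfHyps A Γ Θ Φ)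
    (hρ : IsRel A .rel (wkΓ Γ) (wkΘ Θ) ρ (tyFst σ) (tySnd τ))
    (ht : HasType Γ .empty t (.pi σ)) (hu : HasType Γ .empty u (.pi τ)) :
    Proves A Γ Θ Φ (.app (polyRel σ τ ρ) t u) := by
  have h1 : Proves A Γ Θ Φ (.allTy (.allTy (.allRel .adm (.var 1) (.var 0)
      (.app ρ (.tapp t.wkT.wkT (.var 1)) (.tapp u.wkT.wkT (.var 0)))))) := by
    refine .allTyI hΦ (.allTyI hΦ.wkT (.allRelI hΦ.wkT.wkT ?_))
    rwa [map_wkT_wkT_wkR]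
  refine .absI ?_ (isFm_polyRel hρ) hΦ ht hu
  simpa [upTy_var_ren] using h1

end Rules

section Equality
variable {S : Signature.{u, v}} {A : Set Scheme} {n : ℕ} {Γ : List (Ty S.toTySig n)}
  {Θ : List (RelDecl S.toTySig n)} {Φ : List (Fm S n)} {σ τ σ' τ' ω : Ty S.toTySig n}
  {ρ ρ' : Rel S n} {κ : Kind} {t t' u u' f g : Tm S n}

/-! ### External equality of terms without linear variables -/

theorem ExtEq.beta (ht : HasType Γ (.single 0 σ) t τ) (hu : HasType Γ .empty u σ)
    (h : t.instL u = t') : ExtEq Γ .empty (.app (.lam σ t) u) t' τ :=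
  h ▸ .betaTerm LCtx.split_empty (by rwa [LCtx.cons_empty]) hu

theorem ExtEq.tbeta {t : Tm S (n + 1)} {t' : Tm S n} {σ : Ty S.toTySig (n + 1)}
    (ht : HasType (Γ.map Ty.wk) .empty t σ) (hω : σ.inst τ = ω) (h : t.instT τ = t') :
    ExtEq Γ .empty (.tapp (.tlam t) τ) t' ω :=
  h ▸ hω ▸ .betaType τ ht

theorem ExtEq.app' (h : ExtEq Γ .empty t t' (.lolli σ τ)) (h' : ExtEq Γ .empty u u' σ) :
    ExtEq Γ .empty (.app t u) (.app t' u') τ := .congApp LCtx.split_empty h h'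

theorem ExtEq.tapp' {σ : Ty S.toTySig (n + 1)} (h : ExtEq Γ .empty t t' (.pi σ))
    (hω : σ.inst τ = ω) : ExtEq Γ .empty (.tapp t τ) (.tapp t' τ) ω := hω ▸ .congTapp τ h

theorem ExtEq.idTm_app (h : HasType Γ .empty t σ) : ExtEq Γ .empty (.app (idTm σ) t) t σ :=
  .beta .lvar h rfl

theorem HasType.single_wkL {t : Tm S n} (h : HasType Γ .empty t τ) (k : ℕ) :
    HasType Γ .empty (t.wkL k) τ := by rwa [h.wkL_eq]

theorem ExtEq.bangMap_app {z h : Tm S n} {α : Ty S.toTySig n} (hz : HasType Γ .empty z (.bang σ))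
    (hh : HasType Γ .empty h (.arrow σ α)) :
    ExtEq Γ .empty (.app (.tapp (.app (bangMap σ) z) α) h) (.app h z) α := by
  have h1 : ExtEq Γ .empty (.app (bangMap σ) z)
      (.tlam (.lam (.arrow σ.wk (.var 0)) (.app (.lvar 0) (z.wkT.wkL 1))))
      (.pi (.lolli (.arrow σ.wk (.var 0)) (.var 0))) := by
    exact .beta hasType_bangMap_body hz (by simp [Ty.arrow])
  have h2 : ExtEq Γ .empty (.tapp (.app (bangMap σ) z) α)
      (.lam (.arrow σ α) (.app (.lvar 0) (z.wkL 1))) (.lolli (.arrow σ α) α) := by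
    refine .trans (h1.tapp' (by simp [Ty.arrow]))
      (.tbeta (σ := .lolli (.arrow σ.wk (.var 0)) (.var 0)) ?_ ?_ ?_)
    · refine .lam (.app (LCtx.split_left _) ?_ (hz.wkT.single_wkL 1))
      rw [LCtx.cons_empty]; exact .lvar
    · simp [Ty.arrow]
    · simp [Ty.arrow, Tm.ren_eq_subst]
  refine .trans (h2.app' (.refl hh)) (.beta (.app (LCtx.split_left _) .lvar (hz.single_wkL 1)) hh ?_)
  simp

theorem ExtEq.tensorMap_app {x x' h : Tm S n} {α : Ty S.toTySig n} (hx : HasType Γ .empty x σ)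
    (hx' : HasType Γ .empty x' σ') (hh : HasType Γ .empty h (.lolli σ (.lolli σ' α))) :
    ExtEq Γ .empty (.app (.tapp (.app (tensorMap σ σ') (.tensor x x')) α) h)
      (.app (.app h x) x') α := by
  have h1 : ExtEq Γ .empty (.app (tensorMap σ σ') (.tensor x x'))
      (.tlam (.lam (.lolli σ.wk (.lolli σ'.wk (.var 0)))
        (.app (.app (.lvar 0) (x.wkT.wkL 1)) (x'.wkT.wkL 1))))
      (.pi (.lolli (.lolli σ.wk (.lolli σ'.wk (.var 0))) (.var 0))) := by
    refine .trans (.beta hasType_tensorMap_body (hx.tensor' hx') rfl) ?_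
    have h := ExtEq.betaT LCtx.split_empty LCtx.split_empty hx hx'
      (hasType_tensorMap_body₁ (Γ := Γ) (σ := σ) (σ' := σ'))
    simpa using h
  have h2 : ExtEq Γ .empty (.tapp (.app (tensorMap σ σ') (.tensor x x')) α)
      (.lam (.lolli σ (.lolli σ' α)) (.app (.app (.lvar 0) (x.wkL 1)) (x'.wkL 1)))
      (.lolli (.lolli σ (.lolli σ' α)) α) := by
    refine .trans (h1.tapp' (by simp))
      (.tbeta (σ := .lolli (.lolli σ.wk (.lolli σ'.wk (.var 0))) (.var 0)) ?_ ?_ ?_)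
    · refine .lam (.app (LCtx.split_left _) (.app (LCtx.split_left _) ?_ (hx.wkT.single_wkL 1))
        (hx'.wkT.single_wkL 1))
      rw [LCtx.cons_empty]; exact .lvar
    · simp
    · simp [Tm.ren_eq_subst]
  refine .trans (h2.app' (.refl hh)) (.beta (.app (LCtx.split_left _) (.app (LCtx.split_left _)
    .lvar (hx.single_wkL 1)) (hx'.single_wkL 1)) hh ?_)
  simp

/-! ### Internal equality -/

theorem Proves.eqCongr {F F₀ F₁ : Tm S n} (hF : HasType (τ :: σ :: Γ) .empty F ω)
    (h₀ : HasType Γ .empty F₀ ω) (e₀ : F.subst .var (scons u (scons t .ivar)) .lvar = F₀)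
    (e₁ : F.subst .var (scons u' (scons t' .ivar)) .lvar = F₁) (hΦ : WfHyps A Γ Θ Φ)
    (ht : HasType Γ .empty t σ) (hu : HasType Γ .empty u τ)
    (ht' : HasType Γ .empty t' σ) (hu' : HasType Γ .empty u' τ)
    (h : Proves A Γ Θ Φ (.eq σ t t')) (h' : Proves A Γ Θ Φ (.eq τ u u')) :
    Proves A Γ Θ Φ (.eq ω F₀ F₁) := by
  have hfm : IsFm A (τ :: σ :: Γ) Θ (.eq ω (F₀.wkI 2) F) := .eq (h₀.wkI₂ _ _) hF
  have h1 : Proves A Γ Θ Φ (.app (.abs σ τ (.eq ω (F₀.wkI 2) F)) t u) := by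
    refine .absI ?_ hfm hΦ ht hu
    simp only [Fm.subst, e₀]
    simpa using Proves.eqRefl h₀ hΦ
  have h2 := (h1.eqSubst (.abs hfm) h h').absE hfm hΦ ht' hu'
  simp only [Fm.subst, e₁] at h2
  simpa using h2

theorem Proves.eqApp (hΦ : WfHyps A Γ Θ Φ) (ht : HasType Γ .empty t (.lolli σ τ))
    (hu : HasType Γ .empty u σ) (ht' : HasType Γ .empty t' (.lolli σ τ))
    (hu' : HasType Γ .empty u' σ) (h : Proves A Γ Θ Φ (.eq (.lolli σ τ) t t'))
    (h' : Proves A Γ Θ Φ (.eq σ u u')) :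
    Proves A Γ Θ Φ (.eq τ (.app t u) (.app t' u')) :=
  .eqCongr (F := .app (.ivar 1) (.ivar 0)) (.app' (.ivar rfl) (.ivar rfl)) (ht.app' hu) rfl rfl hΦ
    ht hu ht' hu' h h'

theorem Proves.eqTapp {σ : Ty S.toTySig (n + 1)} (hΦ : WfHyps A Γ Θ Φ)
    (ht : HasType Γ .empty t (.pi σ)) (ht' : HasType Γ .empty t' (.pi σ)) (hω : σ.inst τ = ω)
    (h : Proves A Γ Θ Φ (.eq (.pi σ) t t')) :
    Proves A Γ Θ Φ (.eq ω (.tapp t τ) (.tapp t' τ)) :=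
  .eqCongr (F := .tapp (.ivar 0) τ) (.tapp' (.ivar rfl) hω) (.tapp' ht hω) (by simp)
    (by simp) hΦ ht ht ht' ht' h h

theorem Proves.eqBang (hΦ : WfHyps A Γ Θ Φ)
    (ht : HasType Γ .empty t σ) (ht' : HasType Γ .empty t' σ)
    (h : Proves A Γ Θ Φ (.eq σ t t')) :
    Proves A Γ Θ Φ (.eq (.bang σ) (.bang t) (.bang t')) :=
  .eqCongr (F := .bang (.ivar 0)) (.bang (.ivar rfl)) (.bang ht) rfl rfl hΦ ht ht ht' ht' h h

theorem Proves.funext (hext : Scheme.extensionality ∈ A) (hΦ : WfHyps A Γ Θ Φ)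
    (ht : HasType Γ .empty t (.lolli σ τ)) (hu : HasType Γ .empty u (.lolli σ τ))
    (h : Proves A (σ :: Γ) Θ (Φ.map (Fm.wkI 1))
      (.eq τ (.app (t.wkI 1) (.ivar 0)) (.app (u.wkI 1) (.ivar 0)))) :
    Proves A Γ Θ Φ (.eq (.lolli σ τ) t u) :=
  ((Proves.extTm hext ht hu).weakenNil hΦ).impE (.allTmI hΦ h)

theorem Proves.tyext {τ : Ty S.toTySig (n + 1)} (hext : Scheme.extensionality ∈ A)
    (hΦ : WfHyps A Γ Θ Φ) (ht : HasType Γ .empty t (.pi τ)) (hu : HasType Γ .empty u (.pi τ))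
    (h : Proves A (Γ.map Ty.wk) (Θ.map RelDecl.wk) (Φ.map Fm.wkT)
      (.eq τ (.tapp t.wkT (.var 0)) (.tapp u.wkT (.var 0)))) :
    Proves A Γ Θ Φ (.eq (.pi τ) t u) :=
  ((Proves.extTy hext ht hu).weakenNil hΦ).impE (.allTyI hΦ h)

theorem Proves.eqRelE (h : Proves A Γ Θ Φ (.app (eqRel σ) t u)) (hΦ : WfHyps A Γ Θ Φ)
    (ht : HasType Γ .empty t σ) (hu : HasType Γ .empty u σ) : Proves A Γ Θ Φ (.eq σ t u) := by
  have := h.absE isFm_eqRel hΦ ht hu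
  refine .eqTrans (.eqSymm (.ext (.idTm_app ht) hΦ)) ?_
  simpa [idTm] using this

theorem Proves.eqRelI (h : Proves A Γ Θ Φ (.eq σ t u)) (hΦ : WfHyps A Γ Θ Φ)
    (ht : HasType Γ .empty t σ) (hu : HasType Γ .empty u σ) :
    Proves A Γ Θ Φ (.app (eqRel σ) t u) := by
  refine .absI ?_ isFm_eqRel hΦ ht hu
  have := (Proves.ext (A := A) (Θ := Θ) (.idTm_app ht) hΦ).eqTrans h
  simpa [idTm] using this

/-- The graph of `f`, as a reindexing of the equality relation. -/
def graphRel (σ τ : Ty S.toTySig n) (f : Tm S n) : Rel S n := pullRel σ τ f (idTm τ) (eqRel τ)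

theorem isRel_graphRel (hf : HasType Γ .empty f (.lolli σ τ)) :
    IsRel A .adm Γ Θ (graphRel σ τ f) σ τ := .admPull (.admEq τ) hf hasType_idTm

theorem Proves.graphRelE (h : Proves A Γ Θ Φ (.app (graphRel σ τ f) t u)) (hΦ : WfHyps A Γ Θ Φ)
    (hf : HasType Γ .empty f (.lolli σ τ))
    (ht : HasType Γ .empty t σ) (hu : HasType Γ .empty u τ) :
    Proves A Γ Θ Φ (.eq τ (.app f t) u) :=
  ((h.pullE hΦ (.ofAdm (.admEq τ)) hf hasType_idTm ht hu).eqRelE hΦ (hf.app' ht)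
    (hasType_idTm.app' hu)).eqTrans (.ext (.idTm_app hu) hΦ)

theorem Proves.graphRelI (h : Proves A Γ Θ Φ (.eq τ (.app f t) u)) (hΦ : WfHyps A Γ Θ Φ)
    (hf : HasType Γ .empty f (.lolli σ τ))
    (ht : HasType Γ .empty t σ) (hu : HasType Γ .empty u τ) :
    Proves A Γ Θ Φ (.app (graphRel σ τ f) t u) :=
  .pullI (.eqRelI (h.eqTrans (.eqSymm (.ext (.idTm_app hu) hΦ))) hΦ (hf.app' ht)
    (hasType_idTm.app' hu)) hΦ (.ofAdm (.admEq τ)) hf hasType_idTm ht hu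

end Equality

section Renaming
variable {S : Signature.{u, v}} {n m : ℕ} (r : Fin n → Fin m) (ri rr : ℕ → ℕ)

theorem lolliRel_ren (σ τ σ' τ' : Ty S.toTySig n) (ρ ρ' : Rel S n) :
    (lolliRel σ τ σ' τ' ρ ρ').ren r ri rr =
      lolliRel (σ.ren r) (τ.ren r) (σ'.ren r) (τ'.ren r) (ρ.ren r ri rr) (ρ'.ren r ri rr) := by
  simp only [Rel.ren_eq_subst, Ty.ren_eq_subst, lolliRel_subst]

theorem arrowRel_ren (σ τ σ' τ' : Ty S.toTySig n) (ρ ρ' : Rel S n) :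
    (arrowRel σ τ σ' τ' ρ ρ').ren r ri rr =
      arrowRel (σ.ren r) (τ.ren r) (σ'.ren r) (τ'.ren r) (ρ.ren r ri rr) (ρ'.ren r ri rr) := by
  simp only [Rel.ren_eq_subst, Ty.ren_eq_subst, arrowRel_subst]

theorem polyRel_ren (σ τ : Ty S.toTySig (n + 1)) (ρ : Rel S (n + 2)) :
    (polyRel σ τ ρ).ren r ri rr =
      polyRel (σ.ren (upTyRen r)) (τ.ren (upTyRen r))
        (ρ.ren (upTyRen (upTyRen r)) ri (upRen rr)) := by
  simp only [Rel.ren_eq_subst, Ty.ren_eq_subst, polyRel_subst, upTy_var_ren]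
  congr 2
  funext i; cases i <;> simp

end Renaming

section Mono
variable {S : Signature.{u, v}} {A : Set Scheme} {n : ℕ} {Γ : List (Ty S.toTySig n)}
  {Θ : List (RelDecl S.toTySig n)} {Φ : List (Fm S n)} {σ τ σ' τ' ω : Ty S.toTySig n}
  {ρ ρ' ρ₁ ρ₂ ρ₁' ρ₂' : Rel S n} {κ : Kind} {t t' u u' f g : Tm S n}

/-- Provable inclusion of relations between `σ` and `τ`. -/
def Incl (A : Set Scheme) (Γ : List (Ty S.toTySig n)) (Θ : List (RelDecl S.toTySig n))
    (σ τ : Ty S.toTySig n) (ρ ρ' : Rel S n) : Prop :=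
  Proves A (τ :: σ :: Γ) Θ [.app (ρ.wkI 2) (.ivar 1) (.ivar 0)] (.app (ρ'.wkI 2) (.ivar 1) (.ivar 0))

theorem Incl.ren (h : Incl A Γ Θ σ τ ρ ρ') {m : ℕ} (r : Fin n → Fin m)
    (ri rr : ℕ → ℕ) {Γ' : List (Ty S.toTySig m)} {Θ' : List (RelDecl S.toTySig m)}
    (hΓ : ∀ i σ, Γ[i]? = some σ → Γ'[ri i]? = some (σ.ren r))
    (hΘ : ∀ i d, Θ[i]? = some d → Θ'[rr i]? = some (d.ren r)) :
    Incl A Γ' Θ' (σ.ren r) (τ.ren r) (ρ.ren r ri rr) (ρ'.ren r ri rr) := by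
  have := Proves.ren h r (upRen (upRen ri)) rr
    (getElem?_cons_ren _ (getElem?_cons_ren _ hΓ)) hΘ
  simpa only [Incl, List.map, Fm.ren, Rel.wkI_ren, Tm.ren, upRen_one, upRen_zero] using this

theorem Incl.wkI (h : Incl A Γ Θ σ τ ρ ρ') (L : List (Ty S.toTySig n)) :
    Incl A (L ++ Γ) Θ σ τ (ρ.wkI L.length) (ρ'.wkI L.length) := by
  have := h.ren (Γ' := L ++ Γ) (Θ' := Θ) (fun i => i) (· + L.length) (fun i => i)
    (fun i σ hi => by simpa [List.getElem?_append_right] using hi)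
    (fun i d hi => by simpa [RelDecl.ren] using hi)
  rwa [Ty.ren_id, Ty.ren_id] at this

theorem Incl.wkTTR (h : Incl A Γ Θ σ τ ρ ρ') :
    Incl A (wkΓ Γ) (wkΘ Θ) σ.wk2 τ.wk2 ρ.wkTTR ρ'.wkTTR :=
  h.ren (fun i => i.succ.succ) id (· + 1) (fun i σ hi => by simp [hi]) (fun i d hi => by
    simp [hi, RelDecl.wk, RelDecl.ren])

theorem Incl.apply (h : Incl A Γ Θ σ τ ρ ρ') (hρ : IsRel A .rel Γ Θ ρ σ τ) (hΦ : WfHyps A Γ Θ Φ)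
    (ht : HasType Γ .empty t σ) (hu : HasType Γ .empty u τ) (htu : Proves A Γ Θ Φ (.app ρ t u)) :
    Proves A Γ Θ Φ (.app ρ' t u) := by
  have h1 : Proves A Γ Θ [] (.allTm σ (.allTm τ (.imp (.app (ρ.wkI 2) (.ivar 1) (.ivar 0))
      (.app (ρ'.wkI 2) (.ivar 1) (.ivar 0))))) :=
    .allTmI wfHyps_nil (.allTmI wfHyps_nil
      (.impI (.app (hρ.wkI [τ, σ]) (.ivar rfl) (.ivar rfl)) h))
  have h2 := h1.allTmE ht
  simp at h2
  have h3 := h2.allTmE hu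
  simp at h3
  exact (h3.weakenNil hΦ).impE htu

theorem Incl.refl (hρ : IsRel A .rel Γ Θ ρ σ τ) : Incl A Γ Θ σ τ ρ ρ :=
  .head (.app (hρ.wkI [τ, σ]) (.ivar rfl) (.ivar rfl)) wfHyps_nil

theorem isFm_app_wkI (hρ : IsRel A .rel Γ Θ ρ σ τ) :
    IsFm A (τ :: σ :: Γ) Θ (.app (ρ.wkI 2) (.ivar 1) (.ivar 0)) :=
  .app (hρ.wkI [τ, σ]) (.ivar rfl) (.ivar rfl)

theorem Incl.trans (h : Incl A Γ Θ σ τ ρ ρ₁) (h' : Incl A Γ Θ σ τ ρ₁ ρ₂)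
    (hρ : IsRel A .rel Γ Θ ρ σ τ) (hρ₁ : IsRel A .rel Γ Θ ρ₁ σ τ) : Incl A Γ Θ σ τ ρ ρ₂ :=
  (h'.wkI [τ, σ]).apply (hρ₁.wkI [τ, σ]) (wfHyps_nil.cons (isFm_app_wkI hρ)) (.ivar rfl) (.ivar rfl) h

theorem Incl.of_equiv (h : Proves A Γ Θ [] (equivRel σ τ ρ ρ')) (hρ : IsRel A .rel Γ Θ ρ σ τ)
    (hρ' : IsRel A .rel Γ Θ ρ' σ τ) : Incl A Γ Θ σ τ ρ ρ' ∧ Incl A Γ Θ σ τ ρ' ρ := by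
  have h1 := h.wkI [τ, σ]
  have h2 : Proves A (τ :: σ :: Γ) Θ [] (.allTm σ (.allTm τ
      (.iff (.app (ρ.wkI 4) (.ivar 1) (.ivar 0)) (.app (ρ'.wkI 4) (.ivar 1) (.ivar 0))))) := by
    simpa [equivRel, Fm.iff] using h1
  have h3 := h2.allTmE (t := .ivar 1) (.ivar rfl)
  simp [Fm.iff] at h3
  have h4 := h3.allTmE (t := .ivar 0) (.ivar rfl)
  simp at h4
  have h5 : Proves A (τ :: σ :: Γ) Θ [] (.iff (.app (ρ.wkI 2) (.ivar 1) (.ivar 0))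
      (.app (ρ'.wkI 2) (.ivar 1) (.ivar 0))) := by
    simpa [Fm.iff, Rel.ren_eq_subst] using h4
  have w := wfHyps_nil.cons (isFm_app_wkI hρ)
  have w' := wfHyps_nil.cons (isFm_app_wkI hρ')
  exact ⟨(h5.andL.weakenNil w).impE (.head (isFm_app_wkI hρ) wfHyps_nil),
    (h5.andR.weakenNil w').impE (.head (isFm_app_wkI hρ') wfHyps_nil)⟩

theorem Incl.equiv (h : Incl A Γ Θ σ τ ρ ρ') (h' : Incl A Γ Θ σ τ ρ' ρ)
    (hρ : IsRel A .rel Γ Θ ρ σ τ) (hρ' : IsRel A .rel Γ Θ ρ' σ τ) :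
    Proves A Γ Θ [] (equivRel σ τ ρ ρ') :=
  .allTmI wfHyps_nil (.allTmI wfHyps_nil (.andI (.impI (isFm_app_wkI hρ) h)
    (.impI (isFm_app_wkI hρ') h')))

theorem lolliRel_wkI (k : ℕ) (ρ ρ' : Rel S n) : (lolliRel σ τ σ' τ' ρ ρ').wkI k =
    lolliRel σ τ σ' τ' (ρ.wkI k) (ρ'.wkI k) := by
  simp only [Rel.wkI, lolliRel_ren, Ty.ren_id']

theorem arrowRel_wkI (k : ℕ) (ρ ρ' : Rel S n) : (arrowRel σ τ σ' τ' ρ ρ').wkI k =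
    arrowRel σ τ σ' τ' (ρ.wkI k) (ρ'.wkI k) := by
  simp only [Rel.wkI, arrowRel_ren, Ty.ren_id']

theorem polyRel_wkI (k : ℕ) (σ τ : Ty S.toTySig (n + 1)) (ρ : Rel S (n + 2)) :
    (polyRel σ τ ρ).wkI k = polyRel σ τ (ρ.wkI k) := by
  simp [polyRel_ren]

theorem pullRel_wkI (k : ℕ) (f g : Tm S n) (ρ : Rel S n) :
    (pullRel σ τ f g ρ).wkI k = pullRel σ τ (f.wkI k) (g.wkI k) (ρ.wkI k) := by
  simp only [Rel.wkI, Tm.wkI, pullRel_ren, Ty.ren_id']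

theorem Proves.lolli_mono (k : Proves A Γ Θ Φ (.app (lolliRel σ τ σ' τ' ρ₁ ρ₁') f g))
    (hΦ : WfHyps A Γ Θ Φ) (h : Incl A Γ Θ σ τ ρ₂ ρ₁) (h' : Incl A Γ Θ σ' τ' ρ₁' ρ₂')
    (hρ₁ : IsRel A .rel Γ Θ ρ₁ σ τ) (hρ₂ : IsRel A .rel Γ Θ ρ₂ σ τ)
    (hρ₁' : IsRel A .rel Γ Θ ρ₁' σ' τ') (hρ₂' : IsRel A .rel Γ Θ ρ₂' σ' τ')
    (hf : HasType Γ .empty f (.lolli σ σ')) (hg : HasType Γ .empty g (.lolli τ τ')) :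
    Proves A Γ Θ Φ (.app (lolliRel σ τ σ' τ' ρ₂ ρ₂') f g) := by
  have e := isFm_app_wkI hρ₂
  have w := (hΦ.wkI [τ, σ]).cons e
  have k' : Proves A (τ :: σ :: Γ) Θ
      (.app (ρ₂.wkI 2) (.ivar 1) (.ivar 0) :: Φ.map (Fm.wkI 2))
      (.app (lolliRel σ τ σ' τ' (ρ₁.wkI 2) (ρ₁'.wkI 2)) (f.wkI 2) (g.wkI 2)) := by
    rw [← lolliRel_wkI]
    exact (k.wkI [τ, σ]).weaken w (by simp)
  refine .lolliI ?_ hΦ hρ₂ hρ₂' hf hg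
  exact (h'.wkI [τ, σ]).apply (hρ₁'.wkI [τ, σ]) w ((hf.wkI₂ _ _).app' (.ivar rfl))
    ((hg.wkI₂ _ _).app' (.ivar rfl))
    (k'.lolliE w (hρ₁.wkI [τ, σ]) (hρ₁'.wkI [τ, σ]) (hf.wkI₂ _ _) (hg.wkI₂ _ _) (.ivar rfl)
      (.ivar rfl) ((h.wkI [τ, σ]).apply (hρ₂.wkI [τ, σ]) w (.ivar rfl) (.ivar rfl)
        (.head e (hΦ.wkI [τ, σ]))))

theorem Proves.arrow_mono (k : Proves A Γ Θ Φ (.app (arrowRel σ τ σ' τ' ρ₁ ρ₁') f g))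
    (hΦ : WfHyps A Γ Θ Φ) (h : Incl A Γ Θ σ τ ρ₂ ρ₁) (h' : Incl A Γ Θ σ' τ' ρ₁' ρ₂')
    (hρ₁ : IsRel A .rel Γ Θ ρ₁ σ τ) (hρ₂ : IsRel A .rel Γ Θ ρ₂ σ τ)
    (hρ₁' : IsRel A .rel Γ Θ ρ₁' σ' τ') (hρ₂' : IsRel A .rel Γ Θ ρ₂' σ' τ')
    (hf : HasType Γ .empty f (.arrow σ σ')) (hg : HasType Γ .empty g (.arrow τ τ')) :
    Proves A Γ Θ Φ (.app (arrowRel σ τ σ' τ' ρ₂ ρ₂') f g) := by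
  have e := isFm_app_wkI hρ₂
  have w := (hΦ.wkI [τ, σ]).cons e
  have k' : Proves A (τ :: σ :: Γ) Θ
      (.app (ρ₂.wkI 2) (.ivar 1) (.ivar 0) :: Φ.map (Fm.wkI 2))
      (.app (arrowRel σ τ σ' τ' (ρ₁.wkI 2) (ρ₁'.wkI 2)) (f.wkI 2) (g.wkI 2)) := by
    rw [← arrowRel_wkI]
    exact (k.wkI [τ, σ]).weaken w (by simp)
  refine .arrowI ?_ hΦ hρ₂ hρ₂' hf hg
  exact (h'.wkI [τ, σ]).apply (hρ₁'.wkI [τ, σ]) w ((hf.wkI₂ _ _).app' (.bang (.ivar rfl)))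
    ((hg.wkI₂ _ _).app' (.bang (.ivar rfl)))
    (k'.arrowE w (hρ₁.wkI [τ, σ]) (hρ₁'.wkI [τ, σ]) (hf.wkI₂ _ _) (hg.wkI₂ _ _) (.ivar rfl)
      (.ivar rfl) ((h.wkI [τ, σ]).apply (hρ₂.wkI [τ, σ]) w (.ivar rfl) (.ivar rfl)
        (.head e (hΦ.wkI [τ, σ]))))

theorem Proves.polyE' {σ τ : Ty S.toTySig (n + 1)} {ρ : Rel S (n + 2)}
    (h : Proves A Γ Θ Φ (.app (polyRel σ τ ρ) t u)) (hΦ : WfHyps A Γ Θ Φ)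
    (hρ : IsRel A .rel (wkΓ Γ) (wkΘ Θ) ρ (tyFst σ) (tySnd τ))
    (ht : HasType Γ .empty t (.pi σ)) (hu : HasType Γ .empty u (.pi τ)) :
    Proves A (wkΓ Γ) (wkΘ Θ) (Φ.map Fm.wkTTR)
      (.app ρ (.tapp t.wkT.wkT (.var 1)) (.tapp u.wkT.wkT (.var 0))) := by
  have h1 : Proves A Γ Θ Φ (.allTy (.allTy (.allRel .adm (.var 1) (.var 0)
      (.app ρ (.tapp t.wkT.wkT (.var 1)) (.tapp u.wkT.wkT (.var 0)))))) := by
    have := h.absE (isFm_polyRel hρ) hΦ ht hu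
    simpa [upTy_var_ren] using this
  have h2 := h1.ren (Γ' := wkΓ Γ) (Θ' := wkΘ Θ) (fun i => i.succ.succ) id (· + 1)
    (fun i σ hi => by simp [hi]) (fun i d hi => by simp [hi, RelDecl.wk, RelDecl.ren])
  have h3 := ((h2.allTyE (.var 1)).allTyE (.var 0)).allRelE (ρ := .var 0)
    (σ := .var 1) (τ := .var 0) (.var rfl)
  have e : ∀ i : Fin (n + 2), (inst₂ (.var 1) (.var 0) (upTyRen (upTyRen fun i => i.succ.succ) i) :
      Ty S.toTySig (n + 2)) = .var i := by
    intro i; refine Fin.cases rfl (fun i => Fin.cases rfl (fun i => rfl) i) i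
  have e' : ∀ i : ℕ, scons (.var 0 : Rel S (n + 2)) .var (upRen (· + 1) i) = .var i := by
    intro i; cases i <;> rfl
  have e₂ : (Fin.cases (.var 0) .var (2 : Fin (n + 3)) : Ty S.toTySig (n + 2)) = .var 1 := rfl
  have eΦ : Φ.map Fm.wkTTR = Φ.map fun χ => χ.ren (fun i => i.succ.succ) (fun i => i) (· + 1) := rfl
  rw [eΦ]
  simpa [upTy_cases_subst, inst₂, e, e', e₂, Tm.ren_eq_subst] using h3

theorem Proves.poly_mono {σ τ : Ty S.toTySig (n + 1)} {ρ₁ ρ₂ : Rel S (n + 2)}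
    (k : Proves A Γ Θ Φ (.app (polyRel σ τ ρ₁) t u)) (hΦ : WfHyps A Γ Θ Φ)
    (h : Incl A (wkΓ Γ) (wkΘ Θ) (tyFst σ) (tySnd τ) ρ₁ ρ₂)
    (hρ₁ : IsRel A .rel (wkΓ Γ) (wkΘ Θ) ρ₁ (tyFst σ) (tySnd τ))
    (hρ₂ : IsRel A .rel (wkΓ Γ) (wkΘ Θ) ρ₂ (tyFst σ) (tySnd τ))
    (ht : HasType Γ .empty t (.pi σ)) (hu : HasType Γ .empty u (.pi τ)) :
    Proves A Γ Θ Φ (.app (polyRel σ τ ρ₂) t u) := by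
  refine .polyI ?_ hΦ hρ₂ ht hu
  refine h.apply hρ₁ hΦ.wkTTR ?_ ?_ (k.polyE' hΦ hρ₁ ht hu)
  · refine .tapp' ht.wkT.wkT ?_
    simp
    congr 1; funext i; refine Fin.cases rfl (fun i => rfl) i
  · refine .tapp' hu.wkT.wkT ?_
    simp
    congr 1; funext i; refine Fin.cases rfl (fun i => rfl) i

theorem Incl.lolli (h : Incl A Γ Θ σ τ ρ₂ ρ₁) (h' : Incl A Γ Θ σ' τ' ρ₁' ρ₂')
    (hρ₁ : IsRel A .rel Γ Θ ρ₁ σ τ) (hρ₂ : IsRel A .rel Γ Θ ρ₂ σ τ)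
    (hρ₁' : IsRel A .rel Γ Θ ρ₁' σ' τ') (hρ₂' : IsRel A .rel Γ Θ ρ₂' σ' τ') :
    Incl A Γ Θ (.lolli σ σ') (.lolli τ τ') (lolliRel σ τ σ' τ' ρ₁ ρ₁')
      (lolliRel σ τ σ' τ' ρ₂ ρ₂') := by
  have e := isFm_app_wkI (isRel_lolliRel hρ₁ hρ₁')
  have k := Proves.head e wfHyps_nil
  have w := wfHyps_nil.cons e
  unfold Incl
  rw [lolliRel_wkI] at k w ⊢
  rw [lolliRel_wkI]
  exact k.lolli_mono w (h.wkI [_, _]) (h'.wkI [_, _]) (hρ₁.wkI [_, _]) (hρ₂.wkI [_, _])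
    (hρ₁'.wkI [_, _]) (hρ₂'.wkI [_, _]) (.ivar rfl) (.ivar rfl)

theorem Incl.arrow (h : Incl A Γ Θ σ τ ρ₂ ρ₁) (h' : Incl A Γ Θ σ' τ' ρ₁' ρ₂')
    (hρ₁ : IsRel A .rel Γ Θ ρ₁ σ τ) (hρ₂ : IsRel A .rel Γ Θ ρ₂ σ τ)
    (hρ₁' : IsRel A .rel Γ Θ ρ₁' σ' τ') (hρ₂' : IsRel A .rel Γ Θ ρ₂' σ' τ') :
    Incl A Γ Θ (.arrow σ σ') (.arrow τ τ') (arrowRel σ τ σ' τ' ρ₁ ρ₁')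
      (arrowRel σ τ σ' τ' ρ₂ ρ₂') := by
  have e := isFm_app_wkI (isRel_arrowRel hρ₁ hρ₁')
  have k := Proves.head e wfHyps_nil
  have w := wfHyps_nil.cons e
  unfold Incl
  rw [arrowRel_wkI] at k w ⊢
  rw [arrowRel_wkI]
  exact k.arrow_mono w (h.wkI [_, _]) (h'.wkI [_, _]) (hρ₁.wkI [_, _]) (hρ₂.wkI [_, _])
    (hρ₁'.wkI [_, _]) (hρ₂'.wkI [_, _]) (.ivar rfl) (.ivar rfl)

theorem Incl.poly {σ τ : Ty S.toTySig (n + 1)} {ρ₁ ρ₂ : Rel S (n + 2)}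
    (h : Incl A (wkΓ Γ) (wkΘ Θ) (tyFst σ) (tySnd τ) ρ₁ ρ₂)
    (hρ₁ : IsRel A .rel (wkΓ Γ) (wkΘ Θ) ρ₁ (tyFst σ) (tySnd τ))
    (hρ₂ : IsRel A .rel (wkΓ Γ) (wkΘ Θ) ρ₂ (tyFst σ) (tySnd τ)) :
    Incl A Γ Θ (.pi σ) (.pi τ) (polyRel σ τ ρ₁) (polyRel σ τ ρ₂) := by
  have e := isFm_app_wkI (isRel_polyRel hρ₁)
  have k := Proves.head e wfHyps_nil
  have w := wfHyps_nil.cons e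
  unfold Incl
  rw [polyRel_wkI] at k w ⊢
  rw [polyRel_wkI]
  exact k.poly_mono w (h.wkI [_, _]) (hρ₁.wkI [_, _]) (hρ₂.wkI [_, _]) (.ivar rfl) (.ivar rfl)

theorem Incl.pull (h : Incl A Γ Θ σ τ ρ₁ ρ₂) (hρ₁ : IsRel A .rel Γ Θ ρ₁ σ τ)
    (hρ₂ : IsRel A .rel Γ Θ ρ₂ σ τ)
    (hf : HasType Γ .empty f (.lolli σ' σ)) (hg : HasType Γ .empty g (.lolli τ' τ)) :
    Incl A Γ Θ σ' τ' (pullRel σ' τ' f g ρ₁) (pullRel σ' τ' f g ρ₂) := by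
  have e := isFm_app_wkI (isRel_pullRel hρ₁ hf hg)
  have k := Proves.head e wfHyps_nil
  have w := wfHyps_nil.cons e
  unfold Incl
  rw [pullRel_wkI] at k w ⊢
  rw [pullRel_wkI]
  refine .pullI ?_ w (hρ₂.wkI [_, _]) (hf.wkI₂ _ _) (hg.wkI₂ _ _) (.ivar rfl) (.ivar rfl)
  exact (h.wkI [_, _]).apply (hρ₁.wkI [_, _]) w ((hf.wkI₂ _ _).app' (.ivar rfl))
    ((hg.wkI₂ _ _).app' (.ivar rfl))
    (k.pullE w (hρ₁.wkI [_, _]) (hf.wkI₂ _ _) (hg.wkI₂ _ _) (.ivar rfl) (.ivar rfl))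

theorem isRel_var_wkΘ : IsRel A .adm (wkΓ Γ) (wkΘ Θ) (.var 0 : Rel S (n + 2)) (.var 1) (.var 0) :=
  .var rfl

theorem Incl.bang (h : Incl A Γ Θ σ τ ρ₁ ρ₂) (hρ₁ : IsRel A .rel Γ Θ ρ₁ σ τ)
    (hρ₂ : IsRel A .rel Γ Θ ρ₂ σ τ) :
    Incl A Γ Θ (.bang σ) (.bang τ) (bangRel σ τ ρ₁) (bangRel σ τ ρ₂) := by
  refine .pull (.poly ?_ (isRel_bangRel_body hρ₁) (isRel_bangRel_body hρ₂))
    (isRel_polyRel (isRel_bangRel_body hρ₁)) (isRel_polyRel (isRel_bangRel_body hρ₂))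
    hasType_bangMap hasType_bangMap
  have r0 := (isRel_var_wkΘ (S := S) (A := A) (Γ := Γ) (Θ := Θ)).isRel
  have := Incl.lolli (Incl.arrow h.wkTTR (.refl r0) hρ₂.wkTTR hρ₁.wkTTR r0 r0)
    (.refl r0) (isRel_arrowRel hρ₁.wkTTR r0) (isRel_arrowRel hρ₂.wkTTR r0) r0 r0
  simpa [Ty.arrow, Ty.ren_eq_subst] using this

theorem Incl.tensor (h : Incl A Γ Θ σ τ ρ₁ ρ₂) (h' : Incl A Γ Θ σ' τ' ρ₁' ρ₂')
    (hρ₁ : IsRel A .rel Γ Θ ρ₁ σ τ) (hρ₂ : IsRel A .rel Γ Θ ρ₂ σ τ)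
    (hρ₁' : IsRel A .rel Γ Θ ρ₁' σ' τ') (hρ₂' : IsRel A .rel Γ Θ ρ₂' σ' τ') :
    Incl A Γ Θ (.tensor σ σ') (.tensor τ τ') (tensorRel σ τ σ' τ' ρ₁ ρ₁')
      (tensorRel σ τ σ' τ' ρ₂ ρ₂') := by
  refine .pull (.poly ?_ (isRel_tensorRel_body hρ₁ hρ₁') (isRel_tensorRel_body hρ₂ hρ₂'))
    (isRel_polyRel (isRel_tensorRel_body hρ₁ hρ₁'))
    (isRel_polyRel (isRel_tensorRel_body hρ₂ hρ₂')) hasType_tensorMap hasType_tensorMap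
  have r0 := (isRel_var_wkΘ (S := S) (A := A) (Γ := Γ) (Θ := Θ)).isRel
  have k₁ := isRel_lolliRel hρ₁'.wkTTR r0
  have k₂ := isRel_lolliRel hρ₂'.wkTTR r0
  have := Incl.lolli (Incl.lolli h.wkTTR (Incl.lolli h'.wkTTR (.refl r0) hρ₂'.wkTTR hρ₁'.wkTTR r0 r0)
    hρ₂.wkTTR hρ₁.wkTTR k₂ k₁)
    (.refl r0) (isRel_lolliRel hρ₁.wkTTR k₁) (isRel_lolliRel hρ₂.wkTTR k₂) r0 r0
  simpa [Ty.ren_eq_subst] using this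

theorem Proves.wkTTR {φ : Fm S n} (h : Proves A Γ Θ Φ φ) :
    Proves A (wkΓ Γ) (wkΘ Θ) (Φ.map Fm.wkTTR) φ.wkTTR :=
  h.ren (fun i => i.succ.succ) id (· + 1) (fun i σ hi => by simp [hi]) (fun i d hi => by
    simp [hi, RelDecl.wk, RelDecl.ren])

/-! ### Introduction and elimination for tensor and exponential relations -/

theorem ExtEq.hasType_bangMap_tapp {z : Tm S n} {α : Ty S.toTySig n}
    (hz : HasType Γ .empty z (.bang σ)) :
    HasType Γ .empty (.tapp (.app (bangMap σ) z) α) (.lolli (.arrow σ α) α) :=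
  .tapp' (hasType_bangMap.app' hz) (by simp [Ty.arrow])

theorem ExtEq.hasType_tensorMap_tapp {z : Tm S n} {α : Ty S.toTySig n}
    (hz : HasType Γ .empty z (.tensor σ σ')) :
    HasType Γ .empty (.tapp (.app (tensorMap σ σ') z) α) (.lolli (.lolli σ (.lolli σ' α)) α) :=
  .tapp' (hasType_tensorMap.app' hz) (by simp)

theorem tensorMap_ren {m : ℕ} (r : Fin n → Fin m) (ri rl : ℕ → ℕ) :
    (tensorMap σ σ' : Tm S n).ren r ri rl = tensorMap (σ.ren r) (σ'.ren r) := by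
  simp only [Tm.ren_eq_subst, Ty.ren_eq_subst, tensorMap_subst]

theorem bangMap_ren {m : ℕ} (r : Fin n → Fin m) (ri rl : ℕ → ℕ) :
    (bangMap σ : Tm S n).ren r ri rl = bangMap (σ.ren r) := by
  simp only [Tm.ren_eq_subst, Ty.ren_eq_subst, bangMap_subst]

theorem Proves.cast {φ ψ : Fm S n} (h : Proves A Γ Θ Φ φ) (e : φ = ψ) : Proves A Γ Θ Φ ψ :=
  e ▸ h

theorem Fm.wkTTR_app : (Fm.app ρ t u).wkTTR = .app ρ.wkTTR t.wkT.wkT u.wkT.wkT := by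
  simp [Fm.wkTTR]

theorem Proves.castRel (h : Proves A Γ Θ Φ (.app ρ t u)) (e : ρ = ρ') :
    Proves A Γ Θ Φ (.app ρ' t u) :=
  e ▸ h

theorem Proves.bangI {x y : Tm S n} (h : Proves A Γ Θ Φ (.app ρ x y)) (hΦ : WfHyps A Γ Θ Φ)
    (hρ : IsRel A .rel Γ Θ ρ σ τ) (hx : HasType Γ .empty x σ) (hy : HasType Γ .empty y τ) :
    Proves A Γ Θ Φ (.app (bangRel σ τ ρ) (.bang x) (.bang y)) := by
  have hbx := hasType_bangMap.app' (.bang hx)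
  have hby := hasType_bangMap.app' (.bang hy)
  refine .pullI (.polyI ?_ hΦ (isRel_bangRel_body hρ) hbx hby) hΦ
    (isRel_polyRel (isRel_bangRel_body hρ)) hasType_bangMap hasType_bangMap (.bang hx) (.bang hy)
  have r0 := (isRel_var_wkΘ (S := S) (A := A) (Γ := Γ) (Θ := Θ)).isRel
  have hax := isRel_arrowRel hρ.wkTTR r0
  have ex : ∀ (α : Ty S.toTySig (n + 2)) (x : Tm S n) (σ : Ty S.toTySig n),
      (Tm.tapp ((Tm.app (bangMap σ) (.bang x)).wkT.wkT) α) =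
        .tapp (.app (bangMap σ.wk2) (.bang x.wkT.wkT)) α := by
    intro α x σ; simp [bangMap_ren]
  rw [ex, ex]
  have hx' := hx.wkTT
  have hy' := hy.wkTT
  have hΦ' := hΦ.wkTTR
  have h' := h.wkTTR
  refine .lolliI ?_ hΦ' hax r0 (ExtEq.hasType_bangMap_tapp (.bang hx'))
    (ExtEq.hasType_bangMap_tapp (.bang hy'))
  have e := isFm_app_wkI hax
  have w := (hΦ'.wkI [_, _]).cons e
  have k := Proves.head e (hΦ'.wkI [_, _])
  have h'' := (h'.wkI [.arrow τ.wk2 (.var 0), .arrow σ.wk2 (.var 1)]).weaken w (by simp)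
  have k₂ := k.castRel (arrowRel_wkI _ _ _)
  have k' := k₂.arrowE w (hρ.wkTTR.wkI [_, _]) (r0.wkI [_, _]) (.ivar rfl) (.ivar rfl)
    (hx'.wkI₂ _ _) (hy'.wkI₂ _ _) (h''.cast (by rw [Fm.wkTTR_app]; rfl))
  have ex' : ∀ (α : Ty S.toTySig (n + 2)) (x : Tm S (n + 2)) (σ : Ty S.toTySig (n + 2)),
      (Tm.tapp (Tm.app (bangMap σ) (.bang x)) α).wkI 2 =
        .tapp (.app (bangMap σ) (.bang (x.wkI 2))) α := by
    intro α x σ; simp [bangMap_ren]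
  rw [ex', ex']
  exact k'.eqSubst (r0.wkI [_, _]) (.eqSymm (.ext (.bangMap_app (.bang (hx'.wkI₂ _ _)) (.ivar rfl)) w))
    (.eqSymm (.ext (.bangMap_app (.bang (hy'.wkI₂ _ _)) (.ivar rfl)) w))

theorem Proves.tensorI {x y x' y' : Tm S n} (h : Proves A Γ Θ Φ (.app ρ x y))
    (h' : Proves A Γ Θ Φ (.app ρ' x' y')) (hΦ : WfHyps A Γ Θ Φ)
    (hρ : IsRel A .rel Γ Θ ρ σ τ) (hρ' : IsRel A .rel Γ Θ ρ' σ' τ')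
    (hx : HasType Γ .empty x σ) (hy : HasType Γ .empty y τ)
    (hx' : HasType Γ .empty x' σ') (hy' : HasType Γ .empty y' τ') :
    Proves A Γ Θ Φ (.app (tensorRel σ τ σ' τ' ρ ρ') (.tensor x x') (.tensor y y')) := by
  have hbx := hasType_tensorMap.app' (hx.tensor' hx')
  have hby := hasType_tensorMap.app' (hy.tensor' hy')
  refine .pullI (.polyI ?_ hΦ (isRel_tensorRel_body hρ hρ') hbx hby) hΦ
    (isRel_polyRel (isRel_tensorRel_body hρ hρ')) hasType_tensorMap hasType_tensorMap
    (hx.tensor' hx') (hy.tensor' hy')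
  have r0 := (isRel_var_wkΘ (S := S) (A := A) (Γ := Γ) (Θ := Θ)).isRel
  have hax' := isRel_lolliRel hρ'.wkTTR r0
  have hax := isRel_lolliRel hρ.wkTTR hax'
  have ex : ∀ (α : Ty S.toTySig (n + 2)) (x x' : Tm S n) (σ σ' : Ty S.toTySig n),
      (Tm.tapp ((Tm.app (tensorMap σ σ') (.tensor x x')).wkT.wkT) α) =
        .tapp (.app (tensorMap σ.wk2 σ'.wk2) (.tensor x.wkT.wkT x'.wkT.wkT)) α := by
    intro α x x' σ σ'; simp [tensorMap_ren]
  rw [ex, ex]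
  have hx₂ := hx.wkTT
  have hy₂ := hy.wkTT
  have hx₂' := hx'.wkTT
  have hy₂' := hy'.wkTT
  have hΦ' := hΦ.wkTTR
  have h₂ := h.wkTTR
  have h₂' := h'.wkTTR
  refine .lolliI ?_ hΦ' hax r0 (ExtEq.hasType_tensorMap_tapp (hx₂.tensor' hx₂'))
    (ExtEq.hasType_tensorMap_tapp (hy₂.tensor' hy₂'))
  have e := isFm_app_wkI hax
  have w := (hΦ'.wkI [_, _]).cons e
  have k := Proves.head e (hΦ'.wkI [_, _])
  have h₃ := (h₂.wkI [.lolli τ.wk2 (.lolli τ'.wk2 (.var 0)),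
    .lolli σ.wk2 (.lolli σ'.wk2 (.var 1))]).weaken w (by simp)
  have h₃' := (h₂'.wkI [.lolli τ.wk2 (.lolli τ'.wk2 (.var 0)),
    .lolli σ.wk2 (.lolli σ'.wk2 (.var 1))]).weaken w (by simp)
  have k₂ := k.castRel ((lolliRel_wkI _ _ _).trans (congrArg _ (lolliRel_wkI _ _ _)))
  have k' := (k₂.lolliE w (hρ.wkTTR.wkI [_, _]) (isRel_lolliRel (hρ'.wkTTR.wkI [_, _])
    (r0.wkI [_, _])) (.ivar rfl) (.ivar rfl)
    (hx₂.wkI₂ _ _) (hy₂.wkI₂ _ _) (h₃.cast (by rw [Fm.wkTTR_app]; rfl))).lolliE w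
    (hρ'.wkTTR.wkI [_, _]) (r0.wkI [_, _])
    (.app' (.ivar rfl) (hx₂.wkI₂ _ _)) (.app' (.ivar rfl) (hy₂.wkI₂ _ _))
    (hx₂'.wkI₂ _ _) (hy₂'.wkI₂ _ _) (h₃'.cast (by rw [Fm.wkTTR_app]; rfl))
  have ex' : ∀ (α : Ty S.toTySig (n + 2)) (x x' : Tm S (n + 2)) (σ σ' : Ty S.toTySig (n + 2)),
      (Tm.tapp (Tm.app (tensorMap σ σ') (.tensor x x')) α).wkI 2 =
        .tapp (.app (tensorMap σ σ') (.tensor (x.wkI 2) (x'.wkI 2))) α := by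
    intro α x x' σ σ'; simp [tensorMap_ren]
  rw [ex', ex']
  exact k'.eqSubst (r0.wkI [_, _])
    (.eqSymm (.ext (.tensorMap_app (hx₂.wkI₂ _ _) (hx₂'.wkI₂ _ _) (.ivar rfl)) w))
    (.eqSymm (.ext (.tensorMap_app (hy₂.wkI₂ _ _) (hy₂'.wkI₂ _ _) (.ivar rfl)) w))

theorem Proves.bangE {a b : Tm S n} {α β : Ty S.toTySig n} {R : Rel S n}
    (h : Proves A Γ Θ Φ (.app (bangRel σ τ ρ) a b)) (hΦ : WfHyps A Γ Θ Φ)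
    (hρ : IsRel A .rel Γ Θ ρ σ τ) (hR : IsRel A .adm Γ Θ R α β)
    (ha : HasType Γ .empty a (.bang σ)) (hb : HasType Γ .empty b (.bang τ))
    (hf : HasType Γ .empty f (.arrow σ α)) (hg : HasType Γ .empty g (.arrow τ β))
    (hfg : Proves A Γ Θ Φ (.app (arrowRel σ τ α β ρ R) f g)) :
    Proves A Γ Θ Φ (.app R (.app f a) (.app g b)) := by
  have h1 := h.pullE hΦ (isRel_polyRel (isRel_bangRel_body hρ)) hasType_bangMap hasType_bangMap ha hb
  have h2 := h1.polyE hΦ (isRel_bangRel_body hρ) (hasType_bangMap.app' ha)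
    (hasType_bangMap.app' hb) hR
  have h3 : Proves A Γ Θ Φ (.app (lolliRel (.arrow σ α) (.arrow τ β) α β
      (arrowRel σ τ α β ρ R) R) (.tapp (.app (bangMap σ) a) α) (.tapp (.app (bangMap τ) b) β)) := by
    have e₁ : (inst₂ α β 1 : Ty S.toTySig n) = α := rfl
    have e₀ : (inst₂ α β 0 : Ty S.toTySig n) = β := rfl
    have e₂ : ∀ i : Fin n, (inst₂ α β i.succ.succ : Ty S.toTySig n) = .var i := fun i => rfl
    simp only [lolliRel_subst, arrowRel_subst, Ty.subst, Ty.arrow, Ty.wk2, Ty.ren_subst, e₀, e₁,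
      e₂, Rel.subst, Rel.wkTTR, Rel.ren_subst, Ty.subst_var, scons_zero] at h2
    simpa [Ty.arrow] using h2
  have h4 := h3.lolliE hΦ (isRel_arrowRel hρ hR.isRel) hR.isRel (ExtEq.hasType_bangMap_tapp ha)
    (ExtEq.hasType_bangMap_tapp hb) hf hg hfg
  exact h4.eqSubst hR.isRel (.ext (.bangMap_app ha hf) hΦ) (.ext (.bangMap_app hb hg) hΦ)

end Mono

section Ind
variable {K : TySig.{u}}

/-- Renaming of type variables in an inductively constructed type. -/
def IndTy.ren : {k : ℕ} → IndTy K k → {m : ℕ} → (Fin k → Fin m) → IndTy K m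
  | _, .var i, _, r => .var (r i)
  | _, .closed σ, _, _ => .closed σ
  | _, .unit, _, _ => .unit
  | _, .tensor σ τ, _, r => .tensor (σ.ren r) (τ.ren r)
  | _, .lolli σ τ, _, r => .lolli (σ.ren r) (τ.ren r)
  | _, .bang σ, _, r => .bang (σ.ren r)
  | _, .pi σ, _, r => .pi (σ.ren (upTyRen r))

attribute [simp] IndTy.ren IndTy.toTy IndTy.interp

@[simp] theorem IndTy.toTy_ren {k : ℕ} (G : IndTy K k) :
    ∀ {m : ℕ} (r : Fin k → Fin m), (G.ren r).toTy = G.toTy.ren r := by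
  induction G <;> intros <;> simp [*]

/-- The closed types from which an inductively constructed type is built. -/
def IndTy.leaves : {k : ℕ} → IndTy K k → List (Ty K 0)
  | _, .var _ => []
  | _, .closed σ => [σ]
  | _, .unit => []
  | _, .tensor σ τ => σ.leaves ++ τ.leaves
  | _, .lolli σ τ => σ.leaves ++ τ.leaves
  | _, .bang σ => σ.leaves
  | _, .pi σ => σ.leaves

/-- The type obtained by replacing variables and closed types by variables. -/
def IndTy.skel : {k : ℕ} → IndTy K k → {N : ℕ} → (Fin k → Fin N) → (Ty K 0 → Fin N) → Ty K N
  | _, .var i, _, e, _ => .var (e i)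
  | _, .closed σ, _, _, l => .var (l σ)
  | _, .unit, _, _, _ => .unit
  | _, .tensor σ τ, _, e, l => .tensor (σ.skel e l) (τ.skel e l)
  | _, .lolli σ τ, _, e, l => .lolli (σ.skel e l) (τ.skel e l)
  | _, .bang σ, _, e, l => .bang (σ.skel e l)
  | _, .pi σ, _, e, l => .pi (σ.skel (upTyRen e) (fun C => (l C).succ))

theorem IndTy.skel_subst {k : ℕ} (G : IndTy K k) : ∀ {N n : ℕ} (e : Fin k → Fin N)
    (l : Ty K 0 → Fin N) (τ : Fin N → Ty K n), (∀ C ∈ G.leaves, τ (l C) = C.ofClosed) →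
    (G.skel e l).subst τ = G.toTy.subst (fun i => τ (e i)) := by
  induction G with
  | var i => intros; rfl
  | closed σ => intro N n e l τ h; simpa [skel] using h σ (by simp [leaves])
  | unit => intros; rfl
  | tensor σ σ' ih ih' | lolli σ σ' ih ih' =>
    intro N n e l τ h
    simp [skel, ih e l τ (fun C hC => h C (by simp [leaves, hC])),
      ih' e l τ (fun C hC => h C (by simp [leaves, hC]))]
  | bang σ ih => intro N n e l τ h; simp [skel, ih e l τ h]
  | pi σ ih =>
    intro N n e l τ h
    simp only [skel, Ty.subst, toTy]
    rw [ih _ _ _ (fun C hC => by simp [upTy, h C hC])]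
    congr 2
    funext i; refine Fin.cases rfl (fun i => rfl) i

end Ind

section Interp
variable {S : Signature.{u, v}} {A : Set Scheme} {n : ℕ} {Γ : List (Ty S.toTySig n)}
  {Θ : List (RelDecl S.toTySig n)} {k : ℕ}

/-- A vector of types extended by the first of two new type variables. -/
abbrev extFst (τ : Fin k → Ty S.toTySig n) : Fin (k + 1) → Ty S.toTySig (n + 2) :=
  Fin.cases (.var 1) fun i => (τ i).wk2

/-- A vector of types extended by the second of two new type variables. -/
abbrev extSnd (τ : Fin k → Ty S.toTySig n) : Fin (k + 1) → Ty S.toTySig (n + 2) :=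
  Fin.cases (.var 0) fun i => (τ i).wk2

theorem tyFst_upTy (σ : Ty S.toTySig (k + 1)) (τ : Fin k → Ty S.toTySig n) :
    tyFst (σ.subst (upTy τ)) = σ.subst (extFst τ) := by
  simp only [tyFst, Ty.subst_subst]
  congr 1; funext i; refine Fin.cases rfl (fun i => ?_) i
  simp [Ty.ren_eq_subst]

theorem tySnd_upTy (σ : Ty S.toTySig (k + 1)) (τ : Fin k → Ty S.toTySig n) :
    tySnd (σ.subst (upTy τ)) = σ.subst (extSnd τ) := by
  simp only [tySnd, Ty.subst_subst]
  congr 1; funext i; refine Fin.cases rfl (fun i => ?_) i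
  simp [Ty.ren_eq_subst]

theorem isRel_extRel {κ : Kind} {τ τ' : Fin k → Ty S.toTySig n} {ρ : Fin k → Rel S n}
    (h : ∀ i, IsRel A κ Γ Θ (ρ i) (τ i) (τ' i)) (hκ : IsRel A κ (wkΓ Γ) (wkΘ Θ)
      (.var 0 : Rel S (n + 2)) (.var 1) (.var 0)) (i : Fin (k + 1)) :
    IsRel A κ (wkΓ Γ) (wkΘ Θ) (extRel ρ i) (extFst τ i) (extSnd τ' i) :=
  Fin.cases hκ (fun i => (h i).wkTTR) i

theorem IndTy.interp_ren {S : Signature.{u, v}} {k : ℕ} (G : IndTy S.toTySig k) :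
    ∀ {m n : ℕ} (r : Fin k → Fin m)
    (τ τ' : Fin m → Ty S.toTySig n) (ρ : Fin m → Rel S n), (G.ren r).interp τ τ' ρ =
      G.interp (fun i => τ (r i)) (fun i => τ' (r i)) (fun i => ρ (r i)) := by
  induction G with
  | var i | closed σ | unit => intros; simp
  | tensor σ σ' ih ih' | lolli σ σ' ih ih' => intros; simp [ih, ih']
  | bang σ ih => intros; simp [ih]
  | pi σ ih =>
    intro m n r τ τ' ρ
    simp only [ren, interp, ih, toTy_ren, Ty.ren_subst]
    congr 2 <;> funext i <;> refine Fin.cases rfl (fun i => rfl) i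

theorem IndTy.interp_subst {S : Signature.{u, v}} {k : ℕ} (G : IndTy S.toTySig k) :
    ∀ {n m : ℕ} (τ τ' : Fin k → Ty S.toTySig n) (ρ : Fin k → Rel S n)
    (s : Fin n → Ty S.toTySig m) (si : ℕ → Tm S m) (sr : ℕ → Rel S m),
    (G.interp τ τ' ρ).subst s si sr = G.interp (fun i => (τ i).subst s)
      (fun i => (τ' i).subst s) (fun i => (ρ i).subst s si sr) := by
  induction G with
  | var i => intros; simp
  | closed σ => intros; simp; funext i; exact i.elim0
  | unit => intros; simp [unitRel_subst]
  | tensor σ σ' ih ih' => intros; simp [ih, ih', tensorRel_subst]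
  | lolli σ σ' ih ih' => intros; simp [ih, ih', lolliRel_subst]
  | bang σ ih => intros; simp [ih, bangRel_subst]
  | pi σ ih =>
    intro m n τ τ' ρ s si sr
    simp only [interp, ih, polyRel_subst, Ty.subst_subst]
    congr 2
    · funext i; refine Fin.cases rfl (fun i => ?_) i; simp
    · funext i; refine Fin.cases rfl (fun i => ?_) i; simp
    · funext i; refine Fin.cases rfl (fun i => ?_) i; simp
    · funext i; refine Fin.cases rfl (fun i => ?_) i; simp
    · funext i; refine Fin.cases rfl (fun i => ?_) i; simp [extRel]

theorem IndTy.isRel_interp {S : Signature.{u, v}} {k : ℕ} (G : IndTy S.toTySig k) :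
    ∀ {n : ℕ} {Γ : List (Ty S.toTySig n)} {Θ : List (RelDecl S.toTySig n)}
    {τ τ' : Fin k → Ty S.toTySig n} {ρ : Fin k → Rel S n},
    (∀ i, IsRel A .rel Γ Θ (ρ i) (τ i) (τ' i)) →
    IsRel A .rel Γ Θ (G.interp τ τ' ρ) (G.toTy.subst τ) (G.toTy.subst τ') := by
  induction G with
  | var i => intro n Γ Θ τ τ' ρ h; exact h i
  | closed σ =>
    intro n Γ Θ τ τ' ρ h
    have := IsRel.admInterp (A := A) (Γ := Γ) (Θ := Θ) σ (τ := Fin.elim0) (τ' := Fin.elim0)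
      (ρ := Fin.elim0) (fun i => i.elim0)
    simpa [Ty.closed_subst] using this.isRel
  | unit => intros; exact isRel_unitRel
  | tensor σ σ' ih ih' => intro n Γ Θ τ τ' ρ h; exact isRel_tensorRel (ih h) (ih' h)
  | lolli σ σ' ih ih' => intro n Γ Θ τ τ' ρ h; exact isRel_lolliRel (ih h) (ih' h)
  | bang σ ih => intro n Γ Θ τ τ' ρ h; exact isRel_bangRel (ih h)
  | pi σ ih =>
    intro n Γ Θ τ τ' ρ h
    refine isRel_polyRel ?_
    rw [tyFst_upTy, tySnd_upTy]
    exact ih (isRel_extRel h isRel_var_wkΘ.isRel)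

/-- Monotonicity of the relational interpretation. -/
theorem IndTy.interp_mono {S : Signature.{u, v}} {k : ℕ} (G : IndTy S.toTySig k) :
    ∀ {n : ℕ} {Γ : List (Ty S.toTySig n)} {Θ : List (RelDecl S.toTySig n)}
    {τ τ' : Fin k → Ty S.toTySig n} {ρ ρ' : Fin k → Rel S n},
    (∀ i, IsRel A .rel Γ Θ (ρ i) (τ i) (τ' i)) → (∀ i, IsRel A .rel Γ Θ (ρ' i) (τ i) (τ' i)) →
    (∀ i, G.Occurs true i → Incl A Γ Θ (τ i) (τ' i) (ρ i) (ρ' i)) →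
    (∀ i, G.Occurs false i → Incl A Γ Θ (τ i) (τ' i) (ρ' i) (ρ i)) →
    Incl A Γ Θ (G.toTy.subst τ) (G.toTy.subst τ') (G.interp τ τ' ρ) (G.interp τ τ' ρ') := by
  induction G with
  | var i => intro n Γ Θ τ τ' ρ ρ' h h' hp hn; exact hp i ⟨rfl, rfl⟩
  | closed σ =>
    intro n Γ Θ τ τ' ρ ρ' h h' hp hn
    exact .refl ((IndTy.closed σ).isRel_interp h)
  | unit => intros; exact .refl isRel_unitRel
  | tensor σ σ' ih ih' =>
    intro n Γ Θ τ τ' ρ ρ' h h' hp hn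
    exact .tensor (ih h h' (fun i hi => hp i (.inl hi)) (fun i hi => hn i (.inl hi)))
      (ih' h h' (fun i hi => hp i (.inr hi)) (fun i hi => hn i (.inr hi)))
      (σ.isRel_interp h) (σ.isRel_interp h') (σ'.isRel_interp h) (σ'.isRel_interp h')
  | lolli σ σ' ih ih' =>
    intro n Γ Θ τ τ' ρ ρ' h h' hp hn
    exact .lolli (ih h' h (fun i hi => hn i (.inl hi)) (fun i hi => hp i (.inl hi)))
      (ih' h h' (fun i hi => hp i (.inr hi)) (fun i hi => hn i (.inr hi)))
      (σ.isRel_interp h) (σ.isRel_interp h') (σ'.isRel_interp h) (σ'.isRel_interp h')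
  | bang σ ih =>
    intro n Γ Θ τ τ' ρ ρ' h h' hp hn
    exact .bang (ih h h' hp hn) (σ.isRel_interp h) (σ.isRel_interp h')
  | pi σ ih =>
    intro n Γ Θ τ τ' ρ ρ' h h' hp hn
    have r0 := (isRel_var_wkΘ (S := S) (A := A) (Γ := Γ) (Θ := Θ)).isRel
    have e := isRel_extRel h r0
    have e' := isRel_extRel h' r0
    refine .poly ?_ ?_ ?_ <;> rw [tyFst_upTy, tySnd_upTy]
    · refine ih e e' (fun i => ?_) (fun i => ?_)
      · exact Fin.cases (fun _ => .refl r0) (fun i hi => (hp i hi).wkTTR) i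
      · exact Fin.cases (fun _ => .refl r0) (fun i hi => (hn i hi).wkTTR) i
    · exact σ.isRel_interp e
    · exact σ.isRel_interp e'

end Interp

section IdentityExtension
variable {S : Signature.{u, v}} {A : Set Scheme}

/-- The relational interpretation of a skeleton in the logic agrees with the interpretation of the
inductively constructed type. -/
theorem IndTy.incl_interp_skel {k : ℕ} (hid : Scheme.identityExtension ∈ A)
    (G : IndTy S.toTySig k) : ∀ {n N : ℕ} {Γ : List (Ty S.toTySig n)}
    {Θ : List (RelDecl S.toTySig n)} (e : Fin k → Fin N) (l : Ty S.toTySig 0 → Fin N)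
    {τ τ' : Fin N → Ty S.toTySig n} {ρ : Fin N → Rel S n},
    (∀ i, IsRel A .adm Γ Θ (ρ i) (τ i) (τ' i)) →
    (∀ C ∈ G.leaves, τ (l C) = C.ofClosed ∧ τ' (l C) = C.ofClosed ∧ ρ (l C) = eqRel C.ofClosed) →
    let τ₁ := fun i => τ (e i)
    let τ₂ := fun i => τ' (e i)
    let R := G.interp τ₁ τ₂ (fun i => ρ (e i))
    Incl A Γ Θ (G.toTy.subst τ₁) (G.toTy.subst τ₂) (.interp (G.skel e l) ρ) R ∧
      Incl A Γ Θ (G.toTy.subst τ₁) (G.toTy.subst τ₂) R (.interp (G.skel e l) ρ) := by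
  induction G with
  | var i =>
    intro n N Γ Θ e l τ τ' ρ h hl
    exact Incl.of_equiv (.interpVar (e i) h) (IsRel.admInterp (.var (e i)) h).isRel (h (e i)).isRel
  | closed σ =>
    intro n N Γ Θ e l τ τ' ρ h hl τ₁ τ₂ R
    obtain ⟨h₁, h₂, h₃⟩ := hl σ (by simp [leaves])
    have a := Incl.of_equiv (.interpVar (l σ) h) (IsRel.admInterp (.var (l σ)) h).isRel
      (h (l σ)).isRel
    have hσ := (IndTy.closed (K := S.toTySig) σ).isRel_interp (fun i => (h (e i)).isRel)
    have e₀ : σ.subst (Fin.elim0 : Fin 0 → Ty S.toTySig n) = σ.ofClosed := by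
      simp [Ty.closed_subst]
    have b := Proves.identityExtension (A := A) (Γ := Γ) (Θ := Θ) σ Fin.elim0 hid
    rw [show (fun i => eqRel (Fin.elim0 i) : Fin 0 → Rel S n) = Fin.elim0 from
      funext fun i => i.elim0, e₀] at b
    have hc := IsRel.admInterp (A := A) (Γ := Γ) (Θ := Θ) σ (τ := Fin.elim0) (τ' := Fin.elim0)
      (ρ := Fin.elim0) (fun i => i.elim0)
    rw [e₀] at hc
    have hr := (IsRel.admInterp (.var (l σ)) h).isRel
    simp only [Ty.subst, h₁, h₂, h₃] at a hr
    have b' := Incl.of_equiv b hc.isRel (.ofAdm (.admEq _))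
    simp only [toTy, Ty.ofClosed_subst, R, interp, skel]
    exact ⟨a.1.trans b'.2 hr (.ofAdm (.admEq _)),
      b'.1.trans a.2 hc.isRel (.ofAdm (.admEq _))⟩
  | unit =>
    intro n N Γ Θ e l τ τ' ρ h hl
    exact Incl.of_equiv (.interpUnit h) (IsRel.admInterp .unit h).isRel isRel_unitRel
  | tensor σ σ' ih ih' =>
    intro n N Γ Θ e l τ τ' ρ h hl
    have i₁ := ih e l h (fun C hC => hl C (by simp [leaves, hC]))
    have i₂ := ih' e l h (fun C hC => hl C (by simp [leaves, hC]))
    have s₁ := (IsRel.admInterp (σ.skel e l) h).isRel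
    have s₂ := (IsRel.admInterp (σ'.skel e l) h).isRel
    have r₁ := σ.isRel_interp (fun i => (h (e i)).isRel)
    have r₂ := σ'.isRel_interp (fun i => (h (e i)).isRel)
    have a := Incl.of_equiv (.interpTensor (σ.skel e l) (σ'.skel e l) h)
      (IsRel.admInterp (.tensor _ _) h).isRel (isRel_tensorRel s₁ s₂)
    have s := (IsRel.admInterp (.tensor (σ.skel e l) (σ'.skel e l)) h).isRel
    have u₁ : ∀ C ∈ σ.leaves, τ (l C) = C.ofClosed := fun C hC => (hl C (by simp [leaves, hC])).1
    have u₂ : ∀ C ∈ σ.leaves, τ' (l C) = C.ofClosed := fun C hC => (hl C (by simp [leaves, hC])).2.1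
    have u₃ : ∀ C ∈ σ'.leaves, τ (l C) = C.ofClosed := fun C hC => (hl C (by simp [leaves, hC])).1
    have u₄ : ∀ C ∈ σ'.leaves, τ' (l C) = C.ofClosed := fun C hC => (hl C (by simp [leaves, hC])).2.1
    simp only [Ty.subst, skel_subst _ _ _ _ u₁, skel_subst _ _ _ _ u₂, skel_subst _ _ _ _ u₃,
      skel_subst _ _ _ _ u₄] at a s s₁ s₂
    exact ⟨a.1.trans (.tensor i₁.1 i₂.1 s₁ r₁ s₂ r₂) s (isRel_tensorRel s₁ s₂),
      (Incl.tensor i₁.2 i₂.2 r₁ s₁ r₂ s₂).trans a.2 (isRel_tensorRel r₁ r₂) (isRel_tensorRel s₁ s₂)⟩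
  | lolli σ σ' ih ih' =>
    intro n N Γ Θ e l τ τ' ρ h hl
    have i₁ := ih e l h (fun C hC => hl C (by simp [leaves, hC]))
    have i₂ := ih' e l h (fun C hC => hl C (by simp [leaves, hC]))
    have s₁ := (IsRel.admInterp (σ.skel e l) h).isRel
    have s₂ := (IsRel.admInterp (σ'.skel e l) h).isRel
    have r₁ := σ.isRel_interp (fun i => (h (e i)).isRel)
    have r₂ := σ'.isRel_interp (fun i => (h (e i)).isRel)
    have a := Incl.of_equiv (.interpLolli (σ.skel e l) (σ'.skel e l) h)
      (IsRel.admInterp (.lolli _ _) h).isRel (isRel_lolliRel s₁ s₂)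
    have s := (IsRel.admInterp (.lolli (σ.skel e l) (σ'.skel e l)) h).isRel
    have u₁ : ∀ C ∈ σ.leaves, τ (l C) = C.ofClosed := fun C hC => (hl C (by simp [leaves, hC])).1
    have u₂ : ∀ C ∈ σ.leaves, τ' (l C) = C.ofClosed := fun C hC => (hl C (by simp [leaves, hC])).2.1
    have u₃ : ∀ C ∈ σ'.leaves, τ (l C) = C.ofClosed := fun C hC => (hl C (by simp [leaves, hC])).1
    have u₄ : ∀ C ∈ σ'.leaves, τ' (l C) = C.ofClosed := fun C hC => (hl C (by simp [leaves, hC])).2.1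
    simp only [Ty.subst, skel_subst _ _ _ _ u₁, skel_subst _ _ _ _ u₂, skel_subst _ _ _ _ u₃,
      skel_subst _ _ _ _ u₄] at a s s₁ s₂
    exact ⟨a.1.trans (.lolli i₁.2 i₂.1 s₁ r₁ s₂ r₂) s (isRel_lolliRel s₁ s₂),
      (Incl.lolli i₁.1 i₂.2 r₁ s₁ r₂ s₂).trans a.2 (isRel_lolliRel r₁ r₂) (isRel_lolliRel s₁ s₂)⟩
  | bang σ ih =>
    intro n N Γ Θ e l τ τ' ρ h hl
    have i₁ := ih e l h hl
    have s₁ := (IsRel.admInterp (σ.skel e l) h).isRel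
    have r₁ := σ.isRel_interp (fun i => (h (e i)).isRel)
    have a := Incl.of_equiv (.interpBang (σ.skel e l) h)
      (IsRel.admInterp (.bang _) h).isRel (isRel_bangRel s₁)
    have s := (IsRel.admInterp (.bang (σ.skel e l)) h).isRel
    have u₁ : ∀ C ∈ σ.leaves, τ (l C) = C.ofClosed := fun C hC => (hl C hC).1
    have u₂ : ∀ C ∈ σ.leaves, τ' (l C) = C.ofClosed := fun C hC => (hl C hC).2.1
    simp only [Ty.subst, skel_subst _ _ _ _ u₁, skel_subst _ _ _ _ u₂] at a s s₁
    exact ⟨a.1.trans (.bang i₁.1 s₁ r₁) s (isRel_bangRel s₁),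
      (Incl.bang i₁.2 r₁ s₁).trans a.2 (isRel_bangRel r₁) (isRel_bangRel s₁)⟩
  | pi σ ih =>
    intro n N Γ Θ e l τ τ' ρ h hl τ₁ τ₂ R
    have h' := isRel_extRel h isRel_var_wkΘ
    have hl' : ∀ C ∈ σ.leaves, extFst τ (l C).succ = C.ofClosed ∧
        extSnd τ' (l C).succ = C.ofClosed ∧ extRel ρ (l C).succ = eqRel C.ofClosed := by
      intro C hC
      obtain ⟨h₁, h₂, h₃⟩ := hl C hC
      simp [h₁, h₂, h₃, extRel, Rel.ren_eq_subst, eqRel_subst]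
    have i₁ := ih (upTyRen e) (fun C => (l C).succ) h' hl'
    have e₁ : (fun i => extFst τ (upTyRen e i)) = extFst τ₁ := by
      funext i; refine Fin.cases rfl (fun i => rfl) i
    have e₂ : (fun i => extSnd τ' (upTyRen e i)) = extSnd τ₂ := by
      funext i; refine Fin.cases rfl (fun i => rfl) i
    have e₃ : (fun i => extRel ρ (upTyRen e i)) = extRel fun i => ρ (e i) := by
      funext i; refine Fin.cases rfl (fun i => rfl) i
    simp only [e₁, e₂, e₃] at i₁
    have s₁ := (IsRel.admInterp (σ.skel (upTyRen e) (fun C => (l C).succ)) h').isRel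
    have r₁ := σ.isRel_interp (fun i => (isRel_extRel (fun i => h (e i)) isRel_var_wkΘ i).isRel)
    have u₁ : (σ.skel (upTyRen e) (fun C => (l C).succ)).subst (extFst τ) =
        σ.toTy.subst (extFst τ₁) := by
      rw [← e₁]; exact skel_subst _ _ _ _ fun C hC => (hl' C hC).1
    have u₂ : (σ.skel (upTyRen e) (fun C => (l C).succ)).subst (extSnd τ') =
        σ.toTy.subst (extSnd τ₂) := by
      rw [← e₂]; exact skel_subst _ _ _ _ fun C hC => (hl' C hC).2.1
    have v₁ := (IndTy.pi σ).skel_subst e l τ (fun C hC => (hl C hC).1)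
    have v₂ := (IndTy.pi σ).skel_subst e l τ' (fun C hC => (hl C hC).2.1)
    simp only [skel, Ty.subst, toTy, Ty.pi.injEq] at v₁ v₂
    simp only [u₁, u₂] at s₁
    have s₁' := s₁
    have r₁' := r₁
    have i₁' := i₁
    rw [← tyFst_upTy, ← tySnd_upTy] at s₁' r₁' i₁'
    have a := Incl.of_equiv (.interpPi (σ.skel (upTyRen e) (fun C => (l C).succ)) h)
      (IsRel.admInterp (.pi _) h).isRel (by
        simp only [Ty.subst, v₁, v₂]
        exact isRel_polyRel s₁')
    have s := (IsRel.admInterp (.pi (σ.skel (upTyRen e) (fun C => (l C).succ))) h).isRel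
    simp only [Ty.subst, v₁, v₂] at a s
    exact ⟨a.1.trans (.poly i₁'.1 s₁' r₁') s (isRel_polyRel s₁'),
      (Incl.poly i₁'.2 r₁' s₁').trans a.2 (isRel_polyRel r₁') (isRel_polyRel s₁')⟩

theorem exists_index {α : Type*} (k : ℕ) (L : List α) : ∃ l : α → Fin (k + (L.length + 1)),
    ∀ C ∈ L, ∃ j : Fin L.length, L.get j = C ∧ l C = Fin.natAdd k j.castSucc := by
  classical
  refine ⟨fun C => if h : ∃ j : Fin L.length, L.get j = C then Fin.natAdd k h.choose.castSucc
    else Fin.natAdd k (Fin.last _), fun C hC => ?_⟩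
  have h : ∃ j : Fin L.length, L.get j = C := List.mem_iff_get.1 hC
  exact ⟨h.choose, h.choose_spec, dif_pos h⟩

/-- Values at variables, extended by values at the elements of a list. -/
def appendList {α β : Type*} {k : ℕ} (f : Fin k → β) (L : List α) (g : α → β) (d : β) :
    Fin (k + (L.length + 1)) → β :=
  Fin.append f (Fin.lastCases d fun j => g (L.get j))

theorem appendList_castAdd {α β : Type*} {k : ℕ} (f : Fin k → β) (L : List α) (g : α → β) (d : β)
    (i : Fin k) : appendList f L g d (Fin.castAdd _ i) = f i := by
  simp [appendList]

theorem appendList_natAdd {α β : Type*} {k : ℕ} (f : Fin k → β) (L : List α) (g : α → β) (d : β)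
    (i) : appendList f L g d (Fin.natAdd k i) = Fin.lastCases (motive := fun _ => β) d
      (fun j => g (L.get j)) i :=
  Fin.append_right ..

theorem appendList_index {α β : Type*} {k : ℕ} (f : Fin k → β) (L : List α) (g : α → β) (d : β)
    {i} {C : α} (h : ∃ j : Fin L.length, L.get j = C ∧ i = Fin.natAdd k j.castSucc) :
    appendList f L g d i = g C := by
  obtain ⟨j, rfl, rfl⟩ := h
  rw [appendList_natAdd, Fin.lastCases_castSucc]

variable {n k : ℕ} {Γ : List (Ty S.toTySig n)} {Θ : List (RelDecl S.toTySig n)}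

theorem isRel_appendList {τ τ' : Fin k → Ty S.toTySig n} {ρ : Fin k → Rel S n}
    (h : ∀ i, IsRel A .adm Γ Θ (ρ i) (τ i) (τ' i)) (L : List (Ty S.toTySig 0)) (i) :
    IsRel A .adm Γ Θ (appendList ρ L (fun C => eqRel C.ofClosed) (eqRel .unit) i)
      (appendList τ L (fun C => C.ofClosed) .unit i) (appendList τ' L (fun C => C.ofClosed) .unit i) := by
  refine Fin.addCases (fun i => ?_) (fun i => ?_) i
  · simpa only [appendList_castAdd] using h i
  · simp only [appendList_natAdd]
    refine Fin.lastCases ?_ (fun i => ?_) i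
    · simp only [Fin.lastCases_last]; exact .admEq _
    · simp only [Fin.lastCases_castSucc]; exact .admEq _

theorem IndTy.adm_interp (hid : Scheme.identityExtension ∈ A) (G : IndTy S.toTySig k)
    {τ τ' : Fin k → Ty S.toTySig n} {ρ : Fin k → Rel S n}
    (h : ∀ i, IsRel A .adm Γ Θ (ρ i) (τ i) (τ' i)) :
    IsRel A .adm Γ Θ (G.interp τ τ' ρ) (G.toTy.subst τ) (G.toTy.subst τ') := by
  obtain ⟨l, hl⟩ := exists_index k G.leaves
  have h' := isRel_appendList h G.leaves
  have a := G.incl_interp_skel hid (Fin.castAdd _) l h' (fun C hC => ⟨appendList_index _ _ _ _ (hl C hC),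
    appendList_index _ _ _ _ (hl C hC), appendList_index _ _ _ _ (hl C hC)⟩)
  have s := IsRel.admInterp (G.skel (Fin.castAdd _) l) h'
  rw [skel_subst _ _ _ _ (fun C hC => appendList_index _ _ _ _ (hl C hC)),
    skel_subst _ _ _ _ (fun C hC => appendList_index _ _ _ _ (hl C hC))] at s
  simp only [appendList_castAdd] at a s
  have r := G.isRel_interp (fun i => (h i).isRel)
  exact .admEquiv s r (a.1.equiv a.2 s.isRel r)

/-- The identity extension scheme for inductively constructed types. -/
theorem IndTy.interp_eqRel (hid : Scheme.identityExtension ∈ A) (G : IndTy S.toTySig k)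
    (τ : Fin k → Ty S.toTySig n) :
    Incl A Γ Θ (G.toTy.subst τ) (G.toTy.subst τ) (G.interp τ τ fun i => eqRel (τ i))
      (eqRel (G.toTy.subst τ)) ∧
    Incl A Γ Θ (G.toTy.subst τ) (G.toTy.subst τ) (eqRel (G.toTy.subst τ))
      (G.interp τ τ fun i => eqRel (τ i)) := by
  obtain ⟨l, hl⟩ := exists_index k G.leaves
  have h : ∀ i, IsRel A .adm Γ Θ (eqRel (τ i)) (τ i) (τ i) := fun i => .admEq _
  have h' := isRel_appendList h G.leaves
  have e₁ : ∀ C ∈ G.leaves, appendList τ G.leaves (fun C => C.ofClosed) .unit (l C) = C.ofClosed :=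
    fun C hC => appendList_index _ _ _ _ (hl C hC)
  have a := G.incl_interp_skel hid (Fin.castAdd _) l h' (fun C hC => ⟨appendList_index _ _ _ _ (hl C hC),
    appendList_index _ _ _ _ (hl C hC), appendList_index _ _ _ _ (hl C hC)⟩)
  have e₂ := G.skel_subst (Fin.castAdd _) l _ e₁
  have s := (IsRel.admInterp (G.skel (Fin.castAdd _) l) h').isRel
  have b := Proves.identityExtension (A := A) (Γ := Γ) (Θ := Θ) (G.skel (Fin.castAdd _) l)
    (appendList τ G.leaves (fun C => C.ofClosed) .unit) hid
  rw [show (fun i => eqRel (appendList τ G.leaves (fun C => C.ofClosed) .unit i)) =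
      appendList (fun i => eqRel (τ i)) G.leaves (fun C => (eqRel C.ofClosed : Rel S n))
        (eqRel .unit) from funext fun i => by
      refine Fin.addCases (fun i => ?_) (fun i => ?_) i
      · simp only [appendList_castAdd]
      · simp only [appendList_natAdd]
        refine Fin.lastCases ?_ (fun i => ?_) i
        · simp only [Fin.lastCases_last]
        · simp only [Fin.lastCases_castSucc]] at b
  rw [e₂] at b s
  simp only [appendList_castAdd] at a b s
  have b' := Incl.of_equiv b s (.ofAdm (.admEq _))
  have r := G.isRel_interp (fun i => (h i).isRel)
  exact ⟨a.2.trans b'.1 r s, b'.2.trans a.1 (.ofAdm (.admEq _)) s⟩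

end IdentityExtension

section Act
variable {S : Signature.{u, v}}

theorem idTm_subst {n m : ℕ} (σ : Ty S.toTySig n) (s : Fin n → Ty S.toTySig m)
    (si sl : ℕ → Tm S m) : (idTm σ).subst s si sl = idTm (σ.subst s) := by
  simp [idTm]

theorem idTm_ren {n m : ℕ} (σ : Ty S.toTySig n) (r : Fin n → Fin m) (ri rl : ℕ → ℕ) :
    (idTm σ : Tm S n).ren r ri rl = idTm (σ.ren r) := by
  simp [idTm]

theorem Ty.ren_succ_inst_var {K : TySig.{u}} {n : ℕ} (ρ : Ty K (n + 1)) :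
    (ρ.ren (upTyRen Fin.succ)).inst (.var 0) = ρ := by
  simp only [Ty.inst, Ty.ren_subst]
  conv_rhs => rw [← Ty.subst_var ρ]
  congr 1; funext i; refine Fin.cases rfl (fun i => rfl) i

theorem LCtx.single_wk {K : TySig.{u}} {n : ℕ} (j : ℕ) (σ : Ty K n) :
    (LCtx.single j σ).wk = .single j σ.wk := by
  funext i; simp only [LCtx.wk, LCtx.single]; split <;> simp

/-- Substitution in the functorial action. -/
theorem IndTy.act_subst {k : ℕ} (G : IndTy S.toTySig k) :
    ∀ (p : Bool) {n m : ℕ} (τ τ' : Fin k → Ty S.toTySig n) (f : Fin k → Tm S n)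
    (s : Fin n → Ty S.toTySig m) (si sl : ℕ → Tm S m),
    (G.act p τ τ' f).subst s si sl = G.act p (fun i => (τ i).subst s) (fun i => (τ' i).subst s)
      (fun i => (f i).subst s si sl) := by
  induction G with
  | var i => intros; simp [act]
  | closed σ => intros; simp [act, idTm_subst]
  | unit => intros; simp [act, idTm_subst]
  | tensor σ σ' ih ih' | lolli σ σ' ih ih' =>
    intro p n m τ τ' f s si sl
    simp only [act, ← ih, ← ih']
    cases p <;> simp [Nat.add_assoc]
  | bang σ ih =>
    intro p n m τ τ' f s si sl
    simp only [act, ← ih]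
    cases p <;> simp
  | @pi k σ ih =>
    intro p n m τ τ' f s si sl
    have e : ∀ τ : Fin k → Ty S.toTySig n, (fun i => (upTy τ i).subst (upTy s)) =
        upTy fun i => (τ i).subst s := by
      intro τ
      funext i; refine Fin.cases rfl (fun i => ?_) i; simp
    have e' : (fun i => (Fin.cases (idTm (.var 0)) (fun i => (f i).wkT) i : Tm S (n + 1)).subst
        (upTy s) (fun i => (si i).wkT) (fun i => (sl i).wkT)) =
        Fin.cases (idTm (.var 0)) (fun i => ((f i).subst s si sl).wkT) := by
      funext i; refine Fin.cases ?_ (fun i => ?_) i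
      · simp [idTm_subst]
      · simp
    have := ih p (upTy τ) (upTy τ') (Fin.cases (idTm (.var 0)) fun i => (f i).wkT) (upTy s)
      (fun i => (si i).wkT) (fun i => (sl i).wkT)
    rw [e', e, e] at this
    simp only [act, ← this]
    cases p <;> simp [e]

theorem IndTy.act_ren {k : ℕ} (G : IndTy S.toTySig k) (p : Bool) {n m : ℕ}
    (τ τ' : Fin k → Ty S.toTySig n) (f : Fin k → Tm S n) (r : Fin n → Fin m) (ri rl : ℕ → ℕ) :
    (G.act p τ τ' f).ren r ri rl = G.act p (fun i => (τ i).ren r) (fun i => (τ' i).ren r)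
      (fun i => (f i).ren r ri rl) := by
  simp only [Tm.ren_eq_subst, Ty.ren_eq_subst, act_subst]

theorem HasType.wkL_single {n : ℕ} {Γ : List (Ty S.toTySig n)} {t : Tm S n} {τ : Ty S.toTySig n}
    (h : HasType Γ .empty t τ) (k : ℕ) : HasType Γ .empty (t.wkL k) τ := by rwa [h.wkL_eq]

theorem HasType.appR {n : ℕ} {Γ : List (Ty S.toTySig n)} {Δ : LCtx S.toTySig n} {t u : Tm S n}
    {σ τ : Ty S.toTySig n} (h : HasType Γ .empty t (.lolli σ τ)) (h' : HasType Γ Δ u σ) :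
    HasType Γ Δ (.app t u) τ := .app (LCtx.split_right _) h h'

/-- The functorial action has the expected type, if the variables which are mapped non-trivially
occur with the right sign only. -/
theorem IndTy.hasType_act {k : ℕ} (G : IndTy S.toTySig k) :
    ∀ (p : Bool) {n : ℕ} {Γ : List (Ty S.toTySig n)} {τ τ' : Fin k → Ty S.toTySig n}
    {f : Fin k → Tm S n}, (∀ i, HasType Γ .empty (f i) (.lolli (τ i) (τ' i))) →
    (∀ i, G.Occurs (!p) i → τ i = τ' i) →
    HasType Γ .empty (G.act p τ τ' f) (.lolli (G.toTy.subst (if p then τ else τ'))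
      (G.toTy.subst (if p then τ' else τ))) := by
  induction G with
  | var i =>
    intro p n Γ τ τ' f hf ho
    cases p
    · have e := ho i ⟨rfl, rfl⟩
      have := hf i
      rw [e] at this
      simpa [act, e] using this
    · exact hf i
  | closed σ => intro p n Γ τ τ' f hf ho; simpa [act] using hasType_idTm
  | unit => intro p n Γ τ τ' f hf ho; exact hasType_idTm
  | tensor σ σ' ih ih' =>
    intro p n Γ τ τ' f hf ho
    have h₁ := (ih p hf fun i hi => ho i (.inl hi)).wkL_single 3
    have h₂ := (ih' p hf fun i hi => ho i (.inr hi)).wkL_single 3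
    refine .lam ?_
    rw [LCtx.cons_empty]
    refine .letT (LCtx.split_left _) .lvar (.tensor (Δ₁ := .single 1 _) (Δ₂ := .single 0 _) ?_
      (h₁.appR .lvar) (h₂.appR .lvar))
    rintro (_ | _ | j) <;> simp [LCtx.cons, LCtx.single, LCtx.empty, scons]
  | lolli σ σ' ih ih' =>
    intro p n Γ τ τ' f hf ho
    have h₁ : HasType Γ .empty ((σ.act (!p) τ τ' f).wkL 2)
        (.lolli (σ.toTy.subst (if p then τ' else τ)) (σ.toTy.subst (if p then τ else τ'))) := by
      have := (ih (!p) hf fun i hi => ho i (.inl hi)).wkL_single 2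
      cases p <;> exact this
    have h₂ := (ih' p hf fun i hi => ho i (.inr hi)).wkL_single 2
    refine .lam (.lam (h₂.appR (.app (Δ₁ := .single 1 _) (Δ₂ := .single 0 _) ?_ .lvar
      (h₁.appR .lvar))))
    rintro (_ | _ | j) <;> simp [LCtx.cons, LCtx.single, LCtx.empty, scons]
  | bang σ ih =>
    intro p n Γ τ τ' f hf ho
    have h₁ := ((ih p hf ho).wkL_single 1).wkI (σ.toTy.subst (if p then τ else τ'))
    refine .lam ?_
    rw [LCtx.cons_empty]
    exact .letB (LCtx.split_left _) .lvar (.bang (h₁.app' (.ivar rfl)))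
  | pi σ ih =>
    intro p n Γ τ τ' f hf ho
    have h₁ := (ih p (Γ := Γ.map Ty.wk) (τ := upTy τ) (τ' := upTy τ')
      (f := Fin.cases (idTm (.var 0)) fun i => (f i).wkT)
      (fun i => by
        refine Fin.cases hasType_idTm (fun i => ?_) i
        exact (hf i).wkT)
      (fun i => by
        refine Fin.cases (fun _ => rfl) (fun i hi => ?_) i
        simp [ho i hi])).wkL_single 1
    refine .lam (.tlam ?_)
    rw [LCtx.cons_empty]
    refine HasType.appR (σ := σ.toTy.subst (upTy (if p then τ else τ'))) ?_ ?_
    · cases p <;> exact h₁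
    · have : HasType (Γ.map Ty.wk) (.single 0 (Ty.pi (σ.toTy.subst (upTy (if p then τ else τ')))).wk)
        (.lvar 0 : Tm S (n + 1)) (.pi ((σ.toTy.subst (upTy (if p then τ else τ'))).ren
          (upTyRen Fin.succ))) := .lvar
      rw [← LCtx.single_wk] at this
      exact this.tapp' (Ty.ren_succ_inst_var _)

theorem ExtEq.id_appR {n : ℕ} {Γ : List (Ty S.toTySig n)} {Δ : LCtx S.toTySig n} {t u : Tm S n}
    {σ : Ty S.toTySig n} (h : ExtEq Γ .empty t (idTm σ) (.lolli σ σ)) (h' : HasType Γ Δ u σ) :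
    ExtEq Γ Δ (.app t u) u σ :=
  .trans (.congApp (LCtx.split_right _) h (.refl h')) (.betaTerm (LCtx.split_right _)
    (by rw [LCtx.cons_empty]; exact .lvar) h')

/-- The functorial action preserves identities. -/
theorem IndTy.act_id {k : ℕ} (G : IndTy S.toTySig k) :
    ∀ (p : Bool) {n : ℕ} {Γ : List (Ty S.toTySig n)} (τ : Fin k → Ty S.toTySig n),
    ExtEq Γ .empty (G.act p τ τ (fun i => idTm (τ i))) (idTm (G.toTy.subst τ))
      (.lolli (G.toTy.subst τ) (G.toTy.subst τ)) := by
  induction G with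
  | var i => intros; exact .refl hasType_idTm
  | closed σ => intros; simpa [act] using ExtEq.refl hasType_idTm
  | unit => intros; exact .refl hasType_idTm
  | tensor σ σ' ih ih' =>
    intro p n Γ τ
    have t₁ := σ.hasType_act p (Γ := Γ) (fun i => hasType_idTm (σ := τ i)) (fun _ _ => rfl)
    have t₂ := σ'.hasType_act p (Γ := Γ) (fun i => hasType_idTm (σ := τ i)) (fun _ _ => rfl)
    simp only [act, ite_self, t₁.wkL_eq, t₂.wkL_eq]
    refine .congLam ?_
    rw [LCtx.cons_empty]
    refine .trans (.congLetT (LCtx.split_left _) (.refl .lvar) (.congTensor (Δ₁ := .single 1 _)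
      (Δ₂ := .single 0 _) ?_ ((ih p τ).id_appR .lvar) ((ih' p τ).id_appR .lvar)))
      (.commT (f := .lvar 0) (LCtx.split_left _) .lvar (by rw [LCtx.cons_empty]; exact .lvar))
    rintro (_ | _ | j) <;> simp [LCtx.cons, LCtx.single, LCtx.empty, scons]
  | lolli σ σ' ih ih' =>
    intro p n Γ τ
    have t₁ := σ.hasType_act (!p) (Γ := Γ) (fun i => hasType_idTm (σ := τ i)) (fun _ _ => rfl)
    have t₂ := σ'.hasType_act p (Γ := Γ) (fun i => hasType_idTm (σ := τ i)) (fun _ _ => rfl)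
    rw [ite_self] at t₁
    simp only [act, ite_self, t₁.wkL_eq, t₂.wkL_eq]
    have e : LCtx.Split (((LCtx.empty.cons (.lolli (σ.toTy.subst τ) (σ'.toTy.subst τ))).cons
        (σ.toTy.subst τ))) (.single 1 (.lolli (σ.toTy.subst τ) (σ'.toTy.subst τ)))
        (.single 0 (σ.toTy.subst τ)) := by
      rintro (_ | _ | j) <;> simp [LCtx.cons, LCtx.single, LCtx.empty, scons]
    have h₁ := (ih (!p) (Γ := Γ) τ).id_appR (.lvar (j := 0))
    refine .congLam (.trans (.congLam (.trans ((ih' p τ).id_appR (.app e .lvar (t₁.appR .lvar)))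
      (.congApp e (.refl .lvar) h₁))) ?_)
    exact .etaTerm (t := .lvar 0) (by rw [LCtx.cons_empty]; exact .lvar)
  | bang σ ih =>
    intro p n Γ τ
    have t₁ := σ.hasType_act p (Γ := Γ) (fun i => hasType_idTm (σ := τ i)) (fun _ _ => rfl)
    simp only [act, ite_self, t₁.wkL_eq]
    have e : (σ.act p τ τ fun i => idTm (τ i)).wkI 1 = σ.act p τ τ fun i => idTm (τ i) := by
      simp [act_ren, idTm_ren]
    rw [e]
    refine .congLam ?_
    rw [LCtx.cons_empty]
    exact .trans (.congLetB (LCtx.split_left _) (.refl .lvar) (.congBang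
      ((ih p τ).id_appR (.ivar rfl))))
      (.commB (f := .lvar 0) (LCtx.split_left _) .lvar (by rw [LCtx.cons_empty]; exact .lvar))
  | pi σ ih =>
    intro p n Γ τ
    have e : (Fin.cases (idTm (.var 0)) fun i => (idTm (τ i)).wkT : Fin _ → Tm S (n + 1)) =
        fun i => idTm (upTy τ i) := by
      funext i; refine Fin.cases rfl (fun i => ?_) i
      simp [idTm_ren]
    have t₁ := σ.hasType_act p (Γ := Γ.map Ty.wk) (fun i => hasType_idTm (σ := upTy τ i))
      (fun _ _ => rfl)
    simp only [act, ite_self, e, t₁.wkL_eq]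
    have h : HasType (Γ.map Ty.wk) (.single 0 (Ty.pi (σ.toTy.subst (upTy τ))).wk)
        (.lvar 0 : Tm S (n + 1)) (.pi ((σ.toTy.subst (upTy τ)).ren (upTyRen Fin.succ))) := .lvar
    rw [← LCtx.single_wk] at h
    refine .congLam ?_
    rw [LCtx.cons_empty]
    exact .trans (.congTlam ((ih p (upTy τ)).id_appR (h.tapp' (Ty.ren_succ_inst_var _))))
      (.etaType (t := .lvar 0) .lvar)

end Act

section OneVariable
variable {K : TySig.{u}}

theorem Ty.ren_one (c : Ty K 1) {n : ℕ} (r : Fin 1 → Fin n) :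
    c.ren r = c.subst fun _ => .var (r 0) := by
  rw [Ty.ren_eq_subst]; congr 1; funext i; rw [Subsingleton.elim i 0]

theorem Ty.subst_one (c : Ty K 1) {n : ℕ} (s : Fin 1 → Ty K n) : c.subst s = c.subst fun _ => s 0 := by
  congr 1; funext i; rw [Subsingleton.elim i 0]

theorem Ty.ofClosed_ex (c : Ty K 1) {n : ℕ} : ((Ty.ex c).ofClosed : Ty K n) =
    .pi (.lolli (.pi (.lolli (c.subst fun _ => .var 0) (.var 1))) (.var 0)) := by
  simp [Ty.ex, Ty.ofClosed, Ty.ren_one, upTyRen]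
  rfl

end OneVariable

section Terms
variable {S : Signature.{u, v}} {n : ℕ} {Γ : List (Ty S.toTySig n)} {α α' β τ τ' : Ty S.toTySig n}
  {a f g h z : Tm S n}

/-! ### The functorial action as a polymorphic term -/

/-- The type of `functorTm`. -/
def IndTy.functorTy (σ : IndTy S.toTySig 1) : IndTy S.toTySig 0 :=
  .pi (.pi (.lolli (.bang (.lolli (.var 1) (.var 0)))
    (.lolli (σ.ren fun _ => 1) (σ.ren fun _ => 0))))

theorem IndTy.hasType_functor_body (σ : IndTy S.toTySig 1) (hσ : ¬ σ.Occurs false 0) :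
    HasType Γ .empty (.lam (.bang (.lolli τ τ')) (.letB (.lolli τ τ') (.lvar 0)
      (σ.act true (fun _ => τ) (fun _ => τ') (fun _ => .ivar 0))))
      (.lolli (.bang (.lolli τ τ'))
        (.lolli (σ.toTy.subst fun _ => τ) (σ.toTy.subst fun _ => τ'))) := by
  refine .lam ?_
  rw [LCtx.cons_empty]
  refine .letB (LCtx.split_left _) .lvar ?_
  exact σ.hasType_act true (fun _ => .ivar rfl) (fun i hi => by
    rw [Subsingleton.elim i 0] at hi; exact absurd hi hσ)

theorem IndTy.hasType_functorTm (σ : IndTy S.toTySig 1) (hσ : ¬ σ.Occurs false 0) :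
    HasType [] .empty σ.functorTm σ.functorTy.toTy := by
  refine .tlam (.tlam ?_)
  have := σ.hasType_functor_body (Γ := []) (τ := (.var 1 : Ty S.toTySig 2)) (τ' := .var 0) hσ
  simpa [functorTy, Ty.ren_one] using this

theorem IndTy.ofClosed_functorTm (σ : IndTy S.toTySig 1) : (σ.functorTm.ofClosed : Tm S n) =
    .tlam (.tlam (.lam (.bang (.lolli (.var 1) (.var 0)))
      (.letB (.lolli (.var 1) (.var 0)) (.lvar 0)
        (σ.act true (fun _ => .var 1) (fun _ => .var 0) (fun _ => .ivar 0))))) := by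
  simp [Tm.ofClosed, functorTm, act_ren, upTyRen]
  exact ⟨rfl, rfl⟩

theorem IndTy.map_act (σ : IndTy S.toTySig 1) (hσ : ¬ σ.Occurs false 0)
    (hf : HasType Γ .empty f (.lolli τ τ')) :
    ExtEq Γ .empty (σ.map τ τ' f) (σ.act true (fun _ => τ) (fun _ => τ') (fun _ => f))
      (.lolli (σ.toTy.subst fun _ => τ) (σ.toTy.subst fun _ => τ')) := by
  have h1 : ExtEq Γ .empty (.tapp σ.functorTm.ofClosed τ)
      (.tlam (.lam (.bang (.lolli τ.wk (.var 0))) (.letB (.lolli τ.wk (.var 0)) (.lvar 0)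
        (σ.act true (fun _ => τ.wk) (fun _ => .var 0) (fun _ => .ivar 0)))))
      (.pi (.lolli (.bang (.lolli τ.wk (.var 0)))
        (.lolli (σ.toTy.subst fun _ => τ.wk) (σ.toTy.subst fun _ => .var 0)))) := by
    rw [ofClosed_functorTm]
    have e₁ : (upTy (Fin.cases τ .var) 1 : Ty S.toTySig (n + 1)) = τ.wk := rfl
    refine .tbeta (.tlam (σ.hasType_functor_body hσ)) ?_ ?_
    · simp [e₁]
    · simp [act_subst, e₁]
  have h2 : ExtEq Γ .empty (.tapp (.tapp σ.functorTm.ofClosed τ) τ')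
      (.lam (.bang (.lolli τ τ')) (.letB (.lolli τ τ') (.lvar 0)
        (σ.act true (fun _ => τ) (fun _ => τ') (fun _ => .ivar 0))))
      (.lolli (.bang (.lolli τ τ'))
        (.lolli (σ.toTy.subst fun _ => τ) (σ.toTy.subst fun _ => τ'))) := by
    refine .trans (h1.tapp' (by simp)) (.tbeta (σ.hasType_functor_body hσ) ?_ ?_)
    · simp
    · simp [act_subst]
  have hact := σ.hasType_act true (Γ := Γ) (τ := fun _ => τ) (τ' := fun _ => τ') (fun _ => hf)
    (fun i hi => by rw [Subsingleton.elim i 0] at hi; exact absurd hi hσ)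
  have hact' := σ.hasType_act true (Γ := .lolli τ τ' :: Γ) (τ := fun _ => τ) (τ' := fun _ => τ')
    (f := fun _ => .ivar 0) (fun _ => .ivar rfl)
    (fun i hi => by rw [Subsingleton.elim i 0] at hi; exact absurd hi hσ)
  refine .trans (h2.app' (.refl (.bang hf))) (.trans (.beta (.letB (LCtx.split_left _) .lvar hact')
    (.bang hf) ?_) (.trans (.betaB hf hact') ?_))
  · simp [act_subst]
  · simp only [Tm.instI, act_subst, Ty.subst_var, Tm.subst, scons_zero]
    exact .refl hact

theorem IndTy.hasType_map (σ : IndTy S.toTySig 1) (hσ : ¬ σ.Occurs false 0)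
    (hf : HasType Γ .empty f (.lolli τ τ')) : HasType Γ .empty (σ.map τ τ' f)
      (.lolli (σ.toTy.subst fun _ => τ) (σ.toTy.subst fun _ => τ')) := by
  have h := (σ.hasType_functorTm hσ).ofClosed (Γ := Γ)
  have h1 := h.tapp' (τ := τ) (ω := .pi (.lolli (.bang (.lolli τ.wk (.var 0)))
        (.lolli (σ.toTy.subst fun _ => τ.wk) (σ.toTy.subst fun _ => .var 0)))) (by
    have e₁ : (upTy (Fin.cases τ .var) 1 : Ty S.toTySig (n + 1)) = τ.wk := rfl
    simp [functorTy, Ty.ren_one, Ty.ofClosed, upTyRen, e₁])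
  exact (h1.tapp' (by simp)).app' (.bang hf)

/-! ### Existential types -/

variable (c : Ty S.toTySig 1)

theorem ofClosed_pack : ((pack c).ofClosed : Tm S n) = .tlam (.lam (c.subst fun _ => .var 0)
    (.tlam (.lam (.pi (.lolli (c.subst fun _ => .var 0) (.var 1)))
      (.app (.tapp (.lvar 0) (.var 1)) (.lvar 1))))) := by
  simp [pack, Tm.ofClosed, Ty.ren_one, upTyRen]
  exact ⟨rfl, rfl⟩

theorem hasType_pack_body₂ : HasType Γ (.single 0 (c.subst fun _ => α))
    (.lam (.pi (.lolli (c.subst fun _ => .var 0) β.wk)) (.app (.tapp (.lvar 0) α) (.lvar 1)))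
    (.lolli (.pi (.lolli (c.subst fun _ => .var 0) β.wk)) β) := by
  refine .lam (.app (Δ₁ := .single 0 (.pi (.lolli (c.subst fun _ => .var 0) β.wk)))
    (Δ₂ := .single 1 (c.subst fun _ => α)) ?_ (.tapp' .lvar ?_) .lvar)
  · rintro (_ | _ | j) <;> simp [LCtx.cons, LCtx.single, LCtx.empty, scons]
  · simp

theorem hasType_pack_body₁ : HasType Γ (.single 0 (c.subst fun _ => α))
    (.tlam (.lam (.pi (.lolli (c.subst fun _ => .var 0) (.var 1)))
      (.app (.tapp (.lvar 0) α.wk) (.lvar 1)))) (Ty.ex c).ofClosed := by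
  rw [Ty.ofClosed_ex]
  refine .tlam ?_
  rw [LCtx.single_wk]
  have := hasType_pack_body₂ (Γ := Γ.map Ty.wk) (α := α.wk) (β := .var 0) c
  simpa using this

theorem hasType_pack' : HasType Γ .empty (pack c).ofClosed
    (.pi (.lolli (c.subst fun _ => .var 0) (Ty.ex c).ofClosed)) := by
  rw [ofClosed_pack]
  refine .tlam (.lam ?_)
  have := hasType_pack_body₁ (Γ := Γ.map Ty.wk) (α := .var 0) c
  rw [show LCtx.empty.wk = LCtx.empty from rfl, LCtx.cons_empty]
  exact this

theorem Tm.ofClosed_zero (t : Tm S 0) : t.ofClosed = t := by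
  rw [Tm.ofClosed, show (Fin.elim0 : Fin 0 → Fin 0) = fun i => i from funext fun i => i.elim0]
  simp [Tm.ren_eq_subst, Tm.subst_var]

theorem hasType_pack : HasType [] .empty (pack c)
    (.pi (.lolli (c.subst fun _ => .var 0) (Ty.ex c).ofClosed)) := by
  have := hasType_pack' (Γ := ([] : List (Ty S.toTySig 0))) c
  rwa [Tm.ofClosed_zero] at this

theorem hasType_pack_app (ha : HasType Γ .empty a (c.subst fun _ => α)) :
    HasType Γ .empty (.app (.tapp (pack c).ofClosed α) a) (Ty.ex c).ofClosed :=
  ((hasType_pack' c).tapp' (by simp)).app' ha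

theorem pack_beta (ha : HasType Γ .empty a (c.subst fun _ => α))
    (hh : HasType Γ .empty h (.pi (.lolli (c.subst fun _ => .var 0) β.wk))) :
    ExtEq Γ .empty (.app (.tapp (.app (.tapp (pack c).ofClosed α) a) β) h)
      (.app (.tapp h α) a) β := by
  have h1 : ExtEq Γ .empty (.tapp (pack c).ofClosed α)
      (.lam (c.subst fun _ => α) (.tlam (.lam (.pi (.lolli (c.subst fun _ => .var 0) (.var 1)))
        (.app (.tapp (.lvar 0) α.wk) (.lvar 1)))))
      (.lolli (c.subst fun _ => α) (Ty.ex c).ofClosed) := by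
    rw [ofClosed_pack]
    refine .tbeta (σ := .lolli (c.subst fun _ => .var 0) (Ty.ex c).ofClosed) (.lam ?_) ?_ ?_
    · rw [LCtx.cons_empty]; exact hasType_pack_body₁ c
    · simp
    · have e₁ : (upTy (Fin.cases α .var) 1 : Ty S.toTySig (n + 1)) = α.wk := rfl
      have e₂ : (upTy (upTy (Fin.cases α .var)) 1 : Ty S.toTySig (n + 2)) = .var 1 := rfl
      simp [e₁, e₂]
  have h2 : ExtEq Γ .empty (.app (.tapp (pack c).ofClosed α) a)
      (.tlam (.lam (.pi (.lolli (c.subst fun _ => .var 0) (.var 1)))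
        (.app (.tapp (.lvar 0) α.wk) (a.wkT.wkL 1)))) (Ty.ex c).ofClosed :=
    .trans (h1.app' (.refl ha)) (.beta (hasType_pack_body₁ c) ha (by simp))
  have ha' : HasType Γ .empty (a.wkL 1) (c.subst fun _ => α) := ha.wkL_single 1
  have h3 : ExtEq Γ .empty (.tapp (.app (.tapp (pack c).ofClosed α) a) β)
      (.lam (.pi (.lolli (c.subst fun _ => .var 0) β.wk)) (.app (.tapp (.lvar 0) α) (a.wkL 1)))
      (.lolli (.pi (.lolli (c.subst fun _ => .var 0) β.wk)) β) := by
    rw [Ty.ofClosed_ex] at h2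
    have e₁ : (upTy (Fin.cases β .var) 1 : Ty S.toTySig (n + 1)) = β.wk := rfl
    refine .trans (h2.tapp' (by simp [e₁])) (.tbeta
      (σ := .lolli (.pi (.lolli (c.subst fun _ => .var 0) (.var 1))) (.var 0)) ?_ ?_ ?_)
    · refine .lam (.app (LCtx.split_left _) (.tapp' (σ := .lolli (c.subst fun _ => .var 0) (.var 1))
        ?_ ?_) (ha.wkT.wkL_single 1))
      · rw [LCtx.cons_empty]; exact .lvar
      · simp [Ty.inst]; rfl
    · simp [e₁]
    · simp [e₁, Tm.ren_eq_subst]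
  refine .trans (h3.app' (.refl hh)) (.beta (.app (LCtx.split_left _) (.tapp' .lvar ?_) ha') hh ?_)
  · simp
  · simp

end Terms

section Coalgebra
variable {S : Signature.{u, v}} {n : ℕ} {Γ : List (Ty S.toTySig n)} {α β τ τ' : Ty S.toTySig n}
  {a f g h z F : Tm S n}

section Unfold
variable (c : Ty S.toTySig 1)

theorem coalgTy_subst : (coalgTy c).subst (fun _ => α) =
    .tensor (.bang (.lolli α (c.subst fun _ => α))) α := by
  simp [coalgTy]

theorem ofClosed_unfoldTm : ((unfoldTm c).ofClosed : Tm S n) =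
    .tlam (.lam (.bang (.lolli (.var 0) (c.subst fun _ => .var 0))) (.lam (.var 0)
      (.app (.tapp (pack (coalgTy c)).ofClosed (.var 0)) (.tensor (.lvar 1) (.lvar 0))))) := by
  have e : (unfoldTm c).ofClosed = (unfoldTm c).ren (Fin.elim0 : Fin 0 → Fin n) id id := rfl
  rw [e, unfoldTm]
  simp only [Tm.ren, (hasType_pack (coalgTy c)).ofClosed_ren, Ty.ren, Ty.ren_one]
  rfl

theorem hasType_unfold_body₀ : HasType Γ
    ((LCtx.single 0 (.bang (.lolli α (c.subst fun _ => α)))).cons α)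
    (.app (.tapp (pack (coalgTy c)).ofClosed α) (.tensor (.lvar 1) (.lvar 0)))
    (Ty.nu c).ofClosed := by
  refine ((hasType_pack' (coalgTy c)).tapp' (τ := α)
    (ω := .lolli ((coalgTy c).subst fun _ => α) (Ty.ex (coalgTy c)).ofClosed) (by simp)).appR ?_
  rw [coalgTy_subst]
  refine .tensor (Δ₁ := .single 1 _) (Δ₂ := .single 0 _) ?_ .lvar .lvar
  rintro (_ | _ | j) <;> simp [LCtx.cons, LCtx.single, LCtx.empty, scons]

theorem hasType_unfold_body : HasType Γ .empty
    (.lam (.bang (.lolli α (c.subst fun _ => α))) (.lam α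
      (.app (.tapp (pack (coalgTy c)).ofClosed α) (.tensor (.lvar 1) (.lvar 0)))))
    (.lolli (.bang (.lolli α (c.subst fun _ => α))) (.lolli α (Ty.nu c).ofClosed)) :=
  .lam (by rw [LCtx.cons_empty]; exact .lam (hasType_unfold_body₀ c))

theorem hasType_unfoldTm' : HasType Γ .empty (unfoldTm c).ofClosed
    (.pi (.lolli (.bang (.lolli (.var 0) (c.subst fun _ => .var 0)))
      (.lolli (.var 0) (Ty.nu c).ofClosed))) := by
  rw [ofClosed_unfoldTm]
  exact .tlam (hasType_unfold_body c)

theorem hasType_unfoldTm : HasType [] .empty (unfoldTm c)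
    (.pi (.lolli (.bang (.lolli (.var 0) (c.subst fun _ => .var 0)))
      (.lolli (.var 0) (Ty.nu c).ofClosed))) := by
  have := hasType_unfoldTm' (Γ := ([] : List (Ty S.toTySig 0))) c
  rwa [Tm.ofClosed_zero] at this

/-- `unfold α F`. -/
abbrev unfoldAt (α : Ty S.toTySig n) (F : Tm S n) : Tm S n :=
  .app (.tapp (unfoldTm c).ofClosed α) F

theorem hasType_unfoldAt (hF : HasType Γ .empty F (.bang (.lolli α (c.subst fun _ => α)))) :
    HasType Γ .empty (unfoldAt c α F) (.lolli α (Ty.nu c).ofClosed) :=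
  ((hasType_unfoldTm' c).tapp' (by simp)).app' hF

theorem unfold_beta (hF : HasType Γ .empty F (.bang (.lolli α (c.subst fun _ => α))))
    (hz : HasType Γ .empty z α) : ExtEq Γ .empty (.app (unfoldAt c α F) z)
      (.app (.tapp (pack (coalgTy c)).ofClosed α) (.tensor F z)) (Ty.nu c).ofClosed := by
  have p := hasType_pack (coalgTy c)
  have h1 : ExtEq Γ .empty (.tapp (unfoldTm c).ofClosed α)
      (.lam (.bang (.lolli α (c.subst fun _ => α))) (.lam α
      (.app (.tapp (pack (coalgTy c)).ofClosed α) (.tensor (.lvar 1) (.lvar 0)))))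
      (.lolli (.bang (.lolli α (c.subst fun _ => α))) (.lolli α (Ty.nu c).ofClosed)) := by
    rw [ofClosed_unfoldTm]
    exact .tbeta (hasType_unfold_body c) (by simp) (by simp [p.ofClosed_subst])
  have h2 : ExtEq Γ .empty (unfoldAt c α F)
      (.lam α (.app (.tapp (pack (coalgTy c)).ofClosed α) (.tensor (F.wkL 1) (.lvar 0))))
      (.lolli α (Ty.nu c).ofClosed) :=
    .trans (h1.app' (.refl hF)) (.beta (.lam (hasType_unfold_body₀ c)) hF
      (by simp [p.ofClosed_subst]))
  refine .trans (h2.app' (.refl hz)) (.beta ?_ hz ?_)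
  · refine ((hasType_pack' (coalgTy c)).tapp' (τ := α)
      (ω := .lolli ((coalgTy c).subst fun _ => α) (Ty.ex (coalgTy c)).ofClosed) (by simp)).appR ?_
    rw [coalgTy_subst]
    exact .tensor (LCtx.split_right _) (hF.wkL_single 1) .lvar
  · simp [p.ofClosed_subst]

end Unfold

/-! ### The final coalgebra structure -/

variable (σ : IndTy S.toTySig 1)

/-- `!(α ⊸ σ(α)) ⊗ α` as an inductively constructed type. -/
def IndTy.coalg : IndTy S.toTySig 1 := .tensor (.bang (.lolli (.var 0) σ)) (.var 0)

theorem IndTy.map_subst (hσ : ¬ σ.Occurs false 0) {m : ℕ} (s : Fin n → Ty S.toTySig m)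
    (si sl : ℕ → Tm S m) : (σ.map τ τ' f).subst s si sl =
      σ.map (τ.subst s) (τ'.subst s) (f.subst s si sl) := by
  simp [map, (σ.hasType_functorTm hσ).ofClosed_subst]

theorem IndTy.map_ren (hσ : ¬ σ.Occurs false 0) {m : ℕ} (r : Fin n → Fin m)
    (ri rl : ℕ → ℕ) : (σ.map τ τ' f).ren r ri rl =
      σ.map (τ.ren r) (τ'.ren r) (f.ren r ri rl) := by
  simp only [Tm.ren_eq_subst, Ty.ren_eq_subst, σ.map_subst hσ]

/-- The body of `outAux` at a type. -/
abbrev outBody (α : Ty S.toTySig n) : Tm S n :=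
  .letT (.bang (.lolli α (σ.toTy.subst fun _ => α))) α (.lvar 0)
    (.letB (.lolli α (σ.toTy.subst fun _ => α)) (.lvar 1)
      (.app (σ.map α (Ty.nu σ.toTy).ofClosed (unfoldAt σ.toTy α (.bang (.ivar 0))))
        (.app (.ivar 0) (.lvar 0))))

theorem ofClosed_outAux (hσ : ¬ σ.Occurs false 0) : ((outAux σ).ofClosed : Tm S n) =
    .tlam (.lam ((coalgTy σ.toTy).subst fun _ => .var 0) (outBody σ (.var 0))) := by
  have e : (outAux σ).ofClosed = (outAux σ).ren (Fin.elim0 : Fin 0 → Fin n) id id := rfl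
  rw [e, outAux]
  simp only [Tm.ren, σ.map_ren hσ, (hasType_unfoldTm σ.toTy).ofClosed_ren, Ty.ren,
    Ty.ofClosed_ren]
  simp only [Ty.ren_one]
  rfl

theorem hasType_outBody₀ (hσ : ¬ σ.Occurs false 0) :
    HasType (.lolli α (σ.toTy.subst fun _ => α) :: Γ) (.single 0 α)
      (.app (σ.map α (Ty.nu σ.toTy).ofClosed (unfoldAt σ.toTy α (.bang (.ivar 0))))
        (.app (.ivar 0) (.lvar 0))) (σ.toTy.subst fun _ => (Ty.nu σ.toTy).ofClosed) :=
  (σ.hasType_map hσ (hasType_unfoldAt σ.toTy (.bang (.ivar rfl)))).appR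
    (HasType.appR (.ivar rfl) .lvar)

theorem hasType_outBody₁ (hσ : ¬ σ.Occurs false 0) : HasType Γ
    ((LCtx.empty.cons (.bang (.lolli α (σ.toTy.subst fun _ => α)))).cons α)
    (.letB (.lolli α (σ.toTy.subst fun _ => α)) (.lvar 1)
      (.app (σ.map α (Ty.nu σ.toTy).ofClosed (unfoldAt σ.toTy α (.bang (.ivar 0))))
        (.app (.ivar 0) (.lvar 0)))) (σ.toTy.subst fun _ => (Ty.nu σ.toTy).ofClosed) := by
  refine .letB (Δ₁ := .single 1 _) (Δ₂ := .single 0 _) ?_ .lvar (hasType_outBody₀ σ hσ)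
  rintro (_ | _ | j) <;> simp [LCtx.cons, LCtx.single, LCtx.empty, scons]

theorem hasType_outBody (hσ : ¬ σ.Occurs false 0) : HasType Γ (.single 0 ((coalgTy σ.toTy).subst fun _ => α))
    (outBody σ α) (σ.toTy.subst fun _ => (Ty.nu σ.toTy).ofClosed) := by
  rw [coalgTy_subst]
  exact .letT (LCtx.split_left _) .lvar (hasType_outBody₁ σ hσ)

theorem hasType_outAux' (hσ : ¬ σ.Occurs false 0) : HasType Γ .empty (outAux σ).ofClosed
    (.pi (.lolli ((coalgTy σ.toTy).subst fun _ => .var 0)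
      (σ.toTy.subst fun _ => (Ty.nu σ.toTy).ofClosed))) := by
  rw [ofClosed_outAux σ hσ]
  refine .tlam (.lam ?_)
  rw [show LCtx.empty.wk = LCtx.empty from rfl, LCtx.cons_empty]
  exact hasType_outBody σ hσ

theorem hasType_outAux (hσ : ¬ σ.Occurs false 0) : HasType [] .empty (outAux σ)
    (.pi (.lolli ((coalgTy σ.toTy).subst fun _ => .var 0)
      (σ.toTy.subst fun _ => (Ty.nu σ.toTy).ofClosed))) := by
  have := hasType_outAux' (Γ := ([] : List (Ty S.toTySig 0))) σ hσ
  rwa [Tm.ofClosed_zero] at this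

theorem outAux_beta (hσ : ¬ σ.Occurs false 0) (hf : HasType Γ .empty f (.lolli α (σ.toTy.subst fun _ => α)))
    (hz : HasType Γ .empty z α) :
    ExtEq Γ .empty (.app (.tapp (outAux σ).ofClosed α) (.tensor (.bang f) z))
      (.app (σ.map α (Ty.nu σ.toTy).ofClosed (unfoldAt σ.toTy α (.bang f))) (.app f z))
      (σ.toTy.subst fun _ => (Ty.nu σ.toTy).ofClosed) := by
  have h1 : ExtEq Γ .empty (.tapp (outAux σ).ofClosed α)
      (.lam ((coalgTy σ.toTy).subst fun _ => α) (outBody σ α))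
      (.lolli ((coalgTy σ.toTy).subst fun _ => α)
        (σ.toTy.subst fun _ => (Ty.nu σ.toTy).ofClosed)) := by
    rw [ofClosed_outAux σ hσ]
    refine .tbeta (σ := .lolli ((coalgTy σ.toTy).subst fun _ => .var 0)
      (σ.toTy.subst fun _ => (Ty.nu σ.toTy).ofClosed)) (.lam ?_) (by simp) ?_
    · rw [LCtx.cons_empty]
      exact hasType_outBody σ hσ
    · simp [σ.map_subst hσ, (hasType_unfoldTm σ.toTy).ofClosed_subst]
  have ht : HasType Γ .empty (.tensor (.bang f) z) ((coalgTy σ.toTy).subst fun _ => α) := by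
    rw [coalgTy_subst]
    exact (HasType.bang hf).tensor' hz
  have h2 : ExtEq Γ .empty (.app (.tapp (outAux σ).ofClosed α) (.tensor (.bang f) z))
      (.letT (.bang (.lolli α (σ.toTy.subst fun _ => α))) α (.tensor (.bang f) z)
        (.letB (.lolli α (σ.toTy.subst fun _ => α)) (.lvar 1)
          (.app (σ.map α (Ty.nu σ.toTy).ofClosed (unfoldAt σ.toTy α (.bang (.ivar 0))))
            (.app (.ivar 0) (.lvar 0))))) (σ.toTy.subst fun _ => (Ty.nu σ.toTy).ofClosed) :=
    .trans (h1.app' (.refl ht)) (.beta (hasType_outBody σ hσ) ht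
      (by simp [σ.map_subst hσ, (hasType_unfoldTm σ.toTy).ofClosed_subst]))
  have h3 := ExtEq.betaT LCtx.split_empty LCtx.split_empty (.bang hf) hz
    (hasType_outBody₁ (Γ := Γ) σ hσ)
  have h4 : HasType (.lolli α (σ.toTy.subst fun _ => α) :: Γ) .empty
      (.app (σ.map α (Ty.nu σ.toTy).ofClosed (unfoldAt σ.toTy α (.bang (.ivar 0))))
        (.app (.ivar 0) (z.wkI 1))) (σ.toTy.subst fun _ => (Ty.nu σ.toTy).ofClosed) :=
    (σ.hasType_map hσ (hasType_unfoldAt σ.toTy (.bang (.ivar rfl)))).app'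
      (HasType.app' (.ivar rfl) (hz.wkI _))
  have h5 := ExtEq.betaB hf h4
  simp [σ.map_subst hσ, (hasType_unfoldTm σ.toTy).ofClosed_subst] at h3 h5
  exact h2.trans (h3.trans h5)

theorem ofClosed_outTm (hσ : ¬ σ.Occurs false 0) :
    ((outTm σ).ofClosed : Tm S n) = .lam (Ty.nu σ.toTy).ofClosed
    (.app (.tapp (.lvar 0) (σ.toTy.subst fun _ => (Ty.nu σ.toTy).ofClosed))
      (outAux σ).ofClosed) := by
  have e : (outTm σ).ofClosed = (outTm σ).ren (Fin.elim0 : Fin 0 → Fin n) id id := rfl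
  rw [e, outTm]
  have key : ∀ ri rl, (outAux σ).ren (Fin.elim0 : Fin 0 → Fin n) ri rl = (outAux σ).ofClosed := by
    intro ri rl
    conv_lhs => rw [← Tm.ofClosed_zero (outAux σ)]
    exact (hasType_outAux σ hσ).ofClosed_ren _ _ _
  simp only [Tm.ren, Ty.inst, Ty.subst_ren, key]
  rw [Ty.subst_one]
  rfl

theorem hasType_outTm_body (hσ : ¬ σ.Occurs false 0) : HasType Γ (.single 0 (Ty.nu σ.toTy).ofClosed)
    (.app (.tapp (.lvar 0) (σ.toTy.subst fun _ => (Ty.nu σ.toTy).ofClosed)) (outAux σ).ofClosed)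
    (σ.toTy.subst fun _ => (Ty.nu σ.toTy).ofClosed) := by
  refine .app (LCtx.split_left _) (σ := .pi (.lolli ((coalgTy σ.toTy).subst fun _ => .var 0)
      (σ.toTy.subst fun _ => (Ty.nu σ.toTy).ofClosed))) ?_ (hasType_outAux' σ hσ)
  rw [Ty.nu, Ty.ofClosed_ex]
  refine .tapp' .lvar ?_
  have e₁ : ∀ τ : Ty S.toTySig n, (upTy (Fin.cases τ .var) 1 : Ty S.toTySig (n + 1)) = τ.wk :=
    fun _ => rfl
  simp [e₁, Ty.ofClosed_ex]

theorem hasType_outTm' (hσ : ¬ σ.Occurs false 0) : HasType Γ .empty (outTm σ).ofClosed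
    (.lolli (Ty.nu σ.toTy).ofClosed (σ.toTy.subst fun _ => (Ty.nu σ.toTy).ofClosed)) := by
  rw [ofClosed_outTm σ hσ]
  refine .lam ?_
  rw [LCtx.cons_empty]
  exact hasType_outTm_body σ hσ

theorem hasType_outTm (hσ : ¬ σ.Occurs false 0) : HasType [] .empty (outTm σ)
    (.lolli (Ty.nu σ.toTy).ofClosed (σ.toTy.subst fun _ => (Ty.nu σ.toTy).ofClosed)) := by
  have := hasType_outTm' (Γ := ([] : List (Ty S.toTySig 0))) σ hσ
  rwa [Tm.ofClosed_zero] at this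

theorem out_pack (hσ : ¬ σ.Occurs false 0) (ha : HasType Γ .empty a ((coalgTy σ.toTy).subst fun _ => α)) :
    ExtEq Γ .empty (.app (outTm σ).ofClosed (.app (.tapp (pack (coalgTy σ.toTy)).ofClosed α) a))
      (.app (.tapp (outAux σ).ofClosed α) a) (σ.toTy.subst fun _ => (Ty.nu σ.toTy).ofClosed) := by
  rw [ofClosed_outTm σ hσ]
  refine .trans (.beta (hasType_outTm_body σ hσ) (hasType_pack_app (coalgTy σ.toTy) ha) rfl) ?_
  have e := (hasType_outAux σ hσ).ofClosed_subst (n := n) (.var : Fin n → Ty S.toTySig n) .ivar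
    (scons (.app (.tapp (pack (coalgTy σ.toTy)).ofClosed α) a) .lvar)
  simp only [Tm.instL, Tm.subst, e, scons_zero, Ty.subst_var]
  exact pack_beta _ ha (by simpa using hasType_outAux' σ hσ)

theorem out_unfold (hσ : ¬ σ.Occurs false 0) (hf : HasType Γ .empty f (.lolli α (σ.toTy.subst fun _ => α)))
    (hz : HasType Γ .empty z α) :
    ExtEq Γ .empty (.app (outTm σ).ofClosed (.app (unfoldAt σ.toTy α (.bang f)) z))
      (.app (σ.map α (Ty.nu σ.toTy).ofClosed (unfoldAt σ.toTy α (.bang f))) (.app f z))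
      (σ.toTy.subst fun _ => (Ty.nu σ.toTy).ofClosed) := by
  have ht : HasType Γ .empty (.tensor (.bang f) z) ((coalgTy σ.toTy).subst fun _ => α) := by
    rw [coalgTy_subst]
    exact (HasType.bang hf).tensor' hz
  exact .trans (.app' (.refl (hasType_outTm' σ hσ)) (unfold_beta _ (.bang hf) hz))
    (.trans (out_pack σ hσ ht) (outAux_beta σ hσ hf hz))

end Coalgebra

section Parametricity
variable {S : Signature.{u, v}} {A : Set Scheme} {n : ℕ} {Γ : List (Ty S.toTySig n)}
  {Θ : List (RelDecl S.toTySig n)} {Φ : List (Fm S n)} {σ τ σ' τ' ω α β : Ty S.toTySig n}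
  {ρ R : Rel S n} {t u a b f g h x z : Tm S n} {k : ℕ}

/-- Weakening by a type variable. -/
theorem Proves.wkT {φ : Fm S n} (h : Proves A Γ Θ Φ φ) :
    Proves A (Γ.map Ty.wk) (Θ.map RelDecl.wk) (Φ.map Fm.wkT) φ.wkT :=
  h.ren Fin.succ id id (fun i σ hi => by simp [hi])
    (fun i d hi => by simp [hi, RelDecl.wk, RelDecl.ren])

theorem IndTy.param (hid : Scheme.identityExtension ∈ A) (G : IndTy S.toTySig k)
    (τ : Fin k → Ty S.toTySig n) (hΦ : WfHyps A Γ Θ Φ)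
    (ht : HasType Γ .empty t (G.toTy.subst τ)) :
    Proves A Γ Θ Φ (.app (G.interp τ τ fun i => eqRel (τ i)) t t) :=
  (G.interp_eqRel hid τ).2.apply (.ofAdm (.admEq _)) hΦ ht ht (.eqRelI (.eqRefl ht hΦ) hΦ ht ht)

theorem Proves.interpPiE (G : IndTy S.toTySig (k + 1)) {τ τ' : Fin k → Ty S.toTySig n}
    {ρ : Fin k → Rel S n} (h : Proves A Γ Θ Φ (.app ((IndTy.pi G).interp τ τ' ρ) t u))
    (hΦ : WfHyps A Γ Θ Φ) (hρ : ∀ i, IsRel A .rel Γ Θ (ρ i) (τ i) (τ' i))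
    (ht : HasType Γ .empty t (.pi (G.toTy.subst (upTy τ))))
    (hu : HasType Γ .empty u (.pi (G.toTy.subst (upTy τ')))) (hR : IsRel A .adm Γ Θ R α β) :
    Proves A Γ Θ Φ (.app (G.interp (Fin.cases α τ) (Fin.cases β τ') (Fin.cases R ρ))
      (.tapp t α) (.tapp u β)) := by
  have hi := G.isRel_interp (A := A) (isRel_extRel hρ isRel_var_wkΘ.isRel)
  rw [← tyFst_upTy, ← tySnd_upTy] at hi
  have h1 := h.polyE hΦ hi ht hu hR
  rw [G.interp_subst] at h1
  refine h1.castRel ?_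
  congr 1
  · funext i; refine Fin.cases rfl (fun i => ?_) i; simp
  · funext i; refine Fin.cases rfl (fun i => ?_) i; simp
  · funext i; refine Fin.cases rfl (fun i => ?_) i; simp [extRel]

/-- Elements of `Πα. c(α) ⊸ β` identify related arguments. -/
theorem Proves.eq_of_interp (hid : Scheme.identityExtension ∈ A) (c : IndTy S.toTySig 1)
    (hΦ : WfHyps A Γ Θ Φ) (hh : HasType Γ .empty h (.pi (.lolli (c.toTy.subst fun _ => .var 0) β.wk)))
    (hR : IsRel A .adm Γ Θ R τ τ')
    (ha : HasType Γ .empty a (c.toTy.subst fun _ => τ))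
    (hb : HasType Γ .empty b (c.toTy.subst fun _ => τ'))
    (hab : Proves A Γ Θ Φ (.app (c.interp (fun _ => τ) (fun _ => τ') (fun _ => R)) a b)) :
    Proves A Γ Θ Φ (.eq β (.app (.tapp h τ) a) (.app (.tapp h τ') b)) := by
  have e : ((IndTy.lolli (c.ren fun _ => 0) (.var 1) : IndTy S.toTySig 2)).toTy.subst
      (upTy fun _ => β) = .lolli (c.toTy.subst fun _ => .var 0) β.wk := by
    simp [Ty.ren_one]
  have h1 := IndTy.param hid (.pi (.lolli (c.ren fun _ => 0) (.var 1))) (fun _ : Fin 1 => β)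
    (Θ := Θ) hΦ (t := h) (by simp only [IndTy.toTy, Ty.subst] at e ⊢; rwa [e])
  have h2 := h1.interpPiE _ hΦ (fun _ => .ofAdm (.admEq β)) (by rwa [e]) (by rwa [e]) hR
  simp only [IndTy.interp, IndTy.interp_ren, IndTy.toTy_ren, Ty.ren_subst, IndTy.toTy,
    Ty.subst] at h2
  have t₁ : HasType Γ .empty (.tapp h τ) (.lolli (c.toTy.subst fun _ => τ) β) :=
    hh.tapp' (by simp)
  have t₂ : HasType Γ .empty (.tapp h τ') (.lolli (c.toTy.subst fun _ => τ') β) :=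
    hh.tapp' (by simp)
  have h3 := Proves.lolliE h2 hΦ (c.isRel_interp fun _ => hR.isRel) (.ofAdm (.admEq β)) t₁ t₂ ha hb hab
  exact h3.eqRelE hΦ (t₁.app' ha) (t₂.app' hb)

/-- Related elements have equal packages. -/
theorem Proves.eq_pack (hid : Scheme.identityExtension ∈ A) (hext : Scheme.extensionality ∈ A)
    (c : IndTy S.toTySig 1) (hΦ : WfHyps A Γ Θ Φ) (hR : IsRel A .adm Γ Θ R τ τ')
    (ha : HasType Γ .empty a (c.toTy.subst fun _ => τ))
    (hb : HasType Γ .empty b (c.toTy.subst fun _ => τ'))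
    (hab : Proves A Γ Θ Φ (.app (c.interp (fun _ => τ) (fun _ => τ') (fun _ => R)) a b)) :
    Proves A Γ Θ Φ (.eq (Ty.ex c.toTy).ofClosed
      (.app (.tapp (pack c.toTy).ofClosed τ) a) (.app (.tapp (pack c.toTy).ofClosed τ') b)) := by
  have p := hasType_pack c.toTy
  have tp := hasType_pack_app c.toTy ha
  have tq := hasType_pack_app c.toTy hb
  have hΦ' := hΦ.wkT
  have ha' := ha.wkT
  have hb' := hb.wkT
  have hR' := hR.wkT
  have hab' := hab.wkT
  have tp' := tp.wkT
  have tq' := tq.wkT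
  simp only [Ty.ofClosed_ex] at tp tq ⊢
  refine .tyext hext hΦ tp tq ?_
  simp only [Tm.wkT, Tm.ren, p.ofClosed_ren] at tp' tq' ⊢
  simp only [Ty.wk, Ty.ofClosed_ren] at tp' tq'
  rw [Ty.ofClosed_ex] at tp' tq'
  have e₁ : (upTy (Fin.cases (.var 0) .var) 1 : Ty S.toTySig (n + 2)) = .var 1 := rfl
  have e₂ : (.pi (.lolli (c.toTy.subst fun _ => .var 0) (.var 1)) : Ty S.toTySig (n + 1)) =
      .pi (.lolli (c.toTy.subst fun _ => .var 0) (Ty.wk (.var 0))) := rfl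
  refine .funext hext hΦ' (tp'.tapp' (by simp [e₁])) (tq'.tapp' (by simp [e₁])) ?_
  have hΦ₂ := hΦ'.wkI [.pi (.lolli (c.toTy.subst fun _ => .var 0) (.var 1))]
  have ha₂ := ha'.wkI (.pi (.lolli (c.toTy.subst fun _ => .var 0) (.var 1)))
  have hb₂ := hb'.wkI (.pi (.lolli (c.toTy.subst fun _ => .var 0) (.var 1)))
  have hR₂ := hR'.wkI [.pi (.lolli (c.toTy.subst fun _ => .var 0) (.var 1))]
  have hab₂ := hab'.wkI [.pi (.lolli (c.toTy.subst fun _ => .var 0) (.var 1))]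
  simp only [Ty.wk, Ty.subst_ren] at ha₂ hb₂
  have hab₃ : Proves A _ _ _ (.app (c.interp (fun _ => τ.wk) (fun _ => τ'.wk)
    (fun _ => R.wkT.wkI 1)) (a.wkT.wkI 1) (b.wkT.wkI 1)) := hab₂.cast (by
      simp [Rel.ren_eq_subst, IndTy.interp_subst, Ty.ren_eq_subst])
  simp only [Tm.wkI, Tm.ren, p.ofClosed_ren, id_eq_fun, Ty.ren_id]
  refine .eqTrans (.ext (pack_beta c.toTy ha₂ (.ivar rfl)) hΦ₂) (.eqTrans ?_
    (.eqSymm (.ext (pack_beta c.toTy hb₂ (.ivar rfl)) hΦ₂)))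
  exact .eq_of_interp hid c hΦ₂ (.ivar rfl) hR₂ ha₂ hb₂ hab₃

end Parametricity

theorem Ty.subst_upTy_inst {K : TySig.{u}} {k n : ℕ} (σ : Ty K (k + 1)) (s : Fin k → Ty K n)
    (τ : Ty K n) : (σ.subst (upTy s)).inst τ = σ.subst (Fin.cases τ s) := by
  simp only [Ty.inst, Ty.subst_subst]
  congr 1; funext i; refine Fin.cases rfl (fun i => ?_) i
  simp

section Functor
variable {S : Signature.{u, v}} {A : Set Scheme} {n : ℕ} {Γ : List (Ty S.toTySig n)}
  {Θ : List (RelDecl S.toTySig n)} {Φ : List (Fm S n)} {σ' τ τ' ω α β : Ty S.toTySig n}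
  {ρ R : Rel S n} {t u a b f g h x y z w : Tm S n} {k : ℕ}

theorem graphRel_ren {m : ℕ} (r : Fin n → Fin m) (ri rr : ℕ → ℕ) :
    (graphRel τ τ' f).ren r ri rr = graphRel (τ.ren r) (τ'.ren r) (f.ren r ri id) := by
  rw [graphRel, pullRel_ren, graphRel]
  simp [idTm_ren, Rel.ren_eq_subst, eqRel_subst, Ty.ren_eq_subst]

/-- `σ[⟨h⟩]` relates `x` and `σ(h) x`. -/
theorem IndTy.interp_graphRel (σ : IndTy S.toTySig 1) (hσ : ¬ σ.Occurs false 0)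
    (hid : Scheme.identityExtension ∈ A) (hΦ : WfHyps A Γ Θ Φ)
    (hh : HasType Γ .empty h (.lolli τ τ')) (hx : HasType Γ .empty x (σ.toTy.subst fun _ => τ)) :
    Proves A Γ Θ Φ (.app (σ.interp (fun _ => τ) (fun _ => τ') fun _ => graphRel τ τ' h)
      x (.app (σ.map τ τ' h) x)) := by
  have m := (σ.hasType_functorTm hσ).ofClosed (Γ := Γ)
  rw [← σ.functorTy.toTy.closed_subst Fin.elim0] at m
  have h1 := σ.functorTy.param hid (Θ := Θ) Fin.elim0 hΦ m
  have rg := isRel_graphRel (A := A) (Θ := Θ) hh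
  have r₁ : ∀ i : Fin 1, IsRel A .rel Γ Θ (Fin.cases (eqRel τ) (fun i => eqRel (Fin.elim0 i)) i)
      (Fin.cases τ Fin.elim0 i) (Fin.cases τ Fin.elim0 i) :=
    fun i => Fin.cases (.ofAdm (.admEq τ)) (fun i => i.elim0) i
  have h2 := h1.interpPiE _ hΦ (fun i => i.elim0) m m (.admEq τ)
  have m' := HasType.tapp' m (Ty.subst_upTy_inst _ _ τ)
  have h3 := h2.interpPiE _ hΦ r₁ m' m' rg
  simp only [interp, interp_ren, toTy_ren, Ty.ren_subst, toTy, Ty.subst] at h3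
  have c₁ : HasType Γ .empty (.tapp (.tapp σ.functorTm.ofClosed τ) τ)
      (.lolli (.bang (.lolli τ τ)) (.lolli (σ.toTy.subst fun _ => τ) (σ.toTy.subst fun _ => τ))) :=
    m'.tapp' (by simp [Ty.subst_upTy_inst])
  have c₂ : HasType Γ .empty (.tapp (.tapp σ.functorTm.ofClosed τ) τ')
      (.lolli (.bang (.lolli τ τ')) (.lolli (σ.toTy.subst fun _ => τ) (σ.toTy.subst fun _ => τ'))) :=
    m'.tapp' (by simp [Ty.subst_upTy_inst])
  have re : IsRel A .rel Γ Θ (eqRel τ) τ τ := .ofAdm (.admEq τ)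
  have i₁ := σ.isRel_interp (A := A) (Γ := Γ) (Θ := Θ) (fun _ : Fin 1 => re)
  have i₂ := σ.isRel_interp (fun _ : Fin 1 => rg.isRel)
  have l := isRel_lolliRel re rg.isRel
  have hid' := hasType_idTm (Γ := Γ) (σ := τ)
  have h4 : Proves A Γ Θ Φ (.app (lolliRel τ τ τ τ' (eqRel τ) (graphRel τ τ' h)) (idTm τ) h) := by
    refine .lolliI ?_ hΦ re rg.isRel hid' hh
    have e := isFm_app_wkI re
    have w := (hΦ.wkI [τ, τ]).cons e
    have k := Proves.head e (hΦ.wkI [τ, τ])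
    have k' : Proves A (τ :: τ :: Γ) Θ _ (.eq τ (.ivar 1) (.ivar 0)) :=
      (k.castRel (by simp [Rel.ren_eq_subst, eqRel_subst])).eqRelE w (.ivar rfl) (.ivar rfl)
    have e₁ : (graphRel τ τ' h).wkI 2 = graphRel τ τ' (h.wkI 2) := by
      rw [Rel.wkI, graphRel_ren]; simp
    have e₂ : (idTm τ : Tm S n).wkI 2 = idTm τ := by simp [idTm_ren]
    rw [e₁, e₂]
    have hh₂ := hh.wkI₂ τ τ
    refine .graphRelI ?_ w hh₂ (hasType_idTm.app' (.ivar rfl)) (hh₂.app' (.ivar rfl))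
    exact .eqApp w hh₂ (hasType_idTm.app' (.ivar rfl)) hh₂ (.ivar rfl) (.eqRefl hh₂ w)
      (.eqTrans (.ext (.idTm_app (.ivar rfl)) w) k')
  have h5 := Proves.lolliE h3 hΦ (isRel_bangRel l) (isRel_lolliRel i₁ i₂) c₁ c₂ (.bang hid')
    (.bang hh) (h4.bangI hΦ l hid' hh)
  have h6 := Proves.lolliE h5 hΦ i₁ i₂ (c₁.app' (.bang hid')) (c₂.app' (.bang hh)) hx hx
    (σ.param hid _ hΦ hx)
  refine h6.eqSubst i₂ (.ext ?_ hΦ) (.eqRefl ((σ.hasType_map hσ hh).app' hx) hΦ)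
  exact .trans (.app' ((σ.map_act hσ hid').trans (σ.act_id true fun _ => τ)) (.refl hx))
    (.idTm_app hx)

/-! ### Extensionality for tensor products and exponentials -/

theorem Proves.eq_of_eq_bang (hid : Scheme.identityExtension ∈ A) (hΦ : WfHyps A Γ Θ Φ)
    (ht : HasType Γ .empty t (.lolli (.bang τ) ω)) (hu : HasType Γ .empty u (.lolli (.bang τ) ω))
    (hw : HasType Γ .empty w (.bang τ))
    (h : Proves A (τ :: Γ) Θ (Φ.map (Fm.wkI 1))
      (.eq ω (.app (t.wkI 1) (.bang (.ivar 0))) (.app (u.wkI 1) (.bang (.ivar 0))))) :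
    Proves A Γ Θ Φ (.eq ω (.app t w) (.app u w)) := by
  have re : IsRel A .rel Γ Θ (eqRel τ) τ τ := .ofAdm (.admEq τ)
  have rω : IsRel A .adm Γ Θ (eqRel ω) ω ω := .admEq ω
  have h1 := (IndTy.bang (.var (0 : Fin 1))).param hid (Θ := Θ) (fun _ => τ) hΦ hw
  refine (Proves.bangE h1 hΦ re rω hw hw ht hu ?_).eqRelE hΦ (ht.app' hw) (hu.app' hw)
  refine .arrowI ?_ hΦ re rω.isRel ht hu
  have e := isFm_app_wkI re
  have w := (hΦ.wkI [τ, τ]).cons e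
  have k := Proves.head e (hΦ.wkI [τ, τ])
  have k' : Proves A (τ :: τ :: Γ) Θ _ (.eq τ (.ivar 1) (.ivar 0)) :=
    (k.castRel (by simp [Rel.ren_eq_subst, eqRel_subst])).eqRelE w (.ivar rfl) (.ivar rfl)
  have ht₂ := ht.wkI₂ τ τ
  have hu₂ := hu.wkI₂ τ τ
  have h2 : Proves A (τ :: τ :: Γ) Θ (.app ((eqRel τ).wkI 2) (.ivar 1) (.ivar 0) ::
      Φ.map (Fm.wkI 2)) (.eq ω (.app (t.wkI 2) (.bang (.ivar 1)))
        (.app (u.wkI 2) (.bang (.ivar 1)))) := by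
    refine .weaken (Φ := Φ.map (Fm.wkI 2)) w (by simp) ?_
    have := h.wkI [τ]
    rw [List.length_singleton, map_wkI_wkI] at this
    simpa using this
  refine Proves.castRel (ρ := eqRel ω) (.eqRelI (h2.eqTrans (.eqApp w hu₂ (.bang (.ivar rfl)) hu₂
    (.bang (.ivar rfl)) (.eqRefl hu₂ w) (.eqBang w (.ivar rfl) (.ivar rfl) k'))) w
      (ht₂.app' (.bang (.ivar rfl))) (hu₂.app' (.bang (.ivar rfl))))
    (by simp [Rel.ren_eq_subst, eqRel_subst])

end Functor

section TensorExt
variable {S : Signature.{u, v}} {A : Set Scheme} {n : ℕ} {Γ : List (Ty S.toTySig n)}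
  {Θ : List (RelDecl S.toTySig n)} {Φ : List (Fm S n)} {τ τ' ω : Ty S.toTySig n}
  {t u a x y : Tm S n}

/-- `λ°x. λ°y. t (x ⊗ y)`. -/
def curryTm (τ τ' : Ty S.toTySig n) (t : Tm S n) : Tm S n :=
  .lam τ (.lam τ' (.app (t.wkL 2) (.tensor (.lvar 1) (.lvar 0))))

theorem split_single_cons : ((LCtx.single 0 τ).cons τ').Split (.single 1 τ) (.single 0 τ') := by
  rintro (_ | _ | j) <;> simp [LCtx.cons, LCtx.single, scons]

theorem hasType_curryTm_body (ht : HasType Γ .empty t (.lolli (.tensor τ τ') ω)) :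
    HasType Γ ((LCtx.single 0 τ).cons τ') (.app (t.wkL 2) (.tensor (.lvar 1) (.lvar 0))) ω :=
  (ht.single_wkL 2).appR (.tensor split_single_cons .lvar .lvar)

theorem hasType_curryTm_body' (ht : HasType Γ .empty t (.lolli (.tensor τ τ') ω)) :
    HasType Γ (.single 0 τ) (.lam τ' (.app (t.wkL 2) (.tensor (.lvar 1) (.lvar 0)))) (.lolli τ' ω) :=
  .lam (hasType_curryTm_body ht)

theorem hasType_curryTm (ht : HasType Γ .empty t (.lolli (.tensor τ τ') ω)) :
    HasType Γ .empty (curryTm τ τ' t) (.lolli τ (.lolli τ' ω)) :=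
  .lam (by rw [LCtx.cons_empty]; exact hasType_curryTm_body' ht)

theorem curryTm_beta (ht : HasType Γ .empty t (.lolli (.tensor τ τ') ω))
    (hx : HasType Γ .empty x τ) (hy : HasType Γ .empty y τ') :
    ExtEq Γ .empty (.app (.app (curryTm τ τ' t) x) y) (.app t (.tensor x y)) ω := by
  have h1 : ExtEq Γ .empty (.app (curryTm τ τ' t) x)
      (.lam τ' (.app (t.wkL 1) (.tensor (x.wkL 1) (.lvar 0)))) (.lolli τ' ω) :=
    .beta (hasType_curryTm_body' ht) hx (by simp [Tm.ren_eq_subst])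
  refine .trans (h1.app' (.refl hy)) (.beta ?_ hy (by simp))
  exact (ht.single_wkL 1).appR (.tensor (LCtx.split_right _) (hx.single_wkL 1) .lvar)

theorem letT_curryTm (ht : HasType Γ .empty t (.lolli (.tensor τ τ') ω))
    (ha : HasType Γ .empty a (.tensor τ τ')) :
    ExtEq Γ .empty (.letT τ τ' a (.app (.app ((curryTm τ τ' t).wkL 2) (.lvar 1)) (.lvar 0)))
      (.app t a) ω := by
  have e : ∀ k, t.subst (fun i => .var i) (fun i => .ivar i) (fun j => .lvar (j + k)) = t :=
    fun k => by simpa [Tm.ren_eq_subst] using ht.wkL_eq k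
  have h1 : ExtEq Γ (.single 1 τ) (.app ((curryTm τ τ' t).wkL 2) (.lvar 1))
      (.lam τ' (.app (t.wkL 1) (.tensor (.lvar 2) (.lvar 0)))) (.lolli τ' ω) := by
    rw [(hasType_curryTm ht).wkL_eq]
    have := ExtEq.betaTerm (LCtx.split_right (.single 1 τ)) (t := .lam τ' (.app (t.wkL 2)
      (.tensor (.lvar 1) (.lvar 0)))) (by rw [LCtx.cons_empty]; exact hasType_curryTm_body' ht) .lvar
    simpa [curryTm, Tm.ren_eq_subst] using this
  have h2 : ExtEq Γ ((LCtx.single 0 τ).cons τ')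
      (.app (.app ((curryTm τ τ' t).wkL 2) (.lvar 1)) (.lvar 0))
      (.app t (.tensor (.lvar 1) (.lvar 0))) ω := by
    refine .trans (.congApp split_single_cons h1 (.refl .lvar)) ?_
    have := ExtEq.betaTerm (Γ := Γ)
      (split_single_cons (τ := τ) (τ' := τ')) (τ := ω) (t := .app (t.wkL 1)
      (.tensor (.lvar 2) (.lvar 0))) (u := .lvar 0) ?_ .lvar
    · simpa [e] using this
    · refine (ht.single_wkL 1).appR (.tensor (Δ₁ := .single 2 τ) (Δ₂ := .single 0 τ') ?_ .lvar .lvar)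
      rintro (_ | _ | _ | j) <;> simp [LCtx.cons, LCtx.single, scons]
  rw [← LCtx.cons_empty] at h2
  refine .trans (.congLetT LCtx.split_empty (.refl ha) h2) ?_
  have h3 := ExtEq.commT (Γ := Γ) (τ := ω) (f := .app (t.wkL 1) (.lvar 0)) LCtx.split_empty ha
    (by rw [LCtx.cons_empty]; exact (ht.single_wkL 1).appR .lvar)
  simpa [e] using h3

/-- Terms which agree on tensors `x ⊗ y` are equal on all elements of the tensor product. -/
theorem Proves.eq_of_eq_tensor (hext : Scheme.extensionality ∈ A) (hΦ : WfHyps A Γ Θ Φ)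
    (ht : HasType Γ .empty t (.lolli (.tensor τ τ') ω))
    (hu : HasType Γ .empty u (.lolli (.tensor τ τ') ω)) (ha : HasType Γ .empty a (.tensor τ τ'))
    (h : Proves A (τ' :: τ :: Γ) Θ (Φ.map (Fm.wkI 2))
      (.eq ω (.app (t.wkI 2) (.tensor (.ivar 1) (.ivar 0)))
        (.app (u.wkI 2) (.tensor (.ivar 1) (.ivar 0))))) :
    Proves A Γ Θ Φ (.eq ω (.app t a) (.app u a)) := by
  have ct := hasType_curryTm ht
  have cu := hasType_curryTm hu
  have h1 : Proves A Γ Θ Φ (.eq (.lolli τ (.lolli τ' ω)) (curryTm τ τ' t) (curryTm τ τ' u)) := by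
    refine .funext hext hΦ ct cu (.funext hext (hΦ.wkI [τ]) ((ct.wkI τ).app' (.ivar rfl))
      ((cu.wkI τ).app' (.ivar rfl)) ?_)
    have w := hΦ.wkI [τ', τ]
    have e : ∀ t : Tm S n, Tm.wkI 1 (Tm.app (Tm.wkI 1 (curryTm τ τ' t)) (.ivar 0)) =
        .app (curryTm τ τ' (t.wkI 2)) (.ivar 1) := fun t => by simp [curryTm]
    rw [e, e, map_wkI_wkI]
    exact .eqTrans (.ext (curryTm_beta (ht.wkI₂ _ _) (.ivar rfl) (.ivar rfl)) w)
      (h.eqTrans (.eqSymm (.ext (curryTm_beta (hu.wkI₂ _ _) (.ivar rfl) (.ivar rfl)) w)))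
  have h2 : Proves A Γ Θ Φ (.eq ω
      (.letT τ τ' a (.app (.app ((curryTm τ τ' t).wkL 2) (.lvar 1)) (.lvar 0)))
      (.letT τ τ' a (.app (.app ((curryTm τ τ' u).wkL 2) (.lvar 1)) (.lvar 0)))) := by
    refine .eqCongr (F := .letT τ τ' (a.wkI 2) (.app (.app (.ivar 0) (.lvar 1)) (.lvar 0)))
      (.letT LCtx.split_empty (ha.wkI₂ _ _) ?_) (.letT LCtx.split_empty ha ?_) (by simp)
      (by simp) hΦ ct ct cu cu h1 h1
    · rw [LCtx.cons_empty]
      exact .app split_single_cons (HasType.appR (.ivar rfl) .lvar) .lvar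
    · rw [LCtx.cons_empty]
      exact .app split_single_cons ((ct.single_wkL 2).appR .lvar) .lvar
  exact .eqTrans (.eqSymm (.ext (letT_curryTm ht ha) hΦ)) (h2.eqTrans (.ext (letT_curryTm hu ha) hΦ))

end TensorExt

section Packages
variable {S : Signature.{u, v}} {A : Set Scheme} {n : ℕ} {Γ : List (Ty S.toTySig n)}
  {Θ : List (RelDecl S.toTySig n)} {Φ : List (Fm S n)} {α β : Ty S.toTySig n}
  {g : Tm S 0} {h x : Tm S n}

/-- `λ°z. g z β h`. -/
def evalTm (ε β : Ty S.toTySig n) (g h : Tm S n) : Tm S n :=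
  .lam ε (.app (.tapp (.app (g.wkL 1) (.lvar 0)) β) (h.wkL 1))

theorem tapp_ex (c : Ty S.toTySig 1) (hx : HasType Γ .empty x (Ty.ex c).ofClosed) :
    HasType Γ .empty (.tapp x β) (.lolli (.pi (.lolli (c.subst fun _ => .var 0) β.wk)) β) := by
  rw [Ty.ofClosed_ex] at hx
  have e₁ : (upTy (Fin.cases β .var) 1 : Ty S.toTySig (n + 1)) = β.wk := rfl
  exact hx.tapp' (by simp [e₁])

section
variable (c : Ty S.toTySig 1) {g : Tm S n}

theorem hasType_evalTm_body
    (hg : HasType Γ .empty g (.lolli (Ty.ex c).ofClosed (Ty.ex c).ofClosed))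
    (hh : HasType Γ .empty h (.pi (.lolli (c.subst fun _ => .var 0) β.wk))) :
    HasType Γ (.single 0 (Ty.ex c).ofClosed)
    (.app (.tapp (.app (g.wkL 1) (.lvar 0)) β) (h.wkL 1)) β := by
  have h1 := (hg.single_wkL 1).appR (.lvar (j := 0))
  rw [Ty.ofClosed_ex] at h1 ⊢
  have e₁ : (upTy (Fin.cases β .var) 1 : Ty S.toTySig (n + 1)) = β.wk := rfl
  exact .app (LCtx.split_left _) (h1.tapp' (by simp [e₁]) :
    HasType _ _ _ (.lolli (.pi (.lolli (c.subst fun _ => .var 0) β.wk)) β)) (hh.single_wkL 1)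

theorem hasType_evalTm
    (hg : HasType Γ .empty g (.lolli (Ty.ex c).ofClosed (Ty.ex c).ofClosed))
    (hh : HasType Γ .empty h (.pi (.lolli (c.subst fun _ => .var 0) β.wk))) :
    HasType Γ .empty (evalTm (Ty.ex c).ofClosed β g h)
    (.lolli (Ty.ex c).ofClosed β) :=
  .lam (by rw [LCtx.cons_empty]; exact hasType_evalTm_body c hg hh)

theorem evalTm_beta
    (hg : HasType Γ .empty g (.lolli (Ty.ex c).ofClosed (Ty.ex c).ofClosed))
    (hh : HasType Γ .empty h (.pi (.lolli (c.subst fun _ => .var 0) β.wk)))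
    (hx : HasType Γ .empty x (Ty.ex c).ofClosed) :
    ExtEq Γ .empty (.app (evalTm (Ty.ex c).ofClosed β g h) x) (.app (.tapp (.app g x) β) h) β :=
  .beta (hasType_evalTm_body c hg hh) hx (by simp)

end

theorem evalTm_ren {ε : Ty S.toTySig n} {g : Tm S n} {m : ℕ} (r : Fin n → Fin m) (ri : ℕ → ℕ) :
    (evalTm ε β g h).ren r ri id =
      evalTm (ε.ren r) (β.ren r) (g.ren r ri id) (h.ren r ri id) := by
  simp [evalTm]

theorem Proves.interp_lolli_pack (hid : Scheme.identityExtension ∈ A) (c : IndTy S.toTySig 1)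
    (hg₀ : HasType [] .empty g (.lolli (Ty.ex c.toTy).ofClosed (Ty.ex c.toTy).ofClosed))
    (hg : ∀ {m : ℕ} {Γ : List (Ty S.toTySig m)}, HasType Γ .empty g.ofClosed
      (.lolli (Ty.ex c.toTy).ofClosed (Ty.ex c.toTy).ofClosed))
    (hp : ∀ {m : ℕ} {Γ : List (Ty S.toTySig m)} {Θ : List (RelDecl S.toTySig m)}
      {Φ : List (Fm S m)} {α : Ty S.toTySig m} {a : Tm S m}, WfHyps A Γ Θ Φ →
      HasType Γ .empty a (c.toTy.subst fun _ => α) →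
      Proves A Γ Θ Φ (.eq (Ty.ex c.toTy).ofClosed
        (.app g.ofClosed (.app (.tapp (pack c.toTy).ofClosed α) a))
        (.app (.tapp (pack c.toTy).ofClosed α) a)))
    (hΦ : WfHyps A Γ Θ Φ)
    (hh : HasType Γ .empty h (.pi (.lolli (c.toTy.subst fun _ => .var 0) β.wk))) :
    Proves A (wkΓ Γ) (wkΘ Θ) (Φ.map Fm.wkTTR)
      (.app (lolliRel (c.toTy.subst fun _ => .var 1) (c.toTy.subst fun _ => .var 0)
          (Ty.ex c.toTy).ofClosed.wk2 β.wk2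
          (c.interp (fun _ => .var 1) (fun _ => .var 0) fun _ => .var 0)
          (graphRel (Ty.ex c.toTy).ofClosed β
            (evalTm (Ty.ex c.toTy).ofClosed β g.ofClosed h)).wkTTR)
        (.tapp (pack c.toTy).ofClosed.wkT.wkT (.var 1)) (.tapp h.wkT.wkT (.var 0))) := by
  have p := hasType_pack c.toTy
  have eE : (Ty.ex c.toTy).ofClosed.wk2 = ((Ty.ex c.toTy).ofClosed : Ty S.toTySig (n + 2)) := by
    simp [Ty.wk2, Ty.ofClosed_ren]
  have hh₂ := hh.wkTT
  have eh : (Ty.pi (.lolli (c.toTy.subst fun _ => .var 0) β.wk)).wk2 =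
      (.pi (.lolli (c.toTy.subst fun _ => .var 0) β.wk2.wk) : Ty S.toTySig (n + 2)) := by
    simp [Ty.wk2]
  rw [eh] at hh₂
  have eR : ∀ h : Tm S n, (graphRel (Ty.ex c.toTy).ofClosed β
      (evalTm (Ty.ex c.toTy).ofClosed β g.ofClosed h)).wkTTR =
      graphRel (Ty.ex c.toTy).ofClosed β.wk2
        (evalTm (Ty.ex c.toTy).ofClosed β.wk2 g.ofClosed h.wkT.wkT) := fun h => by
    rw [Rel.wkTTR, graphRel_ren, evalTm_ren, hg₀.ofClosed_ren, Ty.ofClosed_ren]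
    simp [Ty.wk2]
  have eR₂ : ∀ h : Tm S (n + 2), (graphRel (Ty.ex c.toTy).ofClosed β.wk2
      (evalTm (Ty.ex c.toTy).ofClosed β.wk2 g.ofClosed h)).wkI 2 =
      graphRel (Ty.ex c.toTy).ofClosed β.wk2
        (evalTm (Ty.ex c.toTy).ofClosed β.wk2 g.ofClosed (h.wkI 2)) := fun h => by
    rw [Rel.wkI, graphRel_ren, evalTm_ren, hg₀.ofClosed_ren, Ty.ofClosed_ren]
    simp
  have t₁ := (hasType_pack' (Γ := wkΓ Γ) c.toTy).tapp' (τ := .var 1)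
    (ω := .lolli (c.toTy.subst fun _ => .var 1) (Ty.ex c.toTy).ofClosed) (by simp)
  have t₂ : HasType (wkΓ Γ) .empty (.tapp h.wkT.wkT (.var 0))
      (.lolli (c.toTy.subst fun _ => .var 0) β.wk2) :=
    hh₂.tapp' (by simp [Ty.wk2, Ty.ren_eq_subst])
  have r0 : IsRel A .adm (wkΓ Γ) (wkΘ Θ) (.var 0) (.var 1) (.var 0) := isRel_var_wkΘ
  have rc := c.isRel_interp (fun _ => r0.isRel)
  rw [eR, eE]
  generalize h.wkT.wkT = h' at hh₂ t₂ ⊢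
  simp only [Tm.wkT, p.ofClosed_ren]
  refine .lolliI ?_ hΦ.wkTTR rc (isRel_graphRel (hasType_evalTm _ hg hh₂)).isRel t₁ t₂
  have e := isFm_app_wkI rc
  have w := (hΦ.wkTTR.wkI [c.toTy.subst fun _ => .var 0, c.toTy.subst fun _ => .var 1]).cons e
  have k := Proves.head e
    (hΦ.wkTTR.wkI [c.toTy.subst fun _ => .var 0, c.toTy.subst fun _ => .var 1])
  have k' := k.castRel (ρ' := c.interp (fun _ => .var 1) (fun _ => .var 0) fun _ => .var 0) (by
    simp [Rel.ren_eq_subst, IndTy.interp_subst])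
  have h₄ := hh₂.wkI₂ (c.toTy.subst fun _ => .var 1) (c.toTy.subst fun _ => .var 0)
  have t₃ : HasType ((c.toTy.subst fun _ => .var 0) :: (c.toTy.subst fun _ => .var 1) :: wkΓ Γ)
    .empty (.tapp (h'.wkI 2) (.var 0)) (.lolli (c.toTy.subst fun _ => .var 0) β.wk2) :=
    h₄.tapp' (by simp [Ty.wk2, Ty.ren_eq_subst])
  have tp := hasType_pack_app (Γ := (c.toTy.subst fun _ => .var 0) ::
    (c.toTy.subst fun _ => .var 1) :: wkΓ Γ) (a := .ivar 1) (α := .var 1) c.toTy (.ivar rfl)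
  have tgp := hg.app' tp
  have tx := tapp_ex (β := β.wk2) c.toTy tp
  have tgx := tapp_ex (β := β.wk2) c.toTy tgp
  rw [eR₂]
  simp only [Tm.wkI, Tm.ren, p.ofClosed_ren] at h₄ t₃ ⊢
  refine .graphRelI ?_ w (hasType_evalTm _ hg h₄) tp (t₃.app' (.ivar rfl))
  refine .eqTrans (.ext (evalTm_beta c.toTy hg h₄ tp) w) (.eqTrans (.eqApp w tgx h₄ tx h₄
    ?_ (.eqRefl h₄ w)) (.eqTrans (.ext (pack_beta c.toTy (.ivar rfl) h₄) w)
    (.eq_of_interp hid c w h₄ (r0.wkI [_, _]) (.ivar rfl) (.ivar rfl) k')))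
  have := hp w (a := .ivar 1) (α := .var 1) (.ivar rfl)
  rw [Ty.ofClosed_ex] at this tp tgp
  have e₁ : (upTy (Fin.cases β.wk2 .var) 1 : Ty S.toTySig (n + 2 + 1)) = β.wk2.wk := rfl
  exact .eqTapp w tgp tp (by simp [e₁]) this

theorem Proves.eq_eval_pack (hid : Scheme.identityExtension ∈ A) (c : IndTy S.toTySig 1)
    (hg : HasType [] .empty g (.lolli (Ty.ex c.toTy).ofClosed (Ty.ex c.toTy).ofClosed))
    (hp : ∀ {m : ℕ} {Γ : List (Ty S.toTySig m)} {Θ : List (RelDecl S.toTySig m)}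
      {Φ : List (Fm S m)} {α : Ty S.toTySig m} {a : Tm S m}, WfHyps A Γ Θ Φ →
      HasType Γ .empty a (c.toTy.subst fun _ => α) →
      Proves A Γ Θ Φ (.eq (Ty.ex c.toTy).ofClosed
        (.app g.ofClosed (.app (.tapp (pack c.toTy).ofClosed α) a))
        (.app (.tapp (pack c.toTy).ofClosed α) a)))
    (hΦ : WfHyps A Γ Θ Φ) (hx : HasType Γ .empty x (Ty.ex c.toTy).ofClosed)
    (hh : HasType Γ .empty h (.pi (.lolli (c.toTy.subst fun _ => .var 0) β.wk))) :
    Proves A Γ Θ Φ (.eq β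
      (.app (.tapp (.app g.ofClosed (.app (.tapp x (Ty.ex c.toTy).ofClosed)
        (pack c.toTy).ofClosed)) β) h) (.app (.tapp x β) h)) := by
  have hg' : ∀ {m : ℕ} {Γ : List (Ty S.toTySig m)}, HasType Γ .empty g.ofClosed
      (.lolli (Ty.ex c.toTy).ofClosed (Ty.ex c.toTy).ofClosed) := fun {m Γ} => by
    have := hg.ofClosed (Γ := Γ)
    change HasType _ _ _ (Ty.ren (.lolli _ _) _) at this
    rwa [Ty.ren, Ty.ofClosed_ren] at this
  have p := hasType_pack' (Γ := Γ) c.toTy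
  have p0 := hasType_pack c.toTy
  have he := hasType_evalTm c.toTy hg' hh
  have rR := isRel_graphRel (A := A) (Θ := Θ) he
  set m := evalTm (Ty.ex c.toTy).ofClosed β g.ofClosed h with hm
  have hx₁ := tapp_ex (β := (Ty.ex c.toTy).ofClosed) c.toTy hx
  have hx₂ := tapp_ex (β := β) c.toTy hx
  set F : IndTy S.toTySig 1 := .pi (.lolli (c.ren fun _ => 0) (.var 1)) with hF
  have ex : (IndTy.pi (.lolli F (.var 0))).toTy.subst (Fin.elim0 : Fin 0 → Ty S.toTySig n) =
      (Ty.ex c.toTy).ofClosed := by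
    rw [Ty.ofClosed_ex]
    have e₁ : (upTy (upTy Fin.elim0) 1 : Ty S.toTySig (n + 2)) = .var 1 := rfl
    simp [e₁, hF]
  have eF : ∀ s : Fin 1 → Ty S.toTySig n, F.toTy.subst s =
      .pi (.lolli (c.toTy.subst fun _ => .var 0) (s 0).wk) := fun s => by
    have e₁ : upTy s 1 = (s 0).wk := rfl
    simp [hF, e₁]
  have h1 := (IndTy.pi (.lolli F (.var 0))).param hid (Θ := Θ) Fin.elim0 hΦ (t := x) (by rwa [ex])
  rw [← ex] at hx
  have h2 := h1.interpPiE _ hΦ (fun i => i.elim0) hx hx rR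
  rw [ex] at hx
  have hr : ∀ i : Fin 1, IsRel A .rel Γ Θ
      ((Fin.cases (graphRel (Ty.ex c.toTy).ofClosed β m) (fun i => eqRel (Fin.elim0 i)) :
        Fin 1 → Rel S n) i)
      ((Fin.cases (Ty.ex c.toTy).ofClosed Fin.elim0 : Fin 1 → Ty S.toTySig n) i)
      ((Fin.cases β Fin.elim0 : Fin 1 → Ty S.toTySig n) i) :=
    Fin.cases rR.isRel (fun i => i.elim0)
  have h3 := Proves.lolliE h2 hΦ (F.isRel_interp hr) rR.isRel
    (by rw [eF]; exact hx₁) (by rw [eF]; exact hx₂) (x := (pack c.toTy).ofClosed) (y := h)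
    (by rw [eF]; simpa [Ty.wk, Ty.ofClosed_ren] using p) (by rw [eF]; exact hh) ?_
  · exact .eqTrans (.eqSymm (.ext (evalTm_beta c.toTy hg' hh (hx₁.app' (by
      simpa [Ty.wk, Ty.ofClosed_ren] using p))) hΦ)) (h3.graphRelE hΦ he (hx₁.app' (by
      simpa [Ty.wk, Ty.ofClosed_ren] using p)) (hx₂.app' hh))
  · have hi := (IndTy.lolli (c.ren fun _ => 0) (.var 1)).isRel_interp (A := A)
      (isRel_extRel hr isRel_var_wkΘ.isRel)
    rw [← tyFst_upTy, ← tySnd_upTy] at hi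
    refine Proves.polyI ?_ hΦ hi ?_ ?_
    · simp only [IndTy.interp, IndTy.interp_ren, IndTy.toTy_ren, Ty.ren_subst, IndTy.toTy, Ty.subst]
      exact Proves.interp_lolli_pack hid c hg hg' hp hΦ hh
    · have := eF (Fin.cases (Ty.ex c.toTy).ofClosed Fin.elim0)
      simp only [hF, IndTy.toTy, Ty.subst] at this ⊢
      simp only [this]
      simpa [Ty.wk, Ty.ofClosed_ren] using p
    · have := eF (Fin.cases β Fin.elim0)
      simp only [hF, IndTy.toTy, Ty.subst] at this ⊢
      simp only [this]
      exact hh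

end Packages

section Uniqueness
variable {S : Signature.{u, v}} {A : Set Scheme} {n : ℕ} {Γ : List (Ty S.toTySig n)}
  {Θ : List (RelDecl S.toTySig n)} {Φ : List (Fm S n)} {α β τ ω : Ty S.toTySig n}
  {g : Tm S 0} {a f h x y z t u w : Tm S n}

theorem HasType.ofClosed_endo {ε : Ty S.toTySig 0}
    (hg : HasType [] .empty g (.lolli ε.ofClosed ε.ofClosed)) :
    HasType Γ .empty g.ofClosed (.lolli ε.ofClosed ε.ofClosed) := by
  have := hg.ofClosed (Γ := Γ)
  change HasType _ _ _ (Ty.ren (.lolli _ _) _) at this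
  rwa [Ty.ren, Ty.ofClosed_ren] at this

theorem Proves.eq_app_pack (hid : Scheme.identityExtension ∈ A)
    (hext : Scheme.extensionality ∈ A) (c : IndTy S.toTySig 1)
    (hg : HasType [] .empty g (.lolli (Ty.ex c.toTy).ofClosed (Ty.ex c.toTy).ofClosed))
    (hp : ∀ {m : ℕ} {Γ : List (Ty S.toTySig m)} {Θ : List (RelDecl S.toTySig m)}
      {Φ : List (Fm S m)} {α : Ty S.toTySig m} {a : Tm S m}, WfHyps A Γ Θ Φ →
      HasType Γ .empty a (c.toTy.subst fun _ => α) →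
      Proves A Γ Θ Φ (.eq (Ty.ex c.toTy).ofClosed
        (.app g.ofClosed (.app (.tapp (pack c.toTy).ofClosed α) a))
        (.app (.tapp (pack c.toTy).ofClosed α) a)))
    (hΦ : WfHyps A Γ Θ Φ) (hx : HasType Γ .empty x (Ty.ex c.toTy).ofClosed) :
    Proves A Γ Θ Φ (.eq (Ty.ex c.toTy).ofClosed (.app g.ofClosed
      (.app (.tapp x (Ty.ex c.toTy).ofClosed) (pack c.toTy).ofClosed)) x) := by
  have p := hasType_pack c.toTy
  have p' : ∀ {m : ℕ} {Γ : List (Ty S.toTySig m)}, HasType Γ .empty (pack c.toTy).ofClosed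
      (.pi (.lolli (c.toTy.subst fun _ => .var 0) (Ty.wk (Ty.ex c.toTy).ofClosed))) := by
    intro m Γ
    simpa [Ty.wk, Ty.ofClosed_ren] using hasType_pack' (Γ := Γ) c.toTy
  have hgx := (hg.ofClosed_endo (Γ := Γ)).app' ((tapp_ex c.toTy hx).app' p')
  have hx₁ := hx.wkT
  rw [Ty.wk, Ty.ofClosed_ren] at hx₁
  have hx₂ := hx₁.wkI (.pi (.lolli (c.toTy.subst fun _ => .var 0) (Ty.wk (.var 0))))
  have key := Proves.eq_eval_pack hid c hg hp (β := .var 0) (h := .ivar 0)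
    (hΦ.wkT.wkI [.pi (.lolli (c.toTy.subst fun _ => .var 0) (Ty.wk (.var 0)))]) hx₂ (.ivar rfl)
  have ty₁ := tapp_ex (β := .var 0) c.toTy hx₁
  have ty₂ := tapp_ex (β := .var 0) c.toTy
    ((hg.ofClosed_endo (Γ := Γ.map Ty.wk)).app' ((tapp_ex c.toTy hx₁).app' p'))
  have e : Tm.wkT (.app g.ofClosed
      (.app (.tapp x (Ty.ex c.toTy).ofClosed) (pack c.toTy).ofClosed)) =
      .app g.ofClosed (.app (.tapp x.wkT (Ty.ex c.toTy).ofClosed) (pack c.toTy).ofClosed) := by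
    simp only [Tm.wkT, Tm.ren, hg.ofClosed_ren, p.ofClosed_ren, Ty.ofClosed_ren]
  have e₂ : Tm.wkI 1 (.tapp (.app g.ofClosed
      (.app (.tapp x.wkT (Ty.ex c.toTy).ofClosed) (pack c.toTy).ofClosed)) (.var 0)) =
      .tapp (.app g.ofClosed (.app (.tapp (x.wkT.wkI 1) (Ty.ex c.toTy).ofClosed)
        (pack c.toTy).ofClosed)) (.var 0) := by
    simp only [Tm.wkI, Tm.ren, hg.ofClosed_ren, p.ofClosed_ren, Ty.ofClosed_ren]
    rfl
  have main : Proves A (Γ.map Ty.wk) (Θ.map RelDecl.wk) (Φ.map Fm.wkT)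
      (.eq (.lolli (.pi (.lolli (c.toTy.subst fun _ => .var 0) (Ty.wk (.var 0)))) (.var 0))
        (.tapp (Tm.wkT (.app g.ofClosed
          (.app (.tapp x (Ty.ex c.toTy).ofClosed) (pack c.toTy).ofClosed))) (.var 0))
        (.tapp x.wkT (.var 0))) := by
    rw [e]
    refine .funext hext hΦ.wkT ty₂ ty₁ ?_
    rw [e₂]
    exact key
  rw [Ty.ofClosed_ex] at hgx hx ⊢
  rw [Ty.ofClosed_ex] at main
  exact .tyext hext hΦ hgx hx main

/-- A closed endomorphism of `∐α.c` which fixes all packages is the identity. -/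
theorem Proves.eq_app_of_pack (hid : Scheme.identityExtension ∈ A)
    (hext : Scheme.extensionality ∈ A) (c : IndTy S.toTySig 1)
    (hg : HasType [] .empty g (.lolli (Ty.ex c.toTy).ofClosed (Ty.ex c.toTy).ofClosed))
    (hp : ∀ {m : ℕ} {Γ : List (Ty S.toTySig m)} {Θ : List (RelDecl S.toTySig m)}
      {Φ : List (Fm S m)} {α : Ty S.toTySig m} {a : Tm S m}, WfHyps A Γ Θ Φ →
      HasType Γ .empty a (c.toTy.subst fun _ => α) →
      Proves A Γ Θ Φ (.eq (Ty.ex c.toTy).ofClosed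
        (.app g.ofClosed (.app (.tapp (pack c.toTy).ofClosed α) a))
        (.app (.tapp (pack c.toTy).ofClosed α) a)))
    (hΦ : WfHyps A Γ Θ Φ) (hx : HasType Γ .empty x (Ty.ex c.toTy).ofClosed) :
    Proves A Γ Θ Φ (.eq (Ty.ex c.toTy).ofClosed (.app g.ofClosed x) x) := by
  have p' : HasType Γ .empty (pack c.toTy).ofClosed
      (.pi (.lolli (c.toTy.subst fun _ => .var 0) (Ty.wk (Ty.ex c.toTy).ofClosed))) := by
    simpa [Ty.wk, Ty.ofClosed_ren] using hasType_pack' (Γ := Γ) c.toTy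
  have hx' := (tapp_ex c.toTy hx).app' p'
  have ei : ∀ m : ℕ, ((idTm (Ty.ex c.toTy).ofClosed : Tm S 0).ofClosed : Tm S m) =
      idTm (Ty.ex c.toTy).ofClosed := fun m => by
    change Tm.ren _ _ _ _ = _
    rw [idTm_ren, Ty.ofClosed_ren]
  have h1 := Proves.eq_app_pack hid hext c (g := idTm (Ty.ex c.toTy).ofClosed) hasType_idTm
    (fun w ha => by
      rw [ei]
      exact .ext (.idTm_app (hasType_pack_app c.toTy ha)) w) hΦ hx
  rw [ei] at h1
  have h2 := Proves.eqTrans (.eqSymm h1) (.ext (.idTm_app hx') hΦ)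
  have g' := hg.ofClosed_endo (Γ := Γ)
  exact .eqTrans (.eqApp hΦ g' hx g' hx' (.eqRefl g' hΦ) h2) (.eq_app_pack hid hext c hg hp hΦ hx)

/-- `λ°x. t (x ⊗ y)`. -/
def appTensor (τ : Ty S.toTySig n) (t y : Tm S n) : Tm S n :=
  .lam τ (.app (t.wkL 1) (.tensor (.lvar 0) (y.wkL 1)))

theorem hasType_appTensor_body (ht : HasType Γ .empty t (.lolli (.tensor τ α) ω))
    (hy : HasType Γ .empty y α) :
    HasType Γ (.single 0 τ) (.app (t.wkL 1) (.tensor (.lvar 0) (y.wkL 1))) ω :=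
  (ht.single_wkL 1).appR (.tensor (LCtx.split_left _) .lvar (hy.single_wkL 1))

theorem hasType_appTensor (ht : HasType Γ .empty t (.lolli (.tensor τ α) ω))
    (hy : HasType Γ .empty y α) : HasType Γ .empty (appTensor τ t y) (.lolli τ ω) :=
  .lam (by rw [LCtx.cons_empty]; exact hasType_appTensor_body ht hy)

theorem appTensor_beta (ht : HasType Γ .empty t (.lolli (.tensor τ α) ω))
    (hy : HasType Γ .empty y α) (hx : HasType Γ .empty x τ) :
    ExtEq Γ .empty (.app (appTensor τ t y) x) (.app t (.tensor x y)) ω :=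
  .beta (hasType_appTensor_body ht hy) hx (by simp)

/-- Terms which agree on all `!f ⊗ z` are equal on all elements of `!τ ⊗ α`. -/
theorem Proves.eq_of_eq_bang_tensor (hid : Scheme.identityExtension ∈ A)
    (hext : Scheme.extensionality ∈ A) (hΦ : WfHyps A Γ Θ Φ)
    (ht : HasType Γ .empty t (.lolli (.tensor (.bang τ) α) ω))
    (hu : HasType Γ .empty u (.lolli (.tensor (.bang τ) α) ω))
    (ha : HasType Γ .empty a (.tensor (.bang τ) α))
    (h : Proves A (τ :: α :: .bang τ :: Γ) Θ (Φ.map (Fm.wkI 3))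
      (.eq ω (.app (t.wkI 3) (.tensor (.bang (.ivar 0)) (.ivar 1)))
        (.app (u.wkI 3) (.tensor (.bang (.ivar 0)) (.ivar 1))))) :
    Proves A Γ Θ Φ (.eq ω (.app t a) (.app u a)) := by
  have w := hΦ.wkI [α, .bang τ]
  have w' := w.wkI [τ]
  have ht₂ := ht.wkI₂ (.bang τ) α
  have hu₂ := hu.wkI₂ (.bang τ) α
  have ht₃ := ht₂.wkI τ
  have hu₃ := hu₂.wkI τ
  have e : ∀ t : Tm S n, (appTensor (.bang τ) (t.wkI 2) (.ivar 0)).wkI 1 =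
      appTensor (.bang τ) ((t.wkI 2).wkI 1) (.ivar 1) := fun t => by simp [appTensor]
  have e₃ : ∀ t : Tm S n, (t.wkI 2).wkI 1 = t.wkI 3 := fun t => by simp
  have eΦ : (Φ.map (Fm.wkI 2)).map (Fm.wkI 1) = Φ.map (Fm.wkI 3) := by
    simp [Function.comp_def, show (Fm.wkI 3 : Fm S n → Fm S n) =
      fun φ => φ.ren (fun i => i) (· + 3) (fun i => i) from rfl]
  refine .eq_of_eq_tensor hext hΦ ht hu ha ?_
  have h1 := Proves.eq_of_eq_bang hid w (hasType_appTensor ht₂ (y := .ivar 0) (.ivar rfl))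
    (hasType_appTensor hu₂ (y := .ivar 0) (.ivar rfl)) (w := .ivar 1) (.ivar rfl) (by
      rw [e, e]
      refine .eqTrans (.ext (appTensor_beta ht₃ (.ivar rfl) (.bang (.ivar rfl))) w') (.eqTrans ?_
        (.eqSymm (.ext (appTensor_beta hu₃ (.ivar rfl) (.bang (.ivar rfl))) w')))
      simp only [List.length_cons, List.length_nil, Nat.zero_add, Nat.reduceAdd, eΦ, e₃]
      exact h)
  exact .eqTrans (.eqSymm (.ext (appTensor_beta ht₂ (.ivar rfl) (.ivar rfl)) w)) (.eqTrans h1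
    (.ext (appTensor_beta hu₂ (.ivar rfl) (.ivar rfl)) w))

/-! ### The final coalgebra is generated by `out` -/

section Coalgebra
variable (σ : IndTy S.toTySig 1)

/-- `unfold ν !out`. -/
abbrev unfoldOut : Tm S n :=
  unfoldAt σ.toTy (Ty.nu σ.toTy).ofClosed (.bang (outTm σ).ofClosed)

theorem hasType_unfoldOut (hσ : ¬ σ.Occurs false 0) : HasType Γ .empty (unfoldOut σ)
    (.lolli (Ty.nu σ.toTy).ofClosed (Ty.nu σ.toTy).ofClosed) :=
  hasType_unfoldAt _ (.bang (hasType_outTm' σ hσ))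

theorem unfoldOut_ren (hσ : ¬ σ.Occurs false 0) {m : ℕ} (r : Fin n → Fin m) (ri rl : ℕ → ℕ) :
    (unfoldOut σ).ren r ri rl = unfoldOut σ := by
  simp only [unfoldOut, unfoldAt, Tm.ren, (hasType_unfoldTm σ.toTy).ofClosed_ren,
    (hasType_outTm σ hσ).ofClosed_ren, Ty.ofClosed_ren]

theorem Proves.coalg_interp_graphRel (hid : Scheme.identityExtension ∈ A)
    (hσ : ¬ σ.Occurs false 0) (hΦ : WfHyps A Γ Θ Φ)
    (hf : HasType Γ .empty f (.lolli α (σ.toTy.subst fun _ => α))) (hz : HasType Γ .empty z α) :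
    Proves A Γ Θ Φ (.app (σ.coalg.interp (fun _ => α) (fun _ => (Ty.nu σ.toTy).ofClosed)
        fun _ => graphRel α (Ty.nu σ.toTy).ofClosed (unfoldAt σ.toTy α (.bang f)))
      (.tensor (.bang f) z)
      (.tensor (.bang (outTm σ).ofClosed) (.app (unfoldAt σ.toTy α (.bang f)) z))) := by
  have hh := hasType_unfoldAt σ.toTy (.bang hf)
  have ho := hasType_outTm' (Γ := Γ) σ hσ
  have rg := (isRel_graphRel (A := A) (Θ := Θ) hh)
  have rσ := σ.isRel_interp (fun _ => rg.isRel)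
  refine .tensorI (.bangI (.lolliI ?_ hΦ rg.isRel rσ hf ho) hΦ (isRel_lolliRel rg.isRel rσ) hf ho)
    (.graphRelI (.eqRefl (hh.app' hz) hΦ) hΦ hh hz (hh.app' hz)) hΦ
    (isRel_bangRel (isRel_lolliRel rg.isRel rσ)) rg.isRel (.bang hf) (.bang ho) hz (hh.app' hz)
  have e := isFm_app_wkI rg.isRel
  have w := (hΦ.wkI [(Ty.nu σ.toTy).ofClosed, α]).cons e
  have k := Proves.head e (hΦ.wkI [(Ty.nu σ.toTy).ofClosed, α])
  have hf₂ := hf.wkI₂ α (Ty.nu σ.toTy).ofClosed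
  have hh₂ := hasType_unfoldAt σ.toTy (.bang hf₂)
  have eh : (graphRel α (Ty.nu σ.toTy).ofClosed (unfoldAt σ.toTy α (.bang f))).wkI 2 =
      graphRel α (Ty.nu σ.toTy).ofClosed (unfoldAt σ.toTy α (.bang (f.wkI 2))) := by
    rw [Rel.wkI, graphRel_ren]
    simp [(hasType_unfoldTm σ.toTy).ofClosed_ren, Ty.ofClosed_ren]
  have ei : (σ.interp (fun _ => α) (fun _ => (Ty.nu σ.toTy).ofClosed)
      fun _ => graphRel α (Ty.nu σ.toTy).ofClosed (unfoldAt σ.toTy α (.bang f))).wkI 2 =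
      σ.interp (fun _ => α) (fun _ => (Ty.nu σ.toTy).ofClosed)
      fun _ => graphRel α (Ty.nu σ.toTy).ofClosed (unfoldAt σ.toTy α (.bang (f.wkI 2))) := by
    rw [← eh]
    simp [Rel.ren_eq_subst, IndTy.interp_subst]
  have eo : (outTm σ).ofClosed.wkI 2 = ((outTm σ).ofClosed : Tm S n) :=
    (hasType_outTm σ hσ).ofClosed_ren _ _ _
  have ho₂ := hasType_outTm' (Γ := (Ty.nu σ.toTy).ofClosed :: α :: Γ) σ hσ
  have k' := (k.castRel eh).graphRelE w hh₂ (.ivar rfl) (.ivar rfl)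
  have hx₁ : HasType ((Ty.nu σ.toTy).ofClosed :: α :: Γ) .empty (.ivar 1) α := .ivar rfl
  have hx₀ : HasType ((Ty.nu σ.toTy).ofClosed :: α :: Γ) .empty (.ivar 0)
    (Ty.nu σ.toTy).ofClosed := .ivar rfl
  have h1 := σ.interp_graphRel hσ hid w hh₂ (hf₂.app' hx₁)
  rw [ei, eo]
  have rg₂ := (isRel_graphRel (A := A) (Θ := Θ) hh₂)
  exact h1.eqSubst (σ.isRel_interp (fun _ => rg₂.isRel)) (.eqRefl (hf₂.app' hx₁) w)
    (.eqTrans (.eqSymm (.ext (out_unfold σ hσ hf₂ hx₁) w)) (.eqApp w ho₂ (hh₂.app' hx₁) ho₂ hx₀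
      (.eqRefl ho₂ w) k'))

theorem Proves.unfoldOut_unfold (hid : Scheme.identityExtension ∈ A)
    (hext : Scheme.extensionality ∈ A) (hσ : ¬ σ.Occurs false 0) (hΦ : WfHyps A Γ Θ Φ)
    (hf : HasType Γ .empty f (.lolli α (σ.toTy.subst fun _ => α))) (hz : HasType Γ .empty z α) :
    Proves A Γ Θ Φ (.eq (Ty.nu σ.toTy).ofClosed
      (.app (unfoldOut σ) (.app (.tapp (pack (coalgTy σ.toTy)).ofClosed α) (.tensor (.bang f) z)))
      (.app (.tapp (pack (coalgTy σ.toTy)).ofClosed α) (.tensor (.bang f) z))) := by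
  have hh := hasType_unfoldAt σ.toTy (.bang hf)
  have ho := hasType_outTm' (Γ := Γ) σ hσ
  have hk := hasType_unfoldOut (Γ := Γ) σ hσ
  have ha : HasType Γ .empty (.tensor (.bang f) z) ((coalgTy σ.toTy).subst fun _ => α) := by
    rw [coalgTy_subst]; exact (HasType.bang hf).tensor' hz
  have hb : HasType Γ .empty
      (.tensor (.bang (outTm σ).ofClosed) (.app (unfoldAt σ.toTy α (.bang f)) z))
      ((coalgTy σ.toTy).subst fun _ => (Ty.nu σ.toTy).ofClosed) := by
    rw [coalgTy_subst]; exact (HasType.bang ho).tensor' (hh.app' hz)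
  have h1 := Proves.eq_pack hid hext σ.coalg hΦ (isRel_graphRel hh) ha hb
    (.coalg_interp_graphRel σ hid hσ hΦ hf hz)
  have tp := hasType_pack_app (coalgTy σ.toTy) ha
  have e := Proves.ext (A := A) (Θ := Θ) (unfold_beta σ.toTy (.bang hf) hz) hΦ
  exact .eqTrans (.eqApp hΦ hk tp hk (hh.app' hz) (.eqRefl hk hΦ) (.eqSymm e))
    (.eqTrans (.ext (unfold_beta σ.toTy (.bang ho) (hh.app' hz)) hΦ) (.eqSymm h1))

theorem Proves.unfoldOut_pack (hid : Scheme.identityExtension ∈ A)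
    (hext : Scheme.extensionality ∈ A) (hσ : ¬ σ.Occurs false 0) (hΦ : WfHyps A Γ Θ Φ)
    (ha : HasType Γ .empty a ((coalgTy σ.toTy).subst fun _ => α)) :
    Proves A Γ Θ Φ (.eq (Ty.nu σ.toTy).ofClosed
      (.app (unfoldOut σ) (.app (.tapp (pack (coalgTy σ.toTy)).ofClosed α) a))
      (.app (.tapp (pack (coalgTy σ.toTy)).ofClosed α) a)) := by
  have p := hasType_pack (coalgTy σ.toTy)
  have hk : ∀ Γ : List (Ty S.toTySig n), HasType Γ .empty (unfoldOut σ) _ :=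
    fun Γ => hasType_unfoldOut (Γ := Γ) σ hσ
  have tp : ∀ Γ : List (Ty S.toTySig n), HasType Γ .empty
      (.tapp (pack (coalgTy σ.toTy)).ofClosed α) (.lolli
      (.tensor (.bang (.lolli α (σ.toTy.subst fun _ => α))) α) (Ty.nu σ.toTy).ofClosed) :=
    fun Γ => (hasType_pack' (coalgTy σ.toTy)).tapp' (by simp [coalgTy_subst, Ty.nu])
  set c : Tm S n := .lam (.tensor (.bang (.lolli α (σ.toTy.subst fun _ => α))) α)
    (.app (unfoldOut σ) (.app (.tapp (pack (coalgTy σ.toTy)).ofClosed α) (.lvar 0))) with hc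
  have hb : ∀ Γ : List (Ty S.toTySig n), HasType Γ (.single 0 _) (.app (unfoldOut σ)
      (.app (.tapp (pack (coalgTy σ.toTy)).ofClosed α) (.lvar 0))) (Ty.nu σ.toTy).ofClosed :=
    fun Γ => (hk Γ).appR ((tp Γ).appR .lvar)
  have hct : ∀ Γ : List (Ty S.toTySig n), HasType Γ .empty c (.lolli
      (.tensor (.bang (.lolli α (σ.toTy.subst fun _ => α))) α) (Ty.nu σ.toTy).ofClosed) :=
    fun Γ => .lam (by rw [LCtx.cons_empty]; exact hb Γ)
  have beta : ∀ {Γ : List (Ty S.toTySig n)} {a : Tm S n},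
      HasType Γ .empty a (.tensor (.bang (.lolli α (σ.toTy.subst fun _ => α))) α) →
      ExtEq Γ .empty (.app c a) (.app (unfoldOut σ)
        (.app (.tapp (pack (coalgTy σ.toTy)).ofClosed α) a)) (Ty.nu σ.toTy).ofClosed :=
    fun ha => .beta (hb _) ha (by
      simp [unfoldOut, p.ofClosed_subst, (hasType_unfoldTm σ.toTy).ofClosed_subst,
        (hasType_outTm σ hσ).ofClosed_subst])
  have ec : c.wkI 3 = c := by
    simp [hc, unfoldOut, p.ofClosed_ren, (hasType_unfoldTm σ.toTy).ofClosed_ren,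
        (hasType_outTm σ hσ).ofClosed_ren, Ty.ofClosed_ren]
  have ep : Tm.wkI 3 (.tapp (pack (coalgTy σ.toTy)).ofClosed α) =
      .tapp (pack (coalgTy σ.toTy)).ofClosed α := by
    simp [p.ofClosed_ren]
  rw [coalgTy_subst] at ha
  refine .eqTrans (.eqSymm (.ext (beta ha) hΦ))
    (.eq_of_eq_bang_tensor hid hext hΦ (hct Γ) (tp Γ) ha ?_)
  rw [ec, ep]
  have w := hΦ.wkI [.lolli α (σ.toTy.subst fun _ => α), α,
    .bang (.lolli α (σ.toTy.subst fun _ => α))]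
  have h0 : HasType (.lolli α (σ.toTy.subst fun _ => α) :: α ::
    .bang (.lolli α (σ.toTy.subst fun _ => α)) :: Γ) .empty (.ivar 0)
    (.lolli α (σ.toTy.subst fun _ => α)) := .ivar rfl
  exact .eqTrans (.ext (beta (.tensor' (.bang h0) (.ivar rfl))) w)
    (.unfoldOut_unfold σ hid hext hσ w h0 (.ivar rfl))

/-- `unfold ν !out` is the identity. -/
theorem Proves.unfoldOut_eq (hid : Scheme.identityExtension ∈ A)
    (hext : Scheme.extensionality ∈ A) (hσ : ¬ σ.Occurs false 0) (hΦ : WfHyps A Γ Θ Φ)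
    (hx : HasType Γ .empty x (Ty.nu σ.toTy).ofClosed) :
    Proves A Γ Θ Φ (.eq (Ty.nu σ.toTy).ofClosed (.app (unfoldOut σ) x) x) := by
  have e : ∀ m : ℕ, ((unfoldOut σ : Tm S 0).ofClosed : Tm S m) = unfoldOut σ :=
    fun m => unfoldOut_ren σ hσ _ _ _
  have := Proves.eq_app_of_pack hid hext σ.coalg (g := unfoldOut σ) (hasType_unfoldOut σ hσ)
    (fun w ha => by rw [e]; exact .unfoldOut_pack σ hid hext hσ w ha) hΦ hx
  rwa [e] at this

end Coalgebra
end Uniqueness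

section Closure
variable {S : Signature.{u, v}} {A : Set Scheme} {n : ℕ} {Γ : List (Ty S.toTySig n)}
  {Θ : List (RelDecl S.toTySig n)} {Φ : List (Fm S n)} {σ τ : Ty S.toTySig n}
  {R Q : Rel S n} {φ : Fm S n} {t u x y : Tm S n}

theorem Proves.wkR (h : Proves A Γ Θ Φ φ) (d : RelDecl S.toTySig n) :
    Proves A Γ (d :: Θ) (Φ.map Fm.wkR) φ.wkR :=
  h.ren id id (· + 1) (fun i σ hi => by simpa using hi) (fun i d hi => by
    simpa [RelDecl.ren] using hi)

theorem IsRel.wkR {κ : Kind} (h : IsRel A κ Γ Θ R σ τ) (d : RelDecl S.toTySig n) :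
    IsRel A κ Γ (d :: Θ) R.wkR σ τ := by
  have := h.ren id id (· + 1) (fun i σ hi => by simpa using hi)
    (Θ' := d :: Θ) (Γ' := Γ) (fun i d hi => by simpa [RelDecl.ren] using hi)
  simpa using this

/-- The proposition that `R` is contained in `Q`. -/
def inclFm (σ τ : Ty S.toTySig n) (R Q : Rel S n) : Fm S n :=
  .allTm σ (.allTm τ (.imp (.app (R.wkI 2) (.ivar 1) (.ivar 0))
    (.app (Q.wkI 2) (.ivar 1) (.ivar 0))))

theorem inclFm_subst {m : ℕ} (s : Fin n → Ty S.toTySig m) (si : ℕ → Tm S m) (sr : ℕ → Rel S m) :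
    (inclFm σ τ R Q).subst s si sr =
      inclFm (σ.subst s) (τ.subst s) (R.subst s si sr) (Q.subst s si sr) := by
  simp [inclFm]

/-- The relation `(x, y). φ ⊃ Q(x, y)`. -/
def impRel (σ τ : Ty S.toTySig n) (φ : Fm S n) (Q : Rel S n) : Rel S n :=
  .abs σ τ (.imp (φ.wkI 2) (.app (Q.wkI 2) (.ivar 1) (.ivar 0)))

theorem impRel_subst {m : ℕ} (s : Fin n → Ty S.toTySig m) (si : ℕ → Tm S m) (sr : ℕ → Rel S m) :
    (impRel σ τ φ Q).subst s si sr =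
      impRel (σ.subst s) (τ.subst s) (φ.subst s si sr) (Q.subst s si sr) := by
  simp [impRel]

/-- The least admissible relation containing `R`. -/
def admClosure (σ τ : Ty S.toTySig n) (R : Rel S n) : Rel S n :=
  .abs σ τ (.allRel .adm σ τ (.app ((impRel σ τ (inclFm σ τ R.wkR (.var 0)) (.var 0)).wkI 2)
    (.ivar 1) (.ivar 0)))

theorem inclFm_wkI (k : ℕ) : (inclFm σ τ R Q).wkI k = inclFm σ τ (R.wkI k) (Q.wkI k) := by
  simp [Fm.ren_eq_subst, Rel.ren_eq_subst, inclFm_subst]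

theorem admClosure_wkI (k : ℕ) : (admClosure σ τ R).wkI k = admClosure σ τ (R.wkI k) := by
  simp [admClosure, impRel_subst, inclFm_subst, Rel.ren_eq_subst]

theorem isFm_inclFm (hR : IsRel A .rel Γ Θ R σ τ) (hQ : IsRel A .rel Γ Θ Q σ τ) :
    IsFm A Γ Θ (inclFm σ τ R Q) :=
  .allTm (.allTm (.imp (isFm_app_wkI hR) (isFm_app_wkI hQ)))

theorem Proves.inclFmE (h : Proves A Γ Θ Φ (inclFm σ τ R Q)) (ht : HasType Γ .empty t σ)
    (hu : HasType Γ .empty u τ) (htu : Proves A Γ Θ Φ (.app R t u)) :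
    Proves A Γ Θ Φ (.app Q t u) := by
  have h1 := h.allTmE ht
  simp at h1
  have h2 := h1.allTmE hu
  simp at h2
  exact h2.impE htu

theorem Proves.inclFmI (hΦ : WfHyps A Γ Θ Φ) (hR : IsRel A .rel Γ Θ R σ τ)
    (h : Proves A (τ :: σ :: Γ) Θ (.app (R.wkI 2) (.ivar 1) (.ivar 0) :: Φ.map (Fm.wkI 2))
      (.app (Q.wkI 2) (.ivar 1) (.ivar 0))) : Proves A Γ Θ Φ (inclFm σ τ R Q) := by
  refine .allTmI hΦ (.allTmI (hΦ.wkI [σ]) (.impI (isFm_app_wkI hR) ?_))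
  rwa [map_wkI_wkI]

theorem isFm_impRel (hφ : IsFm A Γ Θ φ) (hQ : IsRel A .rel Γ Θ Q σ τ) :
    IsFm A (τ :: σ :: Γ) Θ (.imp (φ.wkI 2) (.app (Q.wkI 2) (.ivar 1) (.ivar 0))) :=
  .imp (hφ.wkI [τ, σ]) (isFm_app_wkI hQ)

theorem Proves.impRelE (h : Proves A Γ Θ Φ (.app (impRel σ τ φ Q) t u)) (hφ : IsFm A Γ Θ φ)
    (hQ : IsRel A .rel Γ Θ Q σ τ) (hΦ : WfHyps A Γ Θ Φ) (ht : HasType Γ .empty t σ)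
    (hu : HasType Γ .empty u τ) : Proves A Γ Θ Φ (.imp φ (.app Q t u)) := by
  have := h.absE (isFm_impRel hφ hQ) hΦ ht hu
  simpa using this

theorem Proves.impRelI (h : Proves A Γ Θ Φ (.imp φ (.app Q t u))) (hφ : IsFm A Γ Θ φ)
    (hQ : IsRel A .rel Γ Θ Q σ τ) (hΦ : WfHyps A Γ Θ Φ) (ht : HasType Γ .empty t σ)
    (hu : HasType Γ .empty u τ) : Proves A Γ Θ Φ (.app (impRel σ τ φ Q) t u) := by
  refine .absI ?_ (isFm_impRel hφ hQ) hΦ ht hu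
  simpa using h

theorem isRel_impRel_var (hR : IsRel A .rel Γ Θ R σ τ) :
    IsRel A .adm Γ (⟨.adm, σ, τ⟩ :: Θ) (impRel σ τ (inclFm σ τ R.wkR (.var 0)) (.var 0)) σ τ :=
  .admImp (.var rfl) (isFm_inclFm (hR.wkR _) (.ofAdm (.var rfl)))

theorem isRel_admClosure (hR : IsRel A .rel Γ Θ R σ τ) :
    IsRel A .adm Γ Θ (admClosure σ τ R) σ τ :=
  .admAllRel (isRel_impRel_var hR)

theorem isFm_admClosure (hR : IsRel A .rel Γ Θ R σ τ) : IsFm A (τ :: σ :: Γ) Θ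
    (.allRel .adm σ τ (.app ((impRel σ τ (inclFm σ τ R.wkR (.var 0)) (.var 0)).wkI 2)
      (.ivar 1) (.ivar 0))) :=
  .allRel (isFm_app_wkI (isRel_impRel_var hR).isRel)

theorem Proves.admClosureI (h : Proves A Γ Θ Φ (.app R t u)) (hR : IsRel A .rel Γ Θ R σ τ)
    (hΦ : WfHyps A Γ Θ Φ) (ht : HasType Γ .empty t σ) (hu : HasType Γ .empty u τ) :
    Proves A Γ Θ Φ (.app (admClosure σ τ R) t u) := by
  refine .absI ?_ (isFm_admClosure hR) hΦ ht hu
  simp [impRel_subst, inclFm_subst, Rel.ren_eq_subst]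
  have v : IsRel A .adm Γ (⟨.adm, σ, τ⟩ :: Θ) (.var 0) σ τ := .var rfl
  have i := isFm_inclFm (hR.wkR ⟨.adm, σ, τ⟩) v.isRel
  have w := hΦ.wkR ⟨.adm, σ, τ⟩
  refine .allRelI hΦ ?_
  have key := Proves.impRelI (t := t) (u := u) (.impI i ((Proves.head i w).inclFmE ht hu
    (.weaken (w.cons i) (List.subset_cons_self _ _) ((h.wkR ⟨.adm, σ, τ⟩).cast (by simp))))) i
    v.isRel w ht hu
  exact key.cast (by simp [Rel.ren_eq_subst])

theorem Proves.admClosureE (h : Proves A Γ Θ Φ (.app (admClosure σ τ R) t u))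
    (hR : IsRel A .rel Γ Θ R σ τ) (hQ : IsRel A .adm Γ Θ Q σ τ)
    (hΦ : WfHyps A Γ Θ Φ) (ht : HasType Γ .empty t σ) (hu : HasType Γ .empty u τ)
    (hRQ : Proves A Γ Θ Φ (inclFm σ τ R Q)) :
    Proves A Γ Θ Φ (.app Q t u) := by
  have h1 := h.absE (isFm_admClosure hR) hΦ ht hu
  simp [impRel_subst, inclFm_subst, Rel.ren_eq_subst] at h1
  have h2 := h1.allRelE hQ
  simp [impRel_subst, inclFm_subst, Rel.ren_eq_subst] at h2
  exact (h2.impRelE (isFm_inclFm hR hQ.isRel) hQ.isRel hΦ ht hu).impE hRQ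

end Closure

section Coinduction
variable {S : Signature.{u, v}} {A : Set Scheme} {n : ℕ} {Γ : List (Ty S.toTySig n)}
  {Θ : List (RelDecl S.toTySig n)} {Φ : List (Fm S n)} {R Q : Rel S n} {x y : Tm S n}
  (σ : IndTy S.toTySig 1)

/-- Coinduction for admissible relations. -/
theorem Proves.coinduction_adm (hid : Scheme.identityExtension ∈ A)
    (hext : Scheme.extensionality ∈ A) (hσ : ¬ σ.Occurs false 0) (hΦ : WfHyps A Γ Θ Φ)
    (hQ : IsRel A .adm Γ Θ Q (Ty.nu σ.toTy).ofClosed (Ty.nu σ.toTy).ofClosed)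
    (ho : Proves A Γ Θ Φ (.app (lolliRel (Ty.nu σ.toTy).ofClosed (Ty.nu σ.toTy).ofClosed
      (σ.toTy.subst fun _ => (Ty.nu σ.toTy).ofClosed)
      (σ.toTy.subst fun _ => (Ty.nu σ.toTy).ofClosed) Q
      (σ.interp (fun _ => (Ty.nu σ.toTy).ofClosed) (fun _ => (Ty.nu σ.toTy).ofClosed) fun _ => Q))
      (outTm σ).ofClosed (outTm σ).ofClosed))
    (hx : HasType Γ .empty x (Ty.nu σ.toTy).ofClosed)
    (hy : HasType Γ .empty y (Ty.nu σ.toTy).ofClosed) (hxy : Proves A Γ Θ Φ (.app Q x y)) :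
    Proves A Γ Θ Φ (.eq (Ty.nu σ.toTy).ofClosed x y) := by
  have ho₀ := hasType_outTm' (Γ := Γ) σ hσ
  have l := isRel_lolliRel hQ.isRel (σ.isRel_interp fun _ => hQ.isRel)
  have tt : ∀ {x : Tm S n}, HasType Γ .empty x (Ty.nu σ.toTy).ofClosed →
      HasType Γ .empty (.tensor (.bang (outTm σ).ofClosed) x)
        ((coalgTy σ.toTy).subst fun _ => (Ty.nu σ.toTy).ofClosed) := fun h => by
    rw [coalgTy_subst]; exact (HasType.bang ho₀).tensor' h
  have h1 := Proves.eq_pack hid hext σ.coalg hΦ hQ (tt hx) (tt hy)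
    (.tensorI (ho.bangI hΦ l ho₀ ho₀) hxy hΦ (isRel_bangRel l) hQ.isRel (.bang ho₀) (.bang ho₀) hx hy)
  exact .eqTrans (.eqSymm (.unfoldOut_eq σ hid hext hσ hΦ hx))
    (.eqTrans (.ext (unfold_beta σ.toTy (.bang ho₀) hx) hΦ) (.eqTrans h1
      (.eqTrans (.eqSymm (.ext (unfold_beta σ.toTy (.bang ho₀) hy) hΦ))
        (.unfoldOut_eq σ hid hext hσ hΦ hy))))

/-- Coinduction for arbitrary definable relations. -/
theorem Proves.coinduction (hid : Scheme.identityExtension ∈ A)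
    (hext : Scheme.extensionality ∈ A) (hσ : ¬ σ.Occurs false 0) (hΦ : WfHyps A Γ Θ Φ)
    (hR : IsRel A .rel Γ Θ R (Ty.nu σ.toTy).ofClosed (Ty.nu σ.toTy).ofClosed)
    (ho : Proves A Γ Θ Φ (.app (lolliRel (Ty.nu σ.toTy).ofClosed (Ty.nu σ.toTy).ofClosed
      (σ.toTy.subst fun _ => (Ty.nu σ.toTy).ofClosed)
      (σ.toTy.subst fun _ => (Ty.nu σ.toTy).ofClosed) R
      (σ.interp (fun _ => (Ty.nu σ.toTy).ofClosed) (fun _ => (Ty.nu σ.toTy).ofClosed) fun _ => R))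
      (outTm σ).ofClosed (outTm σ).ofClosed))
    (hx : HasType Γ .empty x (Ty.nu σ.toTy).ofClosed)
    (hy : HasType Γ .empty y (Ty.nu σ.toTy).ofClosed) (hxy : Proves A Γ Θ Φ (.app R x y)) :
    Proves A Γ Θ Φ (.eq (Ty.nu σ.toTy).ofClosed x y) := by
  have ho₀ := fun Γ : List (Ty S.toTySig n) => hasType_outTm' (Γ := Γ) σ hσ
  generalize hν : (Ty.nu σ.toTy).ofClosed = ν at *
  generalize hQ : admClosure ν ν R = Q
  have rQ : IsRel A .adm Γ Θ Q ν ν := hQ ▸ isRel_admClosure hR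
  have rσR := σ.isRel_interp fun _ => hR
  have rσQ := σ.isRel_interp fun _ => rQ.isRel
  have aσQ := σ.adm_interp hid fun _ => rQ
  have RQ : Incl A Γ Θ ν ν R Q := by
    have e := isFm_app_wkI hR
    have := Proves.admClosureI (.head e wfHyps_nil) (hR.wkI [ν, ν]) (wfHyps_nil.cons e)
      (.ivar rfl) (.ivar rfl)
    exact this.castRel (by rw [← hQ, admClosure_wkI])
  have mono : Incl A Γ Θ (σ.toTy.subst fun _ => ν) (σ.toTy.subst fun _ => ν)
      (σ.interp (fun _ => ν) (fun _ => ν) fun _ => R)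
      (σ.interp (fun _ => ν) (fun _ => ν) fun _ => Q) :=
    σ.interp_mono (fun _ => hR) (fun _ => rQ.isRel) (fun _ _ => RQ)
      (fun i hi => absurd (Subsingleton.elim i 0 ▸ hi) hσ)
  have ho' := ho.lolli_mono hΦ (.refl hR) mono hR hR rσR rσQ (ho₀ Γ) (ho₀ Γ)
  have eo : (outTm σ).ofClosed.wkI 2 = ((outTm σ).ofClosed : Tm S n) :=
    (hasType_outTm σ hσ).ofClosed_ren _ _ _
  have bQ : Proves A Γ Θ Φ (.app (lolliRel ν ν (σ.toTy.subst fun _ => ν) (σ.toTy.subst fun _ => ν)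
      Q (σ.interp (fun _ => ν) (fun _ => ν) fun _ => Q)) (outTm σ).ofClosed (outTm σ).ofClosed) := by
    have e := isFm_app_wkI rQ.isRel
    have w := (hΦ.wkI [ν, ν]).cons e
    have k := (Proves.head e (hΦ.wkI [ν, ν])).castRel (ρ' := admClosure ν ν (R.wkI 2))
      (by rw [← hQ, admClosure_wkI])
    have rS : IsRel A .adm Γ Θ (pullRel ν ν (outTm σ).ofClosed (outTm σ).ofClosed
        (σ.interp (fun _ => ν) (fun _ => ν) fun _ => Q)) ν ν := .admPull aσQ (ho₀ Γ) (ho₀ Γ)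
    have i : Proves A Γ Θ Φ (inclFm ν ν R (pullRel ν ν (outTm σ).ofClosed (outTm σ).ofClosed
        (σ.interp (fun _ => ν) (fun _ => ν) fun _ => Q))) := by
      refine .inclFmI hΦ hR ?_
      have e := isFm_app_wkI hR
      have w := (hΦ.wkI [ν, ν]).cons e
      have h1 := (ho'.wkI [ν, ν]).cast (ψ := .app (lolliRel ν ν (σ.toTy.subst fun _ => ν)
        (σ.toTy.subst fun _ => ν) (R.wkI 2)
        ((σ.interp (fun _ => ν) (fun _ => ν) fun _ => Q).wkI 2)) ((outTm σ).ofClosed.wkI 2)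
          ((outTm σ).ofClosed.wkI 2)) (by rw [← lolliRel_wkI]; rfl)
      rw [eo] at h1
      rw [pullRel_wkI, eo]
      exact .pullI (.lolliE (.weaken w (List.subset_cons_self _ _) h1) w (hR.wkI [ν, ν])
        (rσQ.wkI [ν, ν]) (ho₀ _) (ho₀ _) (.ivar rfl) (.ivar rfl) (.head e (hΦ.wkI [ν, ν]))) w
        (rσQ.wkI [ν, ν]) (ho₀ _) (ho₀ _) (.ivar rfl) (.ivar rfl)
    refine .lolliI ?_ hΦ rQ.isRel rσQ (ho₀ Γ) (ho₀ Γ)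
    have h1 := Proves.weaken w (List.subset_cons_self _ _) (i.wkI [ν, ν])
    have h2 := k.admClosureE (hR.wkI [ν, ν]) (rS.wkI [ν, ν]) w (.ivar rfl) (.ivar rfl)
      (h1.cast (inclFm_wkI 2))
    have h3 := h2.castRel (pullRel_wkI 2 _ _ _)
    rw [eo] at h3 ⊢
    exact h3.pullE w (rσQ.wkI [ν, ν]) (ho₀ _) (ho₀ _) (.ivar rfl) (.ivar rfl)
  subst hν
  exact .coinduction_adm σ hid hext hσ hΦ rQ bQ hx hy (RQ.apply hR hΦ hx hy hxy)

end Coinduction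

end LAPL

theorem mainTheorem10 {S : LAPL.Signature.{u, v}} (A : Set LAPL.Scheme)
    (hext : LAPL.Scheme.extensionality ∈ A) (hid : LAPL.Scheme.identityExtension ∈ A)
    (σ : LAPL.IndTy S.toTySig 1) (hσ : ¬ σ.Occurs false 0)
    {n : ℕ} (Γ : List (LAPL.Ty S.toTySig n)) (Θ : List (LAPL.RelDecl S.toTySig n))
    (Φ : List (LAPL.Fm S n)) (hΦ : ∀ χ ∈ Φ, LAPL.IsFm A Γ Θ χ)
    (ν σν : LAPL.Ty S.toTySig n) (hν : ν = (LAPL.Ty.nu σ.toTy).ofClosed)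
    (hσν : σν = σ.toTy.subst (fun _ => ν))
    (R : LAPL.Rel S n) (hR : LAPL.IsRel A .rel Γ Θ R ν ν) :
    LAPL.Proves A Γ Θ Φ
      (.imp
        (.app (LAPL.lolliRel ν ν σν σν R (σ.interp (fun _ => ν) (fun _ => ν) (fun _ => R)))
          (LAPL.outTm σ).ofClosed (LAPL.outTm σ).ofClosed)
        (.allTm ν (.allTm ν
          (.imp (.app (R.wkI 2) (.ivar 1) (.ivar 0)) (.eq ν (.ivar 1) (.ivar 0)))))) := by
  subst hν hσν
  have ho := LAPL.hasType_outTm' (Γ := Γ) σ hσ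
  have i := LAPL.IsFm.app (LAPL.isRel_lolliRel hR (σ.isRel_interp fun _ => hR)) ho ho
  refine .impI i (.allTmI (LAPL.WfHyps.cons i hΦ)
    (.allTmI ((LAPL.WfHyps.cons i hΦ).wkI [_]) (.impI (LAPL.isFm_app_wkI hR) ?_)))
  have w := ((LAPL.WfHyps.cons i hΦ).wkI
    [(LAPL.Ty.nu σ.toTy).ofClosed, (LAPL.Ty.nu σ.toTy).ofClosed]).cons (LAPL.isFm_app_wkI hR)
  rw [LAPL.map_wkI_wkI]
  refine LAPL.Proves.coinduction σ hid hext hσ w (hR.wkI [_, _]) ?_ (.ivar rfl) (.ivar rfl)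
    (.hyp w List.mem_cons_self)
  refine (LAPL.Proves.hyp w (List.mem_cons_of_mem _ List.mem_cons_self)).cast ?_
  have eo : (LAPL.outTm σ).ofClosed.wkI 2 = ((LAPL.outTm σ).ofClosed : LAPL.Tm S n) :=
    (LAPL.hasType_outTm σ hσ).ofClosed_ren _ _ _
  have e : ∀ (ρ : LAPL.Rel S n) (t u : LAPL.Tm S n), (LAPL.Fm.app ρ t u).wkI 2 =
      .app (ρ.wkI 2) (t.wkI 2) (u.wkI 2) := fun _ _ _ => rfl
  rw [List.length_cons, List.length_singleton, e, LAPL.lolliRel_wkI, eo]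
  congr 2
  simp [LAPL.Rel.ren_eq_subst, LAPL.IndTy.interp_subst]
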